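/- Let $p$ be a prime and let $G$ be a smooth affine group scheme over $\mathbb F_p$ with an action of $\mathbb G_m$ by group automorphisms. Let $\mathfrak g=\mathrm{Lie}(G)=\bigoplus_i\mathfrak g_i$ be the weight decomposition, and assume that the action is $1$-bounded: $\mathfrak g_i=0$ for $i>1$. Let $M=G^{\mathbb G_m}$, let $P^+\subset G$ (resp. $P^-\subset G$) be the attractor of the action (resp. of the inverse action), and let $P^\pm\to M$ be the retractions. Torsors are right torsors for the étale topology. Let $S$ be a smooth $\mathbb F_p$-scheme with absolute Frobenius $\mathrm{Fr}$, and let $f\in\mathrm{Disp}_1^G(S)$ be an $F$-zip, i.e. a collection of the following data: $P^\pm$-torsors $\mathcal F^\pm$ on $S$; an isomorphism between the $G$-torsors induced by $\mathcal F^+$ and $\mathcal F^-$ (the resulting $G$-torsor is denoted by $\mathcal F$); an isomorphism $\mathcal F^+_M\simeq \mathrm{Fr}^*\mathcal F^-_M$, where $\mathcal F^\pm_M$ is the $M$-torsor induced by $\mathcal F^\pm$. Let $(\mathfrak g_1)_{\mathcal F^\pm}$ be the vector bundle associated with $\mathcal F^\pm_M$ and the $M$-module $\mathfrak g_1$; thus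 $(\mathfrak g_1)_{\mathcal F^+}=\mathrm{Fr}^*(\mathfrak g_1)_{\mathcal F^-}$. Let $\mathcal T(S,f)$ be the set of connections $\nabla$ on $\mathcal F^+$ such that (a) the connection on $\mathcal F^+_M$ induced by $\nabla$ is the one that comes from $\mathcal F^+_M\simeq \mathrm{Fr}^*\mathcal F^-_M$ and the usual connection on a Frobenius pullback; (b) $\nabla$ is integrable; (c) $\mathrm{pCurv}_\nabla=-\mathrm{KS}_\nabla$. Here $\mathrm{KS}_\nabla\in H^0(S,(\mathfrak g_1)_{\mathcal F^-}\otimes\Omega^1_S)$ is the composition of the connection $\nabla_G$ on $\mathcal F$ induced by $\nabla$, viewed as a map from vector fields on $S$ to $G$-invariant vector fields on $\mathcal F$, with the projection of the latter to $(\mathfrak g/\mathrm{Lie}(P^-))_{\mathcal F^-}=(\mathfrak g_1)_{\mathcal F^-}$; and the $p$-curvature $D\mapsto\nabla(D)^p-\nabla(D^p)$, which by (a) has values in the horizontal part $(\mathfrak g_1)_{\mathcal F^-}$ of $\mathrm{Fr}_*(\mathfrak g_1)_{\mathcal F^+}$, is viewed as a section $\mathrm{pCurv}_\nabla$ of $(\mathfrak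 g_1)_{\mathcal F^-}\otimes\Omega^1_S$. Let $\mathcal A'(S,f)=H^0(S,(\mathfrak g_1)_{\mathcal F^+}\otimes\Omega^1_S)=H^0(S,(\mathfrak g_1)_{\mathcal F^-}\otimes\mathrm{Fr}_*\Omega^1_S)$, and let $$\mathcal A(S,f)=\{\omega\in H^0(S,(\mathfrak g_1)_{\mathcal F^-}\otimes(\mathrm{Fr}_*\Omega^1_S)_{\mathrm{closed}})\mid\tilde C(\omega)=\tilde\varphi(\omega)\}\subset\mathcal A'(S,f),$$ where $\tilde C=\mathrm{id}\otimes C$ with $C$ the Cartier operator, and $\tilde\varphi:(\mathfrak g_1)_{\mathcal F^+}\otimes\Omega^1_S\to(\mathfrak g_1)_{\mathcal F^-}\otimes\Omega^1_S$ is induced by the composition $(\mathfrak g_1)_{\mathcal F^+}\hookrightarrow\mathfrak g_{\mathcal F^+}\simeq\mathfrak g_{\mathcal F^-}\twoheadrightarrow(\mathfrak g/\mathfrak g_{\le 0})_{\mathcal F^-}=(\mathfrak g_1)_{\mathcal F^-}$. Then $\mathcal T$ is stable under the action of $\mathcal A$ by translations, and $\mathcal T$ is an $\mathcal A$-torsor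 for the étale topology. That is, for every $(S,f)$ as above: if $\nabla\in\mathcal T(S,f)$ and $\omega\in\mathcal A(S,f)$ then $\nabla+\omega\in\mathcal T(S,f)$; for all $\nabla,\nabla'\in\mathcal T(S,f)$ there is a unique $\omega\in\mathcal A(S,f)$ with $\nabla'=\nabla+\omega$; and there is an étale covering $\{u_i:S_i\to S\}$ such that $\mathcal T(S_i,u_i^*f)\ne\emptyset$ for all $i$ (every $F$-zip on a smooth scheme lifts étale-locally). -/

import Mathlib

open CategoryTheory AlgebraicGeometry TensorProduct KaehlerDifferential

noncomputable section

namespace FZip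

/-! ### Group schemes with an action of the multiplicative group -/

/-- An action of `𝔾ₘ` on the affine group scheme `G = Spec H` over `𝔽_p` by group automorphisms.
An action of `𝔾ₘ` on the scheme `Spec H` is a `ℤ`-grading of the algebra `H`: for an `𝔽_p`-algebra
`A`, a unit `t ∈ Aˣ` sends `g : H → A` to the homomorphism which is `h ↦ t ^ i * g h` on the degree
`i` part. It acts by group automorphisms if and only if the comultiplication and the counit are
homogeneous of degree `0`. -/
structure GmAction (p : ℕ) (H : Type) [CommRing H] [HopfAlgebra (ZMod p) H] where
  deg : ℤ → Submodule (ZMod p) H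
  [graded : GradedAlgebra deg]
  comul_mem : ∀ (i : ℤ), ∀ h ∈ deg i, Coalgebra.comul (R := ZMod p) h ∈
    ⨆ (a : ℤ) (b : ℤ) (_ : a + b = i),
      LinearMap.range (TensorProduct.map (deg a).subtype (deg b).subtype)
  counit_eq_zero : ∀ (i : ℤ), i ≠ 0 → ∀ h ∈ deg i, Coalgebra.counit (R := ZMod p) h = 0

attribute [instance] GmAction.graded

/-- A tangent vector at the unit of `Spec H` with coefficients in `B`, that is, an element of
`Lie(G) ⊗ B`: a derivation `H → B`, where `H` acts on `B` through the counit. -/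
def IsLie {p : ℕ} {H B : Type} [CommRing H] [HopfAlgebra (ZMod p) H] [CommRing B]
    [Algebra (ZMod p) B] (ξ : H →ₗ[ZMod p] B) : Prop :=
  ∀ a b : H, ξ (a * b) = Coalgebra.counit (R := ZMod p) a • ξ b +
    Coalgebra.counit (R := ZMod p) b • ξ a

/-- The three subgroups `P⁺`, `P⁻`, `M` of `G`. -/
inductive Part
  | pos
  | neg
  | levi

/-- The degrees of the homogeneous functions that vanish on the subgroup. For `P⁺` (the attractor,
where `lim_{t → 0} t · g` exists) these are the negative ones, for `P⁻` (the attractor of the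
inverse action) the positive ones, and for `M` (the fixed points) all nonzero ones. -/
def Part.killed : Part → Set ℤ
  | .pos => {i | i < 0}
  | .neg => {i | 0 < i}
  | .levi => {i | i ≠ 0}

lemma Part.zero_notMem (P : Part) : (0 : ℤ) ∉ P.killed := by
  cases P <;> simp [Part.killed]

lemma Part.of_add (P : Part) {a b : ℤ} (h : a + b ∈ P.killed) : a ∈ P.killed ∨ b ∈ P.killed := by
  cases P <;> simp only [Part.killed, Set.mem_ofPred_eq] at * <;> omega

lemma Part.of_add_eq_zero (P : Part) {a b : ℤ} (h : a + b = 0) (ha : a ≠ 0) :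
    a ∈ P.killed ∨ b ∈ P.killed := by
  cases P <;> simp only [Part.killed, Set.mem_ofPred_eq] at * <;> omega

namespace GmAction

variable {p : ℕ} {H : Type} [CommRing H] [HopfAlgebra (ZMod p) H] (μ : GmAction p H)

/-- The component `𝔤ᵢ ⊗ B` of `Lie(G) ⊗ B` on which `𝔾ₘ` acts with weight `i`. -/
def HasWeight (i : ℤ) {B : Type} [CommRing B] [Algebra (ZMod p) B] (ξ : H →ₗ[ZMod p] B) : Prop :=
  ∀ j : ℤ, j ≠ i → ∀ h ∈ μ.deg j, ξ h = 0

/-- The action is `1`-bounded if `𝔤ᵢ = 0` for `i > 1`. -/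
def OneBounded : Prop :=
  ∀ i : ℤ, 1 < i → ∀ ξ : H →ₗ[ZMod p] ZMod p, IsLie ξ → μ.HasWeight i ξ → ξ = 0

/-- The ideal of the closed subgroup `P⁺`, `P⁻` or `M` of `G`. -/
def ideal (P : Part) : Ideal H := Ideal.span {h | ∃ i ∈ P.killed, h ∈ μ.deg i}

instance (P : Part) : ((μ.ideal P).restrictScalars (ZMod p)).IsCoideal where
  counit_eq_zero := by
    intro x hx
    have : μ.ideal P ≤ RingHom.ker (Bialgebra.counitAlgHom (ZMod p) H) := by
      refine Ideal.span_le.2 ?_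
      rintro h ⟨i, hi, hh⟩
      refine μ.counit_eq_zero i ?_ h hh
      rintro rfl
      exact P.zero_notMem hi
    exact this hx
  map_mkQ_comul_eq_zero := by
    intro x hx
    have : μ.ideal P ≤ RingHom.ker ((Algebra.TensorProduct.map
        (Ideal.Quotient.mkₐ (ZMod p) (μ.ideal P)) (Ideal.Quotient.mkₐ (ZMod p) (μ.ideal P))).comp
        (Bialgebra.comulAlgHom (ZMod p) H)) := by
      refine Ideal.span_le.2 ?_
      rintro h ⟨i, hi, hh⟩
      have key : (⨆ (a : ℤ) (b : ℤ) (_ : a + b = i),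
          LinearMap.range (TensorProduct.map (μ.deg a).subtype (μ.deg b).subtype)) ≤
          LinearMap.ker (Algebra.TensorProduct.map (Ideal.Quotient.mkₐ (ZMod p) (μ.ideal P))
            (Ideal.Quotient.mkₐ (ZMod p) (μ.ideal P))).toLinearMap := by
        refine iSup_le fun a => iSup_le fun b => iSup_le fun hab => ?_
        rintro _ ⟨z, rfl⟩
        induction z with
        | zero => simp
        | add y z hy hz => rw [map_add]; exact add_mem hy hz
        | tmul y z =>
          subst hab
          rcases P.of_add hi with h1 | h1
          · have : Ideal.Quotient.mk (μ.ideal P) (y : H) = 0 :=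
              Ideal.Quotient.eq_zero_iff_mem.2 (Ideal.subset_span ⟨a, h1, y.2⟩)
            simp [this]
          · have : Ideal.Quotient.mk (μ.ideal P) (z : H) = 0 :=
              Ideal.Quotient.eq_zero_iff_mem.2 (Ideal.subset_span ⟨b, h1, z.2⟩)
            simp [this]
      exact key (μ.comul_mem i h hh)
    exact this hx

/-- The bialgebra of functions on `P⁺`, `P⁻` or `M`. -/
abbrev coord (P : Part) : Type := H ⧸ μ.ideal P

/-- Restriction of functions from `G` to the subgroup. -/
def restrict (P : Part) : H →ₐ[ZMod p] μ.coord P := Ideal.Quotient.mkₐ (ZMod p) (μ.ideal P)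

lemma restrict_eq_zero (P : Part) {i : ℤ} (hi : i ∈ P.killed) {h : H} (hh : h ∈ μ.deg i) :
    μ.restrict P h = 0 :=
  Ideal.Quotient.eq_zero_iff_mem.2 (Ideal.subset_span ⟨i, hi, hh⟩)

lemma proj_of_mem {i : ℤ} {h : H} (hh : h ∈ μ.deg i) (j : ℤ) :
    GradedAlgebra.proj μ.deg j h = if i = j then h else 0 := by
  rw [GradedAlgebra.proj_apply]
  split_ifs with hij
  · subst hij; exact DirectSum.decompose_of_mem_same _ hh
  · exact DirectSum.decompose_of_mem_ne _ hh hij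

/-- The composition of the retraction `P → M` (the limit of `t · g` as `t` or `t⁻¹` tends to `0`)
with the inclusion `M ⊆ G`, on functions: it takes a function to its part of degree `0`. -/
def limit (P : Part) : H →ₐ[ZMod p] μ.coord P :=
  AlgHom.ofLinearMap ((μ.restrict P).toLinearMap ∘ₗ GradedAlgebra.proj μ.deg 0)
    (by
      have h1 : (1 : H) ∈ μ.deg 0 := SetLike.GradedOne.one_mem
      simp [μ.proj_of_mem h1])
    (by
      intro x y
      induction x using DirectSum.Decomposition.inductionOn μ.deg with
      | zero => simp
      | add a b ha hb => rw [add_mul, map_add, map_add, add_mul, ha, hb]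
      | @homogeneous i a =>
        induction y using DirectSum.Decomposition.inductionOn μ.deg with
        | zero => simp
        | add b c hb hc => rw [mul_add, map_add, map_add, mul_add, hb, hc]
        | @homogeneous j b =>
          have hab : (a : H) * b ∈ μ.deg (i + j) := SetLike.GradedMul.mul_mem a.2 b.2
          simp only [LinearMap.comp_apply, AlgHom.toLinearMap_apply, μ.proj_of_mem hab,
            μ.proj_of_mem a.2, μ.proj_of_mem b.2]
          by_cases hi : i = 0
          · subst hi
            by_cases hj : j = 0
            · subst hj; simp
            · simp [hj]
          · rw [if_neg hi, map_zero, zero_mul]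
            by_cases hij : i + j = 0
            · rw [if_pos hij, map_mul]
              rcases P.of_add_eq_zero hij hi with h | h
              · rw [μ.restrict_eq_zero P h a.2, zero_mul]
              · rw [μ.restrict_eq_zero P h b.2, mul_zero]
            · rw [if_neg hij, map_zero])

/-- The retraction `P → M`, on functions. -/
def retract (P : Part) : μ.coord .levi →ₐ[ZMod p] μ.coord P :=
  Ideal.Quotient.liftₐ (μ.ideal .levi) (μ.limit P) (by
    intro x hx
    have : μ.ideal .levi ≤ RingHom.ker (μ.limit P) := by
      refine Ideal.span_le.2 ?_
      rintro h ⟨i, hi, hh⟩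
      have hi' : i ≠ 0 := hi
      change μ.restrict P (GradedAlgebra.proj μ.deg 0 h) = 0
      rw [μ.proj_of_mem hh, if_neg hi', map_zero]
    exact this hx)

lemma eq_zero_of_mem_ideal_pos {B : Type} [CommRing B] [Algebra (ZMod p) B]
    {ξ : H →ₗ[ZMod p] B} (h1 : IsLie ξ) (h2 : μ.HasWeight 1 ξ) :
    (μ.ideal .pos).restrictScalars (ZMod p) ≤ LinearMap.ker ξ := by
  intro x hx
  change x ∈ Ideal.span _ at hx
  have hgen : ∀ a ∈ {h | ∃ i ∈ Part.pos.killed, h ∈ μ.deg i}, ξ a = 0 ∧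
      Coalgebra.counit (R := ZMod p) a = 0 := by
    rintro a ⟨i, hi, ha⟩
    have hi' : i < 0 := hi
    exact ⟨h2 i (by omega) a ha, μ.counit_eq_zero i (by omega) a ha⟩
  induction hx using Submodule.span_induction with
  | mem a ha => exact (hgen a ha).1
  | zero => simp
  | add a b _ _ ha hb => exact add_mem ha hb
  | smul c a ha' ha =>
    have hc : Coalgebra.counit (R := ZMod p) a = 0 := by
      have : Ideal.span {h | ∃ i ∈ Part.pos.killed, h ∈ μ.deg i} ≤
          RingHom.ker (Bialgebra.counitAlgHom (ZMod p) H) :=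
        Ideal.span_le.2 fun a ha => (hgen a ha).2
      exact this ha'
    have ha0 : ξ a = 0 := ha
    change ξ (c * a) = 0
    rw [h1, ha0, hc, smul_zero, zero_smul, add_zero]

end GmAction

/-- The adjoint coaction `h ↦ ∑ h₍₂₎ ⊗ S(h₍₁₎) h₍₃₎` of a commutative Hopf algebra, dual to
`(x, g) ↦ g⁻¹ x g`. -/
def adjoint (p : ℕ) (H : Type) [CommRing H] [HopfAlgebra (ZMod p) H] :
    H →ₗ[ZMod p] H ⊗[ZMod p] H :=
  (LinearMap.mul' (ZMod p) H ∘ₗ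
      (HopfAlgebra.antipode (ZMod p) (A := H)).rTensor H).lTensor H ∘ₗ
    (TensorProduct.assoc (ZMod p) H H H).toLinearMap ∘ₗ
    ((TensorProduct.comm (ZMod p) H H).toLinearMap ∘ₗ Coalgebra.comul).rTensor H ∘ₗ
    Coalgebra.comul

/-! ### Powers of derivations -/

/-- In characteristic `p`, the `p`-th iterate of a derivation is a derivation. -/
def derivPow {p : ℕ} [Fact p.Prime] {B : Type} [CommRing B] [Algebra (ZMod p) B]
    (D : Derivation (ZMod p) B B) : Derivation (ZMod p) B B :=
  Derivation.mk' ((D : B →ₗ[ZMod p] B) ^ p) (by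
    intro a b
    let d : Module.End (ZMod p) B := (D : B →ₗ[ZMod p] B)
    let x : Module.End (ZMod p) (B ⊗[ZMod p] B) := d.rTensor B
    let y : Module.End (ZMod p) (B ⊗[ZMod p] B) := d.lTensor B
    let m : B ⊗[ZMod p] B →ₗ[ZMod p] B := LinearMap.mul' (ZMod p) B
    have hm : ∀ z, d (m z) = m ((x + y) z) := by
      intro z
      induction z with
      | zero => simp
      | add z w hz hw => simp only [map_add, hz, hw]
      | tmul z w =>
        simp [d, x, y, m, mul_comm, add_comm]
    have hpow : ∀ (n : ℕ) z, (d ^ n) (m z) = m (((x + y) ^ n) z) := by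
      intro n
      induction n with
      | zero => intro z; simp
      | succ n ih => intro z; rw [pow_succ', pow_succ', Module.End.mul_apply, ih, hm]; rfl
    have hxy : Commute x y := by
      refine TensorProduct.ext' fun z w => ?_
      simp [x, y]
    have hp0 : ((p : ℕ) : Module.End (ZMod p) (B ⊗[ZMod p] B)) = 0 := by
      rw [← map_natCast (algebraMap (ZMod p) (Module.End (ZMod p) (B ⊗[ZMod p] B))) p]
      simp
    have hxp : (x + y) ^ p = x ^ p + y ^ p := by
      obtain ⟨r, hr⟩ := hxy.exists_add_pow_prime_eq (Fact.out : p.Prime)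
      rw [hr, hp0]; simp
    have h := hpow p (a ⊗ₜ b)
    rw [hxp] at h
    have hx : x ^ p = (d ^ p).rTensor B := LinearMap.rTensor_pow d p
    have hy : y ^ p = (d ^ p).lTensor B := LinearMap.lTensor_pow d p
    rw [hx, hy] at h
    simp only [m, LinearMap.add_apply, LinearMap.rTensor_tmul, LinearMap.lTensor_tmul, map_add,
      LinearMap.mul'_apply] at h
    rw [smul_eq_mul, smul_eq_mul, add_comm, mul_comm b]
    exact h)

/-! ### The affine étale site of a scheme -/

/-- An affine scheme `Spec R` étale over `X`. (An `𝔽_p`-algebra structure on a ring is unique if it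
exists, and it does if `X` is an `𝔽_p`-scheme.) -/
structure EtAff (p : ℕ) (X : Scheme.{0}) where
  R : Type
  [ring : CommRing R]
  [alg : Algebra (ZMod p) R]
  pt : Spec (CommRingCat.of R) ⟶ X
  [etale : Etale pt]

attribute [instance] EtAff.ring EtAff.alg EtAff.etale

/-- A morphism of affine étale `X`-schemes from `Spec V.R` to `Spec U.R`. -/
structure EtAff.Res {p : ℕ} {X : Scheme.{0}} (U V : EtAff p X) where
  map : U.R →ₐ[ZMod p] V.R
  comp_pt : Spec.map (CommRingCat.ofHom map.toRingHom) ≫ U.pt = V.pt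

/-- An affine étale `X'`-scheme, considered as an étale `X`-scheme via an étale `u : X' ⟶ X`. -/
abbrev EtAff.push {p : ℕ} {X X' : Scheme.{0}} (u : X' ⟶ X) [Etale u] (U : EtAff p X') :
    EtAff p X :=
  { R := U.R, pt := U.pt ≫ u }

def EtAff.Res.push {p : ℕ} {X X' : Scheme.{0}} (u : X' ⟶ X) [Etale u] {U V : EtAff p X'}
    (φ : U.Res V) : (U.push u).Res (V.push u) where
  map := φ.map
  comp_pt := by
    change _ ≫ U.pt ≫ u = V.pt ≫ u
    rw [← φ.comp_pt, Category.assoc]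

/-- Vector fields. -/
abbrev EtAff.Vect {p : ℕ} {X : Scheme.{0}} (U : EtAff p X) : Type :=
  Derivation (ZMod p) U.R U.R

/-- The vector field `D'` is the restriction of `D`. -/
def EtAff.Res.Related {p : ℕ} {X : Scheme.{0}} {U V : EtAff p X} (φ : U.Res V)
    (D : U.Vect) (D' : V.Vect) : Prop :=
  ∀ r, D' (φ.map r) = φ.map (D r)

/-! ### Torsors -/

/-- An (étale) torsor under an affine group scheme `P = Spec K` over `𝔽_p` (acting on the right) on
a scheme `X`. As `P` is affine, the total space `E` is an affine `X`-scheme, and it is described by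
the algebras `fn U` of functions on `E ×_X Spec U.R`, where `Spec U.R` runs through the affine étale
`X`-schemes, with the coaction `(coact b)(e, g) = b (e g)`. The map
`E × P → E ×_X E`, `(e, g) ↦ (e, e g)`, is an isomorphism, and `E` has sections étale-locally. -/
structure Torsor (p : ℕ) (K : Type) [CommRing K] [Bialgebra (ZMod p) K] (X : Scheme.{0}) where
  fn : EtAff p X → Type
  [ring : ∀ U, CommRing (fn U)]
  [alg : ∀ U, Algebra (ZMod p) (fn U)]
  [algR : ∀ U, Algebra U.R (fn U)]
  [tower : ∀ U, IsScalarTower (ZMod p) U.R (fn U)]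
  res : ∀ {U V : EtAff p X}, U.Res V → (fn U →ₐ[ZMod p] fn V)
  res_algebraMap : ∀ {U V : EtAff p X} (φ : U.Res V) (r : U.R),
    res φ (algebraMap U.R (fn U) r) = algebraMap V.R (fn V) (φ.map r)
  res_id : ∀ {U : EtAff p X} (φ : U.Res U), φ.map = AlgHom.id _ _ → ∀ b, res φ b = b
  res_comp : ∀ {U V W : EtAff p X} (φ : U.Res V) (ψ : V.Res W) (χ : U.Res W),
    χ.map = ψ.map.comp φ.map → ∀ b, res χ b = res ψ (res φ b)
  coact : ∀ U, fn U →ₐ[U.R] fn U ⊗[ZMod p] K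
  res_coact : ∀ {U V : EtAff p X} (φ : U.Res V) (b : fn U),
    coact V (res φ b) = Algebra.TensorProduct.map (res φ) (AlgHom.id (ZMod p) K) (coact U b)
  coact_coact : ∀ (U : EtAff p X) (b : fn U),
    TensorProduct.assoc (ZMod p) (fn U) K K
        (((coact U).restrictScalars (ZMod p)).toLinearMap.rTensor K (coact U b)) =
      (Coalgebra.comul (R := ZMod p) (A := K)).lTensor (fn U) (coact U b)
  coact_counit : ∀ (U : EtAff p X) (b : fn U),
    (Coalgebra.counit (R := ZMod p) (A := K)).lTensor (fn U) (coact U b) = b ⊗ₜ 1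
  bijective : ∀ U : EtAff p X, Function.Bijective
    (Algebra.TensorProduct.productMap
      (Algebra.TensorProduct.includeLeft : fn U →ₐ[U.R] fn U ⊗[ZMod p] K) (coact U))
  locally_trivial : ∀ U : EtAff p X, ∃ (R' : Type) (_ : CommRing R') (_ : Algebra U.R R'),
    Algebra.Etale U.R R' ∧ Module.FaithfullyFlat U.R R' ∧ Nonempty (fn U →ₐ[U.R] R')

attribute [instance] Torsor.ring Torsor.alg Torsor.algR Torsor.tower

section

variable {p : ℕ} {K K' : Type} [CommRing K] [Bialgebra (ZMod p) K] [CommRing K']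
  [Bialgebra (ZMod p) K'] {X X' : Scheme.{0}}

/-- Pullback of a torsor along an étale morphism. -/
def Torsor.pullback (E : Torsor p K X) (u : X' ⟶ X) [Etale u] : Torsor p K X' where
  fn U := E.fn (U.push u)
  ring U := E.ring (U.push u)
  alg U := E.alg (U.push u)
  algR U := E.algR (U.push u)
  tower U := E.tower (U.push u)
  res φ := E.res (φ.push u)
  res_algebraMap φ := E.res_algebraMap (φ.push u)
  res_id φ := E.res_id (φ.push u)
  res_comp φ ψ χ := E.res_comp (φ.push u) (ψ.push u) (χ.push u)
  coact U := E.coact (U.push u)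
  res_coact φ := E.res_coact (φ.push u)
  coact_coact U := E.coact_coact (U.push u)
  coact_counit U := E.coact_counit (U.push u)
  bijective U := E.bijective (U.push u)
  locally_trivial U := E.locally_trivial (U.push u)

/-- Let `c : P → P'` be a homomorphism of group schemes, given by `K' → K` on functions. This is a
`c`-equivariant morphism from the `P`-torsor `E` to the `P'`-torsor `E'`, either over `X` (`σ r = r`)
or covering the absolute Frobenius of `X` (`σ r = r ^ p`). In the first case it is the same as an
isomorphism from the `P'`-torsor induced by `E` to `E'`, and in the second case the same as an
isomorphism from it to the Frobenius pullback of `E'`. -/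
structure TorsorHom (c : K' →ₐ[ZMod p] K) (σ : ∀ U : EtAff p X, U.R → U.R)
    (E : Torsor p K X) (E' : Torsor p K' X) where
  map : ∀ U, E'.fn U →ₐ[ZMod p] E.fn U
  map_algebraMap : ∀ (U : EtAff p X) (r : U.R),
    map U (algebraMap U.R (E'.fn U) r) = algebraMap U.R (E.fn U) (σ U r)
  map_res : ∀ {U V : EtAff p X} (φ : U.Res V) (b : E'.fn U),
    map V (E'.res φ b) = E.res φ (map U b)
  map_coact : ∀ (U : EtAff p X) (b : E'.fn U),
    E.coact U (map U b) = Algebra.TensorProduct.map (map U) c (E'.coact U b)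

/-- Pullback of a morphism of torsors along an étale morphism. -/
def TorsorHom.pullback {c : K' →ₐ[ZMod p] K} {σ : ∀ U : EtAff p X, U.R → U.R}
    {E : Torsor p K X} {E' : Torsor p K' X} (i : TorsorHom c σ E E') (u : X' ⟶ X) [Etale u] :
    TorsorHom c (fun U => σ (U.push u)) (E.pullback u) (E'.pullback u) where
  map U := i.map (U.push u)
  map_algebraMap U := i.map_algebraMap (U.push u)
  map_res φ := i.map_res (φ.push u)
  map_coact U := i.map_coact (U.push u)

/-- A morphism that covers the identity of `X`. -/
abbrev TorsorHom.Over (c : K' →ₐ[ZMod p] K) (E : Torsor p K X) (E' : Torsor p K' X) :=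
  TorsorHom c (fun _ r => r) E E'

/-- A morphism that covers the absolute Frobenius of `X`. -/
abbrev TorsorHom.OverFrob (c : K' →ₐ[ZMod p] K) (E : Torsor p K X) (E' : Torsor p K' X) :=
  TorsorHom c (fun _ r => r ^ p) E E'

/-! ### Connections -/

/-- A connection on a torsor `E`: an `𝒪_X`-linear rule which lifts each vector field on `X` to an
invariant vector field on `E`, that is, a splitting of the Atiyah extension. -/
structure Connection (E : Torsor p K X) where
  lift : ∀ U : EtAff p X, U.Vect →ₗ[U.R] Derivation (ZMod p) (E.fn U) (E.fn U)
  lift_algebraMap : ∀ (U : EtAff p X) (D : U.Vect) (r : U.R),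
    lift U D (algebraMap U.R (E.fn U) r) = algebraMap U.R (E.fn U) (D r)
  invariant : ∀ (U : EtAff p X) (D : U.Vect) (b : E.fn U),
    E.coact U (lift U D b) = (lift U D : E.fn U →ₗ[ZMod p] E.fn U).rTensor K (E.coact U b)
  lift_res : ∀ {U V : EtAff p X} (φ : U.Res V) (D : U.Vect) (D' : V.Vect), φ.Related D D' →
    ∀ b, lift V D' (E.res φ b) = E.res φ (lift U D b)

/-- The connection `∇` is integrable. -/
def Connection.Integrable {E : Torsor p K X} (nabla : Connection E) : Prop :=
  ∀ (U : EtAff p X) (D₁ D₂ : U.Vect), nabla.lift U ⁅D₁, D₂⁆ = ⁅nabla.lift U D₁, nabla.lift U D₂⁆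

/-- The `p`-curvature `∇(D)ᵖ - ∇(Dᵖ)`, a vertical vector field on `E`. -/
def Connection.pCurv [Fact p.Prime] {E : Torsor p K X} (nabla : Connection E) (U : EtAff p X)
    (D : U.Vect) : Derivation (ZMod p) (E.fn U) (E.fn U) :=
  derivPow (nabla.lift U D) - nabla.lift U (derivPow D)

/-- The connection on `E'` is induced by the connection on `E`. -/
def Connection.Induces {c : K' →ₐ[ZMod p] K} {E : Torsor p K X} {E' : Torsor p K' X}
    (i : TorsorHom.Over c E E') (nabla : Connection E) (nabla' : Connection E') : Prop :=
  ∀ (U : EtAff p X) (D : U.Vect) (b : E'.fn U),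
    i.map U (nabla'.lift U D b) = nabla.lift U D (i.map U b)

/-- The connection on `E` is the usual connection on the Frobenius pullback of `E'`: the functions
pulled back from `E'` are horizontal. -/
def Connection.IsFrobenius {c : K' →ₐ[ZMod p] K} {E : Torsor p K X} {E' : Torsor p K' X}
    (F : TorsorHom.OverFrob c E E') (nabla : Connection E) : Prop :=
  ∀ (U : EtAff p X) (D : U.Vect) (b : E'.fn U), nabla.lift U D (F.map U b) = 0

end

/-! ### Vector bundles associated with the adjoint representation -/

section

variable {p : ℕ} {H : Type} [CommRing H] [HopfAlgebra (ZMod p) H]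
  {K : Type} [CommRing K] [Bialgebra (ZMod p) K] {X : Scheme.{0}}

lemma map_smul_apply {R B : Type} [CommRing R] [CommRing B] [Algebra (ZMod p) R]
    [Algebra (ZMod p) B] [Algebra R B] [IsScalarTower (ZMod p) R B] (c : H →ₐ[ZMod p] K)
    (r : R) (ξ : H →ₗ[ZMod p] B) (z : H ⊗[ZMod p] H) :
    TensorProduct.map (r • ξ) c.toLinearMap z = r • TensorProduct.map ξ c.toLinearMap z := by
  induction z with
  | zero => simp
  | add y z hy hz => rw [map_add, map_add, smul_add, hy, hz]
  | tmul y z => simp [TensorProduct.smul_tmul']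

/-- Let `P → G` be a homomorphism of group schemes, given by `c : H → K` on functions, and `E` a
`P`-torsor. The sections over `U` of the vector bundle associated with `E` and the `P`-module
`𝔤 = Lie(G)`: the functions `ξ : E → 𝔤` with `ξ (e g) = Ad(g⁻¹) ξ (e)`. -/
def adjointBundle (c : H →ₐ[ZMod p] K) (E : Torsor p K X) (U : EtAff p X) :
    Submodule U.R (H →ₗ[ZMod p] E.fn U) where
  carrier := {ξ | IsLie ξ ∧
    ∀ h, E.coact U (ξ h) = TensorProduct.map ξ c.toLinearMap (adjoint p H h)}
  zero_mem' := ⟨fun a b => by simp, fun h => by simp⟩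
  add_mem' := by
    rintro ξ η ⟨h1, h2⟩ ⟨h3, h4⟩
    refine ⟨fun a b => ?_, fun h => ?_⟩
    · simp only [LinearMap.add_apply, h1 a b, h3 a b, smul_add]; abel
    · rw [LinearMap.add_apply, map_add, h2, h4, TensorProduct.map_add_left, LinearMap.add_apply]
  smul_mem' := by
    rintro r ξ ⟨h1, h2⟩
    refine ⟨fun a b => ?_, fun h => ?_⟩
    · simp only [LinearMap.smul_apply, h1 a b, smul_add, smul_comm r]
    · rw [LinearMap.smul_apply, map_smul, h2, map_smul_apply]

variable (μ : GmAction p H)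

/-- The sections over `U` of the vector bundle associated with an `M`-torsor `E` and the `M`-module
`𝔤₁`. -/
def weightOne (E : Torsor p (μ.coord .levi) X) (U : EtAff p X) :
    Submodule U.R (H →ₗ[ZMod p] E.fn U) where
  carrier := {ξ | ξ ∈ adjointBundle (μ.restrict .levi) E U ∧ μ.HasWeight 1 ξ}
  zero_mem' := ⟨zero_mem _, fun _ _ _ _ => rfl⟩
  add_mem' := by
    rintro ξ η ⟨h1, h2⟩ ⟨h3, h4⟩
    refine ⟨add_mem h1 h3, fun j hj h hh => ?_⟩
    rw [LinearMap.add_apply, h2 j hj h hh, h4 j hj h hh, add_zero]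
  smul_mem' := by
    rintro r ξ ⟨h1, h2⟩
    refine ⟨Submodule.smul_mem _ r h1, fun j hj h hh => ?_⟩
    rw [LinearMap.smul_apply, h2 j hj h hh, smul_zero]

/-! ### `F`-zips -/

/-- An object of `Disp₁^G (X)`. The torsors are `F⁺`, `F⁻` (under `P⁺`, `P⁻`), the `G`-torsor `F`
induced by both of them, and the `M`-torsors `F⁺_M`, `F⁻_M` induced by `F⁺`, `F⁻`; the last datum is
an isomorphism from `F⁺_M` to the Frobenius pullback of `F⁻_M`. -/
structure Disp (X : Scheme.{0}) where
  Fpos : Torsor p (μ.coord .pos) X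
  Fneg : Torsor p (μ.coord .neg) X
  F : Torsor p H X
  Mpos : Torsor p (μ.coord .levi) X
  Mneg : Torsor p (μ.coord .levi) X
  posF : TorsorHom.Over (μ.restrict .pos) Fpos F
  negF : TorsorHom.Over (μ.restrict .neg) Fneg F
  posM : TorsorHom.Over (μ.retract .pos) Fpos Mpos
  negM : TorsorHom.Over (μ.retract .neg) Fneg Mneg
  frob : TorsorHom.OverFrob (AlgHom.id (ZMod p) (μ.coord .levi)) Mpos Mneg

namespace Disp

variable {μ} {X' : Scheme.{0}} (f : Disp μ X)

/-- The restriction of an object of `Disp₁^G` along an étale morphism. -/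
def pullback (u : X' ⟶ X) [Etale u] : Disp μ X' where
  Fpos := f.Fpos.pullback u
  Fneg := f.Fneg.pullback u
  F := f.F.pullback u
  Mpos := f.Mpos.pullback u
  Mneg := f.Mneg.pullback u
  posF := f.posF.pullback u
  negF := f.negF.pullback u
  posM := f.posM.pullback u
  negM := f.negM.pullback u
  frob := f.frob.pullback u

/-- Sections over `U` of the vector bundle `(𝔤₁)_{F⁺}`. -/
abbrev gPos (U : EtAff p X) : Submodule U.R (H →ₗ[ZMod p] f.Mpos.fn U) := weightOne μ f.Mpos U

/-- Sections over `U` of the vector bundle `(𝔤₁)_{F⁻}`. -/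
abbrev gNeg (U : EtAff p X) : Submodule U.R (H →ₗ[ZMod p] f.Mneg.fn U) := weightOne μ f.Mneg U

/-- The pullback map from sections of `(𝔤₁)_{F⁻}` to sections of
`(𝔤₁)_{F⁺} = Fr^* (𝔤₁)_{F⁻}`. -/
def frobPull {U : EtAff p X} (w : f.gNeg U) : f.gPos U :=
  ⟨(f.frob.map U).toLinearMap ∘ₗ w.1, ⟨⟨fun a b => by
      simp only [LinearMap.comp_apply, w.2.1.1 a b, map_add, map_smul], fun h => by
      rw [LinearMap.comp_apply, AlgHom.toLinearMap_apply, f.frob.map_coact, w.2.1.2 h]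
      generalize adjoint p H h = z
      induction z with
      | zero => simp
      | add y z hy hz => simp only [map_add, hy, hz]
      | tmul y z => simp⟩,
    fun j hj h hh => by
      rw [LinearMap.comp_apply, w.2.2 j hj h hh, map_zero]⟩⟩

/-- The vertical vector field on `F⁺` given by a section `ξ` of `(𝔤₁)_{F⁺} ⊆ 𝔤_{F⁺}`: its value at
`e` is the velocity at `ε = 0` of `e (1 + ε ξ(e))`, so on functions it is `b ↦ ∑ b₍₀₎ ξ(b₍₁₎)`. Here
`ξ`, which vanishes on the ideal of `P⁺`, is considered as a map on functions on `P⁺`. -/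
def vertical {U : EtAff p X} (ξ : f.gPos U) : f.Fpos.fn U →ₗ[ZMod p] f.Fpos.fn U :=
  LinearMap.mul' (ZMod p) (f.Fpos.fn U) ∘ₗ
    LinearMap.lTensor (f.Fpos.fn U)
      ((f.posM.map U).toLinearMap ∘ₗ (show μ.coord .pos →ₗ[ZMod p] f.Mpos.fn U from
        ((μ.ideal .pos).restrictScalars (ZMod p)).liftQ ξ.1
          (μ.eq_zero_of_mem_ideal_pos ξ.2.1.1 ξ.2.2))) ∘ₗ
    ((f.Fpos.coact U).restrictScalars (ZMod p)).toLinearMap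

/-- The section `κ` of `(𝔤/Lie(P⁻))_{F⁻} = (𝔤₁)_{F⁻}` is the image of the invariant vector field `Y`
on `F`, that is, `κ` is the component of `Y` normal to `F⁻` along `F⁻`: if a function `b` on `F`
vanishes on `F⁻`, then the restriction of `Y b` to `F⁻` is the derivative of `b` in the direction of
`κ`, which is `∑ b₍₀₎ κ(b₍₁₎)`. -/
def IsNormal {U : EtAff p X} (Y : Derivation (ZMod p) (f.F.fn U) (f.F.fn U)) (κ : f.gNeg U) :
    Prop :=
  ∀ b : f.F.fn U, f.negF.map U b = 0 →
    f.negF.map U (Y b) = LinearMap.mul' (ZMod p) (f.Fneg.fn U)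
      (TensorProduct.map (f.negF.map U).toLinearMap ((f.negM.map U).toLinearMap ∘ₗ κ.1)
        (f.F.coact U b))

/-- The connection on `F⁺_M` induced by `∇` is the one that comes from the isomorphism between
`F⁺_M` and the Frobenius pullback of `F⁻_M`. -/
def IsCompatible (nabla : Connection f.Fpos) : Prop :=
  ∃ nablaM : Connection f.Mpos, nabla.Induces f.posM nablaM ∧ nablaM.IsFrobenius f.frob

/-- The Kodaira-Spencer form: `κ` is `KS_∇ (D)`. -/
def IsKodairaSpencer (nabla : Connection f.Fpos) (U : EtAff p X) (D : U.Vect) (κ : f.gNeg U) :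
    Prop :=
  ∃ nablaG : Connection f.F, nabla.Induces f.posF nablaG ∧ f.IsNormal (nablaG.lift U D) κ

/-- The Katz condition `pCurv_∇ = - KS_∇`. A section `ψ` of `(𝔤₁)_{F⁻} ⊗ Ω¹` corresponds to the
section of `(𝔤₁)_{F⁺} ⊗ Fr^* Ω¹` whose value on `D` is the pullback of `ψ(D)`. -/
def IsKatz [Fact p.Prime] (nabla : Connection f.Fpos) : Prop :=
  ∀ (U : EtAff p X) (D : U.Vect), ∃ κ : f.gNeg U, f.IsKodairaSpencer nabla U D κ ∧
    ∀ b, nabla.pCurv U D b = - f.vertical (f.frobPull κ) b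

/-- The set `𝒯 (X, f)` of admissible connections. -/
def admissible [Fact p.Prime] : Set (Connection f.Fpos) :=
  {nabla | f.IsCompatible nabla ∧ nabla.Integrable ∧ f.IsKatz nabla}

/-! ### The sheaf of groups -/

/-- The pairing of vector fields with a 1-form. -/
def pair {U : EtAff p X} (α : Ω[U.R⁄ZMod p]) : U.Vect →ₗ[U.R] U.R :=
  LinearMap.applyₗ α ∘ₗ (KaehlerDifferential.linearMapEquivDerivation (ZMod p) U.R).symm.toLinearMap

/-- Closed 1-forms. -/
def IsClosedForm {U : EtAff p X} (α : Ω[U.R⁄ZMod p]) : Prop :=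
  ∀ D₁ D₂ : U.Vect, D₁ (pair α D₂) - D₂ (pair α D₁) - pair α ⁅D₁, D₂⁆ = 0

/-- The graph of the Cartier operator `C`, the additive map from closed 1-forms to 1-forms with
`C (aᵖ gᵖ⁻¹ dg) = a dg` and `C (da) = 0`. -/
def cartier (U : EtAff p X) : AddSubgroup (Ω[U.R⁄ZMod p] × Ω[U.R⁄ZMod p]) :=
  AddSubgroup.closure
    ({x | ∃ a g : U.R, x = ((a ^ p * g ^ (p - 1)) • D (ZMod p) U.R g, a • D (ZMod p) U.R g)} ∪
      {x | ∃ a : U.R, x = (D (ZMod p) U.R a, 0)})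

/-- Sections over `U` of `(𝔤₁)_{F⁺} ⊗ Ω¹`. -/
abbrev FormPos (U : EtAff p X) : Type := U.Vect →ₗ[U.R] f.gPos U

/-- Sections over `U` of `(𝔤₁)_{F⁻} ⊗ Ω¹`. -/
abbrev FormNeg (U : EtAff p X) : Type := U.Vect →ₗ[U.R] f.gNeg U

set_option maxSynthPendingDepth 4 in
instance (U : EtAff p X) : AddCommGroup (f.FormPos U) := inferInstance

set_option maxSynthPendingDepth 4 in
instance (U : EtAff p X) : AddCommGroup (f.FormNeg U) := inferInstance

/-- The graph of `C̃ = id ⊗ C`. Its domain is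
`(𝔤₁)_{F⁻} ⊗ (Fr_* Ω¹)_closed ⊆ (𝔤₁)_{F⁻} ⊗ Fr_* Ω¹ = (𝔤₁)_{F⁺} ⊗ Ω¹`. -/
def cartierTwisted (U : EtAff p X) : AddSubgroup (f.FormPos U × f.FormNeg U) :=
  AddSubgroup.closure {x | ∃ (w : f.gNeg U) (α β : Ω[U.R⁄ZMod p]),
    IsClosedForm α ∧ (α, β) ∈ cartier U ∧
      x = ((pair α).smulRight (f.frobPull w), (pair β).smulRight w)}

/-- The composition `(𝔤₁)_{F⁺} → 𝔤_{F⁺} = 𝔤_F = 𝔤_{F⁻} → (𝔤₁)_{F⁻}` takes `ξ` to `κ`. -/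
def IsPhi {U : EtAff p X} (ξ : f.gPos U) (κ : f.gNeg U) : Prop :=
  ∃ η ∈ adjointBundle (AlgHom.id (ZMod p) H) f.F U,
    (∀ h, f.posF.map U (η h) = f.posM.map U (ξ.1 h)) ∧
    ∀ h, f.negM.map U (κ.1 h) = f.negF.map U (η (GradedAlgebra.proj μ.deg 1 h))

lemma IsPhi.zero {U : EtAff p X} : f.IsPhi (0 : f.gPos U) 0 :=
  ⟨0, zero_mem _, fun h => by simp, fun h => by simp⟩

lemma IsPhi.add {U : EtAff p X} {ξ ξ' : f.gPos U} {κ κ' : f.gNeg U} (h1 : f.IsPhi ξ κ)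
    (h2 : f.IsPhi ξ' κ') : f.IsPhi (ξ + ξ') (κ + κ') := by
  obtain ⟨η, hη, h3, h4⟩ := h1
  obtain ⟨η', hη', h5, h6⟩ := h2
  refine ⟨η + η', add_mem hη hη', fun h => ?_, fun h => ?_⟩
  · simp [h3, h5]
  · simp [h4, h6]

lemma IsPhi.neg {U : EtAff p X} {ξ : f.gPos U} {κ : f.gNeg U} (h1 : f.IsPhi ξ κ) :
    f.IsPhi (-ξ) (-κ) := by
  obtain ⟨η, hη, h3, h4⟩ := h1
  refine ⟨-η, neg_mem hη, fun h => ?_, fun h => ?_⟩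
  · simp [h3]
  · simp [h4]

/-- The group `𝒜' (X, f)` of global sections of `(𝔤₁)_{F⁺} ⊗ Ω¹`. -/
def forms : AddSubgroup (∀ U : EtAff p X, f.FormPos U) where
  carrier := {ω | ∀ (U V : EtAff p X) (φ : U.Res V) (D : U.Vect) (D' : V.Vect), φ.Related D D' →
    ∀ h, (ω V D').1 h = f.Mpos.res φ ((ω U D).1 h)}
  zero_mem' := fun U V φ D D' _ h => by simp
  add_mem' := fun h1 h2 U V φ D D' hD h => by
    simp [h1 U V φ D D' hD h, h2 U V φ D D' hD h]
  neg_mem' := fun {ω} h1 U V φ D D' hD h => by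
    change -((ω V D').1 h) = f.Mpos.res φ (-((ω U D).1 h))
    rw [h1 U V φ D D' hD h, map_neg]

/-- The group `𝒜 (X, f)` of closed forms `ω` with `C̃(ω) = φ̃(ω)`. -/
def group : AddSubgroup (∀ U : EtAff p X, f.FormPos U) where
  carrier := {ω | ω ∈ f.forms ∧ ∀ U : EtAff p X, ∃ β : f.FormNeg U,
    (∀ D, f.IsPhi (ω U D) (β D)) ∧ (ω U, β) ∈ f.cartierTwisted U}
  zero_mem' := ⟨zero_mem _, fun U => ⟨0, fun D => IsPhi.zero f, zero_mem _⟩⟩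
  add_mem' := by
    rintro ω ω' ⟨h1, h2⟩ ⟨h3, h4⟩
    refine ⟨add_mem h1 h3, fun U => ?_⟩
    obtain ⟨β, h5, h6⟩ := h2 U
    obtain ⟨β', h7, h8⟩ := h4 U
    exact ⟨β + β', fun D => (h5 D).add f (h7 D), add_mem h6 h8⟩
  neg_mem' := by
    rintro ω ⟨h1, h2⟩
    refine ⟨neg_mem h1, fun U => ?_⟩
    obtain ⟨β, h5, h6⟩ := h2 U
    exact ⟨-β, fun D => (h5 D).neg f, neg_mem h6⟩

/-- The connection `∇'` is the sum of `∇` and the 1-form `ω` with values in `(𝔤₁)_{F⁺}`. -/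
def IsTranslate (ω : ∀ U : EtAff p X, f.FormPos U) (nabla nabla' : Connection f.Fpos) : Prop :=
  ∀ (U : EtAff p X) (D : U.Vect) (b : f.Fpos.fn U),
    nabla'.lift U D b = nabla.lift U D b + f.vertical (ω U D) b

end Disp

end

end FZip

namespace FZip

/-! ### Identities in characteristic `p` -/

section CharP

variable {p : ℕ} [Fact p.Prime]

/-! The weights carry the structural part. As `𝔤ᵢ = 0` for `i > 1`, the vertical fields of weight
one commute and have zero `p`-th power, since these operations produce weights `2` and `p`. The
unipotent radical of `P⁺` acts trivially on `𝔤₁`, and `P⁻` acts on `𝔤/Lie(P⁻) = 𝔤₁` through `M`.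
Hence two connections on `F⁺` with the prescribed induced connection on `F⁺_M` differ by a form `ω`
with values in `(𝔤₁)_{F⁺}` (`exists_forms_isTranslate`). Sections pulled back by Frobenius are
horizontal, so bracketing the vertical field of `∑ gₐ Fr^*wₐ` with `∇(D)` only differentiates the
`gₐ` (`commutator_vertical`).

Consequently, if `∇` is integrable, `∇ + ω` is integrable exactly when `ω` is closed. Jacobson's
formula collapses to `(∇(D) + v)ᵖ = ∇(D)ᵖ + ad(∇(D))ᵖ⁻¹(v)`, so the `p`-curvature changes by
`Dᵖ⁻¹(ω(D)) - ω(Dᵖ)`. This equals `-Fr^*(C̃ω)(D)` because of the identity `Dᵖ⁻¹(gᵖ⁻¹ Dg) = gᵖ⁻¹ Dᵖg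
- (Dg)ᵖ` (`derivation_pow_sub_one`, `pow_sub_derivPow_of_mem_cartierGraph`, `pCurv_translate`). The
Kodaira-Spencer form changes by `φ̃(ω)` (`IsNormal.add_vert`, `isPhi_of_isNormal`). Thus `pCurv =
-KS` is preserved exactly when `C̃(ω) = φ̃(ω)`. The converse direction also uses that every closed
form on a smooth algebra lies in the domain of the Cartier operator (`exists_mem_cartierGraph`), and
that Frobenius pullback of sections is injective because smooth algebras are reduced
(`frobPull_injective`).

For local existence, choose étale-locally coordinates `xⱼ` and compatible trivializations of all the
torsors (`Frame`). The resulting trivial connection is integrable with zero `p`-curvature and some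
Kodaira-Spencer matrix `κ`. Adding `∑ aₖⱼᵖ xⱼᵖ⁻¹ dxⱼ ⊗ Fr^*eₖ`, a closed form with Cartier image `∑
aₖⱼ dxⱼ ⊗ eₖ`, turns the Katz condition into the system `aₖⱼ = κₖⱼ + ∑ᵢ Φₖᵢ xⱼᵖ⁻¹ aᵢⱼᵖ`
(`admissible_nonempty_of_frame`). This system defines an étale algebra, since the unknowns enter the
right side only through `p`-th powers. Its spectrum is surjective, since `1 - T` is surjective for a
Frobenius-semilinear `T` over an algebraically closed field (`exists_sub_eq_of_semilinear`). -/

lemma cast_choose_sub_one (k : ℕ) (hk : k < p) : ((p - 1).choose k : ZMod p) = (-1) ^ k := by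
  induction k with
  | zero => simp
  | succ k ih =>
    have h1 : p.choose (k + 1) = (p - 1).choose k + (p - 1).choose (k + 1) := by
      conv_lhs => rw [← Nat.sub_add_cancel (Fact.out : p.Prime).one_le]
      exact Nat.choose_succ_succ _ _
    have h2 : (p.choose (k + 1) : ZMod p) = 0 :=
      (ZMod.natCast_eq_zero_iff _ _).2
        ((Fact.out : p.Prime).dvd_choose_self (Nat.succ_ne_zero k) hk)
    rw [h1, Nat.cast_add, ih (by omega)] at h2
    rw [pow_succ, mul_neg_one]
    exact eq_neg_of_add_eq_zero_right h2

lemma add_pow_prime {A : Type*} [CommRing A] [Algebra (ZMod p) A] (a b : A) :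
    (a + b) ^ p = a ^ p + b ^ p := by
  obtain ⟨q, hq⟩ := (Commute.all a b).exists_add_pow_prime_eq (Fact.out : p.Prime)
  have hp : (p : A) = 0 := by
    rw [← map_natCast (algebraMap (ZMod p) A) p]; simp
  rw [hq, hp]; simp

lemma sub_pow_prime {A : Type*} [CommRing A] [Algebra (ZMod p) A] (a b : A) :
    (a - b) ^ p = a ^ p - b ^ p := by
  rw [eq_sub_iff_add_eq, ← add_pow_prime, sub_add_cancel]

/-- The binomial coefficients of row `p - 1` are `±1` modulo `p`, and their signs cancel those
coming from `-y`. -/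
lemma sub_pow_sub_one {A : Type*} [Ring A] [Algebra (ZMod p) A] {x y : A} (h : Commute x y) :
    (x - y) ^ (p - 1) = ∑ i ∈ Finset.range p, x ^ i * y ^ (p - 1 - i) := by
  have hp := (Fact.out : p.Prime).one_le
  rw [sub_eq_add_neg, h.neg_right.add_pow, Nat.sub_add_cancel hp]
  refine Finset.sum_congr rfl fun i hi => ?_
  have hi' : i < p := Finset.mem_range.1 hi
  have h1 : ((p - 1).choose i : A) = (-1) ^ (p - 1 - i) := by
    have h2 := cast_choose_sub_one (p := p) (p - 1 - i) (by omega)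
    rw [Nat.choose_symm (by omega)] at h2
    have h3 := congrArg (algebraMap (ZMod p) A) h2
    simpa using h3
  rw [h1, neg_pow y, mul_assoc, mul_assoc]
  congr 1
  rw [← ((Commute.neg_one_left y).pow_pow (p - 1 - i) (p - 1 - i)).eq, ← mul_assoc, ← pow_add,
    ← two_mul, pow_mul]
  simp

/-- The iterated commutator `ad(x)ⁿ(v)`. -/
def adIter {A : Type*} [Ring A] (x v : A) : ℕ → A
  | 0 => v
  | n + 1 => x * adIter x v n - adIter x v n * x

/-- `ad(x)` is the difference of left and right multiplication by `x`, which commute, so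
`sub_pow_sub_one` applies. The resulting sum is the part of `(x + v) ^ p` that is linear in `v`. -/
lemma adIter_sub_one {A : Type*} [Ring A] [Algebra (ZMod p) A] (x v : A) :
    adIter x v (p - 1) = ∑ i ∈ Finset.range p, x ^ i * v * x ^ (p - 1 - i) := by
  let l : Module.End (ZMod p) A := LinearMap.mulLeft (ZMod p) x
  let r : Module.End (ZMod p) A := LinearMap.mulRight (ZMod p) x
  have hlr : Commute l r := by
    refine LinearMap.ext fun z => ?_
    simp [l, r, mul_assoc]
  have h1 : ∀ n, adIter x v n = ((l - r) ^ n) v := by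
    intro n
    induction n with
    | zero => rfl
    | succ n ih => rw [pow_succ', Module.End.mul_apply, ← ih]; rfl
  rw [h1, sub_pow_sub_one hlr, LinearMap.sum_apply]
  refine Finset.sum_congr rfl fun i _ => ?_
  rw [Module.End.mul_apply]
  simp [l, r, LinearMap.pow_mulLeft, LinearMap.pow_mulRight, mul_assoc]

open Polynomial in
lemma derivative_pow_noncomm {A : Type*} [Ring A] (f : A[X]) (n : ℕ) :
    derivative (f ^ n) = ∑ i ∈ Finset.range n, f ^ i * derivative f * f ^ (n - 1 - i) := by
  induction n with
  | zero => simp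
  | succ n ih =>
    rw [pow_succ, derivative_mul, ih, Finset.sum_range_succ, Finset.sum_mul]
    simp only [Nat.add_sub_cancel, Nat.sub_self, pow_zero, mul_one]
    congr 1
    refine Finset.sum_congr rfl fun i hi => ?_
    have hi' : i < n := Finset.mem_range.1 hi
    rw [mul_assoc, ← pow_succ]
    congr 2
    omega

open Polynomial in
lemma coeff_add_C_mul_X_pow {A : Type*} [Ring A] (x v : A) (n : ℕ) :
    ((C x + C v * X) ^ n).coeff 0 = x ^ n ∧ ((C x + C v * X) ^ n).coeff n = v ^ n ∧
      ((C x + C v * X) ^ n).natDegree ≤ n := by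
  have hd : (C x + C v * X : A[X]).natDegree ≤ 1 := by
    refine (natDegree_add_le _ _).trans (max_le (by simp) ((natDegree_C_mul_le _ _).trans natDegree_X_le))
  refine ⟨?_, ?_, ?_⟩
  · induction n with
    | zero => simp
    | succ n ih => rw [pow_succ, mul_coeff_zero, ih, pow_succ]; simp
  · have h := coeff_pow_of_natDegree_le (m := n) hd
    rw [mul_one] at h
    rw [h]; simp
  · simpa using natDegree_pow_le_of_le n hd

open Polynomial in
/-- Jacobson's formula, if `v` commutes with its iterated commutators with `x`. -/
theorem add_pow_prime_of_commute {A : Type*} [Ring A] [Algebra (ZMod p) A] (x v : A)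
    (h : ∀ n, Commute v (adIter x v n)) :
    (x + v) ^ p = x ^ p + v ^ p + adIter x v (p - 1) := by
  have hp := (Fact.out : p.Prime)
  -- The formula is read off from the coefficients of `(x + vX) ^ p`. Its derivative is `ad(f) ^ (p
  -- - 1)` of `v`, and this is a constant polynomial because `v` commutes with all `ad(x) ^ n (v)`.
  let f : A[X] := C x + C v * X
  have had : ∀ n, adIter f (C v) n = C (adIter x v n) := by
    intro n
    induction n with
    | zero => rfl
    | succ n ih =>
      have h3 : v * adIter x v n = adIter x v n * v := h n
      simp only [adIter, ih, f, C_sub, C_mul, add_mul, mul_add]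
      have h1 : C v * X * C (adIter x v n) = C (adIter x v n) * (C v * X) := by
        rw [mul_assoc, X_mul_C, ← mul_assoc, ← mul_assoc, ← C_mul, h3, C_mul]
      rw [h1]; abel
  have hder : derivative (f ^ p) = C (adIter x v (p - 1)) := by
    rw [derivative_pow_noncomm, ← had, adIter_sub_one]
    simp [f]
  obtain ⟨h0, hpp, hdeg⟩ := coeff_add_C_mul_X_pow x v p
  have hcoeff : ∀ n, (f ^ p).coeff (n + 1) * (n + 1) = if n = 0 then adIter x v (p - 1) else 0 := by
    intro n
    have := congrArg (fun q => coeff q n) hder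
    simpa [coeff_derivative, coeff_C] using this
  have h1 : (f ^ p).coeff 1 = adIter x v (p - 1) := by simpa using hcoeff 0
  -- The derivative is constant, so `n` times the coefficient vanishes, and `n` is invertible.
  have h2 : ∀ n, 1 < n → n < p → (f ^ p).coeff n = 0 := by
    intro n hn hnp
    have h3 := hcoeff (n - 1)
    rw [if_neg (by omega), Nat.sub_add_cancel (by omega)] at h3
    have h4 : IsUnit ((n : ZMod p)) := by
      rw [isUnit_iff_ne_zero, Ne, ZMod.natCast_eq_zero_iff]
      exact fun h => absurd (Nat.le_of_dvd (by omega) h) (by omega)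
    have h5 : IsUnit (n : A) := by simpa using h4.map (algebraMap (ZMod p) A)
    have h6 : ((n - 1 : ℕ) : A) + 1 = n := by
      rw [← Nat.cast_succ, Nat.succ_eq_add_one, Nat.sub_add_cancel (by omega)]
    rw [h6] at h3
    exact (h5.mul_left_eq_zero).1 h3
  have heval : (f ^ p).eval 1 = (x + v) ^ p := by
    -- Evaluation is not multiplicative over a noncommutative ring in general, but it is at the
    -- central element `1`.
    have : ∀ n, (f ^ n).eval 1 = (x + v) ^ n := by
      intro n
      induction n with
      | zero => simp
      | succ n ih =>
        rw [pow_succ, pow_succ, ← ih]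
        have h3 := eval₂_mul_noncomm (RingHom.id A) (1 : A) (p := f ^ n) (q := f)
          fun k => Commute.one_right _
        have h4 : f.eval 1 = x + v := by simp [f]
        rw [← h4]
        exact h3
    exact this p
  rw [← heval, eval_eq_sum_range' (Nat.lt_succ_of_le hdeg)]
  simp only [one_pow, mul_one]
  rw [Finset.sum_range_succ, Finset.range_eq_Ico, Finset.sum_eq_sum_Ico_succ_bot hp.pos,
    Finset.sum_eq_sum_Ico_succ_bot hp.one_lt]
  rw [h0, hpp, h1, Finset.sum_eq_zero]
  · abel
  · intro n hn
    obtain ⟨hn1, hn2⟩ := Finset.mem_Ico.1 hn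
    exact h2 n (by omega) hn2

lemma derivation_pow_one {B : Type} [CommRing B] [Algebra (ZMod p) B]
    (D : Derivation (ZMod p) B B) (m : ℕ) (hm : 0 < m) : ((D : B →ₗ[ZMod p] B) ^ m) 1 = 0 := by
  obtain ⟨q, rfl⟩ := Nat.exists_eq_succ_of_ne_zero hm.ne'
  rw [pow_succ, Module.End.mul_apply]
  simp

lemma derivPow_apply {B : Type} [CommRing B] [Algebra (ZMod p) B] (D : Derivation (ZMod p) B B)
    (b : B) : derivPow D b = ((D : B →ₗ[ZMod p] B) ^ p) b := rfl

/-- The extension of a derivation to formal power series. -/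
def seriesDerivation {R : Type} [CommRing R] [Algebra (ZMod p) R] (D : Derivation (ZMod p) R R) :
    Derivation (ZMod p) (PowerSeries R) (PowerSeries R) :=
  Derivation.mk'
    { toFun := fun f => PowerSeries.mk fun n => D (PowerSeries.coeff n f)
      map_add' := fun f g => by ext n; simp
      map_smul' := fun c f => by
        ext n
        have h : ∀ f : PowerSeries R, PowerSeries.coeff n (c • f) = c • PowerSeries.coeff n f := by
          intro f
          rw [← algebraMap_smul R c f, PowerSeries.coeff_smul, smul_eq_mul, Algebra.smul_def]
        simp [h] }
    (by
      intro f g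
      ext n
      simp only [LinearMap.coe_mk, AddHom.coe_mk, PowerSeries.coeff_mk, PowerSeries.coeff_mul,
        map_sum, Derivation.leibniz, smul_eq_mul, map_add, Finset.sum_add_distrib]
      congr 1
      exact Finset.sum_nbij' Prod.swap Prod.swap (by simp [add_comm]) (by simp [add_comm]) (by simp)
        (by simp) (by simp))

lemma coeff_seriesDerivation {R : Type} [CommRing R] [Algebra (ZMod p) R]
    (D : Derivation (ZMod p) R R) (f : PowerSeries R) (n : ℕ) :
    PowerSeries.coeff n (seriesDerivation D f) = D (PowerSeries.coeff n f) := by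
  change PowerSeries.coeff n (PowerSeries.mk fun n => D (PowerSeries.coeff n f)) = _
  rw [PowerSeries.coeff_mk]

lemma coeff_seriesDerivation_pow {R : Type} [CommRing R] [Algebra (ZMod p) R]
    (D : Derivation (ZMod p) R R) (m : ℕ) (f : PowerSeries R) (n : ℕ) :
    PowerSeries.coeff n (((seriesDerivation D : PowerSeries R →ₗ[ZMod p] PowerSeries R) ^ m) f) =
      ((D : R →ₗ[ZMod p] R) ^ m) (PowerSeries.coeff n f) := by
  induction m with
  | zero => rfl
  | succ m ih =>
    rw [pow_succ', pow_succ', Module.End.mul_apply, Module.End.mul_apply, ← ih]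
    exact coeff_seriesDerivation D _ n

/-- The commutators of a derivation with a multiplication operator. -/
lemma adIter_mulLeft {B : Type} [CommRing B] [Algebra (ZMod p) B] (D : Derivation (ZMod p) B B)
    (w : B) (n : ℕ) :
    adIter (A := Module.End (ZMod p) B) (D : B →ₗ[ZMod p] B) (LinearMap.mulLeft (ZMod p) w) n =
      LinearMap.mulLeft (ZMod p) (((D : B →ₗ[ZMod p] B) ^ n) w) := by
  induction n with
  | zero => rfl
  | succ n ih =>
    rw [adIter, ih]
    refine LinearMap.ext fun z => ?_
    rw [pow_succ', Module.End.mul_apply]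
    simp [mul_comm]

/-- The identity `Dᵖ⁻¹(w) + wᵖ = G⁻¹ Dᵖ(G)` for the logarithmic derivative `w` of a unit `G`. -/
lemma pow_logDeriv {B : Type} [CommRing B] [Algebra (ZMod p) B] (D : Derivation (ZMod p) B B)
    (G G' : B) (hG : G * G' = 1) :
    ((D : B →ₗ[ZMod p] B) ^ (p - 1)) (G' * D G) + (G' * D G) ^ p =
      G' * ((D : B →ₗ[ZMod p] B) ^ p) G := by
  let d : Module.End (ZMod p) B := (D : B →ₗ[ZMod p] B)
  let w := G' * D G
  let m : B → Module.End (ZMod p) B := fun b => LinearMap.mulLeft (ZMod p) b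
  have h1 := add_pow_prime_of_commute (p := p) d (m w) (by
    intro n
    rw [adIter_mulLeft]
    refine LinearMap.ext fun z => ?_
    simp [m, mul_left_comm])
  have hmm : m G * m G' = 1 := by
    refine LinearMap.ext fun z => ?_
    simp [m, ← mul_assoc, hG]
  -- The operator `D + w` is the conjugate of `D` by multiplication by `G`, so its `p`-th power is
  -- `G⁻¹ Dᵖ G`. Jacobson's formula expresses the same power as `Dᵖ + wᵖ + Dᵖ⁻¹(w)`.
  have h2 : d + m w = m G' * d * m G := by
    refine LinearMap.ext fun z => ?_
    simp only [m, w, d, LinearMap.add_apply, LinearMap.mulLeft_apply, Module.End.mul_apply,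
      Derivation.coeFn_coe, Derivation.leibniz, smul_eq_mul]
    linear_combination (-(D z)) * hG
  have h3 : ∀ n, (m G' * d * m G) ^ n * m G' = m G' * d ^ n := by
    intro n
    induction n with
    | zero => simp
    | succ n ih =>
      rw [pow_succ', mul_assoc, ih, pow_succ', mul_assoc, mul_assoc, ← mul_assoc (m G), hmm, one_mul]
  -- Both expressions are evaluated at `G' G = 1`, where the term `Dᵖ` vanishes.
  have h4 := congrArg (fun q : Module.End (ZMod p) B => (q * m G') G) h1
  rw [h2, h3, adIter_mulLeft] at h4
  have h5 : (d ^ p) 1 = 0 := derivation_pow_one D _ (Fact.out : p.Prime).pos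
  have h6 : ∀ n z, ((m w) ^ n) z = w ^ n * z := by
    intro n z
    simp [m, LinearMap.pow_mulLeft]
  have hG2 : G' * G = 1 := by rw [mul_comm, hG]
  have h7 : (m G') G = 1 := hG2
  simp only [Module.End.mul_apply, LinearMap.add_apply, h7, h5, h6, LinearMap.mulLeft_apply, mul_one,
    zero_add] at h4
  rw [add_comm]
  exact h4.symm

/-- `Dᵖ⁻¹(gᵖ⁻¹ D g) = gᵖ⁻¹ Dᵖ g - (D g)ᵖ`. -/
theorem derivation_pow_sub_one {R : Type} [CommRing R] [Algebra (ZMod p) R]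
    (D : Derivation (ZMod p) R R) (g : R) :
    ((D : R →ₗ[ZMod p] R) ^ (p - 1)) (g ^ (p - 1) * D g) =
      g ^ (p - 1) * ((D : R →ₗ[ZMod p] R) ^ p) g - (D g) ^ p := by
  open PowerSeries in
  have hp := (Fact.out : p.Prime)
  -- As `g` need not be a unit, `pow_logDeriv` is applied to the unit `1 + gX` of the power series
  -- ring. The coefficients of `X ^ p` then give the identity for `g`.
  let G : R⟦X⟧ := 1 + C g * X
  let G' : R⟦X⟧ := mk fun n => (-g) ^ n
  have hcm : ∀ (b : R) (n : ℕ) (f : R⟦X⟧), coeff (n + 1) (f * (C b * X)) = coeff n f * b := by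
    intro b n f
    rw [← mul_assoc, coeff_succ_mul_X, mul_comm f, coeff_C_mul, mul_comm]
  have hG : G * G' = 1 := by
    ext n
    rw [mul_comm, mul_add, mul_one, map_add]
    cases n with
    | zero => simp [G']
    | succ n => rw [hcm]; simp [G', pow_succ, coeff_one]
  have hDpow : ∀ m, 0 < m → ((seriesDerivation D : R⟦X⟧ →ₗ[ZMod p] R⟦X⟧) ^ m) G =
      C (((D : R →ₗ[ZMod p] R) ^ m) g) * X := by
    intro m hm
    ext n
    rw [coeff_seriesDerivation_pow]
    have h1 := derivation_pow_one D m hm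
    rcases n with _ | n
    · simp [G, h1]
    · rcases n with _ | n
      · simp [G, coeff_one]
      · simp [G, coeff_one]
  have h := pow_logDeriv (seriesDerivation D) G G' hG
  have hD1 : seriesDerivation D G = C (D g) * X := by simpa using hDpow 1 one_pos
  rw [hDpow p hp.pos, hD1] at h
  have h' := congrArg (coeff p) h
  have hc : ∀ y : R, coeff p (G' * (C y * X)) = (-g) ^ (p - 1) * y := by
    intro y
    have h0 := hcm y (p - 1) G'
    rw [Nat.sub_add_cancel hp.one_le] at h0
    rw [h0]; simp [G']
  have hc3 : coeff p ((G' * (C (D g) * X)) ^ p) = (D g) ^ p := by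
    rw [← mul_assoc, mul_pow, coeff_mul_X_pow', if_pos le_rfl, Nat.sub_self, coeff_zero_eq_constantCoeff,
      map_pow, map_mul]
    have : constantCoeff G' = 1 := by
      rw [← coeff_zero_eq_constantCoeff_apply]; simp [G']
    rw [this]; simp
  rw [map_add, coeff_seriesDerivation_pow, hc, hc, hc3] at h'
  -- Fermat's little theorem handles odd `p` and `p = 2` together.
  have hsign : ((-1 : R)) ^ (p - 1) = 1 := by
    have h1 : ((-1 : ZMod p)) ^ (p - 1) = 1 :=
      ZMod.pow_card_sub_one_eq_one (neg_ne_zero.2 one_ne_zero)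
    simpa using congrArg (algebraMap (ZMod p) R) h1
  rw [neg_pow g, hsign, one_mul] at h'
  exact eq_sub_of_add_eq h'

end CharP

/-! ### Closed forms in coordinates -/

set_option linter.unusedSectionVars false

section Coordinates

variable {p : ℕ} [Fact p.Prime] {R : Type} [CommRing R] [Algebra (ZMod p) R]
  {ι : Type} [Fintype ι] [DecidableEq ι]

/-- The differentials of the functions `xᵢ` span `Ω¹`, and the vector fields `∂ᵢ` are dual to
them. -/
structure IsCoord (x : ι → R) (der : ι → Derivation (ZMod p) R R) : Prop where
  apply : ∀ i j, der i (x j) = if i = j then 1 else 0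
  span : Submodule.span R (Set.range fun i => D (ZMod p) R (x i)) = ⊤

lemma derivation_sum_apply {A M κ : Type} [CommRing A] [Algebra (ZMod p) A] [AddCommGroup M]
    [Module A M] [Module (ZMod p) M] (s : Finset κ) (E : κ → Derivation (ZMod p) A M) (a : A) :
    (∑ i ∈ s, E i) a = ∑ i ∈ s, E i a :=
  map_sum (⟨⟨fun E : Derivation (ZMod p) A M => E a, rfl⟩, fun _ _ => rfl⟩ :
    Derivation (ZMod p) A M →+ M) E s

lemma derivation_eq_of_span {x : ι → R}
    (hx : Submodule.span R (Set.range fun i => D (ZMod p) R (x i)) = ⊤) {M : Type} [AddCommGroup M]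
    [Module R M] [Module (ZMod p) M] [IsScalarTower (ZMod p) R M] {D₁ D₂ : Derivation (ZMod p) R M}
    (h : ∀ i, D₁ (x i) = D₂ (x i)) : D₁ = D₂ := by
  have h1 : D₁.liftKaehlerDifferential = D₂.liftKaehlerDifferential := by
    refine LinearMap.ext_on_range hx fun i => ?_
    simp [h]
  ext r
  rw [← Derivation.liftKaehlerDifferential_comp_D, h1, Derivation.liftKaehlerDifferential_comp_D]

/-- If the differentials of the `xᵢ` span `Ω¹` and `R` is of finite type, then `R` is generated by
the `xᵢ` and the `p`-th powers. -/
lemma adjoin_eq_top_of_span [Algebra.FiniteType (ZMod p) R] {x : ι → R}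
    (hx : Submodule.span R (Set.range fun i => D (ZMod p) R (x i)) = ⊤) :
    Algebra.adjoin (ZMod p) (Set.range x ∪ Set.range fun r : R => r ^ p) = ⊤ := by
  set B := Algebra.adjoin (ZMod p) (Set.range x ∪ Set.range fun r : R => r ^ p) with hB
  have hpow : ∀ r : R, r ^ p ∈ B := fun r => Algebra.subset_adjoin (Or.inr ⟨r, rfl⟩)
  have h_int : Algebra.IsIntegral B R := by
    refine ⟨fun r => ?_⟩
    refine IsIntegral.of_pow (Fact.out : p.Prime).pos ?_
    exact isIntegral_algebraMap (x := (⟨r ^ p, hpow r⟩ : B))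
  have hft : Algebra.FiniteType B R := Algebra.FiniteType.of_restrictScalars_finiteType (ZMod p) B R
  have hfin : Module.Finite B R := Algebra.IsIntegral.finite
  -- `Ω¹` relative to `B` is spanned by the `dxᵢ`, and `xᵢ ∈ B`.
  have hunr : Algebra.FormallyUnramified B R := by
    refine ⟨?_⟩
    rw [← Submodule.subsingleton_iff R, ← subsingleton_iff_bot_eq_top, eq_comm]
    have h1 : LinearMap.range (KaehlerDifferential.map (ZMod p) B R R) = ⊤ :=
      LinearMap.range_eq_top.2 (KaehlerDifferential.map_surjective (ZMod p) B R)
    rw [LinearMap.range_eq_map, ← hx, LinearMap.map_span] at h1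
    rw [← h1, Submodule.span_eq_bot]
    rintro _ ⟨_, ⟨i, rfl⟩, rfl⟩
    rw [KaehlerDifferential.map_D]
    exact (D B R).map_algebraMap (⟨x i, Algebra.subset_adjoin (Or.inl ⟨i, rfl⟩)⟩ : B)
  -- The element `t` is killed by all `1 ⊗ s - s ⊗ 1` and is sent to `1` by multiplication. The
  -- kernel of multiplication is nil, because `p`-th powers lie in `B`. So `t` is a unit, `1 ⊗ s = s
  -- ⊗ 1`, and `B → R` is an epimorphism; being finite, it is surjective.
  obtain ⟨t, ht1, ht2⟩ := Algebra.FormallyUnramified.iff_exists_tensorProduct.1 hunr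
  have hnil : ∀ r : R, IsNilpotent ((1 : R) ⊗ₜ[B] r - r ⊗ₜ[B] (1 : R)) := by
    intro r
    refine ⟨p, ?_⟩
    have h1 : (1 : R) ⊗ₜ[B] (r ^ p) = (r ^ p) ⊗ₜ[B] (1 : R) := by
      have : r ^ p = (⟨r ^ p, hpow r⟩ : B) • (1 : R) := by
        rw [Algebra.smul_def, mul_one]; rfl
      rw [this, TensorProduct.tmul_smul, TensorProduct.smul_tmul']
    have h2 := sub_pow_prime (p := p) ((1 : R) ⊗ₜ[B] r) (r ⊗ₜ[B] (1 : R))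
    rw [Algebra.TensorProduct.tmul_pow, Algebra.TensorProduct.tmul_pow, one_pow, h1, sub_self] at h2
    exact h2
  have hunit : IsUnit t := by
    have h1 : 1 - t ∈ Ideal.span (Set.range fun s : R => (1 : R) ⊗ₜ[B] s - s ⊗ₜ[B] (1 : R)) := by
      rw [KaehlerDifferential.span_range_eq_ideal]
      change Algebra.TensorProduct.lmul' B (1 - t) = 0
      rw [map_sub, ht2]; simp
    have h2 : Ideal.span (Set.range fun s : R => (1 : R) ⊗ₜ[B] s - s ⊗ₜ[B] (1 : R)) ≤
        nilradical (R ⊗[B] R) := by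
      refine Ideal.span_le.2 ?_
      rintro _ ⟨s, rfl⟩
      exact mem_nilradical.2 (hnil s)
    have h3 := (mem_nilradical.1 (h2 h1)).isUnit_one_sub
    simpa using h3
  have hepi : Algebra.IsEpi B R := by
    rw [Algebra.isEpi_iff_forall_one_tmul_eq]
    intro r
    exact sub_eq_zero.1 ((hunit.mul_left_eq_zero).1 (ht1 r))
  have hsurj := (Algebra.isEpi_iff_surjective_algebraMap_of_finite (R := B) (A := R)).1 hepi
  rw [eq_top_iff]
  rintro r -
  obtain ⟨b, rfl⟩ := hsurj r
  exact b.2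

/-- Monomials in the `xᵢ` with `p`-th powers as coefficients are stable under products, and scalars
in `𝔽_p` are their own `p`-th powers. This reduces additive statements about `R` to such monomials.
-/
lemma mem_closure_pow_mul_prod {x : ι → R}
    (hx : Algebra.adjoin (ZMod p) (Set.range x ∪ Set.range fun r : R => r ^ p) = ⊤) (r : R) :
    r ∈ AddSubgroup.closure {z | ∃ (a : R) (e : ι → ℕ), z = a ^ p * ∏ i, x i ^ e i} := by
  have hr : r ∈ Algebra.adjoin (ZMod p) (Set.range x ∪ Set.range fun r : R => r ^ p) := by
    rw [hx]; trivial
  have hp := (Fact.out : p.Prime)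
  induction hr using Algebra.adjoin_induction with
  | mem r hr =>
    refine AddSubgroup.subset_closure ?_
    rcases hr with ⟨i, rfl⟩ | ⟨a, rfl⟩
    · refine ⟨1, fun j => if j = i then 1 else 0, ?_⟩
      rw [Finset.prod_eq_single i] <;> simp +contextual
    · exact ⟨a, 0, by simp⟩
  | algebraMap c =>
    refine AddSubgroup.subset_closure ⟨algebraMap (ZMod p) R c, 0, ?_⟩
    rw [← map_pow, ZMod.pow_card]; simp
  | add r s _ _ hr hs => exact add_mem hr hs
  | mul r s hr' hs' hr hs =>
    clear hr' hs'
    induction hr using AddSubgroup.closure_induction with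
    | mem r hr =>
      induction hs using AddSubgroup.closure_induction with
      | mem s hs =>
        obtain ⟨a, e, rfl⟩ := hr
        obtain ⟨b, e', rfl⟩ := hs
        refine AddSubgroup.subset_closure ⟨a * b, e + e', ?_⟩
        simp only [Pi.add_apply, pow_add, Finset.prod_mul_distrib, mul_pow]
        ring
      | zero => simp
      | add s t _ _ h1 h2 => rw [mul_add]; exact add_mem h1 h2
      | neg s _ h1 => rw [mul_neg]; exact neg_mem h1
    | zero => simp
    | add s t _ _ h1 h2 => rw [add_mul]; exact add_mem h1 h2
    | neg s _ h1 => rw [neg_mul]; exact neg_mem h1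

lemma derivation_pow_mul (E : Derivation (ZMod p) R R) {a : R} (ha : E a = 0) (n : ℕ) (f : R) :
    ((E : R →ₗ[ZMod p] R) ^ n) (a * f) = a * ((E : R →ₗ[ZMod p] R) ^ n) f := by
  induction n with
  | zero => rfl
  | succ n ih =>
    rw [pow_succ', Module.End.mul_apply, Module.End.mul_apply, ih]
    simp [ha]

lemma derivation_pow_pow (E : Derivation (ZMod p) R R) {t : R} (ht : E t = 1) (n m : ℕ) :
    ((E : R →ₗ[ZMod p] R) ^ m) (t ^ n) = (n.descFactorial m : R) * t ^ (n - m) := by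
  induction m with
  | zero => simp
  | succ m ih =>
    rw [pow_succ', Module.End.mul_apply, ih, Nat.descFactorial_succ]
    simp [ht, Nat.sub_sub]
    ring

lemma cast_factorial_sub_one : (((p - 1).factorial : ℕ) : R) = -1 := by
  have h := ZMod.wilsons_lemma p
  rw [← map_natCast (algebraMap (ZMod p) R), h, map_neg, map_one]

lemma derivation_pow_apply_pow (E : Derivation (ZMod p) R R) (r : R) : E (r ^ p) = 0 := by
  have h : (p : R) = 0 := by
    have := map_natCast (algebraMap (ZMod p) R) p
    rw [← this]; simp
  rw [Derivation.leibniz_pow, nsmul_eq_mul, h, zero_mul]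

/-- The projection `f ↦ - ∂ᵖ⁻¹(tᵖ⁻¹ f)` either kills a power of `t` or keeps it, and it keeps only
`p`-th powers. -/
lemma neg_derivation_pow_mul_pow (E : Derivation (ZMod p) R R) {t : R} (ht : E t = 1) (e : ℕ) :
    -((E : R →ₗ[ZMod p] R) ^ (p - 1)) (t ^ (p - 1) * t ^ e) = if p ∣ e then t ^ e else 0 := by
  have hp := (Fact.out : p.Prime)
  -- With `e = pq + r`, the factor `t ^ (pq)` is a constant for `∂`, and only `t ^ (p - 1 + r)` gets
  -- differentiated.
  have h0 : t ^ (p - 1) * t ^ e = (t ^ (e / p)) ^ p * t ^ (p - 1 + e % p) := by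
    rw [← pow_mul, ← pow_add, ← pow_add]
    congr 1
    have := Nat.div_add_mod' e p
    omega
  rw [h0, derivation_pow_mul _ (derivation_pow_apply_pow E _), derivation_pow_pow E ht]
  by_cases he : e % p = 0
  · rw [if_pos (Nat.dvd_of_mod_eq_zero he), he, add_zero, Nat.descFactorial_self,
      cast_factorial_sub_one]
    have : e = e / p * p := by have := Nat.div_add_mod' e p; omega
    conv_rhs => rw [this]
    simp [pow_mul]
  · rw [if_neg fun h => he (Nat.mod_eq_zero_of_dvd h)]
    have h1 : t ^ (p - 1 + e % p) = t ^ p * t ^ (e % p - 1) := by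
      rw [← pow_add]; congr 1; have := hp.one_le; omega
    -- For `0 < r < p`, the product of the integers from `r + 1` to `p - 1 + r` contains the factor
    -- `p`.
    have h2 : (((p - 1 + e % p).descFactorial (p - 1) : ℕ) : ZMod p) = 0 := by
      rw [ZMod.natCast_eq_zero_iff]
      have h3 := Nat.factorial_mul_descFactorial (n := p - 1 + e % p) (k := p - 1) (by omega)
      rw [Nat.add_sub_cancel_left] at h3
      have h4 : p ∣ (p - 1 + e % p).factorial := hp.dvd_factorial.2 (by omega)
      rw [← h3] at h4
      refine (hp.dvd_mul.1 h4).resolve_left fun h5 => ?_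
      have := hp.dvd_factorial.1 h5
      have := Nat.mod_lt e hp.pos
      omega
    have h3 : (((p - 1 + e % p).descFactorial (p - 1) : ℕ) : R) = 0 := by
      simpa using congrArg (algebraMap (ZMod p) R) h2
    rw [h3]; simp

/-- Integration with respect to `t`, where `∂ t = 1`. -/
def integral (E : Derivation (ZMod p) R R) (t g : R) : R :=
  ∑ k ∈ Finset.range (p - 1), (((-1) ^ k * ((k + 1).factorial : ZMod p)⁻¹) : ZMod p) •
    (t ^ (k + 1) * ((E : R →ₗ[ZMod p] R) ^ k) g)

/-- This is repeated integration by parts: the derivative of the sum telescopes, and the last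
boundary term contains `∂ᵖ⁻¹ g = 0`. The factorials in the denominators are at most `(p - 1)!`,
hence invertible. -/
lemma derivation_integral (E : Derivation (ZMod p) R R) {t : R} (ht : E t = 1) {g : R}
    (hg : ((E : R →ₗ[ZMod p] R) ^ (p - 1)) g = 0) : E (integral E t g) = g := by
  let s : ℕ → R := fun k => (((-1) ^ k * (k.factorial : ZMod p)⁻¹) : ZMod p) •
    (t ^ k * ((E : R →ₗ[ZMod p] R) ^ k) g)
  have h1 : ∀ k ∈ Finset.range (p - 1), E ((((-1) ^ k * ((k + 1).factorial : ZMod p)⁻¹) : ZMod p) •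
      (t ^ (k + 1) * ((E : R →ₗ[ZMod p] R) ^ k) g)) = s k - s (k + 1) := by
    intro k hk
    have hk' := Finset.mem_range.1 hk
    have hk1 : ((k + 1 : ℕ) : ZMod p) ≠ 0 := by
      rw [Ne, ZMod.natCast_eq_zero_iff]
      exact fun h => absurd (Nat.le_of_dvd (by omega) h) (by omega)
    have h3 : ((-1) ^ k * ((k + 1).factorial : ZMod p)⁻¹ : ZMod p) * ((k + 1 : ℕ) : ZMod p) =
        (-1) ^ k * (k.factorial : ZMod p)⁻¹ := by
      rw [Nat.factorial_succ, Nat.cast_mul, mul_inv]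
      field_simp
    have h4 : ((k : R) + 1) = algebraMap (ZMod p) R ((k + 1 : ℕ) : ZMod p) := by simp
    have h5 : E (((E : R →ₗ[ZMod p] R) ^ k) g) = ((E : R →ₗ[ZMod p] R) ^ (k + 1)) g := by
      rw [pow_succ', Module.End.mul_apply]; rfl
    have h6 : E (t ^ (k + 1)) = ((k + 1 : ℕ) : ZMod p) • t ^ k := by
      rw [Derivation.leibniz_pow, ht, Algebra.smul_def (R := ZMod p), ← h4]
      simp [nsmul_eq_mul]
    rw [Derivation.map_smul, Derivation.leibniz, h5, h6]
    simp only [s, smul_eq_mul, smul_add, pow_succ (-1 : ZMod p)]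
    rw [mul_smul_comm, smul_smul, h3, add_comm, mul_comm (t ^ k), sub_eq_add_neg, ← neg_smul]
    congr 2
    ring
  rw [integral, map_sum, Finset.sum_congr rfl h1, Finset.sum_range_sub']
  simp [s, hg]

namespace IsCoord

variable {x : ι → R} {der : ι → Derivation (ZMod p) R R}

lemma eq_sum (hx : IsCoord x der) (E : Derivation (ZMod p) R R) : E = ∑ i, E (x i) • der i := by
  refine derivation_eq_of_span hx.span fun j => ?_
  rw [derivation_sum_apply]
  simp [hx.apply]

lemma form_eq_sum (hx : IsCoord x der) (α : Ω[R⁄ZMod p]) :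
    α = ∑ i, (der i).liftKaehlerDifferential α • D (ZMod p) R (x i) := by
  have h : LinearMap.id = ∑ i, ((der i).liftKaehlerDifferential).smulRight (D (ZMod p) R (x i)) := by
    refine LinearMap.ext_on_range hx.span fun j => ?_
    simp [hx.apply]
  have h' := LinearMap.congr_fun h α
  simpa using h'

lemma comm (hx : IsCoord x der) (i j : ι) (r : R) : der i (der j r) = der j (der i r) := by
  have h : ⁅der i, der j⁆ = 0 := by
    refine derivation_eq_of_span hx.span fun l => ?_
    rw [Derivation.commutator_apply, hx.apply, hx.apply]
    split_ifs <;> simp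
  have h' := Derivation.congr_fun h r
  rw [Derivation.commutator_apply] at h'
  exact sub_eq_zero.1 h'

lemma comm_pow (hx : IsCoord x der) (i j : ι) (n : ℕ) (r : R) :
    der i (((der j : R →ₗ[ZMod p] R) ^ n) r) = ((der j : R →ₗ[ZMod p] R) ^ n) (der i r) := by
  induction n generalizing r with
  | zero => rfl
  | succ n ih =>
    rw [pow_succ, Module.End.mul_apply, Module.End.mul_apply, ih]
    congr 1
    exact hx.comm i j r

lemma derivPow_eq_zero (hx : IsCoord x der) (i : ι) : derivPow (der i) = 0 := by
  refine derivation_eq_of_span hx.span fun l => ?_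
  obtain ⟨q, hq⟩ := Nat.exists_eq_add_of_le (Fact.out : p.Prime).two_le
  rw [derivPow_apply]
  have h : ((der i : R →ₗ[ZMod p] R) ^ 2) (x l) = 0 := by
    rw [pow_two, Module.End.mul_apply, Derivation.coeFn_coe, hx.apply]
    split_ifs <;> simp
  have h2 : ∀ n, 2 ≤ n → ((der i : R →ₗ[ZMod p] R) ^ n) (x l) = 0 := by
    intro n hn
    obtain ⟨m, rfl⟩ := Nat.exists_eq_add_of_le' hn
    rw [pow_add, Module.End.mul_apply, h, map_zero]
  exact h2 p (Fact.out : p.Prime).two_le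

/-- A function whose partial derivatives vanish is a `p`-th power. -/
lemma exists_pow_eq [Algebra.FiniteType (ZMod p) R] (hx : IsCoord x der) {c : R}
    (hc : ∀ i, der i c = 0) : ∃ a, c = a ^ p := by
  have hp := (Fact.out : p.Prime)
  -- `N i` projects onto the monomials whose exponent of `xᵢ` is divisible by `p`, and `T` composes
  -- these projections. So `T` over all indices sends every element to a `p`-th power, while it
  -- fixes any element that all `∂ᵢ` kill.
  let N : ι → R →ₗ[ZMod p] R := fun i =>
    -(((der i : R →ₗ[ZMod p] R) ^ (p - 1)) ∘ₗ LinearMap.mulLeft (ZMod p) (x i ^ (p - 1)))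
  let T : List ι → R →ₗ[ZMod p] R := fun l => l.foldr (fun i f => N i ∘ₗ f) LinearMap.id
  have hN : ∀ i a f, der i a = 0 → N i (a * f) = a * N i f := by
    intro i a f ha
    simp only [N, LinearMap.neg_apply, LinearMap.comp_apply, LinearMap.mulLeft_apply]
    rw [mul_left_comm, derivation_pow_mul _ ha, mul_neg]
  have hii : ∀ i, der i (x i) = 1 := fun i => by rw [hx.apply, if_pos rfl]
  have hNpow : ∀ i e, N i (x i ^ e) = if p ∣ e then x i ^ e else 0 := fun i e =>
    neg_derivation_pow_mul_pow (der i) (hii i) e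
  have hTc : ∀ l, T l c = c := by
    intro l
    induction l with
    | nil => rfl
    | cons i l ih =>
      change N i (T l c) = c
      have := hN i c 1 (hc i)
      have h1 := hNpow i 0
      rw [pow_zero, if_pos (dvd_zero p)] at h1
      rw [ih, ← mul_one c, this, h1]
  have hTm : ∀ (a : R) (e : ι → ℕ) (l : List ι), T l (a ^ p * ∏ i, x i ^ e i) = 0 ∨
      (T l (a ^ p * ∏ i, x i ^ e i) = a ^ p * ∏ i, x i ^ e i ∧ ∀ i ∈ l, p ∣ e i) := by
    intro a e l
    induction l with
    | nil => exact Or.inr ⟨rfl, by simp⟩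
    | cons i l ih =>
      change N i (T l _) = 0 ∨ (N i (T l _) = _ ∧ _)
      rcases ih with ih | ⟨ih, hl⟩
      · left; rw [ih, map_zero]
      · rw [ih]
        have h1 : a ^ p * ∏ j, x j ^ e j = (a ^ p * ∏ j ∈ Finset.univ.erase i, x j ^ e j) * x i ^ e i := by
          rw [mul_assoc, Finset.prod_erase_mul _ _ (Finset.mem_univ i)]
        have h2 : der i (a ^ p * ∏ j ∈ Finset.univ.erase i, x j ^ e j) = 0 := by
          rw [Derivation.leibniz, derivation_pow_apply_pow, smul_zero, add_zero]
          have : ∀ s : Finset ι, i ∉ s → der i (∏ j ∈ s, x j ^ e j) = 0 := by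
            intro s
            induction s using Finset.induction_on with
            | empty => simp
            | insert j s hj hs =>
              intro hi
              rw [Finset.mem_insert, not_or] at hi
              rw [Finset.prod_insert hj, Derivation.leibniz, hs hi.2, Derivation.leibniz_pow, hx.apply,
                if_neg hi.1]
              simp
          rw [this _ (Finset.notMem_erase i _), smul_zero]
        rw [h1, hN i _ _ h2, hNpow]
        by_cases hd : p ∣ e i
        · right
          rw [if_pos hd]
          refine ⟨rfl, ?_⟩
          simpa [hd] using hl
        · left
          rw [if_neg hd, mul_zero]
  have key : ∀ r ∈ AddSubgroup.closure {z | ∃ (a : R) (e : ι → ℕ), z = a ^ p * ∏ i, x i ^ e i},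
      ∃ a, T Finset.univ.toList r = a ^ p := by
    intro r hr
    induction hr using AddSubgroup.closure_induction with
    | mem r hr =>
      obtain ⟨a, e, rfl⟩ := hr
      rcases hTm a e Finset.univ.toList with h | ⟨h, h'⟩
      · exact ⟨0, by rw [h, zero_pow hp.ne_zero]⟩
      · refine ⟨a * ∏ i, x i ^ (e i / p), ?_⟩
        rw [h, mul_pow, ← Finset.prod_pow]
        congr 1
        refine Finset.prod_congr rfl fun i _ => ?_
        rw [← pow_mul, Nat.div_mul_cancel (h' i (Finset.mem_toList.2 (Finset.mem_univ i)))]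
    | zero => exact ⟨0, by rw [map_zero, zero_pow hp.ne_zero]⟩
    | add r s _ _ h1 h2 =>
      obtain ⟨a, ha⟩ := h1
      obtain ⟨b, hb⟩ := h2
      exact ⟨a + b, by rw [map_add, ha, hb, add_pow_prime]⟩
    | neg r _ h1 =>
      obtain ⟨a, ha⟩ := h1
      refine ⟨0 - a, ?_⟩
      rw [map_neg, ha, sub_pow_prime, zero_pow hp.ne_zero, zero_sub]
  obtain ⟨a, ha⟩ := key c (mem_closure_pow_mul_prod (adjoin_eq_top_of_span hx.span) c)
  exact ⟨a, by rw [← ha, hTc]⟩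

/-- Integration in the direction `xᵢ` does not disturb the derivative along another coordinate. This
lets primitives be built one coordinate at a time. -/
lemma integral_eq_zero (hx : ∀ i j r, der i (der j r) = der j (der i r)) {i j : ι}
    (hij : der j (x i) = 0) {g : R} (hg : der j g = 0) : der j (integral (der i) (x i) g) = 0 := by
  have h : ∀ k, der j (((der i : R →ₗ[ZMod p] R) ^ k) g) = 0 := by
    intro k
    induction k with
    | zero => exact hg
    | succ k ih =>
      rw [pow_succ', Module.End.mul_apply, Derivation.coeFn_coe, hx, ih, map_zero]
  rw [integral, map_sum]
  refine Finset.sum_eq_zero fun k _ => ?_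
  rw [Derivation.map_smul, Derivation.leibniz, h, Derivation.leibniz_pow, hij]
  simp

/-- A closed form is the sum of an exact form and a combination of the forms `xᵢᵖ⁻¹ dxᵢ` with
coefficients in the `p`-th powers. -/
theorem exists_eq_add_sum [Algebra.FiniteType (ZMod p) R] (hx : IsCoord x der) (α : Ω[R⁄ZMod p])
    (hα : ∀ i j, der i ((der j).liftKaehlerDifferential α) =
      der j ((der i).liftKaehlerDifferential α)) :
    ∃ (h : R) (c : ι → R),
      α = D (ZMod p) R h + ∑ i, (c i ^ p * x i ^ (p - 1)) • D (ZMod p) R (x i) := by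
  have hp := (Fact.out : p.Prime)
  let f : ι → R := fun j => (der j).liftKaehlerDifferential α
  have hff : ∀ i j, der i (f j) = der j (f i) := hα
  have hpow0 : ∀ i r, ((der i : R →ₗ[ZMod p] R) ^ p) r = 0 := fun i r =>
    Derivation.congr_fun (hx.derivPow_eq_zero i) r
  have hpow1 : ∀ i r, ((der i : R →ₗ[ZMod p] R) ^ (p - 1)) (der i r) = 0 := by
    intro i r
    have h1 := pow_succ (der i : Module.End (ZMod p) R) (p - 1)
    rw [Nat.sub_add_cancel hp.one_le] at h1
    rw [← hpow0 i r, h1]; rfl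
  -- By closedness, `∂ᵢ ∂ⱼᵖ⁻¹ fⱼ = ∂ⱼᵖ⁻¹ ∂ⱼ fᵢ = ∂ⱼᵖ fᵢ = 0`, so this function is a `p`-th power.
  have hc : ∀ j, ∃ a, -((der j : R →ₗ[ZMod p] R) ^ (p - 1)) (f j) = a ^ p := by
    intro j
    refine hx.exists_pow_eq fun i => ?_
    rw [map_neg, hx.comm_pow, hff, hpow1, neg_zero]
  choose c hc using hc
  -- The correction makes `∂ⱼᵖ⁻¹ gⱼ` vanish, which is the condition for integrating `gⱼ` in the
  -- direction `xⱼ`.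
  let g : ι → R := fun j => f j - c j ^ p * x j ^ (p - 1)
  have hii : ∀ i, der i (x i) = 1 := fun i => by rw [hx.apply, if_pos rfl]
  have hgg : ∀ i j, der i (g j) = der j (g i) := by
    intro i j
    by_cases hij : i = j
    · rw [hij]
    · have h1 : ∀ i j, i ≠ j → der i (c j ^ p * x j ^ (p - 1)) = 0 := by
        intro i j hij
        rw [Derivation.leibniz, derivation_pow_apply_pow, Derivation.leibniz_pow, hx.apply,
          if_neg hij]
        simp
      simp only [g, map_sub, h1 i j hij, h1 j i (Ne.symm hij), hff i j]
  have hg1 : ∀ j, ((der j : R →ₗ[ZMod p] R) ^ (p - 1)) (g j) = 0 := by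
    intro j
    have h1 := neg_derivation_pow_mul_pow (der j) (hii j) 0
    rw [pow_zero, mul_one, if_pos (dvd_zero p)] at h1
    simp only [g, map_sub]
    rw [derivation_pow_mul _ (derivation_pow_apply_pow (der j) _), ← hc j]
    linear_combination ((der j : R →ₗ[ZMod p] R) ^ (p - 1)) (f j) * (-h1)
  have key : ∀ s : Finset ι, ∃ h, ∀ j ∈ s, der j h = g j := by
    intro s
    induction s using Finset.induction_on with
    | empty => exact ⟨0, by simp⟩
    | insert i s hi ih =>
      obtain ⟨h, hh⟩ := ih
      -- The defect `gᵢ - ∂ᵢ h` is killed by the `∂ⱼ` already treated, as the form is closed, so its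
      -- primitive in `xᵢ` keeps the equations already solved.
      refine ⟨h + integral (der i) (x i) (g i - der i h), fun j hj => ?_⟩
      rw [Finset.mem_insert] at hj
      rcases hj with rfl | hj
      · rw [map_add, derivation_integral (der j) (hii j), add_sub_cancel]
        rw [map_sub, hg1, hpow1, sub_zero]
      · have hji : j ≠ i := fun h => hi (h ▸ hj)
        rw [map_add, integral_eq_zero hx.comm, add_zero, hh j hj]
        · rw [hx.apply, if_neg hji]
        · rw [map_sub, hx.comm j i, hh j hj, hgg, sub_self]
  obtain ⟨h, hh⟩ := key Finset.univ
  refine ⟨h, c, ?_⟩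
  rw [hx.form_eq_sum α, hx.form_eq_sum (D (ZMod p) R h), ← Finset.sum_add_distrib]
  refine Finset.sum_congr rfl fun i _ => ?_
  rw [← add_smul, Derivation.liftKaehlerDifferential_comp_D, hh i (Finset.mem_univ i)]
  simp [g, f]

end IsCoord

end Coordinates

/-! ### The Cartier operator on smooth algebras -/

section Cartier

variable {p : ℕ} [Fact p.Prime] {R : Type} [CommRing R] [Algebra (ZMod p) R]

variable (p R) in
/-- The graph of the Cartier operator of an `𝔽_p`-algebra. -/
def cartierGraph : AddSubgroup (Ω[R⁄ZMod p] × Ω[R⁄ZMod p]) :=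
  AddSubgroup.closure
    ({x | ∃ a g : R, x = ((a ^ p * g ^ (p - 1)) • D (ZMod p) R g, a • D (ZMod p) R g)} ∪
      {x | ∃ a : R, x = (D (ZMod p) R a, 0)})

/-- `C` is `p⁻¹`-linear. On exact forms this holds because `cᵖ da = d(cᵖ a)`. -/
lemma smul_mem_cartierGraph (c : R) {α β : Ω[R⁄ZMod p]} (h : (α, β) ∈ cartierGraph p R) :
    (c ^ p • α, c • β) ∈ cartierGraph p R := by
  have key : ∀ x ∈ cartierGraph p R, (c ^ p • x.1, c • x.2) ∈ cartierGraph p R := by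
    intro x hx
    induction hx using AddSubgroup.closure_induction with
    | mem x hx =>
      refine AddSubgroup.subset_closure ?_
      rcases hx with ⟨a, g, rfl⟩ | ⟨a, rfl⟩
      · left
        refine ⟨c * a, g, ?_⟩
        simp only [smul_smul, mul_pow, mul_assoc]
      · right
        refine ⟨c ^ p * a, ?_⟩
        rw [Derivation.leibniz, smul_zero]
        have h : D (ZMod p) R (c ^ p) = 0 := by
          have h0 : (p : R) = 0 := by
            rw [← map_natCast (algebraMap (ZMod p) R) p]; simp
          rw [Derivation.leibniz_pow, ← Nat.cast_smul_eq_nsmul R, h0, zero_smul]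
        rw [h, smul_zero, add_zero]
    | zero =>
      simp only [Prod.fst_zero, Prod.snd_zero, smul_zero]
      exact zero_mem _
    | add x y _ _ hx hy => simpa using add_mem hx hy
    | neg x _ hx => simpa using neg_mem hx
  exact key _ h

/-- The relation of the Cartier operator with the `p`-th powers of derivations. -/
lemma pow_sub_derivPow_of_mem_cartierGraph {α β : Ω[R⁄ZMod p]} (h : (α, β) ∈ cartierGraph p R)
    (E : Derivation (ZMod p) R R) :
    ((E : R →ₗ[ZMod p] R) ^ (p - 1)) (E.liftKaehlerDifferential α) -
      (derivPow E).liftKaehlerDifferential α = -(E.liftKaehlerDifferential β) ^ p := by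
  have hp := (Fact.out : p.Prime)
  have key : ∀ x ∈ cartierGraph p R,
      ((E : R →ₗ[ZMod p] R) ^ (p - 1)) (E.liftKaehlerDifferential x.1) -
      (derivPow E).liftKaehlerDifferential x.1 = -(E.liftKaehlerDifferential x.2) ^ p := by
    intro x hx
    induction hx using AddSubgroup.closure_induction with
    | mem x hx =>
      rcases hx with ⟨a, g, rfl⟩ | ⟨a, rfl⟩
      -- Here the identity is `aᵖ` times `derivation_pow_sub_one`, because `aᵖ` is a constant for
      -- `E`. For exact forms the two terms on the left cancel.
      · simp only [map_smul, Derivation.liftKaehlerDifferential_comp_D, smul_eq_mul, mul_assoc]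
        rw [derivation_pow_mul _ (derivation_pow_apply_pow E a), derivation_pow_sub_one,
          derivPow_apply]
        ring
      · have h1 := pow_succ (E : Module.End (ZMod p) R) (p - 1)
        rw [Nat.sub_add_cancel hp.one_le] at h1
        simp only [Derivation.liftKaehlerDifferential_comp_D, map_zero, zero_pow hp.ne_zero,
          neg_zero, derivPow_apply, h1]
        exact sub_self _
    | zero => simp [hp.ne_zero]
    | add x y _ _ hx hy =>
      simp only [Prod.fst_add, Prod.snd_add, map_add, add_pow_prime]
      linear_combination hx + hy
    | neg x _ hx =>
      have h1 : ∀ b : R, (-b) ^ p = - b ^ p := fun b => by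
        rw [← zero_sub, sub_pow_prime, zero_pow hp.ne_zero, zero_sub]
      simp only [Prod.fst_neg, Prod.snd_neg, map_neg, h1]
      linear_combination -hx
  exact key _ h

/-- Closed forms. -/
def IsClosedOn (α : Ω[R⁄ZMod p]) : Prop :=
  ∀ E₁ E₂ : Derivation (ZMod p) R R, E₁ (E₂.liftKaehlerDifferential α) -
    E₂ (E₁.liftKaehlerDifferential α) - ⁅E₁, E₂⁆.liftKaehlerDifferential α = 0

lemma isClosedOn_pow_smul (a g : R) : IsClosedOn ((a ^ p * g ^ (p - 1)) • D (ZMod p) R g) := by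
  intro E₁ E₂
  have h (E : Derivation (ZMod p) R R) : E (a ^ p) = 0 := derivation_pow_apply_pow E a
  simp only [map_smul, Derivation.liftKaehlerDifferential_comp_D, smul_eq_mul, Derivation.leibniz,
    Derivation.commutator_apply, h, mul_assoc, Derivation.leibniz_pow _ g, nsmul_eq_mul]
  ring

lemma liftKaehlerDifferential_add {M : Type} [AddCommGroup M] [Module R M] [Module (ZMod p) M]
    [IsScalarTower (ZMod p) R M] (E₁ E₂ : Derivation (ZMod p) R M) (α : Ω[R⁄ZMod p]) :
    (E₁ + E₂).liftKaehlerDifferential α =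
      E₁.liftKaehlerDifferential α + E₂.liftKaehlerDifferential α :=
  LinearMap.congr_fun (map_add (KaehlerDifferential.linearMapEquivDerivation (ZMod p) R).symm E₁ E₂) α

lemma liftKaehlerDifferential_smul {M : Type} [AddCommGroup M] [Module R M] [Module (ZMod p) M]
    [IsScalarTower (ZMod p) R M] (r : R) (E : Derivation (ZMod p) R M) (α : Ω[R⁄ZMod p]) :
    (r • E).liftKaehlerDifferential α = r • E.liftKaehlerDifferential α :=
  LinearMap.congr_fun (map_smul (KaehlerDifferential.linearMapEquivDerivation (ZMod p) R).symm r E) α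

/-- The exterior derivative is bilinear over functions: the non-tensorial terms cancel against those
of the bracket. This makes it possible to clear denominators of vector fields. -/
lemma liftKaehlerDifferential_smul_sub (u v : R) (E₁ E₂ : Derivation (ZMod p) R R)
    (α : Ω[R⁄ZMod p]) :
    (u • E₁) ((v • E₂).liftKaehlerDifferential α) - (v • E₂) ((u • E₁).liftKaehlerDifferential α) -
      ⁅u • E₁, v • E₂⁆.liftKaehlerDifferential α =
    u * v * (E₁ (E₂.liftKaehlerDifferential α) - E₂ (E₁.liftKaehlerDifferential α) -
      ⁅E₁, E₂⁆.liftKaehlerDifferential α) := by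
  have h : ⁅u • E₁, v • E₂⁆ = (u * v) • ⁅E₁, E₂⁆ + ((u * E₁ v) • E₂ + (-(v * E₂ u)) • E₁) := by
    ext r
    simp only [Derivation.commutator_apply, Derivation.smul_apply, Derivation.add_apply, smul_eq_mul,
      Derivation.leibniz]
    ring
  rw [h]
  simp only [liftKaehlerDifferential_add, liftKaehlerDifferential_smul, Derivation.smul_apply,
    smul_eq_mul, Derivation.leibniz]
  ring

/-- A derivation of `R` and a derivation of an `R`-algebra that extends it, on 1-forms. -/
lemma liftKaehlerDifferential_map {S : Type} [CommRing S] [Algebra (ZMod p) S] [Algebra R S]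
    [IsScalarTower (ZMod p) R S] {E : Derivation (ZMod p) R R} {E' : Derivation (ZMod p) S S}
    (h : ∀ r, E' (algebraMap R S r) = algebraMap R S (E r)) (α : Ω[R⁄ZMod p]) :
    E'.liftKaehlerDifferential (KaehlerDifferential.map (ZMod p) (ZMod p) R S α) =
      algebraMap R S (E.liftKaehlerDifferential α) := by
  have h1 : (E'.liftKaehlerDifferential.restrictScalars R) ∘ₗ
      (KaehlerDifferential.map (ZMod p) (ZMod p) R S) =
      (Algebra.linearMap R S) ∘ₗ E.liftKaehlerDifferential := by
    refine Derivation.liftKaehlerDifferential_unique _ _ ?_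
    ext r
    simp [h]
  exact LinearMap.congr_fun h1 α

/-- For a smooth algebra `Ω¹` is a direct summand of some `Rⁿ`, and the coordinates of the
inclusion, composed with `d`, are derivations. -/
lemma exists_dual_basis_kaehler [Algebra.Smooth (ZMod p) R] :
    ∃ (n : ℕ) (e : Fin n → Ω[R⁄ZMod p]) (E : Fin n → Derivation (ZMod p) R R),
      ∀ α, α = ∑ i, (E i).liftKaehlerDifferential α • e i := by
  obtain ⟨n, f, g, -, -, hfg⟩ := Module.Finite.exists_comp_eq_id_of_projective R Ω[R⁄ZMod p]
  refine ⟨n, fun i => f (Pi.single i 1),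
    fun i => ((LinearMap.proj i ∘ₗ g).compDer (D (ZMod p) R)), fun α => ?_⟩
  have h1 : ∀ i, ((LinearMap.proj i ∘ₗ g).compDer (D (ZMod p) R)).liftKaehlerDifferential =
      LinearMap.proj i ∘ₗ g := fun i =>
    (KaehlerDifferential.linearMapEquivDerivation (ZMod p) R).symm_apply_apply _
  have h2 : f (g α) = α := LinearMap.congr_fun hfg α
  conv_lhs => rw [← h2, pi_eq_sum_univ' (g α), map_sum]
  refine Finset.sum_congr rfl fun i _ => ?_
  rw [h1, map_smul]
  congr 2

/-- Every derivation of a localization becomes the extension of a derivation of `R` after it is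
multiplied by some denominator. -/
lemma exists_derivation_of_isLocalization [Algebra.Smooth (ZMod p) R] (M : Submonoid R) {S : Type}
    [CommRing S] [Algebra (ZMod p) S] [Algebra R S] [IsScalarTower (ZMod p) R S] [IsLocalization M S]
    (E' : Derivation (ZMod p) S S) : ∃ m ∈ M, ∃ E : Derivation (ZMod p) R R,
      ∀ r, (algebraMap R S m • E') (algebraMap R S r) = algebraMap R S (E r) := by
  obtain ⟨n, e, E, he⟩ := exists_dual_basis_kaehler (p := p) (R := R)
  -- On `R`, the derivation `E'` is determined by its values on the finitely many forms `e i`. So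
  -- one common denominator suffices.
  obtain ⟨m, hm⟩ := IsLocalization.exist_integer_multiples_of_finite M
    fun i => (E'.compAlgebraMap R).liftKaehlerDifferential (e i)
  choose c hc using hm
  refine ⟨m, m.2, ∑ i, c i • E i, fun r => ?_⟩
  have h1 : E' (algebraMap R S r) =
      ∑ i, E i r • (E'.compAlgebraMap R).liftKaehlerDifferential (e i) := by
    have h2 : E' (algebraMap R S r) =
        (E'.compAlgebraMap R).liftKaehlerDifferential (D (ZMod p) R r) := by
      rw [Derivation.liftKaehlerDifferential_comp_D]; rfl
    rw [h2]
    conv_lhs => rw [he (D (ZMod p) R r), map_sum]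
    simp
  rw [Derivation.smul_apply, h1, derivation_sum_apply, map_sum, smul_eq_mul, Finset.mul_sum]
  refine Finset.sum_congr rfl fun i _ => ?_
  have h3 := hc i
  rw [Derivation.smul_apply, smul_eq_mul, map_mul, h3]
  simp only [Algebra.smul_def]
  ring

/-- Up to units, any two vector fields on the localization extend vector fields on `R`, where the
form is closed. Bilinearity does the rest. -/
lemma IsClosedOn.map_of_isLocalization [Algebra.Smooth (ZMod p) R] (M : Submonoid R) (S : Type)
    [CommRing S] [Algebra (ZMod p) S] [Algebra R S] [IsScalarTower (ZMod p) R S] [IsLocalization M S]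
    {α : Ω[R⁄ZMod p]} (hα : IsClosedOn α) :
    IsClosedOn (KaehlerDifferential.map (ZMod p) (ZMod p) R S α) := by
  intro E₁' E₂'
  obtain ⟨m₁, hm₁, E₁, h₁⟩ := exists_derivation_of_isLocalization M E₁'
  obtain ⟨m₂, hm₂, E₂, h₂⟩ := exists_derivation_of_isLocalization M E₂'
  have h := liftKaehlerDifferential_smul_sub (algebraMap R S m₁) (algebraMap R S m₂) E₁' E₂'
    (KaehlerDifferential.map (ZMod p) (ZMod p) R S α)
  have h3 : ∀ r, ⁅algebraMap R S m₁ • E₁', algebraMap R S m₂ • E₂'⁆ (algebraMap R S r) =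
      algebraMap R S (⁅E₁, E₂⁆ r) := by
    intro r
    rw [Derivation.commutator_apply, Derivation.commutator_apply, h₁, h₂, h₁, h₂, map_sub]
  rw [liftKaehlerDifferential_map h₁, liftKaehlerDifferential_map h₂, liftKaehlerDifferential_map h3,
    h₁, h₂, ← map_sub, ← map_sub, hα, map_zero] at h
  have hu : IsUnit (algebraMap R S m₁ * algebraMap R S m₂) :=
    (IsLocalization.map_units S (⟨m₁, hm₁⟩ : M)).mul (IsLocalization.map_units S (⟨m₂, hm₂⟩ : M))
  exact (hu.mul_right_eq_zero).1 h.symm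

/-- A basis of `Ω¹` that consists of exact forms gives coordinates. -/
lemma isCoord_of_basis {ι : Type} [DecidableEq ι] (x : ι → R) (b : Module.Basis ι R Ω[R⁄ZMod p])
    (hb : ∀ i, b i = D (ZMod p) R (x i)) :
    IsCoord x fun i => (b.coord i).compDer (D (ZMod p) R) where
  apply i j := by
    change b.coord i (D (ZMod p) R (x j)) = _
    rw [← hb, Module.Basis.coord_apply, Module.Basis.repr_self, Finsupp.single_apply]
    simp [eq_comm]
  span := by
    have : (fun i => D (ZMod p) R (x i)) = b := funext fun i => (hb i).symm
    rw [this, b.span_eq]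

/-- Smooth algebras have coordinates locally. -/
lemma exists_isCoord_of_isStandardSmooth {S : Type} [CommRing S] [Algebra (ZMod p) S]
    [Algebra.IsStandardSmooth (ZMod p) S] : ∃ (ι : Type) (_ : Fintype ι) (_ : DecidableEq ι)
      (x : ι → S) (der : ι → Derivation (ZMod p) S S), IsCoord x der := by
  classical
  obtain ⟨ι, σ, _, _, ⟨P⟩⟩ := Algebra.IsStandardSmooth.out (R := ZMod p) (S := S)
  have : Fintype ι := Fintype.ofFinite ι
  exact ⟨_, Fintype.ofFinite _, inferInstance, _, _,
    isCoord_of_basis (fun k : ((Set.range P.map)ᶜ : Set _) => P.val k) P.basisKaehler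
      P.basisKaehler_apply⟩

/-- Since `uᵖ` is a constant for every derivation, `d(uᵖ x) = uᵖ dx`. So denominators of coordinates
can be cleared by a `p`-th power without spoiling them. -/
lemma IsCoord.of_smul {ι : Type} [Fintype ι] [DecidableEq ι] {x : ι → R}
    {der : ι → Derivation (ZMod p) R R} (hx : IsCoord x der) {u : R} (hu : IsUnit u)
    (y : ι → R) (hy : ∀ i, y i = u ^ p * x i) :
    ∃ der' : ι → Derivation (ZMod p) R R, IsCoord y der' := by
  obtain ⟨v, hv⟩ := hu.exists_right_inv
  have hvp : v ^ p * u ^ p = 1 := by rw [← mul_pow, mul_comm, hv, one_pow]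
  have hD : ∀ (c r : R), D (ZMod p) R (c ^ p * r) = c ^ p • D (ZMod p) R r := by
    intro c r
    have h0 : (p : R) = 0 := by
      rw [← map_natCast (algebraMap (ZMod p) R) p]; simp
    rw [Derivation.leibniz, Derivation.leibniz_pow, ← Nat.cast_smul_eq_nsmul R, h0, zero_smul,
      smul_zero, add_zero]
  refine ⟨fun i => v ^ p • der i, fun i j => ?_, ?_⟩
  · rw [hy, Derivation.smul_apply, smul_eq_mul, Derivation.leibniz, derivation_pow_apply_pow,
      hx.apply, smul_zero, add_zero, smul_eq_mul, ← mul_assoc, hvp, one_mul]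
  · rw [eq_top_iff, ← hx.span, Submodule.span_le]
    rintro _ ⟨i, rfl⟩
    have h1 : D (ZMod p) R (x i) = v ^ p • D (ZMod p) R (y i) := by
      rw [hy, hD, smul_smul, hvp, one_smul]
    change D (ZMod p) R (x i) ∈ _
    rw [h1]
    exact Submodule.smul_mem _ _ (Submodule.subset_span ⟨i, rfl⟩)

/-- A closed form on a smooth algebra is in the domain of the Cartier operator. -/
theorem exists_mem_cartierGraph [Algebra.Smooth (ZMod p) R] {α : Ω[R⁄ZMod p]} (hα : IsClosedOn α) :
    ∃ β, (α, β) ∈ cartierGraph p R := by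
  have hp := (Fact.out : p.Prime)
  -- The Cartier operator is defined through generators over `R`, so the local statement is glued by
  -- an ideal. Using `cᵖ` instead of `c` makes the set stable under `R`, and sums are allowed as
  -- Frobenius is additive. It suffices that `I` contains a power of each `t` from a covering with
  -- coordinates.
  let I : Ideal R :=
    { carrier := {c | ∃ β, (c ^ p • α, β) ∈ cartierGraph p R}
      zero_mem' := ⟨0, by rw [zero_pow hp.ne_zero, zero_smul]; exact zero_mem _⟩
      add_mem' := by
        rintro a b ⟨β, h1⟩ ⟨γ, h2⟩
        refine ⟨β + γ, ?_⟩
        rw [add_pow_prime, add_smul]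
        exact add_mem h1 h2
      smul_mem' := by
        rintro c a ⟨β, h1⟩
        refine ⟨c • β, ?_⟩
        rw [smul_eq_mul, mul_pow, mul_smul]
        exact smul_mem_cartierGraph c h1 }
  suffices hI : (1 : R) ∈ I by
    obtain ⟨β, h⟩ := hI
    exact ⟨β, by simpa using h⟩
  obtain ⟨s, hs, hsm⟩ := Algebra.Smooth.exists_span_eq_top_isStandardSmooth (ZMod p) R
  rw [← Ideal.eq_top_iff_one, ← Ideal.radical_eq_top, ← top_le_iff, ← hs, Ideal.span_le]
  intro t ht
  have := hsm t ht
  let S := Localization.Away t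
  obtain ⟨ι, _, _, x, der, hx⟩ := exists_isCoord_of_isStandardSmooth (p := p) (S := S)
  obtain ⟨⟨m, hm⟩, hmx⟩ := IsLocalization.exist_integer_multiples_of_finite (Submonoid.powers t) x
  choose y hy using hmx
  have hmu : IsUnit (algebraMap R S m) := IsLocalization.map_units S (⟨m, hm⟩ : Submonoid.powers t)
  -- Multiplying by `mᵖ` rather than `m` gives elements of `R` that are still coordinates on the
  -- localization.
  have hy' : ∀ i, algebraMap R S (m ^ (p - 1) * y i) = algebraMap R S m ^ p * x i := by
    intro i
    have h1 : algebraMap R S (y i) = algebraMap R S m * x i := by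
      rw [hy i, Algebra.smul_def]
    rw [map_mul, h1, map_pow, ← mul_assoc, ← pow_succ, Nat.sub_add_cancel hp.one_le]
  obtain ⟨der', hx'⟩ := hx.of_smul hmu (fun i => algebraMap R S (m ^ (p - 1) * y i)) hy'
  have hcl := hα.map_of_isLocalization (Submonoid.powers t) S
  obtain ⟨h, c, hc⟩ := hx'.exists_eq_add_sum (KaehlerDifferential.map (ZMod p) (ZMod p) R S α) (by
    intro i j
    have h1 := hcl (der' i) (der' j)
    have h2 : ⁅der' i, der' j⁆ = 0 := by
      ext r
      rw [Derivation.commutator_apply, hx'.comm i j, sub_self]; rfl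
    have h3 : (0 : Derivation (ZMod p) S S).liftKaehlerDifferential = 0 :=
      map_zero (KaehlerDifferential.linearMapEquivDerivation (ZMod p) S).symm
    rw [h2, h3] at h1
    simpa [sub_eq_zero] using h1)
  obtain ⟨⟨q, hq⟩, hqc⟩ := IsLocalization.exist_integer_multiples_of_finite (Submonoid.powers t)
    fun o : Option ι => o.elim h c
  choose c' hc' using hqc
  have hc1 : algebraMap R S (c' none) = algebraMap R S q * h := by
    rw [hc' none, Algebra.smul_def]; rfl
  have hc2 : ∀ i, algebraMap R S (c' (some i)) = algebraMap R S q * c i := fun i => by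
    rw [hc' (some i), Algebra.smul_def]; rfl
  -- This form on `R` becomes `qᵖ α` on the localization. The factor is `qᵖ` because `qᵖ dh = d(qᵖ
  -- h)` and `qᵖ cᵢᵖ = (q cᵢ)ᵖ`, so that both kinds of terms keep their shape.
  let γ : Ω[R⁄ZMod p] := D (ZMod p) R (q ^ (p - 1) * c' none) +
    ∑ i, (c' (some i) ^ p * (m ^ (p - 1) * y i) ^ (p - 1)) • D (ZMod p) R (m ^ (p - 1) * y i)
  have hγ : KaehlerDifferential.map (ZMod p) (ZMod p) R S (q ^ p • α) =
      KaehlerDifferential.map (ZMod p) (ZMod p) R S γ := by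
    have h0 : (p : S) = 0 := by
      rw [← map_natCast (algebraMap (ZMod p) S) p]; simp
    rw [map_smul, hc, map_add, KaehlerDifferential.map_D, map_sum, smul_add]
    congr 1
    · rw [map_mul, map_pow, hc1, ← mul_assoc, ← pow_succ, Nat.sub_add_cancel hp.one_le,
        Derivation.leibniz, Derivation.leibniz_pow, ← Nat.cast_smul_eq_nsmul S, h0, zero_smul,
        smul_zero, add_zero, ← map_pow, algebraMap_smul]
    · rw [Finset.smul_sum]
      refine Finset.sum_congr rfl fun i _ => ?_
      rw [map_smul, KaehlerDifferential.map_D, ← algebraMap_smul S (q ^ p), smul_smul,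
        ← algebraMap_smul S (c' (some i) ^ p * _)]
      congr 1
      rw [map_mul _ (c' (some i) ^ p), map_pow _ (c' (some i)), hc2, map_pow _ q, mul_pow,
        map_pow _ _ (p - 1), mul_assoc]
  obtain ⟨⟨r, hr⟩, hrγ⟩ := (IsLocalizedModule.eq_iff_exists (Submonoid.powers t)
    (KaehlerDifferential.map (ZMod p) (ZMod p) R S)).1 hγ
  have hγmem : ∃ β, (γ, β) ∈ cartierGraph p R := by
    refine ⟨0 + ∑ i, c' (some i) • D (ZMod p) R (m ^ (p - 1) * y i), ?_⟩
    have h1 : ∀ i, ((c' (some i) ^ p * (m ^ (p - 1) * y i) ^ (p - 1)) •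
        D (ZMod p) R (m ^ (p - 1) * y i), c' (some i) • D (ZMod p) R (m ^ (p - 1) * y i)) ∈
        cartierGraph p R := fun i => AddSubgroup.subset_closure (Or.inl ⟨_, _, rfl⟩)
    have h2 : (D (ZMod p) R (q ^ (p - 1) * c' none), (0 : Ω[R⁄ZMod p])) ∈ cartierGraph p R :=
      AddSubgroup.subset_closure (Or.inr ⟨_, rfl⟩)
    have h3 := add_mem h2 (sum_mem fun i (_ : i ∈ Finset.univ) => h1 i)
    rw [← prod_mk_sum, Prod.mk_add_mk] at h3
    exact h3
  obtain ⟨β, hβ⟩ := hγmem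
  -- The forms `qᵖ α` and `γ` agree after multiplication by a power `r` of `t`, and therefore after
  -- multiplication by `rᵖ`.
  have hfin : q * r ∈ I := by
    refine ⟨r • β, ?_⟩
    have h1 : (q * r) ^ p • α = r ^ p • γ := by
      have h2 : r • q ^ p • α = r • γ := hrγ
      rw [mul_pow, mul_comm, mul_smul]
      obtain ⟨o, ho⟩ := Nat.exists_eq_succ_of_ne_zero hp.ne_zero
      have h3 : r ^ p = r ^ (p - 1) * r := by rw [← pow_succ, Nat.sub_add_cancel hp.one_le]
      rw [h3, mul_smul, mul_smul, h2]
    rw [h1]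
    exact smul_mem_cartierGraph r hβ
  obtain ⟨a, rfl⟩ := hq
  obtain ⟨b, rfl⟩ := hr
  exact ⟨a + b, by simpa [pow_add] using hfin⟩

/-- Extension of coordinates along a formally étale homomorphism. -/
lemma IsCoord.map {ι : Type} [Fintype ι] [DecidableEq ι] {x : ι → R}
    {der : ι → Derivation (ZMod p) R R} (hx : IsCoord x der) (S : Type) [CommRing S]
    [Algebra (ZMod p) S] [Algebra R S] [IsScalarTower (ZMod p) R S] [Algebra.FormallyEtale R S] :
    ∃ der' : ι → Derivation (ZMod p) S S, IsCoord (fun i => algebraMap R S (x i)) der' ∧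
      ∀ i r, der' i (algebraMap R S r) = algebraMap R S (der i r) := by
  let e := KaehlerDifferential.tensorKaehlerEquivOfFormallyEtale (ZMod p) R S
  have he : ∀ r, e.symm (D (ZMod p) S (algebraMap R S r)) = 1 ⊗ₜ D (ZMod p) R r := fun r =>
    KaehlerDifferential.tensorKaehlerEquivOfFormallyEtale_symm_D_algebraMap (ZMod p) R S r
  let f : ι → (Ω[S⁄ZMod p] →ₗ[S] S) := fun i =>
    (Algebra.TensorProduct.rid R S S).toLinearMap ∘ₗ
      ((der i).liftKaehlerDifferential.baseChange S) ∘ₗ e.symm.toLinearMap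
  have hf : ∀ i r, f i (D (ZMod p) S (algebraMap R S r)) = algebraMap R S (der i r) := by
    intro i r
    simp [f, he, Algebra.smul_def]
  refine ⟨fun i => (f i).compDer (D (ZMod p) S), ⟨fun i j => ?_, ?_⟩, hf⟩
  · change f i (D (ZMod p) S (algebraMap R S (x j))) = _
    rw [hf, hx.apply]
    split_ifs <;> simp
  · rw [eq_top_iff]
    have h1 : ∀ z : S ⊗[R] Ω[R⁄ZMod p], e z ∈
        Submodule.span S (Set.range fun i => D (ZMod p) S (algebraMap R S (x i))) := by
      intro z
      induction z with
      | zero => simp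
      | add y z hy hz => rw [map_add]; exact add_mem hy hz
      | tmul s α =>
        have h2 : e (s ⊗ₜ α) = s • KaehlerDifferential.map (ZMod p) (ZMod p) R S α :=
          KaehlerDifferential.mapBaseChange_tmul (ZMod p) R S s α
        rw [h2]
        refine Submodule.smul_mem _ _ ?_
        rw [hx.form_eq_sum α, map_sum]
        refine sum_mem fun i _ => ?_
        rw [map_smul, KaehlerDifferential.map_D, ← algebraMap_smul S]
        exact Submodule.smul_mem _ _ (Submodule.subset_span ⟨i, rfl⟩)
    intro z _
    rw [← e.apply_symm_apply z]
    exact h1 _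

/-- The algebra is étale over a polynomial ring `A`. By flatness it embeds into its base change to
the fraction field of `A`, and an étale algebra over a field is reduced. -/
lemma isReduced_of_isStandardSmooth {S : Type} [CommRing S] [Algebra (ZMod p) S]
    [Algebra.IsStandardSmooth (ZMod p) S] : IsReduced S := by
  obtain ⟨n, g, -, hg⟩ := RingHom.IsStandardSmooth.exists_etale_mvPolynomial
    ((RingHom.isStandardSmooth_algebraMap (R := ZMod p) (S := S)).2 inferInstance)
  let A := MvPolynomial (Fin n) (ZMod p)
  algebraize [g]
  let F := FractionRing A
  have hflat : Module.Flat A S := inferInstance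
  have hinj : Function.Injective (Algebra.TensorProduct.includeRight : S →ₐ[A] F ⊗[A] S) := by
    have h1 := Module.Flat.rTensor_preserves_injective_linearMap (M := S)
      (Algebra.linearMap A F) (IsFractionRing.injective A F)
    have h2 : ⇑(Algebra.TensorProduct.includeRight : S →ₐ[A] F ⊗[A] S) =
        (LinearMap.rTensor S (Algebra.linearMap A F)) ∘ (TensorProduct.lid A S).symm := by
      ext s; simp
    rw [h2]
    exact h1.comp (TensorProduct.lid A S).symm.injective
  have hred : IsReduced (F ⊗[A] S) := Algebra.FormallyUnramified.isReduced_of_field F (F ⊗[A] S)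
  exact isReduced_of_injective _ hinj

lemma isReduced_of_smooth [Algebra.Smooth (ZMod p) R] : IsReduced R := by
  refine ⟨fun r hr => ?_⟩
  obtain ⟨s, hs, hsm⟩ := Algebra.Smooth.exists_span_eq_top_isStandardSmooth (ZMod p) R
  suffices h : (1 : R) ∈ (Ideal.span {r}).annihilator by
    simpa using (Submodule.mem_annihilator_span_singleton r 1).1 h
  rw [← Ideal.eq_top_iff_one, ← Ideal.radical_eq_top, ← top_le_iff, ← hs, Ideal.span_le]
  intro t ht
  have := hsm t ht
  have := isReduced_of_isStandardSmooth (p := p) (S := Localization.Away t)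
  have h0 := (hr.map (algebraMap R (Localization.Away t))).eq_zero
  obtain ⟨⟨_, n, rfl⟩, hc⟩ := (IsLocalization.map_eq_zero_iff (Submonoid.powers t) _ r).1 h0
  exact ⟨n, (Submodule.mem_annihilator_span_singleton r _).2 hc⟩

end Cartier

/-! ### Convolution -/

section Act

variable {p : ℕ} {T T' K K' B B' : Type} [CommRing T] [Algebra (ZMod p) T] [CommRing T']
  [Algebra (ZMod p) T'] [CommRing K] [Bialgebra (ZMod p) K] [CommRing K'] [Bialgebra (ZMod p) K']
  [CommRing B] [Algebra (ZMod p) B] [CommRing B'] [Algebra (ZMod p) B']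

/-- The map `t ↦ ∑ f(t₍₀₎) g(t₍₁₎)`, where `ρ t = ∑ t₍₀₎ ⊗ t₍₁₎`. -/
def act (ρ : T →ₗ[ZMod p] T ⊗[ZMod p] K) (f : T →ₗ[ZMod p] B) (g : K →ₗ[ZMod p] B) :
    T →ₗ[ZMod p] B :=
  LinearMap.mul' (ZMod p) B ∘ₗ TensorProduct.map f g ∘ₗ ρ

/-- The convolution product. -/
abbrev conv (f g : K →ₗ[ZMod p] B) : K →ₗ[ZMod p] B := act Coalgebra.comul f g

variable (p K B) in
/-- The unit of the convolution product. -/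
def convOne : K →ₗ[ZMod p] B := Algebra.linearMap (ZMod p) B ∘ₗ Coalgebra.counit

lemma convOne_apply (h : K) :
    convOne p K B h = algebraMap (ZMod p) B (Coalgebra.counit (R := ZMod p) h) := rfl

variable (ρ : T →ₗ[ZMod p] T ⊗[ZMod p] K)

lemma act_apply (f : T →ₗ[ZMod p] B) (g : K →ₗ[ZMod p] B) (t : T) :
    act ρ f g t = LinearMap.mul' (ZMod p) B (TensorProduct.map f g (ρ t)) := rfl

lemma act_add_left (f f' : T →ₗ[ZMod p] B) (g : K →ₗ[ZMod p] B) :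
    act ρ (f + f') g = act ρ f g + act ρ f' g := by
  ext t; simp [act_apply, TensorProduct.map_add_left]

lemma act_add_right (f : T →ₗ[ZMod p] B) (g g' : K →ₗ[ZMod p] B) :
    act ρ f (g + g') = act ρ f g + act ρ f g' := by
  ext t; simp [act_apply, TensorProduct.map_add_right]

lemma act_zero_left (g : K →ₗ[ZMod p] B) : act ρ (0 : T →ₗ[ZMod p] B) g = 0 := by
  ext t; simp [act_apply]

lemma act_zero_right (f : T →ₗ[ZMod p] B) : act ρ f (0 : K →ₗ[ZMod p] B) = 0 := by
  ext t; simp [act_apply]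

lemma act_neg_right (f : T →ₗ[ZMod p] B) (g : K →ₗ[ZMod p] B) :
    act ρ f (-g) = -act ρ f g := by
  rw [eq_neg_iff_add_eq_zero, ← act_add_right, neg_add_cancel, act_zero_right]

lemma act_sub_right (f : T →ₗ[ZMod p] B) (g g' : K →ₗ[ZMod p] B) :
    act ρ f (g - g') = act ρ f g - act ρ f g' := by
  rw [sub_eq_add_neg, act_add_right, act_neg_right, sub_eq_add_neg]

lemma act_smul_right {R : Type} [CommRing R] [Algebra (ZMod p) R] [Algebra R B]
    [IsScalarTower (ZMod p) R B] (r : R) (f : T →ₗ[ZMod p] B) (g : K →ₗ[ZMod p] B) :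
    act ρ f (r • g) = r • act ρ f g := by
  ext t
  rw [LinearMap.smul_apply, act_apply, act_apply]
  induction ρ t with
  | zero => simp
  | add x y hx hy => simp only [map_add, hx, hy, smul_add]
  | tmul x y => simp

/-- If `f` is a point of a torsor and `g` a point of the group, then `act ρ f g` is the translate `f
g`, and this is `(f g) g' = f (g g')`. Merely linear maps are allowed in order to cover tangent
vectors. -/
lemma act_act (hρ : ∀ t, TensorProduct.assoc (ZMod p) T K K (ρ.rTensor K (ρ t)) =
      (Coalgebra.comul (R := ZMod p) (A := K)).lTensor T (ρ t))
    (f : T →ₗ[ZMod p] B) (g g' : K →ₗ[ZMod p] B) :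
    act ρ (act ρ f g) g' = act ρ f (conv g g') := by
  ext t
  have h1 : act ρ (act ρ f g) g' t = LinearMap.mul' (ZMod p) B (TensorProduct.map f
      (LinearMap.mul' (ZMod p) B ∘ₗ TensorProduct.map g g')
      (TensorProduct.assoc (ZMod p) T K K (ρ.rTensor K (ρ t)))) := by
    rw [act_apply]
    induction ρ t with
    | zero => simp
    | add x y hx hy => simp only [map_add, hx, hy]
    | tmul x y =>
      simp only [TensorProduct.map_tmul, LinearMap.mul'_apply, LinearMap.rTensor_tmul, act_apply]
      induction ρ x with
      | zero => simp
      | add z w hz hw => simp only [map_add, add_mul, hz, hw, TensorProduct.add_tmul]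
      | tmul z w => simp [mul_assoc]
  rw [h1, hρ, act_apply]
  induction ρ t with
  | zero => simp
  | add x y hx hy => simp only [map_add, hx, hy]
  | tmul x y => simp [act_apply]

lemma conv_conv (f g g' : K →ₗ[ZMod p] B) : conv (conv f g) g' = conv f (conv g g') :=
  act_act _ (fun t => Coalgebra.coassoc_apply t) f g g'

lemma act_convOne (hρ : ∀ t, (Coalgebra.counit (R := ZMod p) (A := K)).lTensor T (ρ t) = t ⊗ₜ 1)
    (f : T →ₗ[ZMod p] B) : act ρ f (convOne p K B) = f := by
  ext t
  have h1 : act ρ f (convOne p K B) t = LinearMap.mul' (ZMod p) B (TensorProduct.map f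
      (Algebra.linearMap (ZMod p) B) ((Coalgebra.counit (R := ZMod p) (A := K)).lTensor T (ρ t))) := by
    rw [act_apply]
    induction ρ t with
    | zero => simp
    | add x y hx hy => simp only [map_add, hx, hy]
    | tmul x y => simp [convOne_apply]
  rw [h1, hρ]
  simp

lemma conv_convOne (f : K →ₗ[ZMod p] B) : conv f (convOne p K B) = f :=
  act_convOne _ (fun t => Coalgebra.lTensor_counit_comul t) f

lemma convOne_conv (f : K →ₗ[ZMod p] B) : conv (convOne p K B) f = f := by
  ext t
  have h1 : conv (convOne p K B) f t = LinearMap.mul' (ZMod p) B (TensorProduct.map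
      (Algebra.linearMap (ZMod p) B) f
      ((Coalgebra.counit (R := ZMod p) (A := K)).rTensor K (Coalgebra.comul t))) := by
    rw [act_apply]
    induction (Coalgebra.comul t : K ⊗[ZMod p] K) with
    | zero => simp
    | add x y hx hy => simp only [map_add, hx, hy]
    | tmul x y => simp [convOne_apply]
  rw [h1, Coalgebra.rTensor_counit_comul]
  simp

lemma comp_act (φ : B →ₐ[ZMod p] B') (f : T →ₗ[ZMod p] B) (g : K →ₗ[ZMod p] B) :
    φ.toLinearMap ∘ₗ act ρ f g = act ρ (φ.toLinearMap ∘ₗ f) (φ.toLinearMap ∘ₗ g) := by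
  ext t
  rw [LinearMap.comp_apply, act_apply, act_apply]
  induction ρ t with
  | zero => simp
  | add x y hx hy => simp only [map_add, hx, hy]
  | tmul x y => simp

lemma comp_convOne (φ : B →ₐ[ZMod p] B') : φ.toLinearMap ∘ₗ convOne p K B = convOne p K B' := by
  ext t; simp [convOne_apply]

/-- Functoriality in the torsor. -/
lemma act_comp {ρ' : T' →ₗ[ZMod p] T' ⊗[ZMod p] K'} (i : T' →ₗ[ZMod p] T) (c : K' →ₗ[ZMod p] K)
    (h : ∀ t, ρ (i t) = TensorProduct.map i c (ρ' t)) (f : T →ₗ[ZMod p] B) (g : K →ₗ[ZMod p] B) :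
    act ρ f g ∘ₗ i = act ρ' (f ∘ₗ i) (g ∘ₗ c) := by
  ext t
  rw [LinearMap.comp_apply, act_apply, act_apply, h]
  induction ρ' t with
  | zero => simp
  | add x y hx hy => simp only [map_add, hx, hy]
  | tmul x y => simp

/-- Leibniz rule. -/
lemma derivation_comp_act (Y : Derivation (ZMod p) B B) (f : T →ₗ[ZMod p] B)
    (g : K →ₗ[ZMod p] B) :
    (Y : B →ₗ[ZMod p] B) ∘ₗ act ρ f g = act ρ ((Y : B →ₗ[ZMod p] B) ∘ₗ f) g +
      act ρ f ((Y : B →ₗ[ZMod p] B) ∘ₗ g) := by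
  ext t
  rw [LinearMap.add_apply, LinearMap.comp_apply, act_apply, act_apply, act_apply]
  induction ρ t with
  | zero => simp
  | add x y hx hy =>
    simp only [map_add, hx, hy]
    abel
  | tmul x y =>
    simp only [TensorProduct.map_tmul, LinearMap.mul'_apply, Derivation.coeFn_coe,
      Derivation.leibniz, smul_eq_mul, LinearMap.comp_apply]
    ring

/-- The coaction is the translate of the universal point of the torsor by the universal point of the
group. -/
lemma act_includeLeft_includeRight :
    act ρ (Algebra.TensorProduct.includeLeft : T →ₐ[ZMod p] T ⊗[ZMod p] K).toLinearMap
      (Algebra.TensorProduct.includeRight : K →ₐ[ZMod p] T ⊗[ZMod p] K).toLinearMap = ρ := by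
  ext t
  rw [act_apply]
  induction ρ t with
  | zero => simp
  | add x y hx hy => simp only [map_add, hx, hy]
  | tmul x y => simp

lemma act_map (f : T →ₗ[ZMod p] B) (g : K →ₗ[ZMod p] B') :
    act ρ ((Algebra.TensorProduct.includeLeft : B →ₐ[ZMod p] B ⊗[ZMod p] B').toLinearMap ∘ₗ f)
      ((Algebra.TensorProduct.includeRight : B' →ₐ[ZMod p] B ⊗[ZMod p] B').toLinearMap ∘ₗ g) =
      TensorProduct.map f g ∘ₗ ρ := by
  ext t
  rw [act_apply, LinearMap.comp_apply]
  induction ρ t with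
  | zero => simp
  | add x y hx hy => simp only [map_add, hx, hy]
  | tmul x y => simp

/-- A derivation at the unit. -/
def IsPointDer (ζ : K →ₗ[ZMod p] B) : Prop :=
  ∀ a b : K, ζ (a * b) = Coalgebra.counit (R := ZMod p) a • ζ b +
    Coalgebra.counit (R := ZMod p) b • ζ a

/-- The functional given by `e` and `ζ` is a derivation over the ring homomorphism given by `e` and
the counit. -/
lemma IsPointDer.mul'_map {ζ : K →ₗ[ZMod p] B} (hζ : IsPointDer ζ) (e : T →ₐ[ZMod p] B)
    (z w : T ⊗[ZMod p] K) :
    LinearMap.mul' (ZMod p) B (TensorProduct.map e.toLinearMap ζ (z * w)) =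
      LinearMap.mul' (ZMod p) B (TensorProduct.map e.toLinearMap (convOne p K B) z) *
        LinearMap.mul' (ZMod p) B (TensorProduct.map e.toLinearMap ζ w) +
      LinearMap.mul' (ZMod p) B (TensorProduct.map e.toLinearMap (convOne p K B) w) *
        LinearMap.mul' (ZMod p) B (TensorProduct.map e.toLinearMap ζ z) := by
  induction z with
  | zero => simp
  | add x y hx hy => simp only [add_mul, map_add, hx, hy, mul_add]; ring
  | tmul x y =>
    induction w with
    | zero => simp
    | add z w hz hw => simp only [mul_add, map_add, hz, hw, add_mul]; ring
    | tmul z w =>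
      simp only [Algebra.TensorProduct.tmul_mul_tmul, TensorProduct.map_tmul, LinearMap.mul'_apply,
        hζ y w, AlgHom.toLinearMap_apply, map_mul, convOne_apply, Algebra.smul_def]
      ring

end Act

namespace Torsor

/-! ### Algebra of torsors -/

variable {p : ℕ} [Fact p.Prime] {K K' : Type} [CommRing K] [Bialgebra (ZMod p) K] [CommRing K']
  [Bialgebra (ZMod p) K'] {X : Scheme.{0}} (E : Torsor p K X) (U : EtAff p X)

/-- The coaction as a linear map. -/
abbrev co : E.fn U →ₗ[ZMod p] E.fn U ⊗[ZMod p] K :=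
  ((E.coact U).restrictScalars (ZMod p)).toLinearMap

section

variable {B B' : Type} [CommRing B] [Algebra (ZMod p) B] [CommRing B'] [Algebra (ZMod p) B']

lemma act_conv (f : E.fn U →ₗ[ZMod p] B) (g g' : K →ₗ[ZMod p] B) :
    act (E.co U) (act (E.co U) f g) g' = act (E.co U) f (conv g g') :=
  act_act _ (E.coact_coact U) f g g'

lemma act_one (f : E.fn U →ₗ[ZMod p] B) : act (E.co U) f (convOne p K B) = f :=
  act_convOne _ (E.coact_counit U) f

/-- The isomorphism `E × P ≃ E ×_X E`. -/
def shear : E.fn U ⊗[U.R] E.fn U ≃ₐ[U.R] E.fn U ⊗[ZMod p] K :=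
  AlgEquiv.ofBijective _ (E.bijective U)

lemma shear_tmul (t t' : E.fn U) : E.shear U (t ⊗ₜ t') = t ⊗ₜ 1 * E.coact U t' := rfl

lemma shear_mul (t : E.fn U) (z : E.fn U ⊗[U.R] E.fn U) :
    E.shear U (t ⊗ₜ 1 * z) = t ⊗ₜ 1 * E.shear U z := by
  rw [map_mul, shear_tmul, map_one, mul_one]

/-- Surjectivity of `shear` says that the image of the coaction generates functions on `E × P` over
functions on `E`. Identities on `E × P` can thus be tested on translates of functions on `E`. -/
lemma induction_coact {P : E.fn U ⊗[ZMod p] K → Prop} (zero : P 0)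
    (add : ∀ x y, P x → P y → P (x + y)) (mul : ∀ t t', P (t ⊗ₜ 1 * E.coact U t'))
    (z : E.fn U ⊗[ZMod p] K) : P z := by
  obtain ⟨w, rfl⟩ := (E.shear U).surjective z
  induction w with
  | zero => rwa [map_zero]
  | add x y hx hy => rw [map_add]; exact add _ _ hx hy
  | tmul x y => exact mul x y

lemma mul'_map_mul (e : E.fn U →ₐ[ZMod p] B) (g : K →ₗ[ZMod p] B) (t : E.fn U)
    (z : E.fn U ⊗[ZMod p] K) :
    LinearMap.mul' (ZMod p) B (TensorProduct.map e.toLinearMap g (t ⊗ₜ 1 * z)) =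
      e t * LinearMap.mul' (ZMod p) B (TensorProduct.map e.toLinearMap g z) := by
  induction z with
  | zero => simp
  | add x y hx hy => simp only [mul_add, map_add, hx, hy]
  | tmul x y => simp [mul_assoc]

/-- A point of a torsor is determined by any of its translates. -/
lemma act_cancel (e : E.fn U →ₐ[ZMod p] B) {g g' : K →ₗ[ZMod p] B}
    (h : act (E.co U) e.toLinearMap g = act (E.co U) e.toLinearMap g') : g = g' := by
  have key : ∀ z, LinearMap.mul' (ZMod p) B (TensorProduct.map e.toLinearMap g z) =
      LinearMap.mul' (ZMod p) B (TensorProduct.map e.toLinearMap g' z) := by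
    intro z
    induction z using E.induction_coact U with
    | zero => simp
    | add x y hx hy => simp only [map_add, hx, hy]
    | mul t t' =>
      rw [mul'_map_mul, mul'_map_mul]
      congr 1
      exact LinearMap.congr_fun h t'
  ext a
  simpa using key (1 ⊗ₜ a)

lemma act_eq_zero (e : E.fn U →ₐ[ZMod p] B) {g : K →ₗ[ZMod p] B}
    (h : act (E.co U) e.toLinearMap g = 0) : g = 0 :=
  E.act_cancel U e (h.trans (act_zero_right _ _).symm)

lemma act_mul_of_isPointDer (e : E.fn U →ₐ[ZMod p] B) {ζ : K →ₗ[ZMod p] B} (hζ : IsPointDer ζ)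
    (t t' : E.fn U) : act (E.co U) e.toLinearMap ζ (t * t') =
      e t * act (E.co U) e.toLinearMap ζ t' + e t' * act (E.co U) e.toLinearMap ζ t := by
  have h1 := hζ.mul'_map e (E.coact U t) (E.coact U t')
  have h2 : ∀ t, LinearMap.mul' (ZMod p) B (TensorProduct.map e.toLinearMap (convOne p K B)
      (E.coact U t)) = e t := fun t => LinearMap.congr_fun (E.act_one U e.toLinearMap) t
  rw [h2, h2, ← map_mul] at h1
  exact h1

/-- By `induction_coact` the Leibniz rule spreads from translates of functions on `E` to all
functions on `E × P`. Then it is restricted to functions on `P`. -/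
lemma isPointDer_of_act (e : E.fn U →ₐ[ZMod p] B) {ζ : K →ₗ[ZMod p] B}
    (h : ∀ t t', act (E.co U) e.toLinearMap ζ (t * t') =
      e t * act (E.co U) e.toLinearMap ζ t' + e t' * act (E.co U) e.toLinearMap ζ t) :
    IsPointDer ζ := by
  have h2 : ∀ t, LinearMap.mul' (ZMod p) B (TensorProduct.map e.toLinearMap (convOne p K B)
      (E.coact U t)) = e t := fun t => LinearMap.congr_fun (E.act_one U e.toLinearMap) t
  have key : ∀ z w : E.fn U ⊗[ZMod p] K,
      LinearMap.mul' (ZMod p) B (TensorProduct.map e.toLinearMap ζ (z * w)) =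
      LinearMap.mul' (ZMod p) B (TensorProduct.map e.toLinearMap (convOne p K B) z) *
        LinearMap.mul' (ZMod p) B (TensorProduct.map e.toLinearMap ζ w) +
      LinearMap.mul' (ZMod p) B (TensorProduct.map e.toLinearMap (convOne p K B) w) *
        LinearMap.mul' (ZMod p) B (TensorProduct.map e.toLinearMap ζ z) := by
    intro z w
    induction z using E.induction_coact U with
    | zero => simp
    | add x y hx hy => simp only [add_mul, map_add, hx, hy, mul_add]; ring
    | mul t t' =>
      induction w using E.induction_coact U with
      | zero => simp
      | add x y hx hy => simp only [mul_add, map_add, hx, hy, add_mul]; ring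
      | mul s s' =>
        have h3 : (t ⊗ₜ 1 * E.coact U t') * (s ⊗ₜ[ZMod p] (1 : K) * E.coact U s') =
            (t * s) ⊗ₜ 1 * E.coact U (t' * s') := by
          have : ((t * s) ⊗ₜ[ZMod p] (1 : K)) = t ⊗ₜ 1 * s ⊗ₜ 1 := by simp
          rw [this, map_mul]; ring
        rw [h3]
        simp only [mul'_map_mul, h2]
        have h4 := h t' s'
        simp only [act_apply, AlgHom.toLinearMap_apply, AlgHom.restrictScalars_apply] at h4
        rw [h4, map_mul]
        ring
  intro a b
  have := key (1 ⊗ₜ a) (1 ⊗ₜ b)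
  simpa [convOne_apply, Algebra.smul_def] using this

variable [Algebra U.R B] [IsScalarTower (ZMod p) U.R B]

/-- Simple transitivity, for linear maps: pair `e` with `δ` on `E ×_X E`, transport along `shear`,
and restrict to `1 ⊗ K`. -/
lemma exists_act_eq (e : E.fn U →ₐ[U.R] B) (δ : E.fn U →ₗ[U.R] B) :
    ∃ g : K →ₗ[ZMod p] B, act (E.co U) (e.restrictScalars (ZMod p)).toLinearMap g =
      δ.restrictScalars (ZMod p) := by
  let G : E.fn U ⊗[U.R] E.fn U →ₗ[U.R] B :=
    LinearMap.mul' U.R B ∘ₗ TensorProduct.map e.toLinearMap δ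
  let g : K →ₗ[ZMod p] B := (G ∘ₗ (E.shear U).symm.toLinearMap).restrictScalars (ZMod p) ∘ₗ
    (Algebra.TensorProduct.includeRight : K →ₐ[ZMod p] E.fn U ⊗[ZMod p] K).toLinearMap
  have hG : ∀ t z, G (t ⊗ₜ 1 * z) = e t * G z := by
    intro t z
    induction z with
    | zero => simp
    | add x y hx hy => simp only [mul_add, map_add, hx, hy]
    | tmul x y => simp [G, mul_assoc]
  have key : ∀ z, LinearMap.mul' (ZMod p) B (TensorProduct.map
      (e.restrictScalars (ZMod p)).toLinearMap g z) = G ((E.shear U).symm z) := by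
    intro z
    induction z with
    | zero => simp
    | add x y hx hy => simp only [map_add, hx, hy]
    | tmul t h =>
      have h1 : (E.shear U).symm (t ⊗ₜ h) = t ⊗ₜ 1 * (E.shear U).symm (1 ⊗ₜ h) := by
        apply (E.shear U).injective
        rw [shear_mul]
        simp
      rw [h1, hG]
      rfl
  refine ⟨g, ?_⟩
  ext t
  rw [act_apply]
  refine (key _).trans ?_
  have h1 : (E.shear U).symm (E.coact U t) = 1 ⊗ₜ t := by
    rw [AlgEquiv.symm_apply_eq, shear_tmul]
    simp [← Algebra.TensorProduct.one_def]
  refine (congrArg G h1).trans ?_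
  simp [G]

lemma exists_algHom_act_eq (e d : E.fn U →ₐ[U.R] B) :
    ∃ g : K →ₐ[ZMod p] B, act (E.co U) (e.restrictScalars (ZMod p)).toLinearMap g.toLinearMap =
      (d.restrictScalars (ZMod p)).toLinearMap := by
  obtain ⟨g, hg⟩ := E.exists_act_eq U e d.toLinearMap
  have key : ∀ z w : E.fn U ⊗[ZMod p] K,
      LinearMap.mul' (ZMod p) B (TensorProduct.map
        (e.restrictScalars (ZMod p)).toLinearMap g (z * w)) =
      LinearMap.mul' (ZMod p) B (TensorProduct.map
        (e.restrictScalars (ZMod p)).toLinearMap g z) *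
        LinearMap.mul' (ZMod p) B (TensorProduct.map
        (e.restrictScalars (ZMod p)).toLinearMap g w) := by
    have hg' : ∀ t, LinearMap.mul' (ZMod p) B (TensorProduct.map
        (e.restrictScalars (ZMod p)).toLinearMap g (E.coact U t)) = d t :=
      fun t => LinearMap.congr_fun hg t
    intro z w
    induction z using E.induction_coact U with
    | zero => simp
    | add x y hx hy => simp only [add_mul, map_add, hx, hy]
    | mul t t' =>
      induction w using E.induction_coact U with
      | zero => simp
      | add x y hx hy => simp only [mul_add, map_add, hx, hy]
      | mul s s' =>
        have h3 : (t ⊗ₜ 1 * E.coact U t') * (s ⊗ₜ[ZMod p] (1 : K) * E.coact U s') =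
            (t * s) ⊗ₜ 1 * E.coact U (t' * s') := by
          have : ((t * s) ⊗ₜ[ZMod p] (1 : K)) = t ⊗ₜ 1 * s ⊗ₜ 1 := by simp
          rw [this, map_mul]; ring
        rw [h3]
        simp only [mul'_map_mul, hg']
        rw [map_mul, map_mul]
        ring
  have h1 : g 1 = 1 := by
    have := LinearMap.congr_fun hg 1
    simpa [act_apply, Algebra.TensorProduct.one_def] using this
  exact ⟨AlgHom.ofLinearMap g h1 fun a b => by simpa using key (1 ⊗ₜ a) (1 ⊗ₜ b), hg⟩

/-- A torsor is trivialized by a point. -/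
def psi (e : E.fn U →ₐ[U.R] B) : B ⊗[U.R] E.fn U →ₐ[U.R] B ⊗[ZMod p] K :=
  Algebra.TensorProduct.productMap
    (Algebra.TensorProduct.includeLeft : B →ₐ[U.R] B ⊗[ZMod p] K)
    ((Algebra.TensorProduct.map e (AlgHom.id (ZMod p) K)).comp (E.coact U))

lemma psi_tmul (e : E.fn U →ₐ[U.R] B) (b : B) (t : E.fn U) :
    E.psi U e (b ⊗ₜ t) = b ⊗ₜ 1 * Algebra.TensorProduct.map e (AlgHom.id (ZMod p) K)
      (E.coact U t) := rfl

/-- The inverse is the base change along `e` of the inverse of `shear`. -/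
lemma psi_bijective (e : E.fn U →ₐ[U.R] B) : Function.Bijective (E.psi U e) := by
  let e' := Algebra.TensorProduct.map e (AlgHom.id U.R (E.fn U))
  have h1 : ∀ z, E.psi U e (e' z) =
      Algebra.TensorProduct.map e (AlgHom.id (ZMod p) K) (E.shear U z) := by
    intro z
    induction z with
    | zero => simp
    | add x y hx hy => simp only [map_add, hx, hy]
    | tmul x y => simp [e', psi_tmul, shear_tmul]
  let L₀ : K →ₗ[ZMod p] B ⊗[U.R] E.fn U :=
    ((e'.comp (E.shear U).symm.toAlgHom).restrictScalars (ZMod p)).toLinearMap ∘ₗ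
    (Algebra.TensorProduct.includeRight : K →ₐ[ZMod p] E.fn U ⊗[ZMod p] K).toLinearMap
  let L : B ⊗[ZMod p] K →ₗ[ZMod p] B ⊗[U.R] E.fn U := TensorProduct.lift
    ((LinearMap.mul (ZMod p) (B ⊗[U.R] E.fn U)).compl₁₂
      ((Algebra.TensorProduct.includeLeft : B →ₐ[U.R] B ⊗[U.R] E.fn U).restrictScalars
        (ZMod p)).toLinearMap L₀)
  have hL : ∀ b h, L (b ⊗ₜ h) = b ⊗ₜ 1 * e' ((E.shear U).symm (1 ⊗ₜ h)) := fun b h => rfl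
  have h2 : ∀ z, E.psi U e (L z) = z := by
    intro z
    induction z with
    | zero => simp
    | add x y hx hy => simp only [map_add, hx, hy]
    | tmul b h =>
      rw [hL, map_mul, h1]
      simp [psi_tmul]
  have hLm : ∀ b z, L (b ⊗ₜ 1 * z) = b ⊗ₜ 1 * L z := by
    intro b z
    induction z with
    | zero => simp
    | add x y hx hy => simp only [mul_add, map_add, hx, hy]
    | tmul c h =>
      simp only [Algebra.TensorProduct.tmul_mul_tmul, hL, one_mul, ← mul_assoc, mul_one]
  have h3 : ∀ z, L (Algebra.TensorProduct.map e (AlgHom.id (ZMod p) K) z) =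
      e' ((E.shear U).symm z) := by
    intro z
    induction z with
    | zero => simp
    | add x y hx hy => simp only [map_add, hx, hy]
    | tmul t h =>
      have h4 : (E.shear U).symm (t ⊗ₜ h) = t ⊗ₜ 1 * (E.shear U).symm (1 ⊗ₜ h) := by
        apply (E.shear U).injective
        rw [shear_mul]
        simp
      rw [h4, map_mul]
      simp [hL, e']
  have h5 : ∀ z, L (E.psi U e z) = z := by
    intro z
    induction z with
    | zero => simp
    | add x y hx hy => simp only [map_add, hx, hy]
    | tmul b t =>
      rw [psi_tmul, hLm, h3]
      have h1 : (E.shear U).symm (E.coact U t) = 1 ⊗ₜ t := by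
        rw [AlgEquiv.symm_apply_eq, shear_tmul]
        simp [← Algebra.TensorProduct.one_def]
      rw [h1]
      simp [e']
  exact ⟨Function.LeftInverse.injective h5, Function.RightInverse.surjective h2⟩

lemma psi_smul (e : E.fn U →ₐ[U.R] B) (b : B) (z : B ⊗[U.R] E.fn U) :
    E.psi U e (b • z) = b • E.psi U e z := by
  induction z with
  | zero => simp
  | add x y hx hy => simp only [map_add, smul_add, hx, hy]
  | tmul x y =>
    rw [TensorProduct.smul_tmul', psi_tmul, psi_tmul, Algebra.smul_def, Algebra.smul_def, ← mul_assoc]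
    simp

end

/-- Over a faithfully flat extension with a section, `psi` identifies the algebra of the torsor with
`R' ⊗ K`, which is free and nonzero. Faithful flatness descends, so the torsor itself can be used as
a covering for descent. -/
instance faithfullyFlat : Module.FaithfullyFlat U.R (E.fn U) := by
  obtain ⟨R', _, _, -, hff, ⟨e⟩⟩ := E.locally_trivial U
  let _ : Algebra (ZMod p) R' := ((algebraMap U.R R').comp (algebraMap (ZMod p) U.R)).toAlgebra
  have : IsScalarTower (ZMod p) U.R R' := IsScalarTower.of_algebraMap_eq fun _ => rfl
  let ψ : (R' ⊗[U.R] E.fn U) ≃ₗ[R'] R' ⊗[ZMod p] K :=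
    LinearEquiv.ofBijective
      { toFun := E.psi U e
        map_add' := map_add _
        map_smul' := E.psi_smul U e } (E.psi_bijective U e)
  have hnt : Nontrivial K := (Bialgebra.counitAlgHom (ZMod p) K).toRingHom.domain_nontrivial
  have h1 : Module.FaithfullyFlat R' (R' ⊗[U.R] E.fn U) :=
    Module.FaithfullyFlat.of_linearEquiv _ _ ψ
  have h2 : Module.FaithfullyFlat U.R (R' ⊗[U.R] E.fn U) := Module.FaithfullyFlat.trans U.R R' _
  have h3 : Module.Flat U.R (E.fn U) := Module.Flat.of_flat_tensorProduct U.R (E.fn U) R'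
  rw [Module.FaithfullyFlat.iff_flat_and_lTensor_reflects_triviality]
  refine ⟨h3, fun N _ _ hN => ?_⟩
  have h4 : Subsingleton ((R' ⊗[U.R] E.fn U) ⊗[U.R] N) :=
    (TensorProduct.assoc U.R R' (E.fn U) N).injective.subsingleton
  exact Module.FaithfullyFlat.lTensor_reflects_triviality U.R (R' ⊗[U.R] E.fn U) N

/-- Descent of membership in a submodule. -/
lemma mem_of_one_tmul_mem {R B M : Type} [CommRing R] [CommRing B] [Algebra R B]
    [Module.FaithfullyFlat R B] [AddCommGroup M] [Module R M] (N : Submodule R M) {m : M}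
    (h : (1 : B) ⊗ₜ[R] m ∈ LinearMap.range (N.subtype.lTensor B)) : m ∈ N := by
  obtain ⟨z, hz⟩ := h
  rw [← Submodule.Quotient.mk_eq_zero, ← Module.FaithfullyFlat.one_tmul_eq_zero_iff R _ (A := B)]
  have h1 : (N.mkQ.lTensor B) (1 ⊗ₜ m) = 0 := by
    rw [← hz, ← LinearMap.comp_apply, ← LinearMap.lTensor_comp]
    have : N.mkQ ∘ₗ N.subtype = 0 := by ext x; simp
    rw [this]; simp
  simpa using h1

/-- The translates of the point `e` cover the torsor: the given data is `psi` of `1 ⊗ t`, and `B` is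
faithfully flat. -/
lemma map_coact_injective {B : Type} [CommRing B] [Algebra (ZMod p) B] [Algebra U.R B]
    [IsScalarTower (ZMod p) U.R B] [Module.FaithfullyFlat U.R B] (e : E.fn U →ₐ[U.R] B)
    {t t' : E.fn U} (h : Algebra.TensorProduct.map e (AlgHom.id (ZMod p) K) (E.coact U t) =
      Algebra.TensorProduct.map e (AlgHom.id (ZMod p) K) (E.coact U t')) : t = t' := by
  apply Module.FaithfullyFlat.tensorProduct_mk_injective (A := U.R) (B := B) (E.fn U)
  apply (E.psi_bijective U e).1
  simp only [TensorProduct.mk_apply, psi_tmul]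
  rw [h]

/-- Invariant functions come from the base. -/
lemma exists_algebraMap_eq {t : E.fn U} (h : E.coact U t = t ⊗ₜ 1) :
    ∃ r, algebraMap U.R (E.fn U) r = t := by
  -- Under `shear`, invariance becomes the descent condition along `U.R → E.fn U`.
  have h1 : (1 : E.fn U) ⊗ₜ[U.R] t = t ⊗ₜ 1 := by
    apply (E.shear U).injective
    rw [shear_tmul, shear_tmul, h]
    simp [← Algebra.TensorProduct.one_def]
  refine mem_of_one_tmul_mem (B := E.fn U) (LinearMap.range (Algebra.linearMap U.R (E.fn U))) ?_
  rw [h1]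
  exact ⟨t ⊗ₜ ⟨1, 1, by simp⟩, by simp⟩

lemma algebraMap_injective : Function.Injective (algebraMap U.R (E.fn U)) :=
  FaithfulSMul.algebraMap_injective _ _

end Torsor

/-! ### Morphisms of torsors over the identity. -/

namespace TorsorHom

variable {p : ℕ} [Fact p.Prime] {K K' : Type} [CommRing K] [Bialgebra (ZMod p) K] [CommRing K']
  [Bialgebra (ZMod p) K'] {X : Scheme.{0}} {E : Torsor p K X} {E' : Torsor p K' X}
  {c : K' →ₐ[ZMod p] K} (i : TorsorHom.Over c E E') (U : EtAff p X)

/-- A morphism over the identity as a homomorphism of algebras over the base. -/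
def alg : E'.fn U →ₐ[U.R] E.fn U :=
  { (i.map U).toRingHom with commutes' := i.map_algebraMap U }

lemma alg_apply (t : E'.fn U) : i.alg U t = i.map U t := rfl

/-- After base change to `E` both torsors are trivial and the morphism becomes `c`. Faithfully flat
descent then transfers properties of `c` to the morphism. -/
lemma shear_map (z : E.fn U ⊗[U.R] E'.fn U) :
    E.shear U ((i.alg U).toLinearMap.lTensor (E.fn U) z) =
      c.toLinearMap.lTensor (E.fn U) (E'.psi U (i.alg U) z) := by
  induction z with
  | zero => simp
  | add x y hx hy => simp only [map_add, hx, hy]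
  | tmul x y =>
    rw [LinearMap.lTensor_tmul, Torsor.shear_tmul, Torsor.psi_tmul, AlgHom.toLinearMap_apply,
      alg_apply, i.map_coact]
    induction E'.coact U y with
    | zero => simp
    | add z w hz hw => simp only [map_add, mul_add, hz, hw]
    | tmul z w => simp [alg_apply]

/-- A function on the source which is compatible with the coaction of the target group comes from
the target. -/
lemma exists_map_eq {t : E.fn U}
    (h : E.coact U t ∈ LinearMap.range (c.toLinearMap.lTensor (E.fn U))) : ∃ t', i.map U t' = t := by
  obtain ⟨z, hz⟩ := h
  obtain ⟨w, rfl⟩ := (E'.psi_bijective U (i.alg U)).2 z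
  have h1 : (1 : E.fn U) ⊗ₜ[U.R] t = (i.alg U).toLinearMap.lTensor (E.fn U) w := by
    apply (E.shear U).injective
    rw [i.shear_map, hz, Torsor.shear_tmul]
    simp [← Algebra.TensorProduct.one_def]
  refine Torsor.mem_of_one_tmul_mem (B := E.fn U) (LinearMap.range (i.alg U).toLinearMap) ?_
  rw [h1]
  refine ⟨(i.alg U).toLinearMap.rangeRestrict.lTensor (E.fn U) w, ?_⟩
  rw [← LinearMap.comp_apply, ← LinearMap.lTensor_comp]
  rfl

lemma map_injective (hc : Function.Injective c) : Function.Injective (i.map U) := by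
  have h1 : Function.Injective ((i.alg U).toLinearMap.lTensor (E.fn U)) := by
    intro z w hzw
    apply (E'.psi_bijective U (i.alg U)).1
    apply Module.Flat.lTensor_preserves_injective_linearMap (M := E.fn U) c.toLinearMap hc
    rw [← i.shear_map, ← i.shear_map, hzw]
  exact (Module.FaithfullyFlat.lTensor_injective_iff_injective U.R (E.fn U)
    (i.alg U).toLinearMap).1 h1

lemma map_surjective (hc : Function.Surjective c) : Function.Surjective (i.map U) := fun _ =>
  i.exists_map_eq U (LinearMap.lTensor_surjective (E.fn U) hc _)

end TorsorHom

namespace Torsor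

/-! ### Vector bundles associated with a matrix representation -/

variable {p : ℕ} [Fact p.Prime] {K : Type} [CommRing K] [Bialgebra (ZMod p) K]
  {X : Scheme.{0}} (E : Torsor p K X) (U : EtAff p X) {n : ℕ}

/-- The linear map whose kernel consists of the vectors of functions on a torsor that transform by
the matrix `A`. -/
def defect (A : Fin n → Fin n → K) :
    (Fin n → E.fn U) →ₗ[U.R] (Fin n → E.fn U ⊗[ZMod p] K) where
  toFun w j := E.coact U (w j) - ∑ i, w i ⊗ₜ A i j
  map_add' w w' := by
    ext j
    simp only [Pi.add_apply, map_add, TensorProduct.add_tmul, Finset.sum_add_distrib]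
    abel
  map_smul' r w := by
    ext j
    simp only [Pi.smul_apply, map_smul, RingHom.id_apply, smul_sub, Finset.smul_sum,
      TensorProduct.smul_tmul']

lemma mem_ker_defect {A : Fin n → Fin n → K} {w : Fin n → E.fn U} :
    w ∈ LinearMap.ker (E.defect U A) ↔ ∀ j, E.coact U (w j) = ∑ i, w i ⊗ₜ A i j := by
  rw [LinearMap.mem_ker, funext_iff]
  exact forall_congr' fun j => sub_eq_zero

/-- The isomorphism induced by `shear`. -/
def shearRight : E.fn U ⊗[U.R] (E.fn U ⊗[ZMod p] K) →ₗ[ZMod p]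
    (E.fn U ⊗[ZMod p] K) ⊗[ZMod p] K :=
  (((E.shear U).toAlgHom.restrictScalars (ZMod p)).toLinearMap.rTensor K) ∘ₗ
    ((AlgebraTensorModule.assoc (ZMod p) U.R U.R (E.fn U) (E.fn U) K).symm.toLinearMap.restrictScalars
      (ZMod p))

lemma shearRight_injective : Function.Injective (E.shearRight U) := by
  have h1 : Function.Injective
      (((E.shear U).toAlgHom.restrictScalars (ZMod p)).toLinearMap.rTensor K) :=
    Module.Flat.rTensor_preserves_injective_linearMap (M := K) _ (E.shear U).injective
  exact h1.comp (AlgebraTensorModule.assoc (ZMod p) U.R U.R (E.fn U) (E.fn U) K).symm.injective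

lemma shearRight_tmul (t t' : E.fn U) (h : K) :
    E.shearRight U (t ⊗ₜ (t' ⊗ₜ h)) = E.shear U (t ⊗ₜ t') ⊗ₜ h := rfl

lemma shearRight_mk (h : K) (f : E.fn U →ₗ[U.R] E.fn U ⊗[ZMod p] K) (hf : ∀ t, f t = t ⊗ₜ h)
    (z : E.fn U ⊗[U.R] E.fn U) : E.shearRight U (f.lTensor (E.fn U) z) = E.shear U z ⊗ₜ h := by
  induction z with
  | zero => simp
  | add x y hx hy => simp only [map_add, hx, hy, TensorProduct.add_tmul]
  | tmul x y => rw [LinearMap.lTensor_tmul, hf, shearRight_tmul]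

lemma shearRight_coact (z : E.fn U ⊗[U.R] E.fn U) :
    TensorProduct.assoc (ZMod p) (E.fn U) K K
      (E.shearRight U ((E.coact U).toLinearMap.lTensor (E.fn U) z)) =
      (Coalgebra.comul (R := ZMod p) (A := K)).lTensor (E.fn U) (E.shear U z) := by
  induction z with
  | zero => simp
  | add x y hx hy => simp only [map_add, hx, hy]
  | tmul x y =>
    have h1 : ∀ w : E.fn U ⊗[ZMod p] K, TensorProduct.assoc (ZMod p) (E.fn U) K K
        (E.shearRight U (x ⊗ₜ w)) = (LinearMap.mulLeft (ZMod p) x).rTensor _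
          (TensorProduct.assoc (ZMod p) (E.fn U) K K ((E.co U).rTensor K w)) := by
      intro w
      induction w with
      | zero => simp
      | add z w hz hw => simp only [map_add, TensorProduct.tmul_add, hz, hw]
      | tmul z w =>
        rw [shearRight_tmul, shear_tmul]
        simp only [LinearMap.rTensor_tmul, AlgHom.toLinearMap_apply, AlgHom.restrictScalars_apply]
        induction E.coact U z with
        | zero => simp
        | add a b ha hb => simp only [map_add, mul_add, TensorProduct.add_tmul, ha, hb]
        | tmul a b => simp
    rw [LinearMap.lTensor_tmul, AlgHom.toLinearMap_apply, h1, E.coact_coact, shear_tmul]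
    induction E.coact U y with
    | zero => simp
    | add a b ha hb => simp only [map_add, mul_add, ha, hb]
    | tmul a b => simp

/-- After base change to `E` the torsor becomes the group, on which `v` is a solution by `hv`. By
flatness the solutions over the base change come from those over the base. -/
lemma exists_tmul_ker_defect (A : Fin n → Fin n → K) (v : Fin n → K)
    (hv : ∀ j, Coalgebra.comul (R := ZMod p) (v j) = ∑ i, v i ⊗ₜ A i j) :
    ∃ z : E.fn U ⊗[U.R] LinearMap.ker (E.defect U A), ∀ j,
      E.shear U (((LinearMap.proj j ∘ₗ (LinearMap.ker (E.defect U A)).subtype :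
        _ →ₗ[U.R] E.fn U)).lTensor (E.fn U) z) = 1 ⊗ₜ v j := by
  let ζ : Fin n → E.fn U ⊗[U.R] E.fn U := fun j => (E.shear U).symm (1 ⊗ₜ v j)
  have hζ : ∀ j, E.shear U (ζ j) = 1 ⊗ₜ v j := fun j => (E.shear U).apply_symm_apply _
  let z := (TensorProduct.piRight U.R U.R (E.fn U) (fun _ : Fin n => E.fn U)).symm ζ
  have hz : ∀ j, ((LinearMap.proj j : (Fin n → E.fn U) →ₗ[U.R] E.fn U)).lTensor (E.fn U) z =
      ζ j := by
    have h1 : ∀ y : E.fn U ⊗[U.R] (Fin n → E.fn U), ∀ j,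
        ((LinearMap.proj j : (Fin n → E.fn U) →ₗ[U.R] E.fn U)).lTensor (E.fn U) y =
        TensorProduct.piRight U.R U.R (E.fn U) (fun _ : Fin n => E.fn U) y j := by
      intro y j
      induction y with
      | zero => simp
      | add a b ha hb => simp only [map_add, ha, hb, Pi.add_apply]
      | tmul a b => simp
    intro j
    rw [h1]
    simp [z]
  have hker : z ∈ LinearMap.ker ((E.defect U A).lTensor (E.fn U)) := by
    rw [LinearMap.mem_ker]
    apply (TensorProduct.piRight U.R U.R (E.fn U)
      (fun _ : Fin n => E.fn U ⊗[ZMod p] K)).injective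
    rw [map_zero]
    ext1 j
    have h1 : ∀ y : E.fn U ⊗[U.R] (Fin n → E.fn U ⊗[ZMod p] K),
        TensorProduct.piRight U.R U.R (E.fn U) (fun _ : Fin n => E.fn U ⊗[ZMod p] K) y j =
        (LinearMap.proj j : (Fin n → E.fn U ⊗[ZMod p] K) →ₗ[U.R] _).lTensor (E.fn U) y := by
      intro y
      induction y with
      | zero => simp
      | add a b ha hb => simp only [map_add, ha, hb, Pi.add_apply]
      | tmul a b => simp
    let m : K → E.fn U →ₗ[U.R] E.fn U ⊗[ZMod p] K := fun h =>
      { toFun := fun t => t ⊗ₜ h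
        map_add' := fun a b => TensorProduct.add_tmul a b h
        map_smul' := fun r a => (TensorProduct.smul_tmul' r a h).symm }
    have h2 : LinearMap.proj j ∘ₗ E.defect U A = (E.coact U).toLinearMap ∘ₗ LinearMap.proj j -
        ∑ i, m (A i j) ∘ₗ LinearMap.proj i := by
      refine LinearMap.ext fun w => ?_
      simp [defect, m]
    rw [h1, ← LinearMap.comp_apply, ← LinearMap.lTensor_comp, h2, LinearMap.lTensor_sub,
      LinearMap.sub_apply, LinearMap.lTensor_comp, LinearMap.comp_apply, hz]
    have h3 : (∑ i, m (A i j) ∘ₗ (LinearMap.proj i : (Fin n → E.fn U) →ₗ[U.R] E.fn U)).lTensor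
        (E.fn U) z = ∑ i, (m (A i j)).lTensor (E.fn U) (ζ i) := by
      rw [← LinearMap.coe_lTensorHom, map_sum, LinearMap.sum_apply]
      refine Finset.sum_congr rfl fun i _ => ?_
      rw [LinearMap.coe_lTensorHom, LinearMap.lTensor_comp, LinearMap.comp_apply, hz]
    rw [h3, Pi.zero_apply, sub_eq_zero]
    apply E.shearRight_injective U
    apply (TensorProduct.assoc (ZMod p) (E.fn U) K K).injective
    rw [shearRight_coact, hζ, LinearMap.lTensor_tmul, hv, map_sum, map_sum, TensorProduct.tmul_sum]
    refine Finset.sum_congr rfl fun i _ => ?_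
    rw [E.shearRight_mk U (A i j) _ (fun t => rfl), hζ]
    rfl
  -- Flatness of `E.fn U` lifts `z` to the base change of the kernel.
  obtain ⟨y, hy⟩ := (Module.Flat.lTensor_exact (E.fn U)
    (LinearMap.exact_subtype_ker_map (E.defect U A)) z).1 hker
  refine ⟨y, fun j => ?_⟩
  rw [LinearMap.lTensor_comp, LinearMap.comp_apply, hy, hz, hζ]

/-- The vector bundle associated with a matrix representation has a dual basis. -/
lemma exists_dual_basis (C C' : Fin n → Fin n → K)
    (hC : ∀ i j, Coalgebra.comul (R := ZMod p) (C i j) = ∑ k, C i k ⊗ₜ C k j)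
    (hC' : ∀ i j, Coalgebra.comul (R := ZMod p) (C' i j) = ∑ k, C' k j ⊗ₜ C' i k)
    (hmul : ∀ i j, ∑ k, C' i k * C k j = if i = j then 1 else 0) :
    ∃ (ι : Type) (_ : Fintype ι) (w v : ι → Fin n → E.fn U),
      (∀ a j, E.coact U (w a j) = ∑ i, w a i ⊗ₜ C i j) ∧
      (∀ a j, E.coact U (v a j) = ∑ i, v a i ⊗ₜ C' j i) ∧
      ∀ i j, ∑ a, w a i * v a j = if i = j then 1 else 0 := by
  let W := LinearMap.ker (E.defect U C)
  let V := LinearMap.ker (E.defect U fun i j => C' j i)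
  -- A dual basis is an expression of the identity matrix as a sum of products of solutions `w` and
  -- dual solutions `v`. Membership in their span `N` is tested by descent after base change to `E`,
  -- where rows of `C` and columns of `C'` are solutions with `C' C = 1`.
  let N : Submodule U.R (Fin n × Fin n → E.fn U) :=
    Submodule.span U.R {M | ∃ w ∈ W, ∃ v ∈ V, M = fun ij => w ij.1 * v ij.2}
  let ev : Fin n × Fin n → N →ₗ[U.R] E.fn U := fun ij => LinearMap.proj ij ∘ₗ N.subtype
  have hprod : ∀ (z : E.fn U ⊗[U.R] W) (y : E.fn U ⊗[U.R] V), ∃ m : E.fn U ⊗[U.R] N, ∀ i j,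
      (ev (i, j)).lTensor (E.fn U) m =
      (LinearMap.proj i ∘ₗ W.subtype : W →ₗ[U.R] E.fn U).lTensor (E.fn U) z *
      (LinearMap.proj j ∘ₗ V.subtype : V →ₗ[U.R] E.fn U).lTensor (E.fn U) y := by
    intro z y
    induction z with
    | zero => exact ⟨0, fun i j => by simp⟩
    | add a b ha hb =>
      obtain ⟨m, hm⟩ := ha
      obtain ⟨m', hm'⟩ := hb
      exact ⟨m + m', fun i j => by rw [map_add, hm, hm', map_add, add_mul]⟩
    | tmul a b =>
      induction y with
      | zero => exact ⟨0, fun i j => by simp⟩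
      | add c d hc hd =>
        obtain ⟨m, hm⟩ := hc
        obtain ⟨m', hm'⟩ := hd
        exact ⟨m + m', fun i j => by rw [map_add, hm, hm', map_add, mul_add]⟩
      | tmul c d =>
        refine ⟨(a * c) ⊗ₜ ⟨fun ij => b.1 ij.1 * d.1 ij.2,
          Submodule.subset_span ⟨b.1, b.2, d.1, d.2, rfl⟩⟩, fun i j => ?_⟩
        simp [ev]
  choose z hz using fun k => E.exists_tmul_ker_defect U C (C k) (fun j => hC k j)
  choose y hy using fun k => E.exists_tmul_ker_defect U (fun i j => C' j i) (fun j => C' j k)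
    (fun j => hC' j k)
  choose m hm using fun k => hprod (z k) (y k)
  have hI : (fun ij : Fin n × Fin n => if ij.1 = ij.2 then (1 : E.fn U) else 0) ∈ N := by
    refine mem_of_one_tmul_mem (B := E.fn U) N ⟨∑ k, m k, ?_⟩
    apply (TensorProduct.piRight U.R U.R (E.fn U) (fun _ : Fin n × Fin n => E.fn U)).injective
    ext1 ⟨i, j⟩
    have h1 : ∀ x : E.fn U ⊗[U.R] N,
        TensorProduct.piRight U.R U.R (E.fn U) (fun _ : Fin n × Fin n => E.fn U)
          (N.subtype.lTensor (E.fn U) x) (i, j) = (ev (i, j)).lTensor (E.fn U) x := by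
      intro x
      induction x with
      | zero => simp
      | add a b ha hb => simp only [map_add, ha, hb, Pi.add_apply]
      | tmul a b => simp [ev]
    rw [h1, map_sum]
    apply (E.shear U).injective
    rw [map_sum]
    have h2 : ∀ k, E.shear U ((ev (i, j)).lTensor (E.fn U) (m k)) = 1 ⊗ₜ (C' j k * C k i) := by
      intro k
      rw [hm, map_mul, hz, hy]
      simp [mul_comm]
    simp only [h2, ← TensorProduct.tmul_sum, hmul, TensorProduct.piRight_apply,
      TensorProduct.piRightHom_tmul, shear_tmul]
    by_cases hij : i = j
    · simp [hij, ← Algebra.TensorProduct.one_def]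
    · simp [hij, Ne.symm hij]
  have hN : ∀ M ∈ N, ∃ (ι : Type) (_ : Fintype ι) (w v : ι → Fin n → E.fn U),
      (∀ a, w a ∈ W) ∧ (∀ a, v a ∈ V) ∧ ∀ i j, ∑ a, w a i * v a j = M (i, j) := by
    intro M hM
    induction hM using Submodule.span_induction with
    | mem M hM =>
      obtain ⟨w, hw, v, hv, rfl⟩ := hM
      exact ⟨Unit, inferInstance, fun _ => w, fun _ => v, fun _ => hw, fun _ => hv,
        fun i j => by simp⟩
    | zero => exact ⟨Empty, inferInstance, nofun, nofun, nofun, nofun, fun i j => by simp⟩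
    | add M M' _ _ h h' =>
      obtain ⟨ι, _, w, v, hw, hv, hM⟩ := h
      obtain ⟨ι', _, w', v', hw', hv', hM'⟩ := h'
      refine ⟨ι ⊕ ι', inferInstance, Sum.elim w w', Sum.elim v v', ?_, ?_, fun i j => ?_⟩
      · rintro (a | a); exacts [hw a, hw' a]
      · rintro (a | a); exacts [hv a, hv' a]
      · simp [hM, hM']
    | smul r M _ h =>
      obtain ⟨ι, _, w, v, hw, hv, hM⟩ := h
      refine ⟨ι, inferInstance, fun a => r • w a, v, fun a => W.smul_mem r (hw a), hv,
        fun i j => ?_⟩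
      simp [← hM, Finset.smul_sum]
  obtain ⟨ι, hι, w, v, hw, hv, hM⟩ := hN _ hI
  exact ⟨ι, hι, w, v, fun a => (E.mem_ker_defect U).1 (hw a), fun a => (E.mem_ker_defect U).1 (hv a),
    hM⟩

end Torsor

/-! ### The adjoint coaction -/

section Conj

variable {p : ℕ} {H B B' : Type} [CommRing H] [HopfAlgebra (ZMod p) H]
  [CommRing B] [Algebra (ZMod p) B] [CommRing B'] [Algebra (ZMod p) B']

lemma act_smul_left {T K R : Type} [CommRing T] [Algebra (ZMod p) T] [CommRing K]
    [Bialgebra (ZMod p) K] (ρ : T →ₗ[ZMod p] T ⊗[ZMod p] K) [CommRing R] [Algebra (ZMod p) R]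
    [Algebra R B] [IsScalarTower (ZMod p) R B] (r : R) (f : T →ₗ[ZMod p] B)
    (g : K →ₗ[ZMod p] B) : act ρ (r • f) g = r • act ρ f g := by
  ext t
  rw [LinearMap.smul_apply, act_apply, act_apply]
  induction ρ t with
  | zero => simp
  | add x y hx hy => simp only [map_add, hx, hy, smul_add]
  | tmul x y => simp

variable (p H) in
/-- The antipode as a homomorphism of algebras. -/
abbrev antip : H →ₐ[ZMod p] H := HopfAlgebra.antipodeAlgHom (ZMod p) H

lemma conv_antip_left (g : H →ₐ[ZMod p] B) :
    conv (g.comp (antip p H)).toLinearMap g.toLinearMap = convOne p H B := by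
  have h1 : conv (antip p H).toLinearMap (AlgHom.id (ZMod p) H).toLinearMap = convOne p H H :=
    HopfAlgebra.mul_antipode_rTensor_comul
  rw [← comp_convOne g, ← h1, comp_act]
  rfl

lemma conv_antip_right (g : H →ₐ[ZMod p] B) :
    conv g.toLinearMap (g.comp (antip p H)).toLinearMap = convOne p H B := by
  have h1 : conv (AlgHom.id (ZMod p) H).toLinearMap (antip p H).toLinearMap = convOne p H H :=
    HopfAlgebra.mul_antipode_lTensor_comul
  rw [← comp_convOne g, ← h1, comp_act]
  rfl

/-- The convolution product of homomorphisms of algebras, that is, the product of points of the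
group. -/
def convAlg {K : Type} [CommRing K] [Bialgebra (ZMod p) K] (g g' : K →ₐ[ZMod p] B) :
    K →ₐ[ZMod p] B :=
  (Algebra.TensorProduct.productMap g g').comp (Bialgebra.comulAlgHom (ZMod p) K)

lemma convAlg_toLinearMap {K : Type} [CommRing K] [Bialgebra (ZMod p) K] (g g' : K →ₐ[ZMod p] B) :
    (convAlg g g').toLinearMap = conv g.toLinearMap g'.toLinearMap := by
  ext h
  change Algebra.TensorProduct.productMap g g' (Coalgebra.comul h) = _
  rw [act_apply]
  induction (Coalgebra.comul h : K ⊗[ZMod p] K) with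
  | zero => simp
  | add x y hx hy => simp only [map_add, hx, hy]
  | tmul x y => simp

/-- Both sides are inverse to `g g'` for convolution, and inverses are unique. -/
lemma convAlg_antip (g g' : H →ₐ[ZMod p] B) :
    (convAlg g g').comp (antip p H) = convAlg (g'.comp (antip p H)) (g.comp (antip p H)) := by
  apply AlgHom.toLinearMap_injective
  have h1 := conv_antip_left (convAlg g g')
  have h2 : conv (convAlg g g').toLinearMap
      (convAlg (g'.comp (antip p H)) (g.comp (antip p H))).toLinearMap = convOne p H B := by
    rw [convAlg_toLinearMap, convAlg_toLinearMap, conv_conv, ← conv_conv g'.toLinearMap,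
      conv_antip_right, convOne_conv, conv_antip_right]
  rw [← conv_convOne ((convAlg g g').comp (antip p H)).toLinearMap, ← h2, ← conv_conv, h1,
    convOne_conv]

/-- The conjugate of a function on a Hopf algebra by a point of the group, that is, the adjoint
action on `Lie(G) ⊗ B`. -/
def conj (g : H →ₐ[ZMod p] B) (ξ : H →ₗ[ZMod p] B) : H →ₗ[ZMod p] B :=
  conv (g.comp (antip p H)).toLinearMap (conv ξ g.toLinearMap)

lemma mul'_map_adjoint (g : H →ₐ[ZMod p] B) (ξ : H →ₗ[ZMod p] B) (h : H) :
    LinearMap.mul' (ZMod p) B (TensorProduct.map ξ g.toLinearMap (adjoint p H h)) = conj g ξ h := by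
  rw [conj, ← conv_conv, act_apply, adjoint]
  simp only [LinearMap.comp_apply]
  induction (Coalgebra.comul h : H ⊗[ZMod p] H) with
  | zero => simp
  | add x y hx hy => simp only [map_add, hx, hy]
  | tmul x y =>
    simp only [LinearMap.rTensor_tmul, LinearMap.comp_apply, TensorProduct.map_tmul,
      LinearMap.mul'_apply, act_apply]
    induction (Coalgebra.comul x : H ⊗[ZMod p] H) with
    | zero => simp
    | add z w hz hw => simp only [map_add, add_mul, hz, hw, TensorProduct.add_tmul]
    | tmul z w =>
      simp only [LinearEquiv.coe_coe, TensorProduct.comm_tmul, TensorProduct.assoc_tmul,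
        LinearMap.lTensor_tmul, LinearMap.comp_apply, LinearMap.rTensor_tmul, LinearMap.mul'_apply,
        TensorProduct.map_tmul, AlgHom.toLinearMap_apply, map_mul, AlgHom.comp_apply,
        HopfAlgebra.antipodeAlgHom_apply]
      ring

/-- This turns the Sweedler formula in `adjointBundle` into conjugation by the universal point of
the subgroup, where convolution identities apply. -/
lemma map_adjoint (c : H →ₐ[ZMod p] B') (ξ : H →ₗ[ZMod p] B) (h : H) :
    TensorProduct.map ξ c.toLinearMap (adjoint p H h) =
      conj ((Algebra.TensorProduct.includeRight : B' →ₐ[ZMod p] B ⊗[ZMod p] B').comp c)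
        ((Algebra.TensorProduct.includeLeft : B →ₐ[ZMod p] B ⊗[ZMod p] B').toLinearMap ∘ₗ ξ) h := by
  rw [← mul'_map_adjoint]
  induction adjoint p H h with
  | zero => simp
  | add x y hx hy => simp only [map_add, hx, hy]
  | tmul x y => simp

lemma comp_conj (φ : B →ₐ[ZMod p] B') (g : H →ₐ[ZMod p] B) (ξ : H →ₗ[ZMod p] B) :
    φ.toLinearMap ∘ₗ conj g ξ = conj (φ.comp g) (φ.toLinearMap ∘ₗ ξ) := by
  rw [conj, comp_act, comp_act]
  rfl

lemma conj_conj (g g' : H →ₐ[ZMod p] B) (ξ : H →ₗ[ZMod p] B) :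
    conj g' (conj g ξ) = conj (convAlg g g') ξ := by
  rw [conj, conj, conj, convAlg_antip, convAlg_toLinearMap, convAlg_toLinearMap]
  simp only [conv_conv]

lemma conj_add (g : H →ₐ[ZMod p] B) (ξ ξ' : H →ₗ[ZMod p] B) :
    conj g (ξ + ξ') = conj g ξ + conj g ξ' := by
  unfold conj conv
  rw [act_add_left, act_add_right]

lemma conj_zero (g : H →ₐ[ZMod p] B) : conj g (0 : H →ₗ[ZMod p] B) = 0 := by
  unfold conj conv
  rw [act_zero_left, act_zero_right]

lemma conj_smul (g : H →ₐ[ZMod p] B) (b : B) (ξ : H →ₗ[ZMod p] B) :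
    conj g (b • ξ) = b • conj g ξ := by
  unfold conj conv
  rw [act_smul_left, act_smul_right]

lemma conj_sum {ι : Type} (s : Finset ι) (g : H →ₐ[ZMod p] B) (ξ : ι → H →ₗ[ZMod p] B) :
    conj g (∑ i ∈ s, ξ i) = ∑ i ∈ s, conj g (ξ i) := by
  classical
  induction s using Finset.induction_on with
  | empty => simp [conj_zero]
  | insert i s hi ih => rw [Finset.sum_insert hi, Finset.sum_insert hi, conj_add, ih]

lemma conj_convOne (g : H →ₐ[ZMod p] B) (hg : g.toLinearMap = convOne p H B)
    (ξ : H →ₗ[ZMod p] B) : conj g ξ = ξ := by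
  have h1 := conv_antip_left g
  rw [conj, hg, conv_convOne]
  rw [hg, conv_convOne] at h1
  rw [h1, convOne_conv]

lemma conv_conj (g : H →ₐ[ZMod p] B) (ξ : H →ₗ[ZMod p] B) :
    conv g.toLinearMap (conj g ξ) = conv ξ g.toLinearMap := by
  rw [conj, ← conv_conv, conv_antip_right, convOne_conv]

lemma eq_conj_of_conv_eq (g : H →ₐ[ZMod p] B) {ξ η : H →ₗ[ZMod p] B}
    (h : conv g.toLinearMap η = conv ξ g.toLinearMap) : η = conj g ξ := by
  rw [conj, ← h, ← conv_conv, conv_antip_left, convOne_conv]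

variable (p H) in
/-- The adjoint coaction as a homomorphism of algebras. -/
def adjointAlg : H →ₐ[ZMod p] H ⊗[ZMod p] H :=
  convAlg ((Algebra.TensorProduct.includeRight).comp (antip p H))
    (convAlg Algebra.TensorProduct.includeLeft Algebra.TensorProduct.includeRight)

lemma adjointAlg_apply (h : H) : adjointAlg p H h = adjoint p H h := by
  have h1 := map_adjoint (AlgHom.id (ZMod p) H) (LinearMap.id : H →ₗ[ZMod p] H) h
  have h2 : TensorProduct.map (LinearMap.id : H →ₗ[ZMod p] H)
    (AlgHom.id (ZMod p) H).toLinearMap = LinearMap.id := TensorProduct.map_id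
  rw [h2, LinearMap.id_apply] at h1
  rw [h1, ← AlgHom.toLinearMap_apply, adjointAlg, convAlg_toLinearMap, convAlg_toLinearMap]
  rfl

/-- The adjoint coaction is multiplicative and conjugation fixes the unit, so conjugation preserves
derivations at the unit. -/
lemma isLie_conj (g : H →ₐ[ZMod p] B) {ξ : H →ₗ[ZMod p] B} (hξ : IsLie ξ) : IsLie (conj g ξ) := by
  have key : ∀ z w : H ⊗[ZMod p] H,
      LinearMap.mul' (ZMod p) B (TensorProduct.map ξ g.toLinearMap (z * w)) =
      LinearMap.mul' (ZMod p) B (TensorProduct.map (convOne p H B) g.toLinearMap z) *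
        LinearMap.mul' (ZMod p) B (TensorProduct.map ξ g.toLinearMap w) +
      LinearMap.mul' (ZMod p) B (TensorProduct.map (convOne p H B) g.toLinearMap w) *
        LinearMap.mul' (ZMod p) B (TensorProduct.map ξ g.toLinearMap z) := by
    intro z w
    induction z with
    | zero => simp
    | add x y hx hy => simp only [add_mul, map_add, hx, hy, mul_add]; ring
    | tmul x y =>
      induction w with
      | zero => simp
      | add z w hz hw => simp only [mul_add, map_add, hz, hw, add_mul]; ring
      | tmul z w =>
        simp only [Algebra.TensorProduct.tmul_mul_tmul, TensorProduct.map_tmul,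
          LinearMap.mul'_apply, hξ x z, AlgHom.toLinearMap_apply, map_mul, convOne_apply,
          Algebra.smul_def]
        ring
  have h1 : ∀ h, LinearMap.mul' (ZMod p) B (TensorProduct.map (convOne p H B) g.toLinearMap
      (adjoint p H h)) = algebraMap (ZMod p) B (Coalgebra.counit (R := ZMod p) h) := by
    intro h
    rw [mul'_map_adjoint, conj, convOne_conv, conv_antip_left, convOne_apply]
  intro a b
  have h2 := key (adjoint p H a) (adjoint p H b)
  rw [h1, h1, mul'_map_adjoint, mul'_map_adjoint, ← adjointAlg_apply, ← adjointAlg_apply,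
    ← map_mul, adjointAlg_apply, mul'_map_adjoint] at h2
  rw [h2, Algebra.smul_def, Algebra.smul_def]

end Conj

namespace GmAction

/-! ### The grading -/

variable {p : ℕ} {H : Type} [CommRing H] [HopfAlgebra (ZMod p) H] (μ : GmAction p H)
  {B B' : Type} [CommRing B] [Algebra (ZMod p) B] [CommRing B'] [Algebra (ZMod p) B']

/-- The component of degree `i`. -/
abbrev prj (i : ℤ) : H →ₗ[ZMod p] H := GradedAlgebra.proj μ.deg i

lemma prj_mem (i : ℤ) (h : H) : μ.prj i h ∈ μ.deg i := by
  rw [GradedAlgebra.proj_apply]; exact SetLike.coe_mem _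

lemma prj_same {i : ℤ} {h : H} (hh : h ∈ μ.deg i) : μ.prj i h = h := by
  rw [μ.proj_of_mem hh, if_pos rfl]

lemma prj_ne {i j : ℤ} (hij : i ≠ j) {h : H} (hh : h ∈ μ.deg i) : μ.prj j h = 0 := by
  rw [μ.proj_of_mem hh, if_neg hij]

lemma mul_mem {i j : ℤ} {a b : H} (ha : a ∈ μ.deg i) (hb : b ∈ μ.deg j) : a * b ∈ μ.deg (i + j) :=
  SetLike.GradedMul.mul_mem ha hb

lemma deg_induction {P : H → Prop} (zero : P 0) (add : ∀ a b, P a → P b → P (a + b))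
    (mem : ∀ i, ∀ h ∈ μ.deg i, P h) (h : H) : P h := by
  induction h using DirectSum.Decomposition.inductionOn μ.deg with
  | zero => exact zero
  | add a b ha hb => exact add a b ha hb
  | homogeneous a => exact mem _ a a.2

lemma ext_deg {N : Type} [AddCommMonoid N] [Module (ZMod p) N] {f g : H →ₗ[ZMod p] N}
    (hfg : ∀ i, ∀ h ∈ μ.deg i, f h = g h) : f = g := by
  ext h
  induction h using μ.deg_induction with
  | zero => simp
  | add a b ha hb => simp only [map_add, ha, hb]
  | mem i h hh => exact hfg i h hh

/-- The tensors of total degree `d`. -/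
def tdeg (d : ℤ) : Submodule (ZMod p) (H ⊗[ZMod p] H) :=
  Submodule.span (ZMod p) {z | ∃ a b : ℤ, a + b = d ∧ ∃ x ∈ μ.deg a, ∃ y ∈ μ.deg b, z = x ⊗ₜ y}

lemma comul_mem_tdeg {d : ℤ} {h : H} (hh : h ∈ μ.deg d) :
    Coalgebra.comul (R := ZMod p) h ∈ μ.tdeg d := by
  have h1 : (⨆ (a : ℤ) (b : ℤ) (_ : a + b = d),
      LinearMap.range (TensorProduct.map (μ.deg a).subtype (μ.deg b).subtype)) ≤ μ.tdeg d := by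
    refine iSup_le fun a => iSup_le fun b => iSup_le fun hab => ?_
    rintro _ ⟨z, rfl⟩
    induction z with
    | zero => simp
    | add y z hy hz => rw [map_add]; exact add_mem hy hz
    | tmul y z => exact Submodule.subset_span ⟨a, b, hab, y, y.2, z, z.2, rfl⟩
  exact h1 (μ.comul_mem d h hh)

lemma tdeg_ext {N : Type} [AddCommMonoid N] [Module (ZMod p) N]
    {F G : H ⊗[ZMod p] H →ₗ[ZMod p] N} {d : ℤ}
    (hFG : ∀ a b : ℤ, a + b = d → ∀ x ∈ μ.deg a, ∀ y ∈ μ.deg b, F (x ⊗ₜ y) = G (x ⊗ₜ y))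
    {z : H ⊗[ZMod p] H} (hz : z ∈ μ.tdeg d) : F z = G z := by
  induction hz using Submodule.span_induction with
  | mem z hz =>
    obtain ⟨a, b, hab, x, hx, y, hy, rfl⟩ := hz
    exact hFG a b hab x hx y hy
  | zero => simp
  | add x y _ _ hx hy => simp only [map_add, hx, hy]
  | smul r x _ hx => simp only [map_smul, hx]

lemma one_mem_deg : (1 : H) ∈ μ.deg 0 := SetLike.GradedOne.one_mem

/-- The antipode is homogeneous. -/
lemma antip_mem {d : ℤ} {h : H} (hh : h ∈ μ.deg d) : antip p H h ∈ μ.deg d := by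
  classical
  -- `S'` is the degree-preserving part of the antipode. As the comultiplication is homogeneous,
  -- `S'` is still a convolution inverse of the identity, so it is the whole antipode.
  let S' : H →ₗ[ZMod p] H :=
    DirectSum.toModule (ZMod p) ℤ H
      (fun i => μ.prj i ∘ₗ (antip p H).toLinearMap ∘ₗ (μ.deg i).subtype) ∘ₗ
      (DirectSum.decomposeLinearEquiv μ.deg).toLinearMap
  have hS' : ∀ i, ∀ h ∈ μ.deg i, S' h = μ.prj i (antip p H h) := by
    intro i h hh
    simp only [S', LinearMap.comp_apply, LinearEquiv.coe_coe, DirectSum.decomposeLinearEquiv_apply]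
    rw [DirectSum.decompose_of_mem _ hh]
    erw [DirectSum.toModule_lof]
    rfl
  have h1 : conv S' (AlgHom.id (ZMod p) H).toLinearMap = convOne p H H := by
    refine μ.ext_deg fun d h hh => ?_
    have h2 : conv S' (AlgHom.id (ZMod p) H).toLinearMap h =
        μ.prj d (conv (antip p H).toLinearMap (AlgHom.id (ZMod p) H).toLinearMap h) := by
      rw [act_apply, act_apply]
      refine μ.tdeg_ext (F := LinearMap.mul' (ZMod p) H ∘ₗ TensorProduct.map S' _)
        (G := μ.prj d ∘ₗ LinearMap.mul' (ZMod p) H ∘ₗ TensorProduct.map _ _) ?_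
        (μ.comul_mem_tdeg hh)
      rintro a b rfl x hx y hy
      simp only [LinearMap.comp_apply, TensorProduct.map_tmul, LinearMap.mul'_apply,
        AlgHom.toLinearMap_apply, AlgHom.id_apply, hS' a x hx]
      generalize antip p H x = s
      induction s using μ.deg_induction with
      | zero => simp
      | add s t hs ht => simp only [map_add, add_mul, hs, ht]
      | mem i s hs =>
        by_cases hi : i = a
        · subst hi; rw [μ.prj_same hs, μ.prj_same (μ.mul_mem hs hy)]
        · rw [μ.prj_ne hi hs, μ.prj_ne (by omega) (μ.mul_mem hs hy), zero_mul]
    have h3 := conv_antip_left (AlgHom.id (ZMod p) H)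
    rw [AlgHom.id_comp] at h3
    rw [h2, h3, convOne_apply]
    by_cases hd : d = 0
    · subst hd
      rw [Algebra.algebraMap_eq_smul_one, map_smul, μ.prj_same μ.one_mem_deg]
    · rw [μ.counit_eq_zero d hd h hh, map_zero, map_zero]
  have h2 : S' = (antip p H).toLinearMap := by
    have h3 := conv_antip_right (AlgHom.id (ZMod p) H)
    rw [AlgHom.id_comp] at h3
    rw [← conv_convOne S', ← h3, ← conv_conv, h1, convOne_conv]
  have h3 := hS' d h hh
  rw [h2, AlgHom.toLinearMap_apply] at h3
  rw [h3]
  exact μ.prj_mem d _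

lemma adjoint_mem_tdeg {d : ℤ} {h : H} (hh : h ∈ μ.deg d) : adjoint p H h ∈ μ.tdeg d := by
  let Θ : (H ⊗[ZMod p] H) ⊗[ZMod p] H →ₗ[ZMod p] H ⊗[ZMod p] H :=
    (LinearMap.mul' (ZMod p) H ∘ₗ
      (HopfAlgebra.antipode (ZMod p) (A := H)).rTensor H).lTensor H ∘ₗ
    (TensorProduct.assoc (ZMod p) H H H).toLinearMap ∘ₗ
    ((TensorProduct.comm (ZMod p) H H).toLinearMap).rTensor H
  have hΘ : ∀ x y z, Θ ((x ⊗ₜ y) ⊗ₜ z) = y ⊗ₜ (antip p H x * z) := fun x y z => rfl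
  have h1 : adjoint p H h = Θ (Coalgebra.comul.rTensor H (Coalgebra.comul (R := ZMod p) h)) := by
    simp only [adjoint, Θ, LinearMap.comp_apply, LinearMap.rTensor_comp]
  have h2 : ∀ a c : ℤ, a + c = d → ∀ z ∈ μ.deg c, ∀ w ∈ μ.tdeg a, Θ (w ⊗ₜ z) ∈ μ.tdeg d := by
    intro a c hac z hz w hw
    induction hw using Submodule.span_induction with
    | mem w hw =>
      obtain ⟨a', b', hab, x, hx, y, hy, rfl⟩ := hw
      rw [hΘ]
      exact Submodule.subset_span ⟨b', a' + c, by omega, y, hy, _,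
        μ.mul_mem (μ.antip_mem hx) hz, rfl⟩
    | zero => simp
    | add x y _ _ hx hy => rw [TensorProduct.add_tmul, map_add]; exact add_mem hx hy
    | smul r x _ hx =>
      rw [← TensorProduct.smul_tmul', map_smul]; exact Submodule.smul_mem _ _ hx
  rw [h1]
  have h3 := μ.comul_mem_tdeg hh
  generalize Coalgebra.comul (R := ZMod p) h = w at h3
  induction h3 using Submodule.span_induction with
  | mem w hw =>
    obtain ⟨a, b, hab, x, hx, y, hy, hw'⟩ := hw
    rw [hw', LinearMap.rTensor_tmul]
    exact h2 a b hab y hy _ (μ.comul_mem_tdeg hx)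
  | zero => simp
  | add x y _ _ hx hy => rw [map_add, map_add]; exact add_mem hx hy
  | smul r x _ hx =>
    rw [map_smul, map_smul]; exact Submodule.smul_mem _ _ hx

/-! ### Weights -/

lemma HasWeight.map_prj {i : ℤ} {ξ : H →ₗ[ZMod p] B} (hξ : μ.HasWeight i ξ) (h : H) :
    ξ (μ.prj i h) = ξ h := by
  induction h using μ.deg_induction with
  | zero => simp
  | add a b ha hb => simp only [map_add, ha, hb]
  | mem j h hh =>
    by_cases hj : j = i
    · subst hj; rw [μ.prj_same hh]
    · rw [μ.prj_ne hj hh, map_zero, hξ j hj h hh]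

lemma hasWeight_comp_prj (i : ℤ) (ξ : H →ₗ[ZMod p] B) : μ.HasWeight i (ξ ∘ₗ μ.prj i) := by
  intro j hj h hh
  rw [LinearMap.comp_apply, μ.prj_ne hj hh, map_zero]

/-- Weights add under convolution because the comultiplication is homogeneous. Combined with
1-boundedness this kills brackets and `p`-th powers of fields of weight one. -/
lemma HasWeight.conv {i j : ℤ} {ξ η : H →ₗ[ZMod p] B} (hξ : μ.HasWeight i ξ)
    (hη : μ.HasWeight j η) : μ.HasWeight (i + j) (conv ξ η) := by
  intro d hd h hh
  rw [act_apply]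
  refine μ.tdeg_ext (F := LinearMap.mul' (ZMod p) B ∘ₗ TensorProduct.map ξ η) (G := 0) ?_
    (μ.comul_mem_tdeg hh)
  rintro a b rfl x hx y hy
  simp only [LinearMap.comp_apply, TensorProduct.map_tmul, LinearMap.mul'_apply,
    LinearMap.zero_apply]
  by_cases ha : a = i
  · rw [hη b (by omega) y hy, mul_zero]
  · rw [hξ a ha x hx, zero_mul]

/-- The counit sees only degree `0`. Hence on homogeneous `a`, `b` every surviving term of the
Leibniz rule lies in the degree of `a * b`. -/
lemma isLie_comp_prj {ξ : H →ₗ[ZMod p] B} (hξ : IsLie ξ) (i : ℤ) : IsLie (ξ ∘ₗ μ.prj i) := by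
  intro a b
  simp only [LinearMap.comp_apply]
  induction a using μ.deg_induction with
  | zero => simp
  | add a a' ha ha' => simp only [add_mul, map_add, ha, ha', add_smul, smul_add]; abel
  | mem j a ha =>
    induction b using μ.deg_induction with
    | zero => simp
    | add b b' hb hb' => simp only [mul_add, map_add, hb, hb', add_smul, smul_add]; abel
    | mem k b hb =>
      by_cases hj : j = 0
      · subst hj
        by_cases hk : k = 0
        · subst hk
          have hab := μ.mul_mem ha hb
          rw [zero_add] at hab
          by_cases hi : 0 = i
          · subst hi; rw [μ.prj_same ha, μ.prj_same hb, μ.prj_same hab, hξ]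
          · simp [μ.prj_ne hi ha, μ.prj_ne hi hb, μ.prj_ne hi hab]
        · have hab := μ.mul_mem ha hb
          rw [zero_add] at hab
          rw [μ.counit_eq_zero k hk b hb, zero_smul, add_zero]
          by_cases hi : k = i
          · subst hi
            rw [μ.prj_same hb, μ.prj_same hab, hξ, μ.counit_eq_zero k hk b hb, zero_smul, add_zero]
          · simp [μ.prj_ne hi hb, μ.prj_ne hi hab]
      · have hab := μ.mul_mem ha hb
        rw [μ.counit_eq_zero j hj a ha, zero_smul, zero_add]
        by_cases hk : k = 0
        · subst hk
          rw [add_zero] at hab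
          by_cases hi : j = i
          · subst hi
            rw [μ.prj_same ha, μ.prj_same hab, hξ, μ.counit_eq_zero j hj a ha, zero_smul, zero_add]
          · simp [μ.prj_ne hi ha, μ.prj_ne hi hab]
        · rw [μ.counit_eq_zero k hk b hb, zero_smul]
          by_cases hi : j + k = i
          · rw [← hi, μ.prj_same hab, hξ, μ.counit_eq_zero j hj a ha, μ.counit_eq_zero k hk b hb,
              zero_smul, zero_smul, add_zero]
          · rw [μ.prj_ne hi hab, map_zero]

lemma _root_.FZip.IsLie.comp {ξ : H →ₗ[ZMod p] B} (hξ : IsLie ξ) (φ : B →ₗ[ZMod p] B') :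
    IsLie (φ ∘ₗ ξ) := by
  intro a b
  simp only [LinearMap.comp_apply, hξ a b, map_add, map_smul]

section

variable [Fact p.Prime]

/-- 1-boundedness is stated for coefficients in `𝔽_p`. Linear functionals on the vector space `B`
separate points and reduce to that case. -/
lemma OneBounded.eq_zero {μ : GmAction p H} (hμ : μ.OneBounded) {ξ : H →ₗ[ZMod p] B}
    (hξ : IsLie ξ) {i : ℤ} (hi : 1 < i) {h : H} (hh : h ∈ μ.deg i) : ξ h = 0 := by
  refine (Module.forall_dual_apply_eq_zero_iff (ZMod p) (ξ h)).1 fun φ => ?_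
  have h1 := hμ i hi ((φ ∘ₗ ξ) ∘ₗ μ.prj i)
    (μ.isLie_comp_prj (B := ZMod p) (fun a b => by
      simp only [LinearMap.comp_apply, hξ a b, map_add, map_smul]) i)
    (μ.hasWeight_comp_prj (B := ZMod p) i _)
  have h2 := LinearMap.congr_fun h1 h
  rwa [LinearMap.comp_apply, μ.prj_same hh] at h2

lemma OneBounded.eq_zero_of_hasWeight {μ : GmAction p H} (hμ : μ.OneBounded)
    {ξ : H →ₗ[ZMod p] B} (hξ : IsLie ξ) {i : ℤ} (hi : 1 < i) (hw : μ.HasWeight i ξ) : ξ = 0 := by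
  refine μ.ext_deg fun j h hh => ?_
  by_cases hj : j = i
  · subst hj; exact hμ.eq_zero hξ hi hh
  · exact hw j hj h hh

/-- A basis of the part of weight one of the Lie algebra. -/
lemma exists_weightOne_basis [Algebra.FiniteType (ZMod p) H] :
    ∃ (n : ℕ) (ξ : Fin n → H →ₗ[ZMod p] ZMod p) (x : Fin n → H),
      (∀ i, IsLie (ξ i)) ∧ (∀ i, μ.HasWeight 1 (ξ i)) ∧ (∀ i, x i ∈ μ.deg 1) ∧
      (∀ i j, ξ i (x j) = if i = j then 1 else 0) ∧
      ∀ (B : Type) [CommRing B] [Algebra (ZMod p) B] (η : H →ₗ[ZMod p] B), IsLie η →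
        μ.HasWeight 1 η → ∀ h, η h = ∑ i, ξ i h • η (x i) := by
  -- With `𝔪` the augmentation ideal, `N` is the sum of the products of two elements of `𝔪` and of
  -- all degrees other than `1`. So the dual of `H ⧸ N` is `𝔤₁`.
  let N : Submodule (ZMod p) H :=
    Submodule.span (ZMod p) ({h | ∃ a b, Coalgebra.counit (R := ZMod p) a = 0 ∧
      Coalgebra.counit (R := ZMod p) b = 0 ∧ h = a * b} ∪ {h | ∃ j, j ≠ 1 ∧ h ∈ μ.deg j})
  have hN : ∀ (B : Type) [CommRing B] [Algebra (ZMod p) B] (η : H →ₗ[ZMod p] B), IsLie η →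
      μ.HasWeight 1 η → N ≤ LinearMap.ker η := by
    intro B _ _ η h1 h2
    refine Submodule.span_le.2 ?_
    rintro h (⟨a, b, ha, hb, rfl⟩ | ⟨j, hj, hh⟩)
    · change η (a * b) = 0
      rw [h1, ha, hb, zero_smul, zero_smul, add_zero]
    · exact h2 j hj h hh
  have hmk1 : N.mkQ 1 = 0 := by
    rw [Submodule.mkQ_apply, Submodule.Quotient.mk_eq_zero]
    exact Submodule.subset_span (Or.inr ⟨0, by decide, μ.one_mem_deg⟩)
  have hmk : ∀ a b, N.mkQ (a * b) = Coalgebra.counit (R := ZMod p) a • N.mkQ b +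
      Coalgebra.counit (R := ZMod p) b • N.mkQ a := by
    intro a b
    let εa := Coalgebra.counit (R := ZMod p) a
    let εb := Coalgebra.counit (R := ZMod p) b
    have h1 : a * b = (a - algebraMap (ZMod p) H εa) * (b - algebraMap (ZMod p) H εb) +
        εa • b + εb • a - (εa * εb) • 1 := by
      simp only [Algebra.smul_def, map_mul]; ring
    have h2 : N.mkQ ((a - algebraMap (ZMod p) H εa) * (b - algebraMap (ZMod p) H εb)) = 0 := by
      rw [Submodule.mkQ_apply, Submodule.Quotient.mk_eq_zero]
      exact Submodule.subset_span (Or.inl ⟨_, _, by simp [εa], by simp [εb], rfl⟩)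
    rw [h1, map_sub, map_add, map_add, h2, map_smul, map_smul, map_smul, hmk1]
    simp [εa, εb]
  -- The class of a product is a combination of the classes of its factors, so algebra generators
  -- span `H ⧸ N`.
  have hfin : Module.Finite (ZMod p) (H ⧸ N) := by
    obtain ⟨s, hs⟩ := (Algebra.FiniteType.out : (⊤ : Subalgebra (ZMod p) H).FG)
    let W : Submodule (ZMod p) (H ⧸ N) := Submodule.span (ZMod p) (N.mkQ '' s)
    have hW : ∀ h, N.mkQ h ∈ W := by
      intro h
      have hh : h ∈ Algebra.adjoin (ZMod p) (s : Set H) := by rw [hs]; trivial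
      induction hh using Algebra.adjoin_induction with
      | mem x hx => exact Submodule.subset_span ⟨x, hx, rfl⟩
      | algebraMap r => rw [Algebra.algebraMap_eq_smul_one, map_smul, hmk1]; simp
      | add x y _ _ hx hy => rw [map_add]; exact add_mem hx hy
      | mul x y _ _ hx hy =>
        rw [hmk]
        exact add_mem (Submodule.smul_mem _ _ hy) (Submodule.smul_mem _ _ hx)
    refine ⟨⟨(s.finite_toSet.image N.mkQ).toFinset, ?_⟩⟩
    rw [Set.Finite.coe_toFinset, eq_top_iff]
    rintro y -
    obtain ⟨h, rfl⟩ := N.mkQ_surjective y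
    exact hW h
  let b := Module.finBasis (ZMod p) (H ⧸ N)
  choose y hy using fun i => N.mkQ_surjective (b i)
  have hξ1 : ∀ i, IsLie (b.coord i ∘ₗ N.mkQ : H →ₗ[ZMod p] ZMod p) := fun i a a' => by
    simp only [LinearMap.comp_apply, hmk, map_add, map_smul]
  have hξ2 : ∀ i, μ.HasWeight 1 (b.coord i ∘ₗ N.mkQ : H →ₗ[ZMod p] ZMod p) := by
    intro i j hj h hh
    have h1 : N.mkQ h = 0 := by
      rw [Submodule.mkQ_apply, Submodule.Quotient.mk_eq_zero]
      exact Submodule.subset_span (Or.inr ⟨j, hj, hh⟩)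
    rw [LinearMap.comp_apply, h1, map_zero]
  refine ⟨_, fun i => b.coord i ∘ₗ N.mkQ, fun i => μ.prj 1 (y i), hξ1, hξ2,
    fun i => μ.prj_mem 1 _, fun i j => ?_, fun B _ _ η h1 h2 h => ?_⟩
  · rw [(hξ2 i).map_prj, LinearMap.comp_apply, hy, Module.Basis.coord_apply,
      Module.Basis.repr_self, Finsupp.single_apply]
    simp [eq_comm]
  · have h3 : N.liftQ η (hN B η h1 h2) (N.mkQ h) = η h := Submodule.liftQ_apply _ _ _
    rw [← h3, ← b.sum_repr (N.mkQ h), map_sum]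
    refine Finset.sum_congr rfl fun i _ => ?_
    have h4 : N.liftQ η (hN B η h1 h2) (N.mkQ (y i)) = η (y i) := Submodule.liftQ_apply _ _ _
    rw [h2.map_prj, map_smul, ← hy i, h4]
    rfl

end

end GmAction

namespace GmAction

/-! ### The subgroups -/

variable {p : ℕ} {H : Type} [CommRing H] [HopfAlgebra (ZMod p) H] (μ : GmAction p H)
  {B B' : Type} [CommRing B] [Algebra (ZMod p) B] [CommRing B'] [Algebra (ZMod p) B']

lemma restrict_surjective (P : Part) : Function.Surjective (μ.restrict P) :=
  Ideal.Quotient.mk_surjective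

lemma comul_restrict (P : Part) (h : H) : Coalgebra.comul (R := ZMod p) (μ.restrict P h) =
    TensorProduct.map (μ.restrict P).toLinearMap (μ.restrict P).toLinearMap
      (Coalgebra.comul (R := ZMod p) h) := rfl

lemma counit_restrict (P : Part) (h : H) :
    Coalgebra.counit (R := ZMod p) (μ.restrict P h) = Coalgebra.counit (R := ZMod p) h := rfl

lemma conv_comp_restrict (P : Part) (f g : μ.coord P →ₗ[ZMod p] B) :
    conv f g ∘ₗ (μ.restrict P).toLinearMap =
      conv (f ∘ₗ (μ.restrict P).toLinearMap) (g ∘ₗ (μ.restrict P).toLinearMap) :=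
  act_comp _ _ _ (μ.comul_restrict P) f g

lemma convOne_comp_restrict (P : Part) :
    convOne p (μ.coord P) B ∘ₗ (μ.restrict P).toLinearMap = convOne p H B := rfl

lemma linearMap_ext_restrict {P : Part} {N : Type} [AddCommMonoid N] [Module (ZMod p) N]
    {f g : μ.coord P →ₗ[ZMod p] N}
    (h : f ∘ₗ (μ.restrict P).toLinearMap = g ∘ₗ (μ.restrict P).toLinearMap) : f = g := by
  refine LinearMap.ext fun x => ?_
  obtain ⟨y, rfl⟩ := μ.restrict_surjective P x
  exact LinearMap.congr_fun h y

/-- The antipode of the subgroup. -/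
def coordAntip (P : Part) : μ.coord P →ₐ[ZMod p] μ.coord P :=
  Ideal.Quotient.liftₐ (μ.ideal P) ((μ.restrict P).comp (antip p H)) (by
    intro x hx
    have : μ.ideal P ≤ RingHom.ker ((μ.restrict P).comp (antip p H)) := by
      refine Ideal.span_le.2 ?_
      rintro h ⟨i, hi, hh⟩
      exact μ.restrict_eq_zero P hi (μ.antip_mem hh)
    exact this hx)

lemma conv_coordAntip_left (P : Part) (g : μ.coord P →ₐ[ZMod p] B) :
    conv (g.comp (μ.coordAntip P)).toLinearMap g.toLinearMap = convOne p (μ.coord P) B := by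
  refine μ.linearMap_ext_restrict ?_
  rw [conv_comp_restrict, convOne_comp_restrict, ← conv_antip_left (g.comp (μ.restrict P))]
  rfl

lemma conv_coordAntip_right (P : Part) (g : μ.coord P →ₐ[ZMod p] B) :
    conv g.toLinearMap (g.comp (μ.coordAntip P)).toLinearMap = convOne p (μ.coord P) B := by
  refine μ.linearMap_ext_restrict ?_
  rw [conv_comp_restrict, convOne_comp_restrict, ← conv_antip_right (g.comp (μ.restrict P))]
  rfl

/-- The inclusion of `M`, on functions. -/
def incl (P : Part) : μ.coord P →ₐ[ZMod p] μ.coord .levi :=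
  Ideal.Quotient.liftₐ (μ.ideal P) (μ.restrict .levi) (by
    intro x hx
    have : μ.ideal P ≤ RingHom.ker (μ.restrict .levi) := by
      refine Ideal.span_le.2 ?_
      rintro h ⟨i, hi, hh⟩
      refine μ.restrict_eq_zero .levi ?_ hh
      rintro rfl
      exact P.zero_notMem hi
    exact this hx)

lemma incl_restrict (P : Part) (h : H) : μ.incl P (μ.restrict P h) = μ.restrict .levi h := rfl

lemma restrict_levi_prj_zero (h : H) : μ.restrict .levi (μ.prj 0 h) = μ.restrict .levi h := by
  induction h using μ.deg_induction with
  | zero => simp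
  | add a b ha hb => simp only [map_add, ha, hb]
  | mem i h hh =>
    by_cases hi : i = 0
    · subst hi; rw [μ.prj_same hh]
    · rw [μ.prj_ne hi hh, map_zero, μ.restrict_eq_zero .levi hi hh]

lemma limit_apply (P : Part) (h : H) : μ.limit P h = μ.restrict P (μ.prj 0 h) := rfl

lemma retract_restrict (P : Part) (h : H) : μ.retract P (μ.restrict .levi h) = μ.limit P h := rfl

lemma incl_retract (P : Part) (x : μ.coord .levi) : μ.incl P (μ.retract P x) = x := by
  obtain ⟨h, rfl⟩ := μ.restrict_surjective .levi x
  rw [retract_restrict, limit_apply, incl_restrict, restrict_levi_prj_zero]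

lemma retract_injective (P : Part) : Function.Injective (μ.retract P) :=
  Function.LeftInverse.injective (μ.incl_retract P)

/-- A basis of `𝔤₁` with the dual elements of `H`. -/
structure WeightOneBasis (n : ℕ) where
  vec : Fin n → H →ₗ[ZMod p] ZMod p
  elt : Fin n → H
  isLie : ∀ i, IsLie (vec i)
  hasWeight : ∀ i, μ.HasWeight 1 (vec i)
  elt_mem : ∀ i, elt i ∈ μ.deg 1
  vec_elt : ∀ i j, vec i (elt j) = if i = j then 1 else 0
  eq_sum : ∀ (B : Type) [CommRing B] [Algebra (ZMod p) B] (η : H →ₗ[ZMod p] B), IsLie η →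
    μ.HasWeight 1 η → ∀ h, η h = ∑ i, vec i h • η (elt i)

/-- `M` preserves the weights. -/
lemma HasWeight.conj {i : ℤ} {ξ : H →ₗ[ZMod p] B} (hw : μ.HasWeight i ξ) (g : H →ₐ[ZMod p] B)
    (hg : ∀ d ≠ 0, ∀ h ∈ μ.deg d, g h = 0) : μ.HasWeight i (conj g ξ) := by
  intro d hd h hh
  rw [← mul'_map_adjoint]
  refine μ.tdeg_ext (F := LinearMap.mul' (ZMod p) B ∘ₗ TensorProduct.map ξ g.toLinearMap) (G := 0)
    ?_ (μ.adjoint_mem_tdeg hh)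
  rintro a b rfl x hx y hy
  simp only [LinearMap.comp_apply, TensorProduct.map_tmul, LinearMap.mul'_apply,
    LinearMap.zero_apply, AlgHom.toLinearMap_apply]
  by_cases ha : a = i
  · rw [hg b (by omega) y hy, mul_zero]
  · rw [hw a ha x hx, zero_mul]

section

variable [Fact p.Prime]

/-- The unipotent radical of `P⁺` acts trivially on `𝔤₁`. -/
lemma map_restrict_pos_adjoint (hμ : μ.OneBounded) {ξ : H →ₗ[ZMod p] B} (hξ : IsLie ξ)
    (hw : μ.HasWeight 1 ξ) (h : H) :
    TensorProduct.map ξ (μ.restrict .pos).toLinearMap (adjoint p H h) =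
      TensorProduct.map ξ (μ.limit .pos).toLinearMap (adjoint p H h) := by
  have key : TensorProduct.map ξ (μ.restrict .pos).toLinearMap ∘ₗ adjoint p H =
      TensorProduct.map ξ (μ.limit .pos).toLinearMap ∘ₗ adjoint p H := by
    refine μ.ext_deg fun d h hh => ?_
    simp only [LinearMap.comp_apply]
    -- In degrees above `1` both sides vanish, the left one by 1-boundedness. In degree `d ≤ 1`,
    -- only `x ⊗ y` with `x` of degree `1` contributes; then `y` has degree `d - 1 ≤ 0`, and
    -- functions of negative degree vanish on `P⁺`.
    by_cases hd : 1 < d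
    · have h1 : TensorProduct.map ξ (μ.restrict .pos).toLinearMap (adjoint p H h) = 0 := by
        rw [map_adjoint]
        exact hμ.eq_zero (isLie_conj _ (hξ.comp _)) hd hh
      have h2 : TensorProduct.map ξ (μ.limit .pos).toLinearMap (adjoint p H h) = 0 := by
        refine μ.tdeg_ext (F := TensorProduct.map ξ (μ.limit .pos).toLinearMap) (G := 0) ?_
          (μ.adjoint_mem_tdeg hh)
        rintro a b rfl x hx y hy
        simp only [TensorProduct.map_tmul, LinearMap.zero_apply, AlgHom.toLinearMap_apply,
          limit_apply]
        by_cases ha : a = 1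
        · rw [μ.prj_ne (by omega) hy, map_zero, TensorProduct.tmul_zero]
        · rw [hw a ha x hx, TensorProduct.zero_tmul]
      rw [h1, h2]
    · refine μ.tdeg_ext (F := TensorProduct.map ξ (μ.restrict .pos).toLinearMap)
        (G := TensorProduct.map ξ (μ.limit .pos).toLinearMap) ?_ (μ.adjoint_mem_tdeg hh)
      rintro a b hab x hx y hy
      simp only [TensorProduct.map_tmul, AlgHom.toLinearMap_apply, limit_apply]
      by_cases ha : a = 1
      · by_cases hb : b = 0
        · subst hb; rw [μ.prj_same hy]
        · rw [μ.prj_ne hb hy, map_zero, μ.restrict_eq_zero .pos (show b < 0 by omega) hy]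
      · rw [hw a ha x hx, TensorProduct.zero_tmul, TensorProduct.zero_tmul]
  exact LinearMap.congr_fun key h

/-- The action of `P⁻` on `𝔤 / Lie(P⁻)` factors through `M`. -/
lemma map_restrict_neg_adjoint (hμ : μ.OneBounded) {ζ : H →ₗ[ZMod p] B} (hζ : IsLie ζ) (h : H) :
    TensorProduct.map ζ (μ.restrict .neg).toLinearMap (adjoint p H (μ.prj 1 h)) =
      TensorProduct.map (ζ ∘ₗ μ.prj 1) (μ.limit .neg).toLinearMap (adjoint p H h) := by
  have key : TensorProduct.map ζ (μ.restrict .neg).toLinearMap ∘ₗ adjoint p H ∘ₗ μ.prj 1 =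
      TensorProduct.map (ζ ∘ₗ μ.prj 1) (μ.limit .neg).toLinearMap ∘ₗ adjoint p H := by
    refine μ.ext_deg fun d h hh => ?_
    simp only [LinearMap.comp_apply]
    -- In degree `1` the tensors have degrees `a + b = 1`. For `a > 1` the first factor dies by
    -- 1-boundedness; for `a < 1` one has `b > 0` and the second factor vanishes on `P⁻`. Only `a =
    -- 1`, `b = 0` remains.
    by_cases hd : d = 1
    · subst hd
      rw [μ.prj_same hh]
      refine μ.tdeg_ext (F := TensorProduct.map ζ (μ.restrict .neg).toLinearMap)
        (G := TensorProduct.map (ζ ∘ₗ μ.prj 1) (μ.limit .neg).toLinearMap) ?_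
        (μ.adjoint_mem_tdeg hh)
      rintro a b hab x hx y hy
      simp only [TensorProduct.map_tmul, AlgHom.toLinearMap_apply, limit_apply,
        LinearMap.comp_apply]
      by_cases ha : a = 1
      · have hb : b = 0 := by omega
        subst ha hb
        rw [μ.prj_same hx, μ.prj_same hy]
      · rw [μ.prj_ne ha hx, map_zero, TensorProduct.zero_tmul]
        by_cases ha1 : 1 < a
        · rw [hμ.eq_zero hζ ha1 hx, TensorProduct.zero_tmul]
        · rw [μ.restrict_eq_zero .neg (show 0 < b by omega) hy, TensorProduct.tmul_zero]
    · rw [μ.prj_ne hd hh, map_zero, map_zero]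
      symm
      refine μ.tdeg_ext (F := TensorProduct.map (ζ ∘ₗ μ.prj 1) (μ.limit .neg).toLinearMap)
        (G := 0) ?_ (μ.adjoint_mem_tdeg hh)
      rintro a b hab x hx y hy
      simp only [TensorProduct.map_tmul, AlgHom.toLinearMap_apply, limit_apply,
        LinearMap.comp_apply, LinearMap.zero_apply]
      by_cases ha : a = 1
      · rw [μ.prj_ne (show b ≠ 0 by omega) hy, map_zero, TensorProduct.tmul_zero]
      · rw [μ.prj_ne ha hx, map_zero, TensorProduct.zero_tmul]
  exact LinearMap.congr_fun key h

lemma exists_weightOneBasis [Algebra.FiniteType (ZMod p) H] :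
    ∃ n, Nonempty (μ.WeightOneBasis n) := by
  obtain ⟨n, ξ, x, h1, h2, h3, h4, h5⟩ := μ.exists_weightOne_basis
  exact ⟨n, ⟨⟨ξ, x, h1, h2, h3, h4, h5⟩⟩⟩

end

/-! ### The matrix of the representation of `M` on `𝔤₁`. -/

namespace WeightOneBasis

variable {μ} {n : ℕ} (b : μ.WeightOneBasis n)

/-- The element `vec i` of `𝔤₁ ⊗ B`. -/
def vecIn (B : Type) [CommRing B] [Algebra (ZMod p) B] (i : Fin n) : H →ₗ[ZMod p] B :=
  Algebra.linearMap (ZMod p) B ∘ₗ b.vec i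

lemma vecIn_apply (i : Fin n) (h : H) : b.vecIn B i h = algebraMap (ZMod p) B (b.vec i h) := rfl

lemma isLie_vecIn (i : Fin n) : IsLie (b.vecIn B i) := fun x y => by
  simp only [vecIn, LinearMap.comp_apply, b.isLie i x y, map_add, map_smul]

lemma hasWeight_vecIn (i : Fin n) : μ.HasWeight 1 (b.vecIn B i) := fun j hj h hh => by
  rw [vecIn_apply, b.hasWeight i j hj h hh, map_zero]

lemma comp_vecIn (φ : B →ₐ[ZMod p] B') (i : Fin n) :
    φ.toLinearMap ∘ₗ b.vecIn B i = b.vecIn B' i := by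
  ext h; simp [vecIn_apply]

lemma eq_sum_vecIn {η : H →ₗ[ZMod p] B} (h1 : IsLie η) (h2 : μ.HasWeight 1 η) :
    η = ∑ i, η (b.elt i) • b.vecIn B i := by
  ext h
  rw [b.eq_sum B η h1 h2 h, LinearMap.sum_apply]
  refine Finset.sum_congr rfl fun i _ => ?_
  rw [LinearMap.smul_apply, vecIn_apply, Algebra.smul_def, smul_eq_mul, mul_comm]

/-- The matrix of the action of the point `g`. -/
def mat (g : H →ₐ[ZMod p] B) (i j : Fin n) : B := conj g (b.vecIn B i) (b.elt j)

lemma conj_vecIn (g : H →ₐ[ZMod p] B) (hg : ∀ d ≠ 0, ∀ h ∈ μ.deg d, g h = 0) (i : Fin n) :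
    conj g (b.vecIn B i) = ∑ j, b.mat g i j • b.vecIn B j :=
  b.eq_sum_vecIn (isLie_conj g (b.isLie_vecIn i)) ((b.hasWeight_vecIn i).conj μ g hg)

lemma comp_mat (φ : B →ₐ[ZMod p] B') (g : H →ₐ[ZMod p] B) (i j : Fin n) :
    φ (b.mat g i j) = b.mat (φ.comp g) i j := by
  have := LinearMap.congr_fun (comp_conj φ g (b.vecIn B i)) (b.elt j)
  rw [comp_vecIn] at this
  exact this

/-- Conjugation by `g⁻¹ ξ g` is a right action, so with basis vectors as rows the matrix is
multiplicative in the same order. -/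
lemma mat_convAlg (g g' : H →ₐ[ZMod p] B) (hg : ∀ d ≠ 0, ∀ h ∈ μ.deg d, g h = 0) (i j : Fin n) :
    b.mat (convAlg g g') i j = ∑ k, b.mat g i k * b.mat g' k j := by
  rw [mat, ← conj_conj, b.conj_vecIn g hg, conj_sum, LinearMap.sum_apply]
  refine Finset.sum_congr rfl fun k _ => ?_
  rw [conj_smul]
  rfl

lemma mat_of_convOne (g : H →ₐ[ZMod p] B) (hg : g.toLinearMap = convOne p H B) (i j : Fin n) :
    b.mat g i j = if i = j then 1 else 0 := by
  rw [mat, conj_convOne g hg, vecIn_apply, b.vec_elt]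
  split_ifs <;> simp

/-- The matrix of the representation of `M` on `𝔤₁`. -/
def rep (i j : Fin n) : μ.coord .levi := b.mat (μ.restrict .levi) i j

/-- The inverse of the matrix of the representation of `M` on `𝔤₁`. -/
def repInv (i j : Fin n) : μ.coord .levi := b.mat ((μ.restrict .levi).comp (antip p H)) i j

lemma comulAlg_restrict (P : Part) :
    (Bialgebra.comulAlgHom (ZMod p) (μ.coord P)).comp (μ.restrict P) =
      convAlg ((Algebra.TensorProduct.includeLeft).comp (μ.restrict P))
        ((Algebra.TensorProduct.includeRight).comp (μ.restrict P)) := by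
  apply AlgHom.toLinearMap_injective
  rw [convAlg_toLinearMap]
  exact (act_map Coalgebra.comul (μ.restrict P).toLinearMap (μ.restrict P).toLinearMap).symm

lemma comul_rep (i j : Fin n) :
    Coalgebra.comul (R := ZMod p) (b.rep i j) = ∑ k, b.rep i k ⊗ₜ b.rep k j := by
  have h1 := b.comp_mat (Bialgebra.comulAlgHom (ZMod p) (μ.coord .levi)) (μ.restrict .levi) i j
  rw [comulAlg_restrict, b.mat_convAlg _ _ (fun d hd h hh => by
    rw [AlgHom.comp_apply, μ.restrict_eq_zero .levi hd hh, map_zero])] at h1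
  refine h1.trans (Finset.sum_congr rfl fun k _ => ?_)
  rw [← comp_mat, ← comp_mat]
  simp [rep]

/-- Inversion reverses products, which swaps the indices compared with `comul_rep`. -/
lemma comul_repInv (i j : Fin n) :
    Coalgebra.comul (R := ZMod p) (b.repInv i j) = ∑ k, b.repInv k j ⊗ₜ b.repInv i k := by
  have h1 := b.comp_mat (Bialgebra.comulAlgHom (ZMod p) (μ.coord .levi))
    ((μ.restrict .levi).comp (antip p H)) i j
  rw [← AlgHom.comp_assoc, comulAlg_restrict, convAlg_antip, b.mat_convAlg _ _ (fun d hd h hh => by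
    rw [AlgHom.comp_apply, AlgHom.comp_apply, μ.restrict_eq_zero .levi hd (μ.antip_mem hh),
      map_zero])] at h1
  refine h1.trans (Finset.sum_congr rfl fun k _ => ?_)
  rw [AlgHom.comp_assoc, AlgHom.comp_assoc,
    ← b.comp_mat _ ((μ.restrict .levi).comp (antip p H)),
    ← b.comp_mat _ ((μ.restrict .levi).comp (antip p H))]
  simp [repInv]

lemma repInv_mul_rep (i j : Fin n) :
    ∑ k, b.repInv i k * b.rep k j = if i = j then 1 else 0 := by
  simp only [repInv, rep]
  rw [← b.mat_convAlg _ _ (fun d hd h hh => by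
    rw [AlgHom.comp_apply, μ.restrict_eq_zero .levi hd (μ.antip_mem hh)])]
  refine b.mat_of_convOne _ ?_ i j
  rw [convAlg_toLinearMap, conv_antip_left]

lemma rep_mul_repInv (i j : Fin n) :
    ∑ k, b.rep i k * b.repInv k j = if i = j then 1 else 0 := by
  have h1 : Matrix.of b.repInv * Matrix.of b.rep = 1 := by
    ext i j
    rw [Matrix.mul_apply, Matrix.one_apply]
    exact b.repInv_mul_rep i j
  have h2 : Matrix.of b.rep * Matrix.of b.repInv = 1 := mul_eq_one_comm.1 h1
  have h3 := congrFun (congrFun h2 i) j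
  rwa [Matrix.mul_apply, Matrix.one_apply] at h3

end WeightOneBasis

end GmAction

/-! ### Invariant vector fields on torsors -/

section

variable {p : ℕ} {H K : Type} [CommRing H] [HopfAlgebra (ZMod p) H] [CommRing K]
  [Bialgebra (ZMod p) K]

/-- A homomorphism of Hopf algebras that defines a closed subgroup. -/
structure IsSubgroup (c : H →ₐ[ZMod p] K) : Prop where
  surjective : Function.Surjective c
  comul : ∀ h, Coalgebra.comul (R := ZMod p) (c h) =
    TensorProduct.map c.toLinearMap c.toLinearMap (Coalgebra.comul (R := ZMod p) h)
  counit : ∀ h, Coalgebra.counit (R := ZMod p) (c h) = Coalgebra.counit (R := ZMod p) h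

lemma isSubgroup_restrict (μ : GmAction p H) (P : Part) : IsSubgroup (μ.restrict P) :=
  ⟨μ.restrict_surjective P, μ.comul_restrict P, μ.counit_restrict P⟩

lemma isSubgroup_id : IsSubgroup (AlgHom.id (ZMod p) H) where
  surjective h := ⟨h, rfl⟩
  comul h := by
    have : TensorProduct.map (AlgHom.id (ZMod p) H).toLinearMap (AlgHom.id (ZMod p) H).toLinearMap =
      LinearMap.id := TensorProduct.map_id
    rw [this]; rfl
  counit h := rfl

variable {c : H →ₐ[ZMod p] K} (hc : IsSubgroup c) {B : Type} [CommRing B] [Algebra (ZMod p) B]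

lemma IsSubgroup.conv_comp {hc : IsSubgroup c} (f g : K →ₗ[ZMod p] B) :
    conv f g ∘ₗ c.toLinearMap = conv (f ∘ₗ c.toLinearMap) (g ∘ₗ c.toLinearMap) :=
  act_comp _ _ _ hc.comul f g

lemma IsSubgroup.ext {hc : IsSubgroup c} {N : Type} [AddCommMonoid N] [Module (ZMod p) N]
    {f g : K →ₗ[ZMod p] N} (h : f ∘ₗ c.toLinearMap = g ∘ₗ c.toLinearMap) : f = g := by
  refine LinearMap.ext fun x => ?_
  obtain ⟨y, rfl⟩ := hc.surjective x
  exact LinearMap.congr_fun h y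

lemma IsSubgroup.isLie_iff {hc : IsSubgroup c} {ζ : K →ₗ[ZMod p] B} :
    IsLie (ζ ∘ₗ c.toLinearMap) ↔ IsPointDer ζ := by
  constructor
  · intro h a b
    obtain ⟨a, rfl⟩ := hc.surjective a
    obtain ⟨b, rfl⟩ := hc.surjective b
    have := h a b
    rw [← map_mul, hc.counit, hc.counit]
    exact this
  · intro h a b
    have := h (c a) (c b)
    rw [← map_mul, hc.counit, hc.counit] at this
    exact this

/-- A functional on `H` that vanishes on the ideal of the subgroup. -/
lemma IsSubgroup.exists_comp_eq {hc : IsSubgroup c} {N : Type} [AddCommGroup N] [Module (ZMod p) N]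
    (ξ : H →ₗ[ZMod p] N) (h : ∀ x, c x = 0 → ξ x = 0) :
    ∃ ζ : K →ₗ[ZMod p] N, ζ ∘ₗ c.toLinearMap = ξ := by
  let e := c.toLinearMap.quotKerEquivOfSurjective hc.surjective
  refine ⟨(LinearMap.ker c.toLinearMap).liftQ ξ (fun x hx => h x hx) ∘ₗ e.symm.toLinearMap, ?_⟩
  ext x
  have h1 : e.symm (c x) = Submodule.Quotient.mk x := by
    rw [LinearEquiv.symm_apply_eq]; rfl
  rw [LinearMap.comp_apply, LinearMap.comp_apply, AlgHom.toLinearMap_apply, LinearEquiv.coe_coe, h1]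
  exact Submodule.liftQ_apply _ _ _

end

namespace Torsor

variable {p : ℕ} [Fact p.Prime] {H K : Type} [CommRing H] [HopfAlgebra (ZMod p) H] [CommRing K]
  [Bialgebra (ZMod p) K] {X : Scheme.{0}} (E : Torsor p K X) (U : EtAff p X)

/-- Invariant linear operators on functions. -/
def IsInv (f : E.fn U →ₗ[ZMod p] E.fn U) : Prop :=
  ∀ b, E.coact U (f b) = f.rTensor K (E.coact U b)

/-- The operator `b ↦ ∑ b₍₀₎ ζ(b₍₁₎)`. -/
def vert (ζ : K →ₗ[ZMod p] E.fn U) : E.fn U →ₗ[ZMod p] E.fn U := act (E.co U) LinearMap.id ζ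

variable {E U}

lemma act_comp_isInv {f : E.fn U →ₗ[ZMod p] E.fn U} (hf : E.IsInv U f) {B : Type} [CommRing B]
    [Algebra (ZMod p) B] (g : E.fn U →ₗ[ZMod p] B) (ζ : K →ₗ[ZMod p] B) :
    act (E.co U) g ζ ∘ₗ f = act (E.co U) (g ∘ₗ f) ζ :=
  act_comp (ρ' := E.co U) (E.co U) f LinearMap.id hf g ζ

/-- In the Leibniz rule for `Y`, the term in which `Y` hits the function cancels by invariance. What
remains is the derivative of the coefficients. -/
lemma commutator_vert {Y : Derivation (ZMod p) (E.fn U) (E.fn U)}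
    (hY : E.IsInv U (Y : E.fn U →ₗ[ZMod p] E.fn U)) (ζ : K →ₗ[ZMod p] E.fn U) :
    (Y : E.fn U →ₗ[ZMod p] E.fn U) ∘ₗ E.vert U ζ - E.vert U ζ ∘ₗ (Y : E.fn U →ₗ[ZMod p] E.fn U) =
      E.vert U ((Y : E.fn U →ₗ[ZMod p] E.fn U) ∘ₗ ζ) := by
  rw [vert, derivation_comp_act, act_comp_isInv hY]
  exact add_sub_cancel_left _ _

/-- Invariance lets the inner operator pass through the coaction, so that composition becomes
convolution of functionals. -/
lemma vert_comp_vert {ζ : K →ₗ[ZMod p] E.fn U} (hζ : E.IsInv U (E.vert U ζ))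
    (η : K →ₗ[ZMod p] E.fn U) : E.vert U η ∘ₗ E.vert U ζ = E.vert U (conv ζ η) := by
  rw [vert, act_comp_isInv hζ, LinearMap.id_comp, vert, vert, act_conv]

lemma vert_cancel {ζ η : K →ₗ[ZMod p] E.fn U} (h : E.vert U ζ = E.vert U η) : ζ = η :=
  E.act_cancel U (AlgHom.id (ZMod p) (E.fn U)) h

/-- For the universal points `e` and `g`, invariance means `e g ζ(e g) = e ζ(e) g`, and `e` may be
cancelled. -/
lemma isInv_vert_iff (ζ : K →ₗ[ZMod p] E.fn U) : E.IsInv U (E.vert U ζ) ↔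
    conv (Algebra.TensorProduct.includeRight : K →ₐ[ZMod p] E.fn U ⊗[ZMod p] K).toLinearMap
        (E.co U ∘ₗ ζ) =
      conv ((Algebra.TensorProduct.includeLeft : E.fn U →ₐ[ZMod p] E.fn U ⊗[ZMod p] K).toLinearMap
        ∘ₗ ζ) Algebra.TensorProduct.includeRight.toLinearMap := by
  have h1 : E.co U ∘ₗ E.vert U ζ = act (E.co U)
      (Algebra.TensorProduct.includeLeft : E.fn U →ₐ[ZMod p] E.fn U ⊗[ZMod p] K).toLinearMap
      (conv (Algebra.TensorProduct.includeRight : K →ₐ[ZMod p] E.fn U ⊗[ZMod p] K).toLinearMap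
        (E.co U ∘ₗ ζ)) := by
    rw [← act_conv, act_includeLeft_includeRight, vert, comp_act]
    rfl
  have h2 : (E.vert U ζ).rTensor K ∘ₗ E.co U = act (E.co U)
      (Algebra.TensorProduct.includeLeft : E.fn U →ₐ[ZMod p] E.fn U ⊗[ZMod p] K).toLinearMap
      (conv ((Algebra.TensorProduct.includeLeft :
        E.fn U →ₐ[ZMod p] E.fn U ⊗[ZMod p] K).toLinearMap ∘ₗ ζ)
        Algebra.TensorProduct.includeRight.toLinearMap) := by
    rw [← act_conv]
    have h3 := comp_act (E.co U)
      (Algebra.TensorProduct.includeLeft : E.fn U →ₐ[ZMod p] E.fn U ⊗[ZMod p] K) LinearMap.id ζ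
    rw [LinearMap.comp_id] at h3
    rw [← h3]
    exact (act_map (E.co U) (E.vert U ζ) LinearMap.id).symm
  constructor
  · intro h
    apply E.act_cancel U
    rw [← h1, ← h2]
    exact LinearMap.ext h
  · intro h b
    have : E.co U ∘ₗ E.vert U ζ = (E.vert U ζ).rTensor K ∘ₗ E.co U := by rw [h1, h2, h]
    exact LinearMap.congr_fun this b

/-- Invariance of the vector field given by a section of the adjoint bundle. -/
lemma isInv_vert_iff_coact {c : H →ₐ[ZMod p] K} (hc : IsSubgroup c) (ζ : K →ₗ[ZMod p] E.fn U) :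
    E.IsInv U (E.vert U ζ) ↔ ∀ h, E.coact U (ζ (c h)) =
      TensorProduct.map (ζ ∘ₗ c.toLinearMap) c.toLinearMap (adjoint p H h) := by
  rw [isInv_vert_iff]
  constructor
  · intro h x
    have h1 := congrArg (fun f => f ∘ₗ c.toLinearMap) h
    simp only [IsSubgroup.conv_comp (hc := hc)] at h1
    have h2 := eq_conj_of_conv_eq
      ((Algebra.TensorProduct.includeRight : K →ₐ[ZMod p] E.fn U ⊗[ZMod p] K).comp c) h1
    rw [map_adjoint]
    exact LinearMap.congr_fun h2 x
  · intro h
    apply IsSubgroup.ext (hc := hc)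
    rw [IsSubgroup.conv_comp (hc := hc), IsSubgroup.conv_comp (hc := hc)]
    have h1 : (E.co U ∘ₗ ζ) ∘ₗ c.toLinearMap =
        conj ((Algebra.TensorProduct.includeRight : K →ₐ[ZMod p] E.fn U ⊗[ZMod p] K).comp c)
        ((Algebra.TensorProduct.includeLeft : E.fn U →ₐ[ZMod p] E.fn U ⊗[ZMod p] K).toLinearMap ∘ₗ
          (ζ ∘ₗ c.toLinearMap)) := by
      ext x
      rw [← map_adjoint]
      exact h x
    rw [h1]
    exact conv_conj ((Algebra.TensorProduct.includeRight : K →ₐ[ZMod p] E.fn U ⊗[ZMod p] K).comp c) _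

/-- The vertical vector field given by a tangent vector at the unit. -/
def vertDer (ζ : K →ₗ[ZMod p] E.fn U) (hζ : IsPointDer ζ) :
    Derivation (ZMod p) (E.fn U) (E.fn U) :=
  Derivation.mk' (E.vert U ζ) fun a b => by
    have h1 := E.act_mul_of_isPointDer U (AlgHom.id (ZMod p) (E.fn U)) hζ a b
    exact h1

lemma vertDer_apply (ζ : K →ₗ[ZMod p] E.fn U) (hζ : IsPointDer ζ) (b : E.fn U) :
    vertDer ζ hζ b = E.vert U ζ b := rfl

lemma vert_algebraMap (ζ : K →ₗ[ZMod p] E.fn U) (hζ : IsPointDer ζ) (r : U.R) :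
    E.vert U ζ (algebraMap U.R (E.fn U) r) = 0 := by
  have h0 : ζ 1 = 0 := by
    have := hζ 1 1
    rw [mul_one, Bialgebra.counit_one, one_smul] at this
    simpa using this
  have h1 : E.coact U (algebraMap U.R (E.fn U) r) = algebraMap U.R (E.fn U) r ⊗ₜ 1 := by
    rw [AlgHom.commutes]; rfl
  change LinearMap.mul' (ZMod p) _ (TensorProduct.map _ _ (E.coact U _)) = 0
  rw [h1]
  simp [h0]

lemma isPointDer_of_vert {ζ : K →ₗ[ZMod p] E.fn U} {Z : Derivation (ZMod p) (E.fn U) (E.fn U)}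
    (h : (Z : E.fn U →ₗ[ZMod p] E.fn U) = E.vert U ζ) : IsPointDer ζ := by
  apply E.isPointDer_of_act U (AlgHom.id (ZMod p) (E.fn U))
  intro t t'
  have h1 : ∀ t, act (E.co U) (AlgHom.id (ZMod p) (E.fn U)).toLinearMap ζ t = Z t :=
    fun t => (LinearMap.congr_fun h t).symm
  rw [h1, h1, h1, Derivation.leibniz]
  rfl

/-- A linear operator over the base is given by a functional. -/
lemma exists_vert_eq (δ : E.fn U →ₗ[U.R] E.fn U) :
    ∃ ζ : K →ₗ[ZMod p] E.fn U, E.vert U ζ = δ.restrictScalars (ZMod p) :=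
  E.exists_act_eq U (AlgHom.id U.R (E.fn U)) δ

/-- An invariant vertical vector field is given by a section of the adjoint bundle. -/
lemma exists_vert_eq_derivation {c : H →ₐ[ZMod p] K} (hc : IsSubgroup c)
    (Z : Derivation (ZMod p) (E.fn U) (E.fn U))
    (hZ : E.IsInv U (Z : E.fn U →ₗ[ZMod p] E.fn U))
    (hR : ∀ r : U.R, Z (algebraMap U.R (E.fn U) r) = 0) :
    ∃ ζ : K →ₗ[ZMod p] E.fn U, (Z : E.fn U →ₗ[ZMod p] E.fn U) = E.vert U ζ ∧
      ζ ∘ₗ c.toLinearMap ∈ adjointBundle c E U := by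
  let δ : E.fn U →ₗ[U.R] E.fn U :=
    { toFun := Z
      map_add' := map_add Z
      map_smul' := fun r b => by
        rw [Algebra.smul_def, Derivation.leibniz, hR, smul_zero, add_zero, smul_eq_mul,
          ← Algebra.smul_def, RingHom.id_apply] }
  obtain ⟨ζ, hζ⟩ := exists_vert_eq δ
  have h1 : (Z : E.fn U →ₗ[ZMod p] E.fn U) = E.vert U ζ := hζ.symm
  refine ⟨ζ, h1, (IsSubgroup.isLie_iff (hc := hc)).2 (isPointDer_of_vert h1),
    (isInv_vert_iff_coact hc ζ).1 (h1 ▸ hZ)⟩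

/-! ### Commutators and `p`-th powers of vector fields of weight one. -/

section Weight

variable {μ : GmAction p H} {P : Part} {E : Torsor p (μ.coord P) X}

/-- Vector fields of weight one commute. -/
lemma vert_commute (hμ : μ.OneBounded) {ζ η : μ.coord P →ₗ[ZMod p] E.fn U} (h1 : IsPointDer ζ)
    (h2 : IsPointDer η) (h3 : E.IsInv U (E.vert U ζ)) (h4 : E.IsInv U (E.vert U η))
    (h5 : μ.HasWeight 1 (ζ ∘ₗ (μ.restrict P).toLinearMap))
    (h6 : μ.HasWeight 1 (η ∘ₗ (μ.restrict P).toLinearMap)) :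
    E.vert U ζ ∘ₗ E.vert U η = E.vert U η ∘ₗ E.vert U ζ := by
  have hc := isSubgroup_restrict μ P
  have h7 : ((⁅vertDer ζ h1, vertDer η h2⁆ : Derivation (ZMod p) (E.fn U) (E.fn U)) :
      E.fn U →ₗ[ZMod p] E.fn U) =
      E.vert U (conv η ζ - conv ζ η) := by
    have : E.vert U (conv η ζ - conv ζ η) = E.vert U (conv η ζ) - E.vert U (conv ζ η) :=
      act_sub_right _ _ _ _
    rw [this, ← vert_comp_vert h3, ← vert_comp_vert h4]
    ext b
    exact Derivation.commutator_apply (D1 := vertDer ζ h1) (D2 := vertDer η h2) b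
  -- The bracket is again a derivation and has weight `2`.
  have h8 : (conv η ζ - conv ζ η) ∘ₗ (μ.restrict P).toLinearMap = 0 := by
    refine hμ.eq_zero_of_hasWeight ((IsSubgroup.isLie_iff (hc := hc)).2 (isPointDer_of_vert h7))
      (show (1 : ℤ) < 1 + 1 by decide) fun j hj h hh => ?_
    rw [LinearMap.sub_comp, IsSubgroup.conv_comp (hc := hc), IsSubgroup.conv_comp (hc := hc),
      LinearMap.sub_apply, (h6.conv μ h5) j hj h hh, (h5.conv μ h6) j hj h hh, sub_zero]
  have h9 : conv η ζ - conv ζ η = 0 :=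
    IsSubgroup.ext (hc := hc) (h8.trans (LinearMap.zero_comp _).symm)
  rw [vert_comp_vert h3, vert_comp_vert h4, sub_eq_zero.1 h9]

/-- The `p`-th power of a vector field of weight one vanishes. -/
lemma vert_pow (hμ : μ.OneBounded) {ζ : μ.coord P →ₗ[ZMod p] E.fn U} (h1 : IsPointDer ζ)
    (h3 : E.IsInv U (E.vert U ζ)) (h5 : μ.HasWeight 1 (ζ ∘ₗ (μ.restrict P).toLinearMap)) :
    (E.vert U ζ : Module.End (ZMod p) (E.fn U)) ^ p = 0 := by
  have hc := isSubgroup_restrict μ P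
  have hp := (Fact.out : p.Prime)
  -- The iterates are given by convolution powers, whose weights grow by one. The `p`-th power is
  -- again a derivation, so 1-boundedness applies to its weight `p ≥ 2`.
  have h6 : ∀ n : ℕ, ∃ η : μ.coord P →ₗ[ZMod p] E.fn U,
      (E.vert U ζ : Module.End (ZMod p) (E.fn U)) ^ (n + 1) = E.vert U η ∧
      μ.HasWeight (n + 1) (η ∘ₗ (μ.restrict P).toLinearMap) := by
    intro n
    induction n with
    | zero => exact ⟨ζ, pow_one _, by simpa using h5⟩
    | succ n ih =>
      obtain ⟨η, h7, h8⟩ := ih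
      refine ⟨conv ζ η, ?_, ?_⟩
      · rw [pow_succ, h7]
        exact vert_comp_vert h3 η
      · rw [IsSubgroup.conv_comp (hc := hc)]
        have := h5.conv μ h8
        push_cast
        rwa [add_comm] at this
  obtain ⟨η, h7, h8⟩ := h6 (p - 1)
  rw [Nat.sub_add_cancel hp.one_le] at h7
  have h9 : (derivPow (vertDer ζ h1) : E.fn U →ₗ[ZMod p] E.fn U) = E.vert U η := by
    rw [← h7]
    rfl
  have h10 : η ∘ₗ (μ.restrict P).toLinearMap = 0 := by
    refine hμ.eq_zero_of_hasWeight ((IsSubgroup.isLie_iff (hc := hc)).2 (isPointDer_of_vert h9))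
      ?_ h8
    have := hp.two_le
    omega
  have h11 : η = 0 := IsSubgroup.ext (hc := hc) (h10.trans (LinearMap.zero_comp _).symm)
  rw [h7, h11]
  exact act_zero_right _ _

end Weight

end Torsor

/-! ### The bundles of an `F`-zip -/

section WeightOne

variable {p : ℕ} [Fact p.Prime] {H : Type} [CommRing H] [HopfAlgebra (ZMod p) H]
  {μ : GmAction p H} {X : Scheme.{0}} (E : Torsor p (μ.coord .levi) X) (U : EtAff p X)
  {n : ℕ} (b : μ.WeightOneBasis n)

lemma map_sum_vecIn_adjoint (w : Fin n → E.fn U) (h : H) :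
    TensorProduct.map (∑ i, w i • b.vecIn (E.fn U) i) (μ.restrict .levi).toLinearMap
      (adjoint p H h) = ∑ i, ∑ j, w i ⊗ₜ (b.vec j h • b.rep i j) := by
  rw [map_adjoint]
  have h1 : (Algebra.TensorProduct.includeLeft :
      E.fn U →ₐ[ZMod p] E.fn U ⊗[ZMod p] μ.coord .levi).toLinearMap ∘ₗ
      (∑ i, w i • b.vecIn (E.fn U) i) =
      ∑ i, (w i ⊗ₜ[ZMod p] (1 : μ.coord .levi)) • b.vecIn (E.fn U ⊗[ZMod p] μ.coord .levi) i := by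
    ext h
    simp [GmAction.WeightOneBasis.vecIn_apply]
  rw [h1, conj_sum, LinearMap.sum_apply]
  refine Finset.sum_congr rfl fun i _ => ?_
  have h2 : conj ((Algebra.TensorProduct.includeRight :
      μ.coord .levi →ₐ[ZMod p] E.fn U ⊗[ZMod p] μ.coord .levi).comp (μ.restrict .levi))
      (b.vecIn (E.fn U ⊗[ZMod p] μ.coord .levi) i) =
      Algebra.TensorProduct.includeRight.toLinearMap ∘ₗ
        conj (μ.restrict .levi) (b.vecIn (μ.coord .levi) i) := by
    rw [comp_conj, b.comp_vecIn]
  rw [conj_smul, h2, b.conj_vecIn _ (fun d hd h hh => μ.restrict_eq_zero .levi hd hh)]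
  rw [LinearMap.smul_apply, LinearMap.comp_apply, LinearMap.sum_apply, map_sum, Finset.smul_sum]
  refine Finset.sum_congr rfl fun j _ => ?_
  have h3 : b.mat (μ.restrict .levi) i j • algebraMap (ZMod p) (μ.coord .levi) (b.vec j h) =
      b.vec j h • b.rep i j := by
    rw [smul_eq_mul, mul_comm, ← Algebra.smul_def]; rfl
  rw [LinearMap.smul_apply, b.vecIn_apply, h3, AlgHom.toLinearMap_apply,
    Algebra.TensorProduct.includeRight_apply, smul_eq_mul, Algebra.TensorProduct.tmul_mul_tmul,
    one_mul, mul_one]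

/-- In the basis of `𝔤₁`, sections of the bundle are vectors of functions that transform by `rep`;
`ofVector` is the inverse passage. -/
lemma coact_elt (ξ : weightOne μ E U) (j : Fin n) :
    E.coact U (ξ.1 (b.elt j)) = ∑ i, ξ.1 (b.elt i) ⊗ₜ b.rep i j := by
  rw [ξ.2.1.2]
  have h1 := b.eq_sum_vecIn ξ.2.1.1 ξ.2.2
  conv_lhs => rw [h1]
  rw [map_sum_vecIn_adjoint]
  refine Finset.sum_congr rfl fun i _ => ?_
  rw [Finset.sum_eq_single j]
  · simp [b.vec_elt]
  · intro k _ hk; simp [b.vec_elt, hk]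
  · simp

/-- The section of the bundle given by a vector of functions. -/
def ofVector (w : Fin n → E.fn U) (hw : ∀ j, E.coact U (w j) = ∑ i, w i ⊗ₜ b.rep i j) :
    weightOne μ E U :=
  ⟨∑ i, w i • b.vecIn (E.fn U) i, ⟨fun x y => by
      simp only [LinearMap.sum_apply, LinearMap.smul_apply, b.isLie_vecIn _ x y, smul_add,
        Finset.sum_add_distrib, Finset.smul_sum, smul_comm (w _)], fun h => by
      rw [map_sum_vecIn_adjoint, Finset.sum_comm, LinearMap.sum_apply, map_sum]
      refine Finset.sum_congr rfl fun j _ => ?_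
      rw [LinearMap.smul_apply, b.vecIn_apply, smul_eq_mul, mul_comm, ← Algebra.smul_def,
        ← AlgHom.restrictScalars_apply (ZMod p), map_smul, AlgHom.restrictScalars_apply, hw,
        Finset.smul_sum]
      simp only [TensorProduct.tmul_smul]⟩,
    fun j hj h hh => by
      simp [b.hasWeight_vecIn _ j hj h hh]⟩

lemma ofVector_elt (w : Fin n → E.fn U) (hw : ∀ j, E.coact U (w j) = ∑ i, w i ⊗ₜ b.rep i j)
    (j : Fin n) : (ofVector E U b w hw).1 (b.elt j) = w j := by
  simp [ofVector, b.vecIn_apply, b.vec_elt]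

lemma weightOne_ext {ξ η : weightOne μ E U} (h : ∀ j, ξ.1 (b.elt j) = η.1 (b.elt j)) : ξ = η := by
  apply Subtype.ext
  rw [b.eq_sum_vecIn ξ.2.1.1 ξ.2.2, b.eq_sum_vecIn η.2.1.1 η.2.2]
  simp only [h]

end WeightOne

namespace Disp

variable {p : ℕ} [Fact p.Prime] {H : Type} [CommRing H] [HopfAlgebra (ZMod p) H]
  {μ : GmAction p H} {X : Scheme.{0}} (f : Disp μ X) {U : EtAff p X}

lemma frobPull_apply (w : f.gNeg U) (h : H) : (f.frobPull w).1 h = f.frob.map U (w.1 h) := rfl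

lemma frobPull_add (w w' : f.gNeg U) : f.frobPull (w + w') = f.frobPull w + f.frobPull w' :=
  Subtype.ext (LinearMap.ext fun h => map_add (f.frob.map U) (w.1 h) (w'.1 h))

lemma frobPull_smul (r : U.R) (w : f.gNeg U) : f.frobPull (r • w) = r ^ p • f.frobPull w := by
  refine Subtype.ext (LinearMap.ext fun h => ?_)
  change f.frob.map U (r • w.1 h) = r ^ p • f.frob.map U (w.1 h)
  rw [Algebra.smul_def, map_mul, f.frob.map_algebraMap, ← Algebra.smul_def]

lemma frobPull_zero : f.frobPull (0 : f.gNeg U) = 0 :=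
  Subtype.ext (LinearMap.ext fun _ => map_zero (f.frob.map U))

lemma frobPull_sum {ι : Type} (s : Finset ι) (w : ι → f.gNeg U) :
    f.frobPull (∑ a ∈ s, w a) = ∑ a ∈ s, f.frobPull (w a) := by
  classical
  induction s using Finset.induction_on with
  | empty => simp [frobPull_zero]
  | insert a s ha ih => rw [Finset.sum_insert ha, Finset.sum_insert ha, frobPull_add, ih]

/-- The bundle `(𝔤₁)_{F⁻}` has a dual basis, and its pullback is a dual basis of `(𝔤₁)_{F⁺}`. -/
lemma exists_dual_basis [Algebra.FiniteType (ZMod p) H] (U : EtAff p X) :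
    ∃ (n : ℕ) (b : μ.WeightOneBasis n) (ι : Type) (_ : Fintype ι) (w : ι → f.gNeg U)
      (l : ι → Fin n → f.Mneg.fn U) (cN : ι → f.gNeg U → U.R) (cP : ι → f.gPos U → U.R),
      (∀ a v, algebraMap _ _ (cN a v) = ∑ j, l a j * v.1 (b.elt j)) ∧
      (∀ a ξ, algebraMap _ _ (cP a ξ) = ∑ j, f.frob.map U (l a j) * ξ.1 (b.elt j)) ∧
      (∀ v, v = ∑ a, cN a v • w a) ∧ ∀ ξ, ξ = ∑ a, cP a ξ • f.frobPull (w a) := by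
  obtain ⟨n, ⟨b⟩⟩ := μ.exists_weightOneBasis
  obtain ⟨ι, _, w, l, hw, hl, hwl⟩ := f.Mneg.exists_dual_basis U b.rep b.repInv b.comul_rep
    b.comul_repInv b.repInv_mul_rep
  -- The contraction of a vector transforming by `repInv` with a section is invariant under `M`, so
  -- it comes from the base. The argument is uniform in `E`, which serves both `F⁻_M` and its
  -- Frobenius pullback.
  have key : ∀ (E : Torsor p (μ.coord .levi) X) (l : Fin n → E.fn U),
      (∀ j, E.coact U (l j) = ∑ i, l i ⊗ₜ b.repInv j i) → ∀ v : weightOne μ E U,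
      ∃ r, algebraMap U.R (E.fn U) r = ∑ j, l j * v.1 (b.elt j) := by
    intro E l hl v
    apply E.exists_algebraMap_eq U
    rw [map_sum]
    simp only [map_mul, hl, coact_elt E U b v, Finset.sum_mul, Finset.mul_sum,
      Algebra.TensorProduct.tmul_mul_tmul]
    rw [TensorProduct.sum_tmul, Finset.sum_comm]
    refine Finset.sum_congr rfl fun i _ => ?_
    rw [Finset.sum_comm]
    have h1 : ∀ k, ∑ j, (l k * v.1 (b.elt i)) ⊗ₜ[ZMod p] (b.repInv j k * b.rep i j) =
        (l k * v.1 (b.elt i)) ⊗ₜ (if i = k then 1 else 0) := by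
      intro k
      rw [← TensorProduct.tmul_sum, ← b.rep_mul_repInv]
      simp only [mul_comm]
    rw [Finset.sum_congr rfl fun k _ => h1 k, Finset.sum_eq_single i]
    · simp
    · intro k _ hk; simp [Ne.symm hk]
    · simp
  have hl' : ∀ a j, f.Mpos.coact U (f.frob.map U (l a j)) =
      ∑ i, f.frob.map U (l a i) ⊗ₜ b.repInv j i := by
    intro a j
    rw [f.frob.map_coact, hl, map_sum]
    simp
  choose cN hcN using fun a => key f.Mneg (l a) (hl a)
  choose cP hcP using fun a => key f.Mpos (fun j => f.frob.map U (l a j)) (hl' a)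
  refine ⟨n, b, ι, inferInstance, fun a => ofVector f.Mneg U b (w a) (hw a), l, cN, cP, hcN, hcP,
    fun v => ?_, fun ξ => ?_⟩
  · refine weightOne_ext f.Mneg U b fun i => ?_
    have h1 : (∑ a, cN a v • ofVector f.Mneg U b (w a) (hw a) : f.gNeg U).1 (b.elt i) =
        ∑ a, cN a v • w a i := by
      simp [ofVector_elt]
    rw [h1]
    simp only [Algebra.smul_def, hcN, Finset.sum_mul]
    rw [Finset.sum_comm]
    have h2 : ∀ j, ∑ a, l a j * v.1 (b.elt j) * w a i =
        (if i = j then 1 else 0) * v.1 (b.elt j) := by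
      intro j
      rw [← hwl, Finset.sum_mul]
      exact Finset.sum_congr rfl fun a _ => by ring
    rw [Finset.sum_congr rfl fun j _ => h2 j]
    simp
  · refine weightOne_ext f.Mpos U b fun i => ?_
    have h1 : (∑ a, cP a ξ • f.frobPull (ofVector f.Mneg U b (w a) (hw a)) : f.gPos U).1 (b.elt i) =
        ∑ a, cP a ξ • f.frob.map U (w a i) := by
      simp [frobPull_apply, ofVector_elt]
    rw [h1]
    simp only [Algebra.smul_def, hcP, Finset.sum_mul]
    rw [Finset.sum_comm]
    have h2 : ∀ j, ∑ a, f.frob.map U (l a j) * ξ.1 (b.elt j) * f.frob.map U (w a i) =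
        (if i = j then 1 else 0) * ξ.1 (b.elt j) := by
      intro j
      have h3 : f.frob.map U (∑ a, w a i * l a j) = if i = j then 1 else 0 := by
        rw [hwl]; split_ifs <;> simp
      rw [← h3, map_sum, Finset.sum_mul]
      exact Finset.sum_congr rfl fun a _ => by rw [map_mul]; ring
    rw [Finset.sum_congr rfl fun j _ => h2 j]
    simp

/-- The coordinates with respect to the dual basis get raised to the `p`-th power, which is
injective on a reduced ring. -/
lemma frobPull_injective [Algebra.FiniteType (ZMod p) H] [IsReduced U.R] {v v' : f.gNeg U}
    (h : f.frobPull v = f.frobPull v') : v = v' := by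
  obtain ⟨n, b, ι, _, w, l, cN, cP, hcN, hcP, hN, -⟩ := f.exists_dual_basis U
  have h1 : ∀ a v, cP a (f.frobPull v) = cN a v ^ p := by
    intro a v
    apply f.Mpos.algebraMap_injective U
    rw [hcP, ← f.frob.map_algebraMap, hcN, map_sum]
    exact Finset.sum_congr rfl fun j _ => by rw [map_mul, frobPull_apply]
  have h2 : ∀ a, cN a v = cN a v' := by
    intro a
    have h3 : (cN a v - cN a v') ^ p = 0 := by
      rw [sub_pow_prime, ← h1, ← h1, h, sub_self]
    exact sub_eq_zero.1 (pow_eq_zero_iff (Fact.out : p.Prime).ne_zero |>.1 h3)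
  rw [hN v, hN v']
  simp only [h2]

end Disp

namespace Disp

/-! ### Vertical vector fields on `F⁺` -/

variable {p : ℕ} [Fact p.Prime] {H : Type} [CommRing H] [HopfAlgebra (ZMod p) H]
  {μ : GmAction p H} {X : Scheme.{0}} (f : Disp μ X) {U : EtAff p X}

/-- The functional on `P⁺` that defines the vertical vector field. -/
def zeta (ξ : f.gPos U) : μ.coord .pos →ₗ[ZMod p] f.Fpos.fn U :=
  (f.posM.map U).toLinearMap ∘ₗ (show μ.coord .pos →ₗ[ZMod p] f.Mpos.fn U from
    ((μ.ideal .pos).restrictScalars (ZMod p)).liftQ ξ.1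
      (μ.eq_zero_of_mem_ideal_pos ξ.2.1.1 ξ.2.2))

lemma vertical_eq (ξ : f.gPos U) : f.vertical ξ = f.Fpos.vert U (f.zeta ξ) := rfl

lemma zeta_comp_restrict (ξ : f.gPos U) :
    f.zeta ξ ∘ₗ (μ.restrict .pos).toLinearMap = (f.posM.map U).toLinearMap ∘ₗ ξ.1 := rfl

lemma zeta_restrict (ξ : f.gPos U) (h : H) :
    f.zeta ξ (μ.restrict .pos h) = f.posM.map U (ξ.1 h) := rfl

lemma zeta_add (ξ ξ' : f.gPos U) : f.zeta (ξ + ξ') = f.zeta ξ + f.zeta ξ' :=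
  μ.linearMap_ext_restrict (LinearMap.ext fun h => map_add (f.posM.map U) (ξ.1 h) (ξ'.1 h))

lemma zeta_smul (r : U.R) (ξ : f.gPos U) : f.zeta (r • ξ) = r • f.zeta ξ :=
  μ.linearMap_ext_restrict (LinearMap.ext fun h => map_smul (f.posM.alg U) r (ξ.1 h))

lemma vertical_add (ξ ξ' : f.gPos U) : f.vertical (ξ + ξ') = f.vertical ξ + f.vertical ξ' := by
  rw [vertical_eq, zeta_add]
  exact act_add_right _ _ _ _

lemma vertical_smul (r : U.R) (ξ : f.gPos U) : f.vertical (r • ξ) = r • f.vertical ξ := by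
  rw [vertical_eq, zeta_smul]
  exact act_smul_right _ _ _ _

lemma posM_injective (U : EtAff p X) : Function.Injective (f.posM.map U) :=
  f.posM.map_injective U (μ.retract_injective .pos)

lemma negM_injective (U : EtAff p X) : Function.Injective (f.negM.map U) :=
  f.negM.map_injective U (μ.retract_injective .neg)

lemma vertical_injective {ξ ξ' : f.gPos U} (h : f.vertical ξ = f.vertical ξ') : ξ = ξ' := by
  have h1 : f.zeta ξ = f.zeta ξ' := Torsor.vert_cancel h
  refine Subtype.ext (LinearMap.ext fun x => f.posM_injective U ?_)
  rw [← zeta_restrict, ← zeta_restrict, h1]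

lemma isPointDer_zeta (ξ : f.gPos U) : IsPointDer (f.zeta ξ) :=
  (IsSubgroup.isLie_iff (hc := isSubgroup_restrict μ .pos)).1 (by
    rw [zeta_comp_restrict]; exact ξ.2.1.1.comp _)

lemma hasWeight_zeta (ξ : f.gPos U) :
    μ.HasWeight 1 (f.zeta ξ ∘ₗ (μ.restrict .pos).toLinearMap) := fun j hj h hh => by
  rw [zeta_comp_restrict, LinearMap.comp_apply, ξ.2.2 j hj h hh, map_zero]

lemma map_posM_retract (ξ : H →ₗ[ZMod p] f.Mpos.fn U) (z : H ⊗[ZMod p] H) :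
    Algebra.TensorProduct.map (f.posM.map U) (μ.retract .pos)
      (TensorProduct.map ξ (μ.restrict .levi).toLinearMap z) =
    TensorProduct.map ((f.posM.map U).toLinearMap ∘ₗ ξ) (μ.limit .pos).toLinearMap z := by
  induction z with
  | zero => simp
  | add x y hx hy => simp only [map_add, hx, hy]
  | tmul x y => rfl

/-- A section `ξ` is equivariant under `M` only, whereas invariance is needed under `P⁺`. The two
agree because the unipotent radical acts trivially on `𝔤₁`. -/
lemma isInv_vertical (hμ : μ.OneBounded) (ξ : f.gPos U) : f.Fpos.IsInv U (f.vertical ξ) := by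
  rw [vertical_eq, Torsor.isInv_vert_iff_coact (isSubgroup_restrict μ .pos)]
  intro h
  rw [zeta_restrict, f.posM.map_coact, ξ.2.1.2, map_posM_retract, zeta_comp_restrict,
    μ.map_restrict_pos_adjoint hμ (ξ.2.1.1.comp _) (by
      rw [← zeta_comp_restrict]; exact f.hasWeight_zeta ξ)]

/-- The vertical vector field as a derivation. -/
def verticalDer (ξ : f.gPos U) : Derivation (ZMod p) (f.Fpos.fn U) (f.Fpos.fn U) :=
  Torsor.vertDer (f.zeta ξ) (f.isPointDer_zeta ξ)

lemma verticalDer_apply (ξ : f.gPos U) (b : f.Fpos.fn U) :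
    f.verticalDer ξ b = f.vertical ξ b := rfl

lemma vertical_algebraMap (ξ : f.gPos U) (r : U.R) :
    f.vertical ξ (algebraMap U.R (f.Fpos.fn U) r) = 0 :=
  Torsor.vert_algebraMap _ (f.isPointDer_zeta ξ) r

/-- Functions on `M` pulled back to `P⁺` have representatives of degree `0`, where a functional of
weight one vanishes. -/
lemma vertical_posM (ξ : f.gPos U) (b : f.Mpos.fn U) : f.vertical ξ (f.posM.map U b) = 0 := by
  have h1 : f.zeta ξ ∘ₗ (μ.retract .pos).toLinearMap = 0 := by
    refine μ.linearMap_ext_restrict (LinearMap.ext fun h => ?_)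
    change f.posM.map U (ξ.1 (μ.prj 0 h)) = 0
    rw [ξ.2.2 0 (by decide) _ (μ.prj_mem 0 h), map_zero]
  have h2 := act_comp (ρ' := f.Mpos.co U) (f.Fpos.co U) (f.posM.map U).toLinearMap
    (μ.retract .pos).toLinearMap (f.posM.map_coact U) LinearMap.id (f.zeta ξ)
  rw [h1, act_zero_right] at h2
  exact LinearMap.congr_fun h2 b

lemma vertical_commute (hμ : μ.OneBounded) (ξ ξ' : f.gPos U) (b : f.Fpos.fn U) :
    f.vertical ξ (f.vertical ξ' b) = f.vertical ξ' (f.vertical ξ b) :=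
  LinearMap.congr_fun (Torsor.vert_commute hμ (f.isPointDer_zeta ξ) (f.isPointDer_zeta ξ')
    (f.isInv_vertical hμ ξ) (f.isInv_vertical hμ ξ') (f.hasWeight_zeta ξ) (f.hasWeight_zeta ξ')) b

/-- An invariant vector field on `F⁺` that is trivial on `F⁺_M` is given by a section of
`(𝔤₁)_{F⁺}`. -/
lemma exists_vertical_eq (hμ : μ.OneBounded) (Z : Derivation (ZMod p) (f.Fpos.fn U) (f.Fpos.fn U))
    (hZ : f.Fpos.IsInv U (Z : f.Fpos.fn U →ₗ[ZMod p] f.Fpos.fn U))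
    (hR : ∀ r : U.R, Z (algebraMap U.R _ r) = 0) (hM : ∀ b, Z (f.posM.map U b) = 0) :
    ∃ ξ : f.gPos U, ∀ b, Z b = f.vertical ξ b := by
  obtain ⟨ζ, h1, h2⟩ := Torsor.exists_vert_eq_derivation (isSubgroup_restrict μ .pos) Z hZ hR
  -- Triviality on `F⁺_M` removes the weight `0`. Negative degrees vanish on `P⁺` and degrees above
  -- `1` die by 1-boundedness, so `ζ` has weight one.
  have h3 : ζ ∘ₗ (μ.retract .pos).toLinearMap = 0 := by
    apply f.Mpos.act_eq_zero U (f.posM.map U)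
    rw [← LinearMap.id_comp (f.posM.map U).toLinearMap, ← act_comp (ρ' := f.Mpos.co U)
      (f.Fpos.co U) (f.posM.map U).toLinearMap (μ.retract .pos).toLinearMap (f.posM.map_coact U)]
    refine LinearMap.ext fun b => ?_
    exact (LinearMap.congr_fun h1 _).symm.trans (hM b)
  let η := ζ ∘ₗ (μ.restrict .pos).toLinearMap
  have hw : μ.HasWeight 1 η := by
    intro j hj h hh
    rcases lt_trichotomy j 0 with hj0 | hj0 | hj0
    · change ζ (μ.restrict .pos h) = 0
      rw [μ.restrict_eq_zero .pos hj0 hh, map_zero]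
    · subst hj0
      have := LinearMap.congr_fun h3 (μ.restrict .levi h)
      rw [LinearMap.comp_apply, AlgHom.toLinearMap_apply, GmAction.retract_restrict,
        GmAction.limit_apply, μ.prj_same hh] at this
      exact this
    · exact hμ.eq_zero h2.1 (by omega) hh
  -- The values of `η` transform through `M`, since the unipotent radical acts trivially, and
  -- therefore descend from `F⁺` to `F⁺_M`.
  have h4 : ∀ h, ∃ x, f.posM.map U x = η h := by
    intro h
    apply f.posM.exists_map_eq U
    rw [h2.2, μ.map_restrict_pos_adjoint hμ h2.1 hw]
    refine ⟨TensorProduct.map η (μ.restrict .levi).toLinearMap (adjoint p H h), ?_⟩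
    induction adjoint p H h with
    | zero => simp
    | add x y hx hy => simp only [map_add, hx, hy]
    | tmul x y => rfl
  choose ξ₀ hξ₀ using h4
  let ξ : H →ₗ[ZMod p] f.Mpos.fn U :=
    { toFun := ξ₀
      map_add' := fun a b => f.posM_injective U (by simp only [map_add, hξ₀])
      map_smul' := fun r a => f.posM_injective U (by
        simp only [map_smul, hξ₀, RingHom.id_apply]) }
  have hξ : (f.posM.map U).toLinearMap ∘ₗ ξ = η := LinearMap.ext hξ₀
  have hinj : Function.Injective (Algebra.TensorProduct.map (f.posM.map U) (μ.retract .pos)) := by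
    have h5 : (⇑(Algebra.TensorProduct.map (f.posM.map U) (μ.retract .pos))) =
        (μ.retract .pos).toLinearMap.lTensor _ ∘ (f.posM.map U).toLinearMap.rTensor _ := by
      funext z
      rw [Function.comp_apply, ← LinearMap.comp_apply, LinearMap.lTensor_comp_rTensor]
      rfl
    rw [h5]
    exact (Module.Flat.lTensor_preserves_injective_linearMap (M := f.Fpos.fn U) _
      (μ.retract_injective .pos)).comp
      (Module.Flat.rTensor_preserves_injective_linearMap _ (f.posM_injective U))
  have hmem : ξ ∈ f.gPos U := by
    refine ⟨⟨fun a b => f.posM_injective U ?_, fun h => hinj ?_⟩, fun j hj h hh =>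
      f.posM_injective U ?_⟩
    · have := h2.1 a b
      change η _ = _ • η _ + _ • η _ at this
      rw [← hξ] at this
      rw [map_add, map_smul, map_smul]
      exact this
    · rw [← f.posM.map_coact, map_posM_retract, hξ]
      change f.Fpos.coact U (f.posM.map U (ξ₀ h)) = _
      rw [hξ₀, ← μ.map_restrict_pos_adjoint hμ h2.1 hw]
      exact h2.2 h
    · rw [map_zero]
      exact (hξ₀ h).trans (hw j hj h hh)
  refine ⟨⟨ξ, hmem⟩, fun b => ?_⟩
  have h5 : f.zeta ⟨ξ, hmem⟩ = ζ :=
    μ.linearMap_ext_restrict ((f.zeta_comp_restrict ⟨ξ, hmem⟩).trans hξ)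
  rw [vertical_eq, h5]
  exact LinearMap.congr_fun h1 b

/-! ### Change of a connection by a one-form -/

lemma isInv_lift {K : Type} [CommRing K] [Bialgebra (ZMod p) K] {E : Torsor p K X}
    (nabla : Connection E) (D : U.Vect) :
    E.IsInv U (nabla.lift U D : E.fn U →ₗ[ZMod p] E.fn U) := nabla.invariant U D

lemma lift_smul_apply {K : Type} [CommRing K] [Bialgebra (ZMod p) K] {E : Torsor p K X}
    (nabla : Connection E) (D : U.Vect) (r : U.R) (b : E.fn U) :
    nabla.lift U D (r • b) = D r • b + r • nabla.lift U D b := by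
  rw [Algebra.smul_def, Derivation.leibniz, nabla.lift_algebraMap, Algebra.smul_def (D r),
    Algebra.smul_def r, smul_eq_mul, smul_eq_mul]
  ring

section

variable {f} {nabla : Connection f.Fpos} {nablaM : Connection f.Mpos}

/-- The sections `frobPull (w a)` are horizontal for the Frobenius connection on `F⁺_M`, so only the
coefficients are differentiated. -/
lemma commutator_vertical (h1 : nabla.Induces f.posM nablaM) (h2 : nablaM.IsFrobenius f.frob) (D : U.Vect) {ι : Type} [Fintype ι] (g : ι → U.R) (w : ι → f.gNeg U)
    (b : f.Fpos.fn U) :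
    nabla.lift U D (f.vertical (∑ a, g a • f.frobPull (w a)) b) -
      f.vertical (∑ a, g a • f.frobPull (w a)) (nabla.lift U D b) =
      f.vertical (∑ a, D (g a) • f.frobPull (w a)) b := by
  have h3 : (nabla.lift U D : f.Fpos.fn U →ₗ[ZMod p] f.Fpos.fn U) ∘ₗ
      f.zeta (∑ a, g a • f.frobPull (w a)) = f.zeta (∑ a, D (g a) • f.frobPull (w a)) := by
    refine μ.linearMap_ext_restrict (LinearMap.ext fun h => ?_)
    have h4 : ∀ c : ι → U.R, (∑ a, c a • f.frobPull (w a) : f.gPos U).1 h =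
        ∑ a, c a • f.frob.map U ((w a).1 h) := by
      intro c
      simp [frobPull_apply]
    change nabla.lift U D (f.posM.map U ((∑ a, g a • f.frobPull (w a) : f.gPos U).1 h)) =
      f.posM.map U ((∑ a, D (g a) • f.frobPull (w a) : f.gPos U).1 h)
    rw [← h1, h4, h4, map_sum]
    congr 1
    refine Finset.sum_congr rfl fun a _ => ?_
    rw [lift_smul_apply, h2, smul_zero, add_zero]
  have h5 := Torsor.commutator_vert (isInv_lift nabla D) (f.zeta (∑ a, g a • f.frobPull (w a)))
  rw [h3] at h5
  exact LinearMap.congr_fun h5 b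

end

end Disp

namespace Disp

/-! ### Translation of connections -/

variable {p : ℕ} [Fact p.Prime] {H : Type} [CommRing H] [HopfAlgebra (ZMod p) H]
  {μ : GmAction p H} {X : Scheme.{0}} {f : Disp μ X} {U : EtAff p X}

lemma adIter_vertical {nabla : Connection f.Fpos} {nablaM : Connection f.Mpos}
    (h1 : nabla.Induces f.posM nablaM) (h2 : nablaM.IsFrobenius f.frob) (D : U.Vect) {ι : Type}
    [Fintype ι] (g : ι → U.R) (w : ι → f.gNeg U) (n : ℕ) :
    adIter (A := Module.End (ZMod p) (f.Fpos.fn U))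
      (nabla.lift U D : f.Fpos.fn U →ₗ[ZMod p] f.Fpos.fn U)
      (f.vertical (∑ a, g a • f.frobPull (w a))) n =
      f.vertical (∑ a, ((D : U.R →ₗ[ZMod p] U.R) ^ n) (g a) • f.frobPull (w a)) := by
  induction n with
  | zero => rfl
  | succ n ih =>
    refine LinearMap.ext fun b => ?_
    simp only [pow_succ', Module.End.mul_apply]
    rw [adIter, ih]
    exact commutator_vertical h1 h2 D (fun a => ((D : U.R →ₗ[ZMod p] U.R) ^ n) (g a)) w b

/-- The change of the `p`-curvature. -/
lemma pCurv_translate (hμ : μ.OneBounded) {nabla nabla' : Connection f.Fpos}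
    {nablaM : Connection f.Mpos} (h1 : nabla.Induces f.posM nablaM)
    (h2 : nablaM.IsFrobenius f.frob) {ι : Type} [Fintype ι] (w : ι → f.gNeg U)
    (α β : ι → Ω[U.R⁄ZMod p]) (hαβ : ∀ a, (α a, β a) ∈ cartier U)
    (h3 : ∀ (D : U.Vect) b, nabla'.lift U D b = nabla.lift U D b +
      f.vertical (∑ a, pair (α a) D • f.frobPull (w a)) b) (D : U.Vect) (b : f.Fpos.fn U) :
    nabla'.pCurv U D b = nabla.pCurv U D b -
      f.vertical (f.frobPull (∑ a, pair (β a) D • w a)) b := by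
  have hp := (Fact.out : p.Prime)
  let x : Module.End (ZMod p) (f.Fpos.fn U) := (nabla.lift U D : f.Fpos.fn U →ₗ[ZMod p] f.Fpos.fn U)
  let v : Module.End (ZMod p) (f.Fpos.fn U) := f.vertical (∑ a, pair (α a) D • f.frobPull (w a))
  have h4 : (nabla'.lift U D : f.Fpos.fn U →ₗ[ZMod p] f.Fpos.fn U) = x + v :=
    LinearMap.ext (h3 D)
  -- The iterated commutators of `x` with `v` are again vertical of weight one, so they commute with
  -- `v`.
  have h5 := add_pow_prime_of_commute (p := p) x v (by
    intro n
    rw [adIter_vertical h1 h2]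
    exact LinearMap.ext fun b => f.vertical_commute hμ _ _ b)
  have h6 : v ^ p = 0 := Torsor.vert_pow hμ (f.isPointDer_zeta _) (f.isInv_vertical hμ _)
    (f.hasWeight_zeta _)
  rw [h6, add_zero, adIter_vertical h1 h2] at h5
  have h7 : derivPow (nabla'.lift U D) b = (x ^ p) b + f.vertical (∑ a,
      ((D : U.R →ₗ[ZMod p] U.R) ^ (p - 1)) (pair (α a) D) • f.frobPull (w a)) b := by
    rw [derivPow_apply, h4, h5]
    rfl
  -- The Cartier identity produces a `p`-th power of `pair (β a) D`. By semilinearity it is the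
  -- coefficient of the Frobenius pullback.
  have h8 : (∑ a, ((D : U.R →ₗ[ZMod p] U.R) ^ (p - 1)) (pair (α a) D) • f.frobPull (w a) :
      f.gPos U) + f.frobPull (∑ a, pair (β a) D • w a) =
      ∑ a, pair (α a) (derivPow D) • f.frobPull (w a) := by
    rw [frobPull_sum, ← Finset.sum_add_distrib]
    refine Finset.sum_congr rfl fun a _ => ?_
    rw [frobPull_smul, ← add_smul]
    congr 1
    have h8 : ((D : U.R →ₗ[ZMod p] U.R) ^ (p - 1)) (pair (α a) D) - pair (α a) (derivPow D) =
      -pair (β a) D ^ p := pow_sub_derivPow_of_mem_cartierGraph (hαβ a) D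
    linear_combination h8
  have h9 := congrArg (fun ξ => f.vertical ξ b) h8
  simp only [vertical_add, LinearMap.add_apply] at h9
  rw [Connection.pCurv, Connection.pCurv, Derivation.sub_apply, Derivation.sub_apply, h7, h3,
    derivPow_apply]
  linear_combination h9

lemma isClosedForm_neg {α : Ω[U.R⁄ZMod p]} (h : IsClosedForm α) : IsClosedForm (-α) := by
  intro D₁ D₂
  have h1 : ∀ D, pair (-α) D = -pair α D := fun D =>
    map_neg D.liftKaehlerDifferential α
  rw [h1, h1, h1, map_neg, map_neg]
  linear_combination -(h D₁ D₂)

/-- Explicit form of the elements of the graph of the twisted Cartier operator. -/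
lemma exists_of_mem_cartierTwisted {ω : f.FormPos U} {β : f.FormNeg U}
    (h : (ω, β) ∈ f.cartierTwisted U) :
    ∃ (ι : Type) (_ : Fintype ι) (w : ι → f.gNeg U) (α γ : ι → Ω[U.R⁄ZMod p]),
      (∀ a, IsClosedForm (α a)) ∧ (∀ a, (α a, γ a) ∈ cartier U) ∧
      (∀ D, ω D = ∑ a, pair (α a) D • f.frobPull (w a)) ∧
      ∀ D, β D = ∑ a, pair (γ a) D • w a := by
  have key : ∀ x ∈ f.cartierTwisted U,
      ∃ (ι : Type) (_ : Fintype ι) (w : ι → f.gNeg U) (α γ : ι → Ω[U.R⁄ZMod p]),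
      (∀ a, IsClosedForm (α a)) ∧ (∀ a, (α a, γ a) ∈ cartier U) ∧
      (∀ D, x.1 D = ∑ a, pair (α a) D • f.frobPull (w a)) ∧
      ∀ D, x.2 D = ∑ a, pair (γ a) D • w a := by
    intro x hx
    induction hx using AddSubgroup.closure_induction with
    | mem x hx =>
      obtain ⟨w, α, γ, h1, h2, rfl⟩ := hx
      exact ⟨Unit, inferInstance, fun _ => w, fun _ => α, fun _ => γ, fun _ => h1, fun _ => h2,
        fun D => by simp, fun D => by simp⟩
    | zero => exact ⟨Empty, inferInstance, nofun, nofun, nofun, nofun, nofun, fun D => by simp,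
        fun D => by simp⟩
    | add x y _ _ hx hy =>
      obtain ⟨ι, _, w, α, γ, h1, h2, h3, h4⟩ := hx
      obtain ⟨ι', _, w', α', γ', h1', h2', h3', h4'⟩ := hy
      refine ⟨ι ⊕ ι', inferInstance, Sum.elim w w', Sum.elim α α', Sum.elim γ γ', ?_, ?_,
        fun D => ?_, fun D => ?_⟩
      · rintro (a | a); exacts [h1 a, h1' a]
      · rintro (a | a); exacts [h2 a, h2' a]
      · simp [h3, h3']
      · simp [h4, h4']
    | neg x _ hx =>
      obtain ⟨ι, _, w, α, γ, h1, h2, h3, h4⟩ := hx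
      have h5 : ∀ (α : Ω[U.R⁄ZMod p]) D, pair (-α) D = -pair α D := fun α D =>
        map_neg D.liftKaehlerDifferential α
      refine ⟨ι, inferInstance, w, fun a => -α a, fun a => -γ a, fun a => isClosedForm_neg (h1 a),
        fun a => neg_mem (h2 a), fun D => ?_, fun D => ?_⟩
      · refine (neg_eq_of_add_eq_zero_right (G := f.gPos U) (a := x.1 D) ?_ :)
        rw [h3, ← Finset.sum_add_distrib]
        exact Finset.sum_eq_zero fun a _ => by rw [← add_smul, h5, add_neg_cancel, zero_smul]
      · refine (neg_eq_of_add_eq_zero_right (G := f.gNeg U) (a := x.2 D) ?_ :)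
        rw [h4, ← Finset.sum_add_distrib]
        exact Finset.sum_eq_zero fun a _ => by rw [← add_smul, h5, add_neg_cancel, zero_smul]
  exact key _ h

/-- The sum of a connection and a one-form. -/
def translate (hμ : μ.OneBounded) (nabla : Connection f.Fpos) (ω : ∀ U : EtAff p X, f.FormPos U)
    (hω : ω ∈ f.forms) : Connection f.Fpos where
  lift U :=
    { toFun := fun D => nabla.lift U D + f.verticalDer (ω U D)
      map_add' := fun D D' => by
        ext b
        simp only [map_add, Derivation.add_apply, verticalDer_apply, vertical_add,
          LinearMap.add_apply]
        abel
      map_smul' := fun r D => by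
        ext b
        simp only [map_smul, Derivation.add_apply, verticalDer_apply, vertical_smul,
          LinearMap.smul_apply, Derivation.smul_apply, RingHom.id_apply, smul_add] }
  lift_algebraMap U D r := by
    change nabla.lift U D _ + f.vertical _ _ = _
    rw [nabla.lift_algebraMap, vertical_algebraMap, add_zero]
  invariant U D b := by
    change f.Fpos.coact U (nabla.lift U D b + f.vertical (ω U D) b) =
      ((nabla.lift U D : f.Fpos.fn U →ₗ[ZMod p] f.Fpos.fn U) + f.vertical (ω U D)).rTensor _ _
    rw [map_add, nabla.invariant, f.isInv_vertical hμ, LinearMap.rTensor_add, LinearMap.add_apply]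
  lift_res {U V} φ D D' hD b := by
    change nabla.lift V D' _ + f.vertical (ω V D') _ =
      f.Fpos.res φ (nabla.lift U D b + f.vertical (ω U D) b)
    rw [map_add, nabla.lift_res φ D D' hD]
    congr 1
    have h1 : (f.Fpos.res φ).toLinearMap ∘ₗ f.zeta (ω U D) = f.zeta (ω V D') := by
      refine μ.linearMap_ext_restrict (LinearMap.ext fun h => ?_)
      change f.Fpos.res φ (f.posM.map U ((ω U D).1 h)) = f.posM.map V ((ω V D').1 h)
      rw [← f.posM.map_res, hω U V φ D D' hD h]
    have h2 := act_comp (ρ' := f.Fpos.co U) (f.Fpos.co V) (f.Fpos.res φ).toLinearMap LinearMap.id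
      (f.Fpos.res_coact φ) LinearMap.id (f.zeta (ω V D'))
    have h3 := comp_act (f.Fpos.co U) (f.Fpos.res φ) LinearMap.id (f.zeta (ω U D))
    rw [h1] at h3
    exact (LinearMap.congr_fun h2 b).trans (LinearMap.congr_fun h3 b).symm

lemma isTranslate_translate (hμ : μ.OneBounded) (nabla : Connection f.Fpos)
    (ω : ∀ U : EtAff p X, f.FormPos U) (hω : ω ∈ f.forms) :
    f.IsTranslate ω nabla (translate hμ nabla ω hω) := fun _ _ _ => rfl

/-- Integrability of the sum of a connection and a closed form. -/
lemma integrable_translate (hμ : μ.OneBounded) {nabla nabla' : Connection f.Fpos}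
    {nablaM : Connection f.Mpos} (h1 : nabla.Induces f.posM nablaM)
    (h2 : nablaM.IsFrobenius f.frob) {D₁ D₂ : U.Vect}
    (h0 : nabla.lift U ⁅D₁, D₂⁆ = ⁅nabla.lift U D₁, nabla.lift U D₂⁆) {ι : Type} [Fintype ι]
    (w : ι → f.gNeg U) (α : ι → Ω[U.R⁄ZMod p]) (hα : ∀ a, IsClosedForm (α a))
    (h3 : ∀ (D : U.Vect) b, nabla'.lift U D b = nabla.lift U D b +
      f.vertical (∑ a, pair (α a) D • f.frobPull (w a)) b) :
    nabla'.lift U ⁅D₁, D₂⁆ = ⁅nabla'.lift U D₁, nabla'.lift U D₂⁆ := by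
  ext b
  rw [Derivation.commutator_apply]
  simp only [h3, map_add]
  rw [h0, Derivation.commutator_apply]
  -- Expanding the bracket of the new lifts, the vertical fields commute among themselves. The mixed
  -- terms together with `ω ⁅D₁, D₂⁆` form the exterior derivative of `ω`.
  have h4 := commutator_vertical h1 h2 D₁ (fun a => pair (α a) D₂) w b
  have h5 := commutator_vertical h1 h2 D₂ (fun a => pair (α a) D₁) w b
  have h6 := f.vertical_commute hμ (∑ a, pair (α a) D₁ • f.frobPull (w a))
    (∑ a, pair (α a) D₂ • f.frobPull (w a)) b
  have h7 : (∑ a, pair (α a) ⁅D₁, D₂⁆ • f.frobPull (w a) : f.gPos U) +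
      ∑ a, D₂ (pair (α a) D₁) • f.frobPull (w a) =
      ∑ a, D₁ (pair (α a) D₂) • f.frobPull (w a) := by
    rw [← Finset.sum_add_distrib]
    refine Finset.sum_congr rfl fun a _ => ?_
    rw [← add_smul]
    congr 1
    linear_combination -(hα a D₁ D₂)
  have h8 := congrArg (fun ξ => f.vertical ξ b) h7
  simp only [vertical_add, LinearMap.add_apply] at h8
  linear_combination h8 - h4 + h5 - h6

/-! ### The induced connection on `F` -/

/-- Every point of `F` is locally a translate of a point of `F⁺`, so an equivariant function on `F`
is determined by its restriction to `F⁺`. -/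
lemma adjointBundle_ext {η η' : H →ₗ[ZMod p] f.F.fn U}
    (h : η ∈ adjointBundle (AlgHom.id (ZMod p) H) f.F U)
    (h' : η' ∈ adjointBundle (AlgHom.id (ZMod p) H) f.F U)
    (hη : ∀ x, f.posF.map U (η x) = f.posF.map U (η' x)) : η = η' := by
  refine LinearMap.ext fun x => ?_
  apply f.F.map_coact_injective U (f.posF.alg U)
  rw [h.2, h'.2]
  induction adjoint p H x with
  | zero => simp
  | add x y hx hy => simp only [map_add, hx, hy]
  | tmul x y =>
    have := hη x
    simp [TorsorHom.alg_apply, this]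

lemma isPointDer_of_mem {η : H →ₗ[ZMod p] f.F.fn U}
    (h : η ∈ adjointBundle (AlgHom.id (ZMod p) H) f.F U) : IsPointDer η := h.1

lemma isInv_of_mem {η : H →ₗ[ZMod p] f.F.fn U}
    (h : η ∈ adjointBundle (AlgHom.id (ZMod p) H) f.F U) : f.F.IsInv U (f.F.vert U η) :=
  (Torsor.isInv_vert_iff_coact isSubgroup_id η).2 h.2

lemma res_mem_adjointBundle {V : EtAff p X} (φ : U.Res V) {η : H →ₗ[ZMod p] f.F.fn U}
    (h : η ∈ adjointBundle (AlgHom.id (ZMod p) H) f.F U) :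
    (f.F.res φ).toLinearMap ∘ₗ η ∈ adjointBundle (AlgHom.id (ZMod p) H) f.F V := by
  refine ⟨h.1.comp _, fun x => ?_⟩
  rw [LinearMap.comp_apply, AlgHom.toLinearMap_apply, f.F.res_coact, h.2]
  induction adjoint p H x with
  | zero => simp
  | add x y hx hy => simp only [map_add, hx, hy]
  | tmul x y => simp

lemma vert_posF {ξ : f.gPos U} {η : H →ₗ[ZMod p] f.F.fn U}
    (h : ∀ x, f.posF.map U (η x) = f.posM.map U (ξ.1 x)) (b : f.F.fn U) :
    f.posF.map U (f.F.vert U η b) = f.vertical ξ (f.posF.map U b) := by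
  have h1 := act_comp (ρ' := f.F.co U) (f.Fpos.co U) (f.posF.map U).toLinearMap
    (μ.restrict .pos).toLinearMap (f.posF.map_coact U) LinearMap.id (f.zeta ξ)
  have h2 := comp_act (f.F.co U) (f.posF.map U) LinearMap.id η
  have h3 : (f.posF.map U).toLinearMap ∘ₗ η = (f.posM.map U).toLinearMap ∘ₗ ξ.1 := LinearMap.ext h
  rw [h3] at h2
  rw [zeta_comp_restrict] at h1
  exact (LinearMap.congr_fun h2 b).trans (LinearMap.congr_fun h1 b).symm

/-- The connection on `F` induced by the sum of a connection on `F⁺` and a one-form. -/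
lemma exists_induces_translate {nabla nabla' : Connection f.Fpos}
    {ω : ∀ U : EtAff p X, f.FormPos U} (hω : ω ∈ f.forms) (h : f.IsTranslate ω nabla nabla')
    {nablaG : Connection f.F} (hG : nabla.Induces f.posF nablaG)
    (η : ∀ U : EtAff p X, U.Vect → H →ₗ[ZMod p] f.F.fn U)
    (hη : ∀ U D, η U D ∈ adjointBundle (AlgHom.id (ZMod p) H) f.F U)
    (hpos : ∀ U D x, f.posF.map U (η U D x) = f.posM.map U ((ω U D).1 x)) :
    ∃ nablaG' : Connection f.F, nabla'.Induces f.posF nablaG' ∧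
      ∀ U D b, nablaG'.lift U D b = nablaG.lift U D b + f.F.vert U (η U D) b := by
  -- The sections `η U D` are given one by one. Linearity in `D` and compatibility with restriction
  -- follow because their restrictions to `F⁺` determine them.
  have hadd : ∀ U (D D' : U.Vect), η U (D + D') = η U D + η U D' := fun U D D' =>
    adjointBundle_ext (hη U _) (add_mem (hη U D) (hη U D')) fun x => by
      have h1 : (ω U (D + D')).1 x = (ω U D).1 x + (ω U D').1 x := by rw [map_add]; rfl
      rw [hpos, h1, map_add, LinearMap.add_apply, map_add, hpos, hpos]
  have hsmul : ∀ U (r : U.R) (D : U.Vect), η U (r • D) = r • η U D := fun U r D =>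
    adjointBundle_ext (hη U _) (Submodule.smul_mem _ r (hη U D)) fun x => by
      rw [hpos, map_smul, LinearMap.smul_apply]
      have h1 := map_smul (f.posF.alg U) r (η U D x)
      have h2 := map_smul (f.posM.alg U) r ((ω U D).1 x)
      simp only [TorsorHom.alg_apply] at h1 h2
      rw [h1, hpos, ← h2]
      rfl
  have hres : ∀ {U V : EtAff p X} (φ : U.Res V) (D : U.Vect) (D' : V.Vect), φ.Related D D' →
      η V D' = (f.F.res φ).toLinearMap ∘ₗ η U D := fun {U V} φ D D' hD =>
    adjointBundle_ext (hη V _) (res_mem_adjointBundle φ (hη U D)) fun x => by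
      rw [hpos, LinearMap.comp_apply, AlgHom.toLinearMap_apply, f.posF.map_res, hpos,
        ← f.posM.map_res, hω U V φ D D' hD]
  refine ⟨{
    lift := fun U =>
      { toFun := fun D => nablaG.lift U D + Torsor.vertDer (η U D) (isPointDer_of_mem (hη U D))
        map_add' := fun D D' => by
          ext b
          simp only [map_add, Derivation.add_apply, Torsor.vertDer_apply, hadd, Torsor.vert,
            act_add_right, LinearMap.add_apply]
          abel
        map_smul' := fun r D => by
          ext b
          simp only [map_smul, Derivation.add_apply, Torsor.vertDer_apply, hsmul, Torsor.vert,
            act_smul_right, LinearMap.smul_apply, Derivation.smul_apply, RingHom.id_apply,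
            smul_add] }
    lift_algebraMap := fun U D r => ?_
    invariant := fun U D b => ?_
    lift_res := fun {U V} φ D D' hD b => ?_ }, fun U D b => ?_, fun U D b => rfl⟩
  · change nablaG.lift U D _ + f.F.vert U _ _ = _
    rw [nablaG.lift_algebraMap, Torsor.vert_algebraMap _ (isPointDer_of_mem (hη U D)), add_zero]
  · change f.F.coact U (nablaG.lift U D b + f.F.vert U (η U D) b) =
      ((nablaG.lift U D : f.F.fn U →ₗ[ZMod p] f.F.fn U) + f.F.vert U (η U D)).rTensor _ _
    rw [map_add, nablaG.invariant, isInv_of_mem (hη U D), LinearMap.rTensor_add,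
      LinearMap.add_apply]
  · change nablaG.lift V D' _ + f.F.vert V (η V D') _ =
      f.F.res φ (nablaG.lift U D b + f.F.vert U (η U D) b)
    rw [map_add, nablaG.lift_res φ D D' hD]
    congr 1
    have h2 := act_comp (ρ' := f.F.co U) (f.F.co V) (f.F.res φ).toLinearMap LinearMap.id
      (f.F.res_coact φ) LinearMap.id (η V D')
    have h3 := comp_act (f.F.co U) (f.F.res φ) LinearMap.id (η U D)
    rw [← hres φ D D' hD] at h3
    exact (LinearMap.congr_fun h2 b).trans (LinearMap.congr_fun h3 b).symm
  · change f.posF.map U (nablaG.lift U D b + f.F.vert U (η U D) b) = _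
    rw [map_add, hG, vert_posF (hpos U D), h]

/-! ### The Kodaira-Spencer form -/

/-- The operator in the definition of the Kodaira-Spencer form. -/
lemma negF_vert_eq (hμ : μ.OneBounded) {η : H →ₗ[ZMod p] f.F.fn U} (hη : IsLie η) {κ : f.gNeg U}
    (hκ : ∀ h, f.negM.map U (κ.1 h) = f.negF.map U (η (GradedAlgebra.proj μ.deg 1 h)))
    {b : f.F.fn U} (hb : f.negF.map U b = 0) :
    f.negF.map U (f.F.vert U η b) = LinearMap.mul' (ZMod p) (f.Fneg.fn U)
      (TensorProduct.map (f.negF.map U).toLinearMap ((f.negM.map U).toLinearMap ∘ₗ κ.1)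
        (f.F.coact U b)) := by
  -- The difference between `η` and its projection to weight one is tangent to `P⁻`, so it does not
  -- see functions vanishing on `F⁻`.
  let ζ : H →ₗ[ZMod p] f.Fneg.fn U :=
    (f.negF.map U).toLinearMap ∘ₗ η - (f.negM.map U).toLinearMap ∘ₗ κ.1
  have hLie : IsLie ζ := by
    intro x y
    have h1 := (hη.comp (f.negF.map U).toLinearMap) x y
    have h2 := (κ.2.1.1.comp (f.negM.map U).toLinearMap) x y
    simp only [ζ, LinearMap.sub_apply, h1, h2, smul_sub]
    abel
  have hζ : ∀ x ∈ μ.ideal .neg, ζ x = 0 := by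
    -- Degree `1` cancels by the choice of `κ`, and higher degrees by 1-boundedness.
    have h0 : ∀ i : ℤ, 0 < i → ∀ x ∈ μ.deg i, ζ x = 0 := by
      intro i hi x hx
      by_cases h1 : i = 1
      · subst h1
        simp only [ζ, LinearMap.sub_apply, LinearMap.comp_apply, AlgHom.toLinearMap_apply, hκ]
        rw [μ.prj_same hx, sub_self]
      · exact hμ.eq_zero hLie (by omega) hx
    intro x hx
    have hε : ∀ x ∈ μ.ideal .neg, Coalgebra.counit (R := ZMod p) x = 0 := fun x hx => by
      rw [← μ.counit_restrict .neg, show μ.restrict .neg x = 0 from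
        Ideal.Quotient.eq_zero_iff_mem.2 hx, map_zero]
    refine Submodule.span_induction (p := fun x _ => ζ x = 0) ?_ (map_zero _) ?_ ?_ hx
    · rintro x ⟨i, hi, hx⟩
      exact h0 i hi x hx
    · intro x y _ _ h1 h2
      rw [map_add, h1, h2, add_zero]
    · intro a x hx h1
      rw [smul_eq_mul, hLie, h1, hε x hx, smul_zero, zero_smul, add_zero]
  obtain ⟨ζ', hζ'⟩ := IsSubgroup.exists_comp_eq (hc := isSubgroup_restrict μ .neg) ζ
    (fun x hx => hζ x (Ideal.Quotient.eq_zero_iff_mem.1 hx))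
  have h1 := act_comp (ρ' := f.F.co U) (f.Fneg.co U) (f.negF.map U).toLinearMap
    (μ.restrict .neg).toLinearMap (f.negF.map_coact U) LinearMap.id ζ'
  rw [hζ', LinearMap.id_comp, act_sub_right] at h1
  have h2 := LinearMap.congr_fun h1 b
  rw [LinearMap.comp_apply, AlgHom.toLinearMap_apply, hb, map_zero, LinearMap.sub_apply] at h2
  have h3 := LinearMap.congr_fun (comp_act (f.F.co U) (f.negF.map U) LinearMap.id η) b
  exact h3.trans (sub_eq_zero.1 h2.symm)

/-- Adding a vertical field changes the Kodaira-Spencer form by the projection of that field, which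
is the source of `φ̃(ω)`. -/
lemma IsNormal.add_vert (hμ : μ.OneBounded) {Y Y' : Derivation (ZMod p) (f.F.fn U) (f.F.fn U)}
    {κ κ' : f.gNeg U} (h : f.IsNormal Y κ) {η : H →ₗ[ZMod p] f.F.fn U} (hη : IsLie η)
    (hκ' : ∀ h, f.negM.map U (κ'.1 h) = f.negF.map U (η (GradedAlgebra.proj μ.deg 1 h)))
    (hY : ∀ b, Y' b = Y b + f.F.vert U η b) : f.IsNormal Y' (κ + κ') := by
  intro b hb
  have h1 : (f.negM.map U).toLinearMap ∘ₗ (κ + κ' : f.gNeg U).1 =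
      (f.negM.map U).toLinearMap ∘ₗ κ.1 + (f.negM.map U).toLinearMap ∘ₗ κ'.1 := by
    rw [← LinearMap.comp_add]; rfl
  rw [hY, map_add, h b hb, negF_vert_eq hμ hη hκ' hb, h1, TensorProduct.map_add_right,
    LinearMap.add_apply, map_add]

/-- The set of admissible connections is stable under translations by the group. -/
theorem exists_translate (hμ : μ.OneBounded) {nabla : Connection f.Fpos}
    (hn : nabla ∈ f.admissible) {ω : ∀ U : EtAff p X, f.FormPos U} (hω : ω ∈ f.group) :
    ∃ nabla' ∈ f.admissible, f.IsTranslate ω nabla nabla' := by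
  obtain ⟨⟨nablaM, hM1, hM2⟩, h_int, hKatz⟩ := hn
  obtain ⟨hω1, hω2⟩ := hω
  choose β hβ1 hβ2 using hω2
  choose η hη1 hη2 hη3 using hβ1
  let nabla' := translate hμ nabla ω hω1
  have htr : f.IsTranslate ω nabla nabla' := isTranslate_translate hμ nabla ω hω1
  refine ⟨nabla', ⟨⟨nablaM, fun U D b => ?_, hM2⟩, fun U D₁ D₂ => ?_, fun U D => ?_⟩, htr⟩
  · rw [htr, vertical_posM, add_zero, hM1]
  · obtain ⟨ι, _, w, α, γ, h1, -, h3, -⟩ := exists_of_mem_cartierTwisted (hβ2 U)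
    exact integrable_translate hμ hM1 hM2 (h_int U D₁ D₂) w α h1 fun D b => by rw [htr, h3]
  · obtain ⟨κ, ⟨nablaG, hG, hκ⟩, hp⟩ := hKatz U D
    obtain ⟨nablaG', hG', hlift⟩ := exists_induces_translate hω1 htr hG η hη1 hη2
    obtain ⟨ι, _, w, α, γ, -, h2, h3, h4⟩ := exists_of_mem_cartierTwisted (hβ2 U)
    -- Here `β` is both `φ̃(ω)`, the change of the Kodaira-Spencer form, and `C̃(ω)`, the negative
    -- of the change of the `p`-curvature.
    refine ⟨κ + β U D, ⟨nablaG', hG', hκ.add_vert hμ (hη1 U D).1 (hη3 U D) (hlift U D)⟩,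
      fun b => ?_⟩
    rw [pCurv_translate hμ hM1 hM2 w α γ h2 (fun D b => by rw [htr, h3]) D b, hp, ← h4,
      frobPull_add, vertical_add, LinearMap.add_apply]
    abel

end Disp

/-! ### The difference of two admissible connections -/

lemma EtAff.smooth_algebra {p : ℕ} {X : Scheme.{0}} (s : X ⟶ Spec (CommRingCat.of (ZMod p)))
    [Smooth s] (U : EtAff p X) : Algebra.Smooth (ZMod p) U.R := by
  obtain ⟨φ, hφ⟩ := Spec.map_surjective (U.pt ≫ s)
  have h1 : Smooth (Spec.map φ) := by rw [hφ]; infer_instance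
  rw [HasRingHomProperty.Spec_iff (P := @Smooth)] at h1
  have h2 : φ.hom = algebraMap (ZMod p) U.R := RingHom.ext_zmod _ _
  rw [h2] at h1
  exact (RingHom.smooth_algebraMap (R := ZMod p) (S := U.R)).1 h1

namespace Torsor

variable {p : ℕ} [Fact p.Prime] {K : Type} [CommRing K]
  [Bialgebra (ZMod p) K] {X : Scheme.{0}} (E : Torsor p K X) (U : EtAff p X)

/-- The map `t ↦ ∑ e(t₍₀₎) g(t₍₁₎)` is linear over the base. -/
def actLin {B : Type} [CommRing B] [Algebra (ZMod p) B] [Algebra U.R B]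
    (e : E.fn U →ₐ[ZMod p] B) (he : ∀ r, e (algebraMap U.R _ r) = algebraMap U.R B r)
    (g : K →ₗ[ZMod p] B) : E.fn U →ₗ[U.R] B where
  toFun := act (E.co U) e.toLinearMap g
  map_add' := map_add _
  map_smul' r b := by
    have h1 : E.coact U (r • b) = algebraMap U.R _ r ⊗ₜ 1 * E.coact U b := by
      rw [map_smul, Algebra.smul_def]
      rfl
    have h2 : act (E.co U) e.toLinearMap g (r • b) = LinearMap.mul' (ZMod p) B
      (TensorProduct.map e.toLinearMap g (E.coact U (r • b))) := rfl
    rw [h2, h1, E.mul'_map_mul U e g, he, RingHom.id_apply, Algebra.smul_def]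
    rfl

variable {E U}

lemma isInv_sub {f g : E.fn U →ₗ[ZMod p] E.fn U} (hf : E.IsInv U f) (hg : E.IsInv U g) :
    E.IsInv U (f - g) := fun b => by
  rw [LinearMap.sub_apply, map_sub, hf, hg, LinearMap.rTensor_sub, LinearMap.sub_apply]

end Torsor

namespace Disp

variable {p : ℕ} [Fact p.Prime] {H : Type} [CommRing H] [HopfAlgebra (ZMod p) H]
  {μ : GmAction p H} {X : Scheme.{0}} {f : Disp μ X} {U : EtAff p X}

/-- The difference is a vertical field that kills all functions pulled back by Frobenius. Along the
point given by this pullback its functional can be cancelled, so it is zero. -/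
lemma isFrobenius_unique {nabla nabla' : Connection f.Mpos} (h : nabla.IsFrobenius f.frob)
    (h' : nabla'.IsFrobenius f.frob) (D : U.Vect) (b : f.Mpos.fn U) :
    nabla'.lift U D b = nabla.lift U D b := by
  let Z := nabla'.lift U D - nabla.lift U D
  obtain ⟨ζ, h1, -⟩ := Torsor.exists_vert_eq_derivation (isSubgroup_restrict μ .levi) Z
    (Torsor.isInv_sub (isInv_lift nabla' D) (isInv_lift nabla D)) (fun r => by
      rw [Derivation.sub_apply, nabla.lift_algebraMap, nabla'.lift_algebraMap, sub_self])
  have h2 := act_comp (ρ' := f.Mneg.co U) (f.Mpos.co U) (f.frob.map U).toLinearMap LinearMap.id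
    (f.frob.map_coact U) LinearMap.id ζ
  have h3 : ζ = 0 := by
    apply f.Mneg.act_eq_zero U (f.frob.map U)
    refine h2.symm.trans (LinearMap.ext fun b => ?_)
    refine (LinearMap.congr_fun h1 _).symm.trans ?_
    change nabla'.lift U D (f.frob.map U b) - nabla.lift U D (f.frob.map U b) = 0
    rw [h, h', sub_zero]
  have h4 := LinearMap.congr_fun h1 b
  rw [h3, Torsor.vert, act_zero_right] at h4
  exact sub_eq_zero.1 h4

/-- The form with values in `(𝔤₁)_{F⁺}` that is the difference of two connections. -/
lemma exists_forms_isTranslate (hμ : μ.OneBounded) {nabla nabla' : Connection f.Fpos}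
    (h : f.IsCompatible nabla) (h' : f.IsCompatible nabla') :
    ∃ ω ∈ f.forms, f.IsTranslate ω nabla nabla' := by
  obtain ⟨nablaM, hM, hF⟩ := h
  obtain ⟨nablaM', hM', hF'⟩ := h'
  have h1 : ∀ (U : EtAff p X) (D : U.Vect), ∃ ξ : f.gPos U, ∀ b,
      (nabla'.lift U D - nabla.lift U D) b = f.vertical ξ b := fun U D => by
    refine f.exists_vertical_eq hμ _
      (Torsor.isInv_sub (isInv_lift nabla' D) (isInv_lift nabla D)) (fun r => ?_) fun b => ?_
    · rw [Derivation.sub_apply, nabla.lift_algebraMap, nabla'.lift_algebraMap, sub_self]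
    · rw [Derivation.sub_apply, ← hM, ← hM', isFrobenius_unique hF hF', sub_self]
  choose ω hω using h1
  have h2 : ∀ (U : EtAff p X) (D : U.Vect) b,
      nabla'.lift U D b = nabla.lift U D b + f.vertical (ω U D) b := fun U D b => by
    rw [← hω, Derivation.sub_apply]; ring
  -- The values `ω U D` are chosen separately; linearity in `D` comes from the injectivity of
  -- `vertical`.
  refine ⟨fun U => {
    toFun := ω U
    map_add' := fun D D' => f.vertical_injective (LinearMap.ext fun b => ?_)
    map_smul' := fun r D => f.vertical_injective (LinearMap.ext fun b => ?_) }, ?_, h2⟩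
  · rw [vertical_add, LinearMap.add_apply, ← hω, ← hω, ← hω, map_add, map_add]
    simp only [Derivation.sub_apply, Derivation.add_apply]
    ring
  · rw [RingHom.id_apply, vertical_smul, LinearMap.smul_apply, ← hω, ← hω, map_smul, map_smul]
    simp only [Derivation.sub_apply, Derivation.smul_apply, smul_sub]
  · intro U V φ D D' hD h
    have h3 : f.zeta (ω V D') = (f.Fpos.res φ).toLinearMap ∘ₗ f.zeta (ω U D) := by
      apply f.Fpos.act_cancel U (f.Fpos.res φ)
      have h4 := act_comp (ρ' := f.Fpos.co U) (f.Fpos.co V) (f.Fpos.res φ).toLinearMap LinearMap.id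
        (f.Fpos.res_coact φ) LinearMap.id (f.zeta (ω V D'))
      have h5 := comp_act (f.Fpos.co U) (f.Fpos.res φ) LinearMap.id (f.zeta (ω U D))
      refine h4.symm.trans (Eq.trans (LinearMap.ext fun b => ?_) h5)
      change f.vertical (ω V D') (f.Fpos.res φ b) = f.Fpos.res φ (f.vertical (ω U D) b)
      rw [← hω, ← hω, Derivation.sub_apply, Derivation.sub_apply, nabla.lift_res φ D D' hD,
        nabla'.lift_res φ D D' hD, map_sub]
    apply f.posM_injective V
    rw [f.posM.map_res]
    exact LinearMap.congr_fun h3 (μ.restrict .pos h)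

/-- A dual basis of `(𝔤₁)_{F⁺}` that is compatible with the Frobenius descent. -/
lemma exists_linear_dual_basis [Algebra.FiniteType (ZMod p) H] (f : Disp μ X) (U : EtAff p X) :
    ∃ (ι : Type) (_ : Fintype ι) (w : ι → f.gNeg U) (c : ι → f.gPos U →ₗ[U.R] U.R)
      (n : ι → ι → U.R), (∀ b a, c b (f.frobPull (w a)) = n b a ^ p) ∧
      ∀ ξ, ξ = ∑ a, c a ξ • f.frobPull (w a) := by
  obtain ⟨n, b, ι, _, w, l, cN, cP, hcN, hcP, -, hP⟩ := f.exists_dual_basis U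
  refine ⟨ι, inferInstance, w, fun a =>
    { toFun := cP a
      map_add' := fun ξ ξ' => f.Mpos.algebraMap_injective U ?_
      map_smul' := fun r ξ => f.Mpos.algebraMap_injective U ?_ }, fun a b => cN a (w b), ?_, hP⟩
  · rw [map_add, hcP, hcP, hcP, ← Finset.sum_add_distrib]
    refine Finset.sum_congr rfl fun j _ => ?_
    rw [← mul_add]
    rfl
  · rw [RingHom.id_apply, smul_eq_mul, map_mul, hcP, hcP, Finset.mul_sum]
    refine Finset.sum_congr rfl fun j _ => ?_
    rw [mul_left_comm, ← Algebra.smul_def]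
    rfl
  · intro a b
    apply f.Mpos.algebraMap_injective U
    change algebraMap _ _ (cP a _) = _
    rw [hcP, ← f.frob.map_algebraMap, hcN, map_sum]
    exact Finset.sum_congr rfl fun j _ => by rw [map_mul, frobPull_apply]

/-- Every linear functional on vector fields comes from a one-form. -/
lemma exists_pair_eq [Algebra.Smooth (ZMod p) U.R] (L : U.Vect →ₗ[U.R] U.R) :
    ∃ α : Ω[U.R⁄ZMod p], pair α = L := by
  obtain ⟨n, e, E, he⟩ := exists_dual_basis_kaehler (p := p) (R := U.R)
  have h0 : ∀ D : U.Vect, D = ∑ i, D.liftKaehlerDifferential (e i) • E i := by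
    intro D
    ext r
    have h1 := congrArg D.liftKaehlerDifferential (he (KaehlerDifferential.D (ZMod p) U.R r))
    rw [Derivation.liftKaehlerDifferential_comp_D, map_sum] at h1
    rw [h1, derivation_sum_apply]
    refine Finset.sum_congr rfl fun i _ => ?_
    rw [map_smul, Derivation.smul_apply, Derivation.liftKaehlerDifferential_comp_D, smul_eq_mul,
      smul_eq_mul, mul_comm]
  refine ⟨∑ i, L (E i) • e i, LinearMap.ext fun D => ?_⟩
  have h2 : pair (∑ i, L (E i) • e i) D =
      D.liftKaehlerDifferential (∑ i, L (E i) • e i) := rfl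
  rw [h2, map_sum]
  conv_rhs => rw [h0 D, map_sum]
  refine Finset.sum_congr rfl fun i _ => ?_
  rw [map_smul, map_smul, smul_eq_mul, smul_eq_mul, mul_comm]

/-- The difference of two integrable connections lies in the domain of the Cartier operator. -/
lemma exists_mem_cartierTwisted [Algebra.FiniteType (ZMod p) H] [Algebra.Smooth (ZMod p) U.R]
    (hμ : μ.OneBounded) {nabla nabla' : Connection f.Fpos} {nablaM : Connection f.Mpos}
    (h1 : nabla.Induces f.posM nablaM) (h2 : nablaM.IsFrobenius f.frob) (hi : nabla.Integrable)
    (hi' : nabla'.Integrable) (ω : f.FormPos U)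
    (hω : ∀ (D : U.Vect) b, nabla'.lift U D b = nabla.lift U D b + f.vertical (ω D) b) :
    ∃ β, (ω, β) ∈ f.cartierTwisted U := by
  obtain ⟨ι, _, w, c, n, hn, hP⟩ := f.exists_linear_dual_basis U
  have hclosed : ∀ (D₁ D₂ : U.Vect) a,
      c a (ω ⁅D₁, D₂⁆) + D₂ (c a (ω D₁)) = D₁ (c a (ω D₂)) := by
    intro D₁ D₂ a
    -- Subtracting the two integrability conditions and using that the vertical fields commute
    -- leaves the closedness of `ω`, expressed in generators.
    have h3 : ω ⁅D₁, D₂⁆ + ∑ a, D₂ (c a (ω D₁)) • f.frobPull (w a) =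
        ∑ a, D₁ (c a (ω D₂)) • f.frobPull (w a) := by
      refine f.vertical_injective (LinearMap.ext fun b => ?_)
      have h4 := congrArg (fun Z => Z b) (hi' U D₁ D₂)
      have h5 := congrArg (fun Z => Z b) (hi U D₁ D₂)
      simp only [Derivation.commutator_apply, hω, map_add] at h4 h5
      have h6 := commutator_vertical h1 h2 D₁ (fun a => c a (ω D₂)) w b
      have h7 := commutator_vertical h1 h2 D₂ (fun a => c a (ω D₁)) w b
      have h8 := f.vertical_commute hμ (ω D₁) (ω D₂) b
      rw [← hP] at h6 h7
      rw [vertical_add, LinearMap.add_apply]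
      linear_combination h4 - h5 + h6 - h7 + h8
    -- The `frobPull (w b)` only generate the bundle, but the matrix `c a (frobPull (w b))` consists
    -- of `p`-th powers. Hence taking coordinates commutes with differentiating coefficients.
    have h9 : ∀ (D : U.Vect) (ξ : f.gPos U), c a (∑ b, D (c b ξ) • f.frobPull (w b)) =
        D (c a ξ) := by
      intro D ξ
      conv_rhs => rw [hP ξ, map_sum, map_sum]
      rw [map_sum]
      refine Finset.sum_congr rfl fun b _ => ?_
      rw [map_smul, map_smul, hn, smul_eq_mul, smul_eq_mul, Derivation.leibniz,
        derivation_pow_apply_pow, smul_zero, zero_add, smul_eq_mul, mul_comm]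
    have h10 := congrArg (c a) h3
    rwa [map_add, h9, h9] at h10
  have h3 : ∀ a, ∃ α : Ω[U.R⁄ZMod p], pair α = c a ∘ₗ ω := fun a => exists_pair_eq _
  choose α hα using h3
  have h4 : ∀ a, IsClosedForm (α a) := by
    intro a D₁ D₂
    rw [hα]
    have := hclosed D₁ D₂ a
    simp only [LinearMap.comp_apply]
    linear_combination -this
  have h5 : ∀ a, ∃ β, (α a, β) ∈ cartier U := fun a => exists_mem_cartierGraph (h4 a)
  choose γ hγ using h5
  refine ⟨∑ a, (pair (γ a)).smulRight (w a), ?_⟩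
  have h6 : (ω, ∑ a, (pair (γ a)).smulRight (w a)) =
      ∑ a, ((pair (α a)).smulRight (f.frobPull (w a)), (pair (γ a)).smulRight (w a)) := by
    rw [Prod.ext_iff, Prod.fst_sum, Prod.snd_sum]
    refine ⟨LinearMap.ext fun D => ?_, rfl⟩
    rw [hP (ω D), LinearMap.sum_apply]
    refine Finset.sum_congr rfl fun a _ => ?_
    rw [LinearMap.smulRight_apply, hα]
    rfl
  rw [h6]
  exact sum_mem fun a _ => AddSubgroup.subset_closure ⟨w a, α a, γ a, h4 a, hγ a, rfl⟩

/-- The normal component determines the part of weight one. -/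
lemma negM_eq_of_normal {η : H →ₗ[ZMod p] f.F.fn U} {κ : f.gNeg U}
    (h : ∀ b, f.negF.map U b = 0 → f.negF.map U (f.F.vert U η b) =
      LinearMap.mul' (ZMod p) (f.Fneg.fn U) (TensorProduct.map (f.negF.map U).toLinearMap
        ((f.negM.map U).toLinearMap ∘ₗ κ.1) (f.F.coact U b))) (x : H) :
    f.negM.map U (κ.1 x) = f.negF.map U (η (GradedAlgebra.proj μ.deg 1 x)) := by
  let ζ : H →ₗ[ZMod p] f.Fneg.fn U :=
    (f.negF.map U).toLinearMap ∘ₗ η - (f.negM.map U).toLinearMap ∘ₗ κ.1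
  let δ₀ := f.F.actLin U (f.negF.map U) (f.negF.map_algebraMap U) ζ
  have hsurj : Function.Surjective (f.negF.alg U).toLinearMap :=
    f.negF.map_surjective U (μ.restrict_surjective .neg)
  -- Hence `δ₀` descends to functions on `F⁻` and is given by a functional on `P⁻`. So `ζ` factors
  -- through `P⁻`, on which functions of degree `1` vanish.
  have h0 : ∀ b, f.negF.map U b = 0 → δ₀ b = 0 := by
    intro b hb
    change act (f.F.co U) (f.negF.map U).toLinearMap ζ b = 0
    rw [act_sub_right, LinearMap.sub_apply, sub_eq_zero]
    have h1 := LinearMap.congr_fun (comp_act (f.F.co U) (f.negF.map U) LinearMap.id η) b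
    exact h1.symm.trans (h b hb)
  let e := (f.negF.alg U).toLinearMap.quotKerEquivOfSurjective hsurj
  let δ : f.Fneg.fn U →ₗ[U.R] f.Fneg.fn U :=
    (LinearMap.ker (f.negF.alg U).toLinearMap).liftQ δ₀ (fun b hb => h0 b hb) ∘ₗ e.symm.toLinearMap
  have hδ : ∀ b, δ (f.negF.map U b) = δ₀ b := by
    intro b
    have h1 : e.symm (f.negF.map U b) = Submodule.Quotient.mk b := by
      rw [LinearEquiv.symm_apply_eq]; rfl
    rw [LinearMap.comp_apply, LinearEquiv.coe_coe, h1]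
    exact Submodule.liftQ_apply _ _ _
  obtain ⟨g, hg⟩ := Torsor.exists_vert_eq δ
  have h1 : ζ = g ∘ₗ (μ.restrict .neg).toLinearMap := by
    apply f.F.act_cancel U (f.negF.map U)
    have h2 := act_comp (ρ' := f.F.co U) (f.Fneg.co U) (f.negF.map U).toLinearMap
      (μ.restrict .neg).toLinearMap (f.negF.map_coact U) LinearMap.id g
    refine Eq.trans (LinearMap.ext fun b => ?_) h2
    exact (hδ b).symm.trans (LinearMap.congr_fun hg (f.negF.map U b)).symm
  have h2 : ζ (μ.prj 1 x) = 0 := by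
    rw [h1, LinearMap.comp_apply, AlgHom.toLinearMap_apply,
      μ.restrict_eq_zero .neg (i := 1) (by simp [Part.killed]) (μ.prj_mem 1 x),
      map_zero]
  have h3 : κ.1 (μ.prj 1 x) = κ.1 x := κ.2.2.map_prj μ x
  rw [← h3]
  exact (sub_eq_zero.1 h2).symm

/-- The change of the Kodaira-Spencer form. -/
lemma isPhi_of_isNormal {nabla nabla' : Connection f.Fpos} {nablaG nablaG' : Connection f.F}
    (hG : nabla.Induces f.posF nablaG) (hG' : nabla'.Induces f.posF nablaG') {D : U.Vect}
    {ξ : f.gPos U} (hξ : ∀ b, nabla'.lift U D b = nabla.lift U D b + f.vertical ξ b)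
    {κ κ' β : f.gNeg U} (hκ : f.IsNormal (nablaG.lift U D) κ)
    (hκ' : f.IsNormal (nablaG'.lift U D) κ') (hβ : κ' = κ + β) : f.IsPhi ξ β := by
  let Z := nablaG'.lift U D - nablaG.lift U D
  obtain ⟨η, h1, h2⟩ := Torsor.exists_vert_eq_derivation isSubgroup_id Z
    (Torsor.isInv_sub (isInv_lift nablaG' D) (isInv_lift nablaG D)) (fun r => by
      rw [Derivation.sub_apply, nablaG.lift_algebraMap, nablaG'.lift_algebraMap, sub_self])
  have hη : ∀ b, f.F.vert U η b = nablaG'.lift U D b - nablaG.lift U D b := fun b =>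
    (LinearMap.congr_fun h1 b).symm
  refine ⟨η, h2, ?_, negM_eq_of_normal fun b hb => ?_⟩
  · have h3 : (f.posF.map U).toLinearMap ∘ₗ η = (f.posM.map U).toLinearMap ∘ₗ ξ.1 := by
      apply f.F.act_cancel U (f.posF.map U)
      have h4 := act_comp (ρ' := f.F.co U) (f.Fpos.co U) (f.posF.map U).toLinearMap
        (μ.restrict .pos).toLinearMap (f.posF.map_coact U) LinearMap.id (f.zeta ξ)
      have h5 := comp_act (f.F.co U) (f.posF.map U) LinearMap.id η
      refine h5.symm.trans (Eq.trans (LinearMap.ext fun b => ?_) h4)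
      change f.posF.map U (f.F.vert U η b) = f.vertical ξ (f.posF.map U b)
      rw [hη, map_sub, hG, hG', hξ, add_sub_cancel_left]
    exact LinearMap.congr_fun h3
  · have h4 : (f.negM.map U).toLinearMap ∘ₗ κ'.1 =
      (f.negM.map U).toLinearMap ∘ₗ κ.1 + (f.negM.map U).toLinearMap ∘ₗ β.1 := by
      rw [← LinearMap.comp_add, hβ]; rfl
    rw [hη, map_sub, hκ b hb, hκ' b hb, h4, TensorProduct.map_add_right, LinearMap.add_apply,
      map_add, add_sub_cancel_left]

/-- Two admissible connections differ by a unique element of the group. -/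
theorem existsUnique_isTranslate [Algebra.FiniteType (ZMod p) H] (hμ : μ.OneBounded)
    (hX : ∀ U : EtAff p X, Algebra.Smooth (ZMod p) U.R) {nabla nabla' : Connection f.Fpos}
    (hn : nabla ∈ f.admissible) (hn' : nabla' ∈ f.admissible) :
    ∃! ω, ω ∈ f.group ∧ f.IsTranslate ω nabla nabla' := by
  obtain ⟨hc, hi, hK⟩ := hn
  obtain ⟨hc', hi', hK'⟩ := hn'
  obtain ⟨ω, hω, htr⟩ := exists_forms_isTranslate hμ hc hc'
  obtain ⟨nablaM, hM1, hM2⟩ := hc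
  refine ⟨ω, ⟨⟨hω, fun U => ?_⟩, htr⟩, fun ω' h => ?_⟩
  · have := hX U
    have := isReduced_of_smooth (p := p) (R := U.R)
    obtain ⟨β, hβ⟩ := exists_mem_cartierTwisted hμ hM1 hM2 hi hi' (ω U) (htr U)
    refine ⟨β, fun D => ?_, hβ⟩
    obtain ⟨ι, _, w, α, γ, -, h2, h3, h4⟩ := exists_of_mem_cartierTwisted hβ
    obtain ⟨κ, ⟨nablaG, hG, hκ⟩, hp⟩ := hK U D
    obtain ⟨κ', ⟨nablaG', hG', hκ'⟩, hp'⟩ := hK' U D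
    refine isPhi_of_isNormal hG hG' (htr U D) hκ hκ' ?_
    -- The Katz conditions and the change of `p`-curvature give `κ' = κ + β` only after Frobenius
    -- pullback. Reducedness removes the pullback.
    apply f.frobPull_injective
    refine f.vertical_injective (LinearMap.ext fun b => ?_)
    have h5 := pCurv_translate hμ hM1 hM2 w α γ h2 (fun D b => by rw [htr, h3]) D b
    rw [hp, hp', ← h4] at h5
    rw [frobPull_add, vertical_add, LinearMap.add_apply]
    linear_combination -h5
  · funext U
    refine LinearMap.ext fun D => f.vertical_injective (LinearMap.ext fun b => ?_)
    have h1 := h.2 U D b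
    rw [htr] at h1
    exact (add_left_cancel h1).symm

end Disp

/-! ### Trivializations of torsors -/

section

variable {p : ℕ} {K : Type} [CommRing K] [Bialgebra (ZMod p) K]

/-- An antipode. -/
structure IsAntip (S : K →ₐ[ZMod p] K) : Prop where
  left : conv S.toLinearMap (AlgHom.id (ZMod p) K).toLinearMap = convOne p K K
  right : conv (AlgHom.id (ZMod p) K).toLinearMap S.toLinearMap = convOne p K K

variable {S : K →ₐ[ZMod p] K} (hS : IsAntip S) {B : Type} [CommRing B] [Algebra (ZMod p) B]

lemma IsAntip.conv_left {hS : IsAntip S} (g : K →ₐ[ZMod p] B) :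
    conv (g.comp S).toLinearMap g.toLinearMap = convOne p K B := by
  rw [← comp_convOne g, ← hS.left, comp_act]
  rfl

lemma IsAntip.conv_right {hS : IsAntip S} (g : K →ₐ[ZMod p] B) :
    conv g.toLinearMap (g.comp S).toLinearMap = convOne p K B := by
  rw [← comp_convOne g, ← hS.right, comp_act]
  rfl

end

lemma isAntip_coordAntip {p : ℕ} {H : Type} [CommRing H] [HopfAlgebra (ZMod p) H]
    (μ : GmAction p H) (P : Part) : IsAntip (μ.coordAntip P) :=
  ⟨μ.conv_coordAntip_left P (AlgHom.id _ _), μ.conv_coordAntip_right P (AlgHom.id _ _)⟩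

lemma isAntip_antip {p : ℕ} {H : Type} [CommRing H] [HopfAlgebra (ZMod p) H] :
    IsAntip (antip p H) :=
  ⟨conv_antip_left (AlgHom.id _ _), conv_antip_right (AlgHom.id _ _)⟩

namespace Torsor

variable {p : ℕ} [Fact p.Prime] {K K' : Type} [CommRing K] [Bialgebra (ZMod p) K] [CommRing K']
  [Bialgebra (ZMod p) K'] {X : Scheme.{0}} (E : Torsor p K X) {U V : EtAff p X}

/-- The functions that come from the base. -/
def base (U : EtAff p X) : U.R →ₐ[ZMod p] E.fn U := IsScalarTower.toAlgHom (ZMod p) U.R (E.fn U)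

/-- An equivariant map from `E` to the group, that is, a trivialization of `E`. -/
def IsTriv (J : K →ₐ[ZMod p] E.fn U) : Prop :=
  ∀ k, E.coact U (J k) =
    TensorProduct.map J.toLinearMap LinearMap.id (Coalgebra.comul (R := ZMod p) k)

variable {E}

lemma isTriv_iff {J : K →ₐ[ZMod p] E.fn U} : E.IsTriv J ↔ E.co U ∘ₗ J.toLinearMap =
    conv ((Algebra.TensorProduct.includeLeft : E.fn U →ₐ[ZMod p] E.fn U ⊗[ZMod p] K).toLinearMap ∘ₗ
      J.toLinearMap) Algebra.TensorProduct.includeRight.toLinearMap := by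
  have h1 := act_map (Coalgebra.comul (R := ZMod p) (A := K)) J.toLinearMap
    (LinearMap.id : K →ₗ[ZMod p] K)
  rw [LinearMap.comp_id] at h1
  rw [conv, h1]
  exact ⟨fun h => LinearMap.ext h, fun h => LinearMap.congr_fun h⟩

lemma coact_comp_base :
    E.co U ∘ₗ (E.base U).toLinearMap = (Algebra.TensorProduct.includeLeft :
      E.fn U →ₐ[ZMod p] E.fn U ⊗[ZMod p] K).toLinearMap ∘ₗ (E.base U).toLinearMap := by
  ext r
  exact (E.coact U).commutes r

/-- The section defined by a trivialization. -/
lemma IsTriv.exists_section {S : K →ₐ[ZMod p] K} (hS : IsAntip S) {J : K →ₐ[ZMod p] E.fn U}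
    (hJ : E.IsTriv J) : ∃ e : E.fn U →ₐ[U.R] U.R,
      act (E.co U) ((E.base U).toLinearMap ∘ₗ (e.restrictScalars (ZMod p)).toLinearMap)
        J.toLinearMap = LinearMap.id ∧
      ∀ k, e (J k) = algebraMap (ZMod p) U.R (Coalgebra.counit (R := ZMod p) k) := by
  -- `A` corresponds to `e ↦ e J(e)⁻¹`, which is invariant and hence comes from a section over the
  -- base.
  let A : E.fn U →ₐ[ZMod p] E.fn U :=
    (Algebra.TensorProduct.productMap (AlgHom.id (ZMod p) (E.fn U)) (J.comp S)).comp
      ((E.coact U).restrictScalars (ZMod p))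
  have hA : A.toLinearMap = act (E.co U) LinearMap.id (J.comp S).toLinearMap := by
    ext t
    change Algebra.TensorProduct.productMap _ _ (E.coact U t) =
      LinearMap.mul' (ZMod p) _ (TensorProduct.map _ _ (E.coact U t))
    induction E.coact U t with
    | zero => simp
    | add x y hx hy => simp only [map_add, hx, hy]
    | tmul x y => simp
  let g : K →ₐ[ZMod p] E.fn U ⊗[ZMod p] K := ((E.coact U).restrictScalars (ZMod p)).comp J
  let l : E.fn U →ₐ[ZMod p] E.fn U ⊗[ZMod p] K := Algebra.TensorProduct.includeLeft
  let r : K →ₐ[ZMod p] E.fn U ⊗[ZMod p] K := Algebra.TensorProduct.includeRight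
  have h1 : g.toLinearMap = conv (l.toLinearMap ∘ₗ J.toLinearMap) r.toLinearMap :=
    isTriv_iff.1 hJ
  -- From `J(e g) = J(e) g` follows `g J(e g)⁻¹ = J(e)⁻¹`, which gives the invariance of `A`.
  have h2 : conv r.toLinearMap (g.comp S).toLinearMap = ((l.comp J).comp S).toLinearMap := by
    have h3 : conv ((l.comp J).comp S).toLinearMap g.toLinearMap = r.toLinearMap := by
      rw [h1, ← conv_conv]
      have h4 := IsAntip.conv_left (hS := hS) (l.comp J)
      refine (congrArg (fun f => conv f r.toLinearMap) h4).trans (convOne_conv _)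
    rw [← h3, conv_conv, IsAntip.conv_right (hS := hS), conv_convOne]
  have h5 : E.co U ∘ₗ A.toLinearMap = l.toLinearMap ∘ₗ A.toLinearMap := by
    rw [hA, comp_act, comp_act]
    have h7 : ((E.coact U).restrictScalars (ZMod p)).toLinearMap ∘ₗ LinearMap.id =
      act (E.co U) l.toLinearMap r.toLinearMap := (act_includeLeft_includeRight (E.co U)).symm
    rw [h7, E.act_conv]
    exact congrArg _ h2
  have h8 : ∀ t, ∃ s, algebraMap U.R (E.fn U) s = A t := fun t =>
    E.exists_algebraMap_eq U (LinearMap.congr_fun h5 t)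
  choose e he using h8
  have hinj := E.algebraMap_injective U
  let e' : E.fn U →ₐ[U.R] U.R :=
    { toFun := e
      map_one' := hinj (by rw [he, map_one, map_one])
      map_mul' := fun x y => hinj (by rw [he, map_mul, map_mul, he, he])
      map_zero' := hinj (by rw [he, map_zero, map_zero])
      map_add' := fun x y => hinj (by rw [he, map_add, map_add, he, he])
      commutes' := fun s => hinj (by
        rw [he]
        change Algebra.TensorProduct.productMap _ _ (E.coact U _) = _
        rw [AlgHom.commutes]
        change Algebra.TensorProduct.productMap _ _ (algebraMap U.R (E.fn U) s ⊗ₜ[ZMod p] (1 : K)) =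
          _
        simp) }
  have he' : (E.base U).toLinearMap ∘ₗ (e'.restrictScalars (ZMod p)).toLinearMap =
      A.toLinearMap := LinearMap.ext he
  refine ⟨e', ?_, fun k => hinj ?_⟩
  · rw [he', hA, E.act_conv, IsAntip.conv_left (hS := hS), E.act_one]
  · refine (he _).trans ?_
    have h9 := act_comp (ρ' := Coalgebra.comul) (E.co U) J.toLinearMap LinearMap.id hJ LinearMap.id
      (J.comp S).toLinearMap
    rw [← hA] at h9
    have h10 := IsAntip.conv_right (hS := hS) J
    have h11 := LinearMap.congr_fun (h9.trans h10) k
    refine h11.trans ?_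
    rw [convOne_apply, ← IsScalarTower.algebraMap_apply]

/-- A trivial torsor is generated over the base by the pullbacks of functions on the group. -/
lemma IsTriv.induction {S : K →ₐ[ZMod p] K} (hS : IsAntip S) {J : K →ₐ[ZMod p] E.fn U}
    (hJ : E.IsTriv J) {P : E.fn U → Prop} (add : ∀ x y, P x → P y → P (x + y))
    (smul : ∀ (r : U.R) k, P (r • J k)) (t : E.fn U) : P t := by
  obtain ⟨e, he, -⟩ := hJ.exists_section hS
  have h1 : ∀ z : E.fn U ⊗[ZMod p] K, P (LinearMap.mul' (ZMod p) (E.fn U) (TensorProduct.map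
      ((E.base U).toLinearMap ∘ₗ (e.restrictScalars (ZMod p)).toLinearMap) J.toLinearMap z)) := by
    intro z
    induction z with
    | zero => simpa using smul 0 0
    | add x y hx hy => rw [map_add, map_add]; exact add _ _ hx hy
    | tmul x y =>
      have := smul (e x) y
      rwa [Algebra.smul_def] at this
  have h2 := h1 (E.coact U t)
  have h3 := LinearMap.congr_fun he t
  rw [act_apply] at h3
  rw [← LinearMap.id_apply (R := ZMod p) t, ← h3]
  exact h2

/-- The trivialization defined by a section. -/
lemma exists_isTriv_of_section (φ : U.Res V) (e : E.fn U →ₐ[ZMod p] V.R)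
    (he : ∀ r, e (algebraMap U.R _ r) = φ.map r) : ∃ J : K →ₐ[ZMod p] E.fn V, E.IsTriv J ∧
      act (E.co U) ((E.base V).toLinearMap ∘ₗ e.toLinearMap) J.toLinearMap =
        (E.res φ).toLinearMap := by
  let _ : Algebra U.R (E.fn V) := ((algebraMap V.R (E.fn V)).comp φ.map.toRingHom).toAlgebra
  have _ : IsScalarTower (ZMod p) U.R (E.fn V) :=
    IsScalarTower.of_algebraMap_eq' (RingHom.ext_zmod _ _)
  let e₀ : E.fn U →ₐ[U.R] E.fn V :=
    { ((E.base V).comp e).toRingHom with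
      commutes' := fun r => congrArg (algebraMap V.R (E.fn V)) (he r) }
  let d₀ : E.fn U →ₐ[U.R] E.fn V :=
    { (E.res φ).toRingHom with commutes' := fun r => E.res_algebraMap φ r }
  obtain ⟨J, hJ⟩ := E.exists_algHom_act_eq U e₀ d₀
  have hJ' : act (E.co U) ((E.base V).toLinearMap ∘ₗ e.toLinearMap) J.toLinearMap =
    (E.res φ).toLinearMap := hJ
  refine ⟨J, isTriv_iff.2 ?_, hJ'⟩
  let l : E.fn V →ₐ[ZMod p] E.fn V ⊗[ZMod p] K := Algebra.TensorProduct.includeLeft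
  let r : K →ₐ[ZMod p] E.fn V ⊗[ZMod p] K := Algebra.TensorProduct.includeRight
  apply E.act_cancel U ((l.comp (E.base V)).comp e)
  have h1 := comp_act (E.co U) ((E.coact V).restrictScalars (ZMod p))
    ((E.base V).toLinearMap ∘ₗ e.toLinearMap) J.toLinearMap
  rw [hJ'] at h1
  have h2 : E.co V ∘ₗ (E.base V).toLinearMap = l.toLinearMap ∘ₗ (E.base V).toLinearMap :=
    coact_comp_base
  have h3 : E.co V ∘ₗ (E.res φ).toLinearMap =
      TensorProduct.map (E.res φ).toLinearMap LinearMap.id ∘ₗ E.co U :=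
    LinearMap.ext (E.res_coact φ)
  have h4 := act_map (E.co U) (E.res φ).toLinearMap (LinearMap.id : K →ₗ[ZMod p] K)
  have h5 := comp_act (E.co U) l ((E.base V).toLinearMap ∘ₗ e.toLinearMap) J.toLinearMap
  rw [hJ'] at h5
  rw [LinearMap.comp_id] at h4
  have h6 := (congrArg (fun x => act (E.co U) x r.toLinearMap) h5).symm.trans h4
  have h7 := (E.act_conv U _ _ _).symm.trans (h6.trans (h3.symm.trans h1))
  have h8 : ((E.coact V).restrictScalars (ZMod p)).toLinearMap ∘ₗ
      (E.base V).toLinearMap ∘ₗ e.toLinearMap =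
      ((l.comp (E.base V)).comp e).toLinearMap := by
    rw [← LinearMap.comp_assoc, h2]
    rfl
  rw [h8] at h7
  exact h7.symm

lemma IsTriv.res {J : K →ₐ[ZMod p] E.fn U} (hJ : E.IsTriv J) (φ : U.Res V) :
    E.IsTriv ((E.res φ).comp J) := fun k => by
  rw [AlgHom.comp_apply, E.res_coact, hJ k]
  induction (Coalgebra.comul k : K ⊗[ZMod p] K) with
  | zero => simp
  | add x y hx hy => simp only [map_add, hx, hy]
  | tmul x y => simp

lemma IsTriv.map {σ : ∀ U : EtAff p X, U.R → U.R} {E' : Torsor p K X}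
    (i : TorsorHom (AlgHom.id (ZMod p) K) σ E' E) {J : K →ₐ[ZMod p] E.fn U} (hJ : E.IsTriv J) :
    E'.IsTriv ((i.map U).comp J) := fun k => by
  rw [AlgHom.comp_apply, i.map_coact, hJ k]
  induction (Coalgebra.comul k : K ⊗[ZMod p] K) with
  | zero => simp
  | add x y hx hy => simp only [map_add, hx, hy]
  | tmul x y => simp

/-- The trivialization of the induced torsor. -/
lemma IsTriv.exists_map {S : K →ₐ[ZMod p] K} (hS : IsAntip S) {J : K →ₐ[ZMod p] E.fn U}
    (hJ : E.IsTriv J) {c : K' →ₐ[ZMod p] K} {E' : Torsor p K' X} (i : TorsorHom.Over c E E') :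
    ∃ J' : K' →ₐ[ZMod p] E'.fn U, E'.IsTriv J' ∧ ∀ k, i.map U (J' k) = J (c k) := by
  obtain ⟨e, he, -⟩ := hJ.exists_section hS
  let e' : E'.fn U →ₐ[ZMod p] U.R := (e.restrictScalars (ZMod p)).comp (i.map U)
  let φ : U.Res U := ⟨AlgHom.id _ _, by
    change Spec.map (𝟙 _) ≫ _ = _
    rw [Spec.map_id, Category.id_comp]⟩
  obtain ⟨J', hJ', h1⟩ := exists_isTriv_of_section (E := E') φ e' (fun r => by
    change e (i.map U _) = r
    rw [i.map_algebraMap]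
    exact e.commutes r)
  refine ⟨J', hJ', LinearMap.congr_fun (f := (i.map U).toLinearMap ∘ₗ J'.toLinearMap)
    (g := J.toLinearMap ∘ₗ c.toLinearMap) ?_⟩
  apply E'.act_cancel U ((E.base U).comp e')
  have h2 : (E'.res φ).toLinearMap = LinearMap.id := LinearMap.ext (E'.res_id φ rfl)
  have h3 := comp_act (E'.co U) (i.map U) ((E'.base U).toLinearMap ∘ₗ e'.toLinearMap)
    J'.toLinearMap
  have h4 : (i.map U).toLinearMap ∘ₗ (E'.base U).toLinearMap = (E.base U).toLinearMap :=
    LinearMap.ext (i.map_algebraMap U)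
  rw [h1, h2, LinearMap.comp_id, ← LinearMap.comp_assoc, h4] at h3
  have h5 := act_comp (ρ' := E'.co U) (E.co U) (i.map U).toLinearMap c.toLinearMap (i.map_coact U)
    ((E.base U).toLinearMap ∘ₗ (e.restrictScalars (ZMod p)).toLinearMap) J.toLinearMap
  rw [he, LinearMap.id_comp] at h5
  exact h3.symm.trans h5

/-- Change of a trivialization by a point of the group. -/
lemma IsTriv.convAlg {J : K →ₐ[ZMod p] E.fn U} (hJ : E.IsTriv J) (m : K →ₐ[ZMod p] U.R) :
    E.IsTriv (convAlg ((E.base U).comp m) J) := by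
  rw [isTriv_iff] at hJ ⊢
  let l : E.fn U →ₐ[ZMod p] E.fn U ⊗[ZMod p] K := Algebra.TensorProduct.includeLeft
  have h1 := comp_act Coalgebra.comul ((E.coact U).restrictScalars (ZMod p))
    ((E.base U).toLinearMap ∘ₗ m.toLinearMap) J.toLinearMap
  have h2 : E.co U ∘ₗ (E.base U).toLinearMap = l.toLinearMap ∘ₗ (E.base U).toLinearMap :=
    coact_comp_base
  have h3 := comp_act Coalgebra.comul l ((E.base U).toLinearMap ∘ₗ m.toLinearMap) J.toLinearMap
  have h4 : (FZip.convAlg ((E.base U).comp m) J).toLinearMap = conv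
    ((E.base U).toLinearMap ∘ₗ m.toLinearMap) J.toLinearMap := convAlg_toLinearMap _ _
  rw [h4]
  refine h1.trans (Eq.trans ?_ (congrArg (fun x => conv x _) h3.symm))
  rw [conv_conv, ← hJ, ← LinearMap.comp_assoc, ← LinearMap.comp_assoc, h2]

/-- Two trivializations differ by a point of the group. -/
lemma IsTriv.exists_eq_convAlg {S : K →ₐ[ZMod p] K} (hS : IsAntip S) {J J' : K →ₐ[ZMod p] E.fn U}
    (hJ : E.IsTriv J) (hJ' : E.IsTriv J') :
    ∃ m : K →ₐ[ZMod p] U.R, J' = FZip.convAlg ((E.base U).comp m) J := by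
  obtain ⟨e, he, -⟩ := hJ.exists_section hS
  refine ⟨(e.restrictScalars (ZMod p)).comp J', ?_⟩
  apply AlgHom.toLinearMap_injective
  rw [convAlg_toLinearMap]
  have h1 := act_comp (ρ' := Coalgebra.comul) (E.co U) J'.toLinearMap LinearMap.id hJ'
    ((E.base U).toLinearMap ∘ₗ (e.restrictScalars (ZMod p)).toLinearMap) J.toLinearMap
  rw [he, LinearMap.id_comp] at h1
  exact h1

/-! ### Trivial connections -/

/-- A trivial torsor is the product of the base and the group, and `D` is extended by zero along the
group. On functions this is `act` of `D` on the section with `J`. -/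
lemma IsTriv.exists_derivation {S : K →ₐ[ZMod p] K} (hS : IsAntip S) {J : K →ₐ[ZMod p] E.fn U}
    (hJ : E.IsTriv J) (D : U.Vect) : ∃ Z : Derivation (ZMod p) (E.fn U) (E.fn U),
      ∀ r k, Z (r • J k) = D r • J k := by
  obtain ⟨e, he, he'⟩ := hJ.exists_section hS
  let f : E.fn U →ₗ[ZMod p] E.fn U := (E.base U).toLinearMap ∘ₗ (D : U.R →ₗ[ZMod p] U.R) ∘ₗ
    (e.restrictScalars (ZMod p)).toLinearMap
  let Z := act (E.co U) f J.toLinearMap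
  have hZ : ∀ (r : U.R) k, Z (r • J k) = D r • J k := by
    intro r k
    change LinearMap.mul' (ZMod p) _ (TensorProduct.map f J.toLinearMap (E.coact U (r • J k))) = _
    rw [map_smul, hJ]
    have h1 : ∀ z : K ⊗[ZMod p] K, LinearMap.mul' (ZMod p) _ (TensorProduct.map f J.toLinearMap
        (r • TensorProduct.map J.toLinearMap LinearMap.id z)) = D r • LinearMap.mul' (ZMod p) _
          (TensorProduct.map (convOne p K (E.fn U)) J.toLinearMap z) := by
      intro z
      induction z with
      | zero => simp
      | add x y hx hy => simp only [map_add, smul_add, hx, hy]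
      | tmul x y =>
        have h2 : f (r • J x) = D r • convOne p K (E.fn U) x := by
          change algebraMap _ _ (D (e (r • J x))) = _
          rw [map_smul, he', smul_eq_mul, Derivation.leibniz, Derivation.map_algebraMap, smul_zero,
            zero_add, convOne_apply, smul_eq_mul, map_mul, ← IsScalarTower.algebraMap_apply,
            mul_comm, ← Algebra.smul_def]
        rw [TensorProduct.map_tmul, TensorProduct.smul_tmul', TensorProduct.map_tmul,
          AlgHom.toLinearMap_apply, h2, LinearMap.mul'_apply, TensorProduct.map_tmul,
          LinearMap.mul'_apply, smul_mul_assoc]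
        rfl
    rw [h1]
    exact congrArg (fun x => D r • x) (LinearMap.congr_fun (convOne_conv J.toLinearMap) k)
  refine ⟨Derivation.mk' Z fun a b => ?_, hZ⟩
  induction a using hJ.induction hS with
  | add x y hx hy => rw [add_mul, map_add, hx, hy, map_add, add_smul, smul_add]; abel
  | smul r k =>
    induction b using hJ.induction hS with
    | add x y hx hy => rw [mul_add, map_add, hx, hy, map_add, add_smul, smul_add]; abel
    | smul s l =>
      rw [smul_mul_smul_comm, ← map_mul, hZ, hZ, hZ, Derivation.leibniz]
      simp only [smul_eq_mul, Algebra.smul_def, map_mul, map_add]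
      ring

lemma IsTriv.derivation_ext {S : K →ₐ[ZMod p] K} (hS : IsAntip S) {J : K →ₐ[ZMod p] E.fn U}
    (hJ : E.IsTriv J) {Z Z' : Derivation (ZMod p) (E.fn U) (E.fn U)}
    (h : ∀ (r : U.R) k, Z (r • J k) = Z' (r • J k)) : Z = Z' := by
  ext t
  induction t using hJ.induction hS with
  | add x y hx hy => rw [map_add, map_add, hx, hy]
  | smul r k => exact h r k

end Torsor

/-- The comultiplication of a function of degree `0` has components in degrees `(a, -a)`. For `a ≠
0` one of the two factors vanishes on `P`, leaving the component `(0, 0)`. -/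
lemma GmAction.comul_retract {p : ℕ} {H : Type} [CommRing H] [HopfAlgebra (ZMod p) H]
    (μ : GmAction p H) (P : Part) (x : μ.coord .levi) :
    Coalgebra.comul (R := ZMod p) (μ.retract P x) =
      TensorProduct.map (μ.retract P).toLinearMap (μ.retract P).toLinearMap
        (Coalgebra.comul (R := ZMod p) x) := by
  obtain ⟨h, rfl⟩ := μ.restrict_surjective .levi x
  rw [retract_restrict, limit_apply, comul_restrict, comul_restrict, ← LinearMap.comp_apply
    (f := TensorProduct.map (μ.retract P).toLinearMap (μ.retract P).toLinearMap),
    ← TensorProduct.map_comp]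
  change _ = TensorProduct.map (μ.limit P).toLinearMap (μ.limit P).toLinearMap _
  have key : TensorProduct.map (μ.restrict P).toLinearMap (μ.restrict P).toLinearMap ∘ₗ
      Coalgebra.comul ∘ₗ μ.prj 0 =
      TensorProduct.map (μ.limit P).toLinearMap (μ.limit P).toLinearMap ∘ₗ
        (Coalgebra.comul (R := ZMod p)) := by
    refine μ.ext_deg fun d h hh => ?_
    simp only [LinearMap.comp_apply]
    by_cases hd : d = 0
    · subst hd
      rw [μ.prj_same hh]
      refine μ.tdeg_ext (fun a b hab x hx y hy => ?_) (μ.comul_mem_tdeg hh)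
      simp only [TensorProduct.map_tmul, AlgHom.toLinearMap_apply, limit_apply]
      by_cases ha : a = 0
      · have hb : b = 0 := by omega
        subst ha hb
        rw [μ.prj_same hx, μ.prj_same hy]
      · rw [μ.prj_ne ha hx, map_zero, TensorProduct.zero_tmul]
        rcases P.of_add_eq_zero hab ha with h | h
        · rw [μ.restrict_eq_zero P h hx, TensorProduct.zero_tmul]
        · rw [μ.restrict_eq_zero P h hy, TensorProduct.tmul_zero]
    · rw [μ.prj_ne hd hh, map_zero, map_zero, ← LinearMap.zero_apply (σ₁₂ := RingHom.id (ZMod p))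
        (Coalgebra.comul (R := ZMod p) h)]
      refine μ.tdeg_ext (fun a b hab x hx y hy => ?_) (μ.comul_mem_tdeg hh)
      simp only [TensorProduct.map_tmul, AlgHom.toLinearMap_apply, limit_apply,
        LinearMap.zero_apply]
      by_cases ha : a = 0
      · rw [μ.prj_ne (by omega) hy, map_zero, TensorProduct.tmul_zero]
      · rw [μ.prj_ne ha hx, map_zero, TensorProduct.zero_tmul]
  exact LinearMap.congr_fun key h

namespace Disp

/-! ### Frames -/

variable {p : ℕ} [Fact p.Prime] {H : Type} [CommRing H] [HopfAlgebra (ZMod p) H]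
  {μ : GmAction p H} {X : Scheme.{0}} {f : Disp μ X} {U V : EtAff p X}

/-- Compatible trivializations of the torsors that constitute an `F`-zip. The torsor `F` has two
trivializations, one induced from `F⁺` and one from `F⁻`. -/
structure Frame (f : Disp μ X) (U : EtAff p X) where
  pos : μ.coord .pos →ₐ[ZMod p] f.Fpos.fn U
  neg : μ.coord .neg →ₐ[ZMod p] f.Fneg.fn U
  levi : μ.coord .levi →ₐ[ZMod p] f.Mneg.fn U
  Gpos : H →ₐ[ZMod p] f.F.fn U
  Gneg : H →ₐ[ZMod p] f.F.fn U
  isTriv_pos : f.Fpos.IsTriv pos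
  isTriv_neg : f.Fneg.IsTriv neg
  isTriv_levi : f.Mneg.IsTriv levi
  isTriv_Gpos : f.F.IsTriv Gpos
  isTriv_Gneg : f.F.IsTriv Gneg
  posF_Gpos : ∀ h, f.posF.map U (Gpos h) = pos (μ.restrict .pos h)
  negF_Gneg : ∀ h, f.negF.map U (Gneg h) = neg (μ.restrict .neg h)
  negM_levi : ∀ k, f.negM.map U (levi k) = neg (μ.retract .neg k)
  posM_levi : ∀ k, f.posM.map U (f.frob.map U (levi k)) = pos (μ.retract .pos k)

/-- Restriction of a frame. -/
def Frame.res (F : f.Frame U) (φ : U.Res V) : f.Frame V where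
  pos := (f.Fpos.res φ).comp F.pos
  neg := (f.Fneg.res φ).comp F.neg
  levi := (f.Mneg.res φ).comp F.levi
  Gpos := (f.F.res φ).comp F.Gpos
  Gneg := (f.F.res φ).comp F.Gneg
  isTriv_pos := F.isTriv_pos.res φ
  isTriv_neg := F.isTriv_neg.res φ
  isTriv_levi := F.isTriv_levi.res φ
  isTriv_Gpos := F.isTriv_Gpos.res φ
  isTriv_Gneg := F.isTriv_Gneg.res φ
  posF_Gpos h := by
    rw [AlgHom.comp_apply, f.posF.map_res, F.posF_Gpos]; rfl
  negF_Gneg h := by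
    rw [AlgHom.comp_apply, f.negF.map_res, F.negF_Gneg]; rfl
  negM_levi h := by
    rw [AlgHom.comp_apply, f.negM.map_res, F.negM_levi]; rfl
  posM_levi h := by
    rw [AlgHom.comp_apply, f.frob.map_res, f.posM.map_res, F.posM_levi]; rfl

/-- The torsor `F⁺_M` gets one trivialization from `F⁺` and another from `F⁻_M` by Frobenius. They
differ by a point of `M`, and translating the trivialization of `F⁺` by this point, through `M ⊆
P⁺`, makes them equal. -/
lemma exists_frame {Jp : μ.coord .pos →ₐ[ZMod p] f.Fpos.fn U} (hp : f.Fpos.IsTriv Jp)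
    {Jn : μ.coord .neg →ₐ[ZMod p] f.Fneg.fn U} (hn : f.Fneg.IsTriv Jn) :
    Nonempty (f.Frame U) := by
  obtain ⟨j, hj, hj'⟩ := hn.exists_map (isAntip_coordAntip μ .neg) f.negM
  obtain ⟨JM, hM, hM'⟩ := hp.exists_map (isAntip_coordAntip μ .pos) f.posM
  have hfj : f.Mpos.IsTriv ((f.frob.map U).comp j) := hj.map f.frob
  obtain ⟨m, hm⟩ := hM.exists_eq_convAlg (isAntip_coordAntip μ .levi) hfj
  have hp' := hp.convAlg (m.comp (μ.incl .pos))
  obtain ⟨Gp, hGp, hGp'⟩ := hp'.exists_map (isAntip_coordAntip μ .pos) f.posF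
  obtain ⟨Gn, hGn, hGn'⟩ := hn.exists_map (isAntip_coordAntip μ .neg) f.negF
  refine ⟨⟨_, Jn, j, Gp, Gn, hp', hn, hj, hGp, hGn, hGp', hGn', hj', fun k => ?_⟩⟩
  have h1 := LinearMap.congr_fun (congrArg AlgHom.toLinearMap hm) k
  rw [convAlg_toLinearMap] at h1
  have h2 := LinearMap.congr_fun (convAlg_toLinearMap
    ((f.Fpos.base U).comp (m.comp (μ.incl .pos))) Jp) (μ.retract .pos k)
  refine (congrArg (f.posM.map U) h1).trans (Eq.trans ?_ h2.symm)
  have h3 := comp_act Coalgebra.comul (f.posM.map U) ((f.Mpos.base U).comp m).toLinearMap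
    JM.toLinearMap
  have h4 := act_comp (ρ' := Coalgebra.comul) Coalgebra.comul (μ.retract .pos).toLinearMap
    (μ.retract .pos).toLinearMap (μ.comul_retract .pos)
    ((f.Fpos.base U).comp (m.comp (μ.incl .pos))).toLinearMap Jp.toLinearMap
  have h5 : (f.posM.map U).toLinearMap ∘ₗ JM.toLinearMap =
    Jp.toLinearMap ∘ₗ (μ.retract .pos).toLinearMap := LinearMap.ext hM'
  have h6 : (f.posM.map U).toLinearMap ∘ₗ ((f.Mpos.base U).comp m).toLinearMap =
      ((f.Fpos.base U).comp (m.comp (μ.incl .pos))).toLinearMap ∘ₗ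
        (μ.retract .pos).toLinearMap := by
    refine LinearMap.ext fun x => ?_
    have h7 : f.posM.map U (f.Mpos.base U (m x)) = f.Fpos.base U (m x) :=
      f.posM.map_algebraMap U (m x)
    refine h7.trans ?_
    simp only [LinearMap.comp_apply, AlgHom.toLinearMap_apply, AlgHom.comp_apply, μ.incl_retract]
  rw [h5, h6] at h3
  exact LinearMap.congr_fun (h3.trans h4.symm) k

namespace Frame

variable (F : f.Frame U) {n : ℕ} (b : μ.WeightOneBasis n)

/-- The section of `(𝔤₁)_{F⁻}` given by an element of the basis of `𝔤₁`. -/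
def sec (a : Fin n) : f.gNeg U :=
  ofVector f.Mneg U b (fun i => F.levi (b.rep a i)) fun j => by
    rw [F.isTriv_levi, b.comul_rep, map_sum]
    rfl

lemma sec_elt (a i : Fin n) : (F.sec b a).1 (b.elt i) = F.levi (b.rep a i) :=
  ofVector_elt _ _ _ _ _ _

lemma sec_apply (a : Fin n) : (F.sec b a).1 =
    conj (F.levi.comp (μ.restrict .levi)) (b.vecIn (f.Mneg.fn U) a) := by
  rw [b.conj_vecIn _ (fun d hd h hh => by
    rw [AlgHom.comp_apply, μ.restrict_eq_zero .levi hd hh, map_zero])]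
  change ∑ i, F.levi (b.rep a i) • b.vecIn (f.Mneg.fn U) i = _
  refine Finset.sum_congr rfl fun i _ => ?_
  rw [← b.comp_mat]
  rfl

lemma sec_res (φ : U.Res V) (a : Fin n) (h : H) :
    ((F.res φ).sec b a).1 h = f.Mneg.res φ ((F.sec b a).1 h) := by
  have h1 := LinearMap.congr_fun (comp_conj (f.Mneg.res φ) (F.levi.comp (μ.restrict .levi))
    (b.vecIn (f.Mneg.fn U) a)) h
  rw [b.comp_vecIn] at h1
  rw [sec_apply, sec_apply]
  exact h1.symm

/-- The sections defined by the basis of `𝔤₁` generate the bundle. -/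
lemma exists_eq_sum (κ : f.gNeg U) : ∃ c : Fin n → U.R, κ = ∑ a, c a • F.sec b a := by
  obtain ⟨e, he, -⟩ := F.isTriv_levi.exists_section (isAntip_coordAntip μ .levi)
  refine ⟨fun a => e (κ.1 (b.elt a)), weightOne_ext f.Mneg U b fun j => ?_⟩
  have h1 := LinearMap.congr_fun he (κ.1 (b.elt j))
  have h2 : LinearMap.mul' (ZMod p) (f.Mneg.fn U) (TensorProduct.map
    ((f.Mneg.base U).toLinearMap ∘ₗ (e.restrictScalars (ZMod p)).toLinearMap) F.levi.toLinearMap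
      (f.Mneg.coact U (κ.1 (b.elt j)))) = κ.1 (b.elt j) := h1
  rw [coact_elt, map_sum, map_sum] at h2
  rw [← h2]
  have h3 : (∑ a, e (κ.1 (b.elt a)) • F.sec b a : f.gNeg U).1 (b.elt j) =
      ∑ a, e (κ.1 (b.elt a)) • (F.sec b a).1 (b.elt j) := by simp
  rw [h3]
  refine Finset.sum_congr rfl fun a _ => ?_
  rw [sec_elt, Algebra.smul_def]
  rfl

end Frame

/-- The projection from `𝔤_{F⁻}` to `(𝔤₁)_{F⁻}`. -/
lemma exists_negM_eq (hμ : μ.OneBounded) {η : H →ₗ[ZMod p] f.F.fn U}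
    (hη : η ∈ adjointBundle (AlgHom.id (ZMod p) H) f.F U) :
    ∃ κ : f.gNeg U, ∀ h, f.negM.map U (κ.1 h) = f.negF.map U (η (GradedAlgebra.proj μ.deg 1 h)) := by
  let ζ : H →ₗ[ZMod p] f.Fneg.fn U := (f.negF.map U).toLinearMap ∘ₗ η
  have hζ : IsLie ζ := hη.1.comp _
  let θ : H →ₗ[ZMod p] f.Fneg.fn U := ζ ∘ₗ μ.prj 1
  -- The part of weight one transforms under `P⁻` through `M`, so it descends from `F⁻` to `F⁻_M`.
  have hθ : ∀ h, f.Fneg.coact U (θ h) =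
      TensorProduct.map θ (μ.limit .neg).toLinearMap (adjoint p H h) := by
    intro h
    rw [← μ.map_restrict_neg_adjoint hμ hζ]
    change f.Fneg.coact U (f.negF.map U (η _)) = _
    rw [f.negF.map_coact, hη.2]
    induction adjoint p H (μ.prj 1 h) with
    | zero => simp
    | add x y hx hy => simp only [map_add, hx, hy]
    | tmul x y => rfl
  have hlim : ∀ (ξ : H →ₗ[ZMod p] f.Mneg.fn U) (z : H ⊗[ZMod p] H),
      Algebra.TensorProduct.map (f.negM.map U) (μ.retract .neg)
        (TensorProduct.map ξ (μ.restrict .levi).toLinearMap z) =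
      TensorProduct.map ((f.negM.map U).toLinearMap ∘ₗ ξ) (μ.limit .neg).toLinearMap z := by
    intro ξ z
    induction z with
    | zero => simp
    | add x y hx hy => simp only [map_add, hx, hy]
    | tmul x y => rfl
  have h4 : ∀ h, ∃ x, f.negM.map U x = θ h := by
    intro h
    apply f.negM.exists_map_eq U
    rw [hθ]
    refine ⟨TensorProduct.map θ (μ.restrict .levi).toLinearMap (adjoint p H h), ?_⟩
    induction adjoint p H h with
    | zero => simp
    | add x y hx hy => simp only [map_add, hx, hy]
    | tmul x y => rfl
  choose κ₀ hκ₀ using h4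
  let κ : H →ₗ[ZMod p] f.Mneg.fn U :=
    { toFun := κ₀
      map_add' := fun a b => f.negM_injective U (by simp only [map_add, hκ₀])
      map_smul' := fun r a => f.negM_injective U (by
        simp only [map_smul, hκ₀, RingHom.id_apply]) }
  have hκ : (f.negM.map U).toLinearMap ∘ₗ κ = θ := LinearMap.ext hκ₀
  have hinj : Function.Injective (Algebra.TensorProduct.map (f.negM.map U) (μ.retract .neg)) := by
    have h5 : (⇑(Algebra.TensorProduct.map (f.negM.map U) (μ.retract .neg))) =
        (μ.retract .neg).toLinearMap.lTensor _ ∘ (f.negM.map U).toLinearMap.rTensor _ := by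
      funext z
      rw [Function.comp_apply, ← LinearMap.comp_apply, LinearMap.lTensor_comp_rTensor]
      rfl
    rw [h5]
    exact (Module.Flat.lTensor_preserves_injective_linearMap (M := f.Fneg.fn U) _
      (μ.retract_injective .neg)).comp
      (Module.Flat.rTensor_preserves_injective_linearMap _ (f.negM_injective U))
  refine ⟨⟨κ, ⟨fun a b => f.negM_injective U ?_, fun h => hinj ?_⟩, fun j hj h hh =>
    f.negM_injective U ?_⟩, hκ₀⟩
  · have := μ.isLie_comp_prj hζ 1 a b
    change θ _ = _ • θ _ + _ • θ _ at this
    rw [← hκ] at this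
    rw [map_add, map_smul, map_smul]
    exact this
  · rw [← f.negM.map_coact, hlim, hκ]
    change f.Fneg.coact U (f.negM.map U (κ₀ h)) = _
    rw [hκ₀, hθ]
  · rw [map_zero]
    refine (hκ₀ h).trans ?_
    change ζ (μ.prj 1 h) = 0
    rw [μ.prj_ne hj hh, map_zero]

lemma IsPhi.smul (r : U.R) {ξ : f.gPos U} {κ : f.gNeg U} (h : f.IsPhi ξ κ) :
    f.IsPhi (r • ξ) (r • κ) := by
  obtain ⟨η, h1, h2, h3⟩ := h
  refine ⟨r • η, Submodule.smul_mem _ r h1, fun h => ?_, fun h => ?_⟩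
  · refine (map_smul (f.posF.alg U) r (η h)).trans
      (Eq.trans ?_ (map_smul (f.posM.alg U) r (ξ.1 h)).symm)
    exact congrArg (fun x => r • x) (h2 h)
  · refine (map_smul (f.negM.alg U) r (κ.1 h)).trans
      (Eq.trans ?_ (map_smul (f.negF.alg U) r (η _)).symm)
    exact congrArg (fun x => r • x) (h3 h)

lemma IsPhi.sum {ι : Type} (s : Finset ι) {ξ : ι → f.gPos U} {κ : ι → f.gNeg U}
    (h : ∀ i, f.IsPhi (ξ i) (κ i)) : f.IsPhi (∑ i ∈ s, ξ i) (∑ i ∈ s, κ i) := by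
  classical
  induction s using Finset.induction_on with
  | empty => simpa using IsPhi.zero f
  | insert i s hi ih => rw [Finset.sum_insert hi, Finset.sum_insert hi]; exact (h i).add f ih

lemma IsPhi.res (φ : U.Res V) {ξ : f.gPos U} {κ : f.gNeg U} (h : f.IsPhi ξ κ) {ξ' : f.gPos V}
    {κ' : f.gNeg V} (hξ : ∀ h, ξ'.1 h = f.Mpos.res φ (ξ.1 h))
    (hκ : ∀ h, κ'.1 h = f.Mneg.res φ (κ.1 h)) : f.IsPhi ξ' κ' := by
  obtain ⟨η, h1, h2, h3⟩ := h
  refine ⟨_, res_mem_adjointBundle φ h1, fun h => ?_, fun h => ?_⟩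
  · rw [LinearMap.comp_apply, AlgHom.toLinearMap_apply, f.posF.map_res, h2, hξ, f.posM.map_res]
  · rw [LinearMap.comp_apply, AlgHom.toLinearMap_apply, f.negF.map_res, ← h3, hκ, f.negM.map_res]

/-- The map from `(𝔤₁)_{F⁺}` to `(𝔤₁)_{F⁻}` is defined everywhere. -/
lemma Frame.exists_isPhi (hμ : μ.OneBounded) (F : f.Frame U) {n : ℕ} (b : μ.WeightOneBasis n)
    (a : Fin n) : ∃ κ, f.IsPhi (f.frobPull (F.sec b a)) κ := by
  -- This is the section of `𝔤_F` that is the constant vector `b.vec a` in the trivialization coming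
  -- from `F⁺`.
  let η := conj F.Gpos (b.vecIn (f.F.fn U) a)
  have hη : η ∈ adjointBundle (AlgHom.id (ZMod p) H) f.F U := by
    refine ⟨isLie_conj _ (b.isLie_vecIn a), fun h => ?_⟩
    let l : f.F.fn U →ₐ[ZMod p] f.F.fn U ⊗[ZMod p] H := Algebra.TensorProduct.includeLeft
    let r : H →ₐ[ZMod p] f.F.fn U ⊗[ZMod p] H := Algebra.TensorProduct.includeRight
    let g := ((f.F.coact U).restrictScalars (ZMod p)).comp F.Gpos
    have h1 : g = convAlg (l.comp F.Gpos) r := by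
      apply AlgHom.toLinearMap_injective
      rw [convAlg_toLinearMap]
      exact Torsor.isTriv_iff.1 F.isTriv_Gpos
    have h2 := comp_conj ((f.F.coact U).restrictScalars (ZMod p)) F.Gpos (b.vecIn (f.F.fn U) a)
    have h3 := comp_conj l F.Gpos (b.vecIn (f.F.fn U) a)
    rw [b.comp_vecIn] at h2 h3
    rw [map_adjoint]
    have h4 : conj g (b.vecIn (f.F.fn U ⊗[ZMod p] H) a) = conj r (l.toLinearMap ∘ₗ η) := by
      rw [h1, ← conj_conj, h3]
    exact LinearMap.congr_fun (h2.trans h4) h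
  obtain ⟨κ, hκ⟩ := exists_negM_eq hμ hη
  refine ⟨κ, η, hη, fun h => ?_, hκ⟩
  have h1 := LinearMap.congr_fun (comp_conj (f.posF.map U) F.Gpos (b.vecIn (f.F.fn U) a)) h
  have h2 := LinearMap.congr_fun (comp_conj ((f.posM.map U).comp (f.frob.map U))
    (F.levi.comp (μ.restrict .levi)) (b.vecIn (f.Mneg.fn U) a)) h
  rw [b.comp_vecIn] at h1 h2
  have h3 : (f.posF.map U).comp F.Gpos = F.pos.comp (μ.restrict .pos) := AlgHom.ext F.posF_Gpos
  have h4 : ((f.posM.map U).comp (f.frob.map U)).comp (F.levi.comp (μ.restrict .levi)) =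
      F.pos.comp (μ.limit .pos) := AlgHom.ext fun x => F.posM_levi (μ.restrict .levi x)
  rw [h3, ← mul'_map_adjoint] at h1
  rw [h4, ← mul'_map_adjoint] at h2
  rw [frobPull_apply, Frame.sec_apply]
  refine h1.trans (Eq.trans ?_ h2.symm)
  -- On `F⁺` the section is conjugation by a point of `P⁺`, while the section of `(𝔤₁)_{F⁺}` uses
  -- its image in `M`. On `𝔤₁` these coincide.
  have h5 := congrArg (fun z => LinearMap.mul' (ZMod p) (f.Fpos.fn U)
    (TensorProduct.map LinearMap.id F.pos.toLinearMap z)) (μ.map_restrict_pos_adjoint hμ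
      (b.isLie_vecIn (B := f.Fpos.fn U) a) (b.hasWeight_vecIn a) h)
  have h6 : ∀ (c : H →ₐ[ZMod p] μ.coord .pos) (z : H ⊗[ZMod p] H), TensorProduct.map LinearMap.id
      F.pos.toLinearMap (TensorProduct.map (b.vecIn (f.Fpos.fn U) a) c.toLinearMap z) =
      TensorProduct.map (b.vecIn (f.Fpos.fn U) a) (F.pos.comp c).toLinearMap z := by
    intro c z
    induction z with
    | zero => simp
    | add x y hx hy => simp only [map_add, hx, hy]
    | tmul x y => rfl
  simp only [h6] at h5
  exact h5

end Disp

/-! ### The connection defined by a trivialization -/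

namespace Torsor

variable {p : ℕ} [Fact p.Prime] {K K' : Type} [CommRing K] [Bialgebra (ZMod p) K] [CommRing K']
  [Bialgebra (ZMod p) K'] {X : Scheme.{0}} {E : Torsor p K X} {U V : EtAff p X}
  {S : K →ₐ[ZMod p] K}

lemma algebraMap_eq_smul (J : K →ₐ[ZMod p] E.fn U) (r : U.R) :
    algebraMap U.R (E.fn U) r = r • J 1 := by
  rw [map_one, Algebra.algebraMap_eq_smul_one]

lemma IsTriv.isInv (hS : IsAntip S) {J : K →ₐ[ZMod p] E.fn U} (hJ : E.IsTriv J) {D : U.Vect}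
    {Z : Derivation (ZMod p) (E.fn U) (E.fn U)} (hZ : ∀ r k, Z (r • J k) = D r • J k) :
    E.IsInv U (Z : E.fn U →ₗ[ZMod p] E.fn U) := by
  intro b
  induction b using hJ.induction hS with
  | add x y hx hy => simp only [map_add, hx, hy]
  | smul r k =>
    rw [Derivation.coeFn_coe, hZ, map_smul, map_smul, hJ]
    induction (Coalgebra.comul k : K ⊗[ZMod p] K) with
    | zero => simp
    | add x y hx hy => simp only [map_add, smul_add, hx, hy]
    | tmul x y =>
      rw [TensorProduct.map_tmul, TensorProduct.smul_tmul', TensorProduct.smul_tmul',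
        LinearMap.rTensor_tmul]
      exact congrArg (fun t => t ⊗ₜ y) (hZ r x).symm

lemma IsTriv.res_derivation (hS : IsAntip S) {J : K →ₐ[ZMod p] E.fn U} (hJ : E.IsTriv J)
    {D : U.Vect} {Z : Derivation (ZMod p) (E.fn U) (E.fn U)} (hZ : ∀ r k, Z (r • J k) = D r • J k)
    (φ : U.Res V) {D' : V.Vect} (hD : φ.Related D D')
    {Z' : Derivation (ZMod p) (E.fn V) (E.fn V)}
    (hZ' : ∀ r k, Z' (r • E.res φ (J k)) = D' r • E.res φ (J k)) (t : E.fn U) :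
    Z' (E.res φ t) = E.res φ (Z t) := by
  have h1 : ∀ (r : U.R) t, E.res φ (r • t) = φ.map r • E.res φ t := fun r t => by
    rw [Algebra.smul_def, map_mul, E.res_algebraMap, ← Algebra.smul_def]
  induction t using hJ.induction hS with
  | add x y hx hy => simp only [map_add, hx, hy]
  | smul r k => rw [hZ, h1, h1, hZ', hD]

/-- The connection for which the functions pulled back from the group are horizontal. -/
def trivConn (hS : IsAntip S) (J : ∀ U, K →ₐ[ZMod p] E.fn U) (hJ : ∀ U, E.IsTriv (J U))
    (hres : ∀ {U V} (φ : U.Res V) k, E.res φ (J U k) = J V k) : Connection E where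
  lift U :=
    { toFun := fun D => ((hJ U).exists_derivation hS D).choose
      map_add' := fun D D' => (hJ U).derivation_ext hS fun r k => by
        rw [Derivation.add_apply, ((hJ U).exists_derivation hS (D + D')).choose_spec,
          ((hJ U).exists_derivation hS D).choose_spec,
          ((hJ U).exists_derivation hS D').choose_spec, Derivation.add_apply, add_smul]
      map_smul' := fun s D => (hJ U).derivation_ext hS fun r k => by
        rw [RingHom.id_apply, Derivation.smul_apply,
          ((hJ U).exists_derivation hS (s • D)).choose_spec,
          ((hJ U).exists_derivation hS D).choose_spec, Derivation.smul_apply, smul_smul,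
          smul_eq_mul] }
  lift_algebraMap U D r := by
    rw [algebraMap_eq_smul (J U), algebraMap_eq_smul (J U)]
    exact ((hJ U).exists_derivation hS D).choose_spec r 1
  invariant U D := (hJ U).isInv hS ((hJ U).exists_derivation hS D).choose_spec
  lift_res {U V} φ D D' hD b := by
    refine (hJ U).res_derivation hS ((hJ U).exists_derivation hS D).choose_spec φ hD
      (fun r k => ?_) b
    rw [hres]
    exact ((hJ V).exists_derivation hS D').choose_spec r k

section

variable {hS : IsAntip S} {J : ∀ U, K →ₐ[ZMod p] E.fn U} {hJ : ∀ U, E.IsTriv (J U)}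
  {hres : ∀ {U V} (φ : U.Res V) k, E.res φ (J U k) = J V k}

lemma trivConn_smul (D : U.Vect) (r : U.R) (k : K) :
    (trivConn hS J hJ hres).lift U D (r • J U k) = D r • J U k :=
  ((hJ U).exists_derivation hS D).choose_spec r k

lemma trivConn_integrable : (trivConn hS J hJ hres).Integrable := fun U D₁ D₂ =>
  (hJ U).derivation_ext hS fun r k => by
    rw [Derivation.commutator_apply]
    simp only [trivConn_smul]
    rw [Derivation.commutator_apply, sub_smul]

/-- Iterates of the lift act only on the coefficients from the base, where the `p`-th iterate is
`derivPow D`. -/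
lemma trivConn_pCurv (D : U.Vect) : (trivConn hS J hJ hres).pCurv U D = 0 := by
  refine (hJ U).derivation_ext hS fun r k => ?_
  have h1 : ∀ n : ℕ, ((((trivConn hS J hJ hres).lift U D :
      Derivation (ZMod p) (E.fn U) (E.fn U)) : E.fn U →ₗ[ZMod p] E.fn U) ^ n) (r • J U k) =
      (((D : U.R →ₗ[ZMod p] U.R) ^ n) r) • J U k := by
    intro n
    induction n with
    | zero => rfl
    | succ n ih =>
      rw [pow_succ', pow_succ', Module.End.mul_apply, Module.End.mul_apply, ih]
      exact trivConn_smul D _ k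
  rw [Connection.pCurv, Derivation.sub_apply, derivPow_apply, h1, trivConn_smul, derivPow_apply,
    sub_self]
  rfl

lemma trivConn_induces {c : K' →ₐ[ZMod p] K} {E' : Torsor p K' X} {S' : K' →ₐ[ZMod p] K'}
    {hS' : IsAntip S'} {J' : ∀ U, K' →ₐ[ZMod p] E'.fn U} {hJ' : ∀ U, E'.IsTriv (J' U)}
    {hres' : ∀ {U V} (φ : U.Res V) k, E'.res φ (J' U k) = J' V k} (i : TorsorHom.Over c E E')
    (hi : ∀ U k, i.map U (J' U k) = J U (c k)) :
    (trivConn hS J hJ hres).Induces i (trivConn hS' J' hJ' hres') := by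
  intro U D b
  have h1 : ∀ (r : U.R) t, i.map U (r • t) = r • i.map U t := fun r t => map_smul (i.alg U) r t
  induction b using (hJ' U).induction hS' with
  | add x y hx hy => simp only [map_add, hx, hy]
  | smul r k => rw [trivConn_smul, h1, h1, hi, trivConn_smul]

end

end Torsor

/-! ### Admissible connections obtained from frames. -/

namespace Disp

variable {p : ℕ} [Fact p.Prime] {H : Type} [CommRing H] [HopfAlgebra (ZMod p) H]
  {μ : GmAction p H} {X : Scheme.{0}} {f : Disp μ X} {U V : EtAff p X}

lemma IsNormal.add {Y Y' : Derivation (ZMod p) (f.F.fn U) (f.F.fn U)} {κ κ' : f.gNeg U}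
    (h : f.IsNormal Y κ) (h' : f.IsNormal Y' κ') : f.IsNormal (Y + Y') (κ + κ') := by
  intro b hb
  have h1 : (f.negM.map U).toLinearMap ∘ₗ (κ + κ' : f.gNeg U).1 =
      (f.negM.map U).toLinearMap ∘ₗ κ.1 + (f.negM.map U).toLinearMap ∘ₗ κ'.1 := by
    rw [← LinearMap.comp_add]; rfl
  rw [Derivation.add_apply, map_add, h b hb, h' b hb, h1, TensorProduct.map_add_right,
    LinearMap.add_apply, map_add]

lemma IsNormal.smul {Y : Derivation (ZMod p) (f.F.fn U) (f.F.fn U)} {κ : f.gNeg U}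
    (h : f.IsNormal Y κ) (r : U.R) : f.IsNormal (r • Y) (r • κ) := by
  intro b hb
  have h1 : (f.negM.map U).toLinearMap ∘ₗ (r • κ : f.gNeg U).1 =
      r • ((f.negM.map U).toLinearMap ∘ₗ κ.1) :=
    LinearMap.ext fun x => map_smul (f.negM.alg U) r (κ.1 x)
  have h2 := LinearMap.congr_fun (act_smul_right (f.F.co U) r (f.negF.map U).toLinearMap
    ((f.negM.map U).toLinearMap ∘ₗ κ.1)) b
  rw [h1]
  refine ((map_smul (f.negF.alg U) r (Y b)).trans ?_).trans h2.symm
  exact congrArg (fun x => r • x) (h b hb)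

lemma IsNormal.zero : f.IsNormal (0 : Derivation (ZMod p) (f.F.fn U) (f.F.fn U)) 0 := by
  intro b hb
  have h1 : (f.negM.map U).toLinearMap ∘ₗ (0 : f.gNeg U).1 = 0 := LinearMap.comp_zero _
  rw [h1, TensorProduct.map_zero_right]
  simp

lemma IsNormal.sum {ι : Type} (s : Finset ι) {Y : ι → Derivation (ZMod p) (f.F.fn U) (f.F.fn U)}
    {κ : ι → f.gNeg U} (h : ∀ i, f.IsNormal (Y i) (κ i)) :
    f.IsNormal (∑ i ∈ s, Y i) (∑ i ∈ s, κ i) := by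
  classical
  induction s using Finset.induction_on with
  | empty => simpa using IsNormal.zero
  | insert i s hi ih => rw [Finset.sum_insert hi, Finset.sum_insert hi]; exact (h i).add ih

/-- The Kodaira-Spencer form of the connection given by a frame. -/
lemma Frame.exists_isNormal (hμ : μ.OneBounded) (F : f.Frame U) (D : U.Vect) :
    ∃ κ : f.gNeg U, ∀ {V : EtAff p X} (φ : U.Res V) (D' : V.Vect), φ.Related D D' →
      ∀ (Y : Derivation (ZMod p) (f.F.fn V) (f.F.fn V)) (κ' : f.gNeg V),
      (∀ r h, Y (r • (F.res φ).Gpos h) = D' r • (F.res φ).Gpos h) →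
      (∀ h, κ'.1 h = f.Mneg.res φ (κ.1 h)) → f.IsNormal Y κ' := by
  -- `Yp` and `Yn` lift `D` through the trivializations of `F` coming from `F⁺` and `F⁻`. Their
  -- difference is a section of `𝔤_F`, whose projection `κ` is the Kodaira-Spencer form, because
  -- `Yn` is tangent to `F⁻`.
  obtain ⟨Yp, hYp⟩ := F.isTriv_Gpos.exists_derivation isAntip_antip D
  obtain ⟨Yn, hYn⟩ := F.isTriv_Gneg.exists_derivation isAntip_antip D
  obtain ⟨η, h1, h2'⟩ := Torsor.exists_vert_eq_derivation isSubgroup_id (Yp - Yn)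
    (Torsor.isInv_sub (F.isTriv_Gpos.isInv isAntip_antip hYp)
      (F.isTriv_Gneg.isInv isAntip_antip hYn)) (fun r => by
      rw [Derivation.sub_apply]
      nth_rw 1 [Torsor.algebraMap_eq_smul F.Gpos]
      rw [Torsor.algebraMap_eq_smul F.Gneg, hYp, hYn, map_one, map_one, sub_self])
  have h2 : η ∈ adjointBundle (AlgHom.id (ZMod p) H) f.F U := h2'
  have hη : ∀ b, f.F.vert U η b = Yp b - Yn b := fun b => (LinearMap.congr_fun h1 b).symm
  obtain ⟨κ, hκ⟩ := exists_negM_eq hμ h2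
  refine ⟨κ, fun {V} φ D' hD Y κ' hY hκ' => ?_⟩
  obtain ⟨Yn', hYn'⟩ := (F.res φ).isTriv_Gneg.exists_derivation isAntip_antip D'
  obtain ⟨Zn', hZn'⟩ := (F.res φ).isTriv_neg.exists_derivation (isAntip_coordAntip μ .neg) D'
  have h3 : f.IsNormal Yn' 0 := by
    intro b hb
    have h4 : ∀ b, f.negF.map V (Yn' b) = Zn' (f.negF.map V b) := by
      intro b
      have h5 : ∀ (r : V.R) t, f.negF.map V (r • t) = r • f.negF.map V t :=
        fun r t => map_smul (f.negF.alg V) r t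
      induction b using (F.res φ).isTriv_Gneg.induction isAntip_antip with
      | add x y hx hy => simp only [map_add, hx, hy]
      | smul r k => rw [hYn', h5, h5, (F.res φ).negF_Gneg, hZn']
    have h6 : (f.negM.map V).toLinearMap ∘ₗ (0 : f.gNeg V).1 = 0 := LinearMap.comp_zero _
    rw [h4, hb, map_zero, h6, TensorProduct.map_zero_right]
    simp
  have h7 := res_mem_adjointBundle φ h2
  have h8 : ∀ t, f.F.vert V ((f.F.res φ).toLinearMap ∘ₗ η) (f.F.res φ t) =
      f.F.res φ (f.F.vert U η t) := by
    intro t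
    have h9 := act_comp (ρ' := f.F.co U) (f.F.co V) (f.F.res φ).toLinearMap LinearMap.id
      (f.F.res_coact φ) LinearMap.id ((f.F.res φ).toLinearMap ∘ₗ η)
    have h10 := comp_act (f.F.co U) (f.F.res φ) LinearMap.id η
    exact (LinearMap.congr_fun h9 t).trans (LinearMap.congr_fun h10 t).symm
  -- The decomposition found over `U` restricts to `V`, so one `κ` over `U` serves all charts `V`.
  -- It suffices to compare on multiples of functions pulled back from the group.
  have h11 : Y = Yn' + Torsor.vertDer ((f.F.res φ).toLinearMap ∘ₗ η) (isPointDer_of_mem h7) := by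
    refine (F.res φ).isTriv_Gpos.derivation_ext isAntip_antip fun r h => ?_
    have h12 : ∀ Z : Derivation (ZMod p) (f.F.fn V) (f.F.fn V), ∀ t,
        Z (r • t) = t * Z (algebraMap V.R _ r) + algebraMap V.R _ r * Z t := by
      intro Z t
      rw [Algebra.smul_def, Derivation.leibniz, smul_eq_mul, smul_eq_mul, add_comm]
    have h13 : Yn' (algebraMap V.R _ r) = algebraMap V.R _ (D' r) := by
      rw [Torsor.algebraMap_eq_smul (F.res φ).Gneg, hYn', ← Torsor.algebraMap_eq_smul]
    have h14 : Yp (F.Gpos h) = 0 := by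
      have := hYp 1 h
      rwa [one_smul, Derivation.map_one_eq_zero, zero_smul] at this
    have h15 : f.F.vert V ((f.F.res φ).toLinearMap ∘ₗ η) ((F.res φ).Gpos h) =
        -Yn' ((F.res φ).Gpos h) := by
      refine (h8 (F.Gpos h)).trans ?_
      rw [hη, h14, zero_sub, map_neg]
      congr 1
      exact (F.isTriv_Gneg.res_derivation isAntip_antip hYn φ hD hYn' _).symm
    rw [hY, Derivation.add_apply, h12 Yn', h12 (Torsor.vertDer _ _), h13, Torsor.vertDer_apply,
      Torsor.vertDer_apply, Torsor.vert_algebraMap _ (isPointDer_of_mem h7), h15, Algebra.smul_def]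
    ring
  have h16 := h3.add_vert hμ (Y' := Y) (κ' := κ') h7.1 (fun h => by
    rw [hκ', f.negM.map_res, hκ, LinearMap.comp_apply, AlgHom.toLinearMap_apply,
      f.negF.map_res]) (fun b => by rw [h11]; rfl)
  rwa [zero_add] at h16

/-- An admissible connection on a trivial `F`-zip from a solution of a system of equations. -/
theorem admissible_nonempty_of_frame (hμ : μ.OneBounded) (F : ∀ U, f.Frame U)
    (hpos : ∀ {U V : EtAff p X} (φ : U.Res V) k, f.Fpos.res φ ((F U).pos k) = (F V).pos k)
    (hlevi : ∀ {U V : EtAff p X} (φ : U.Res V) k, f.Mneg.res φ ((F U).levi k) = (F V).levi k)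
    (hG : ∀ {U V : EtAff p X} (φ : U.Res V) h, f.F.res φ ((F U).Gpos h) = (F V).Gpos h)
    {ι : Type} [Fintype ι] [DecidableEq ι] (x : ∀ U : EtAff p X, ι → U.R)
    (der : ∀ U : EtAff p X, ι → U.Vect) (hx : ∀ U, IsCoord (x U) (der U))
    (hxres : ∀ {U V : EtAff p X} (φ : U.Res V) j, φ.map (x U j) = x V j)
    {n : ℕ} (b : μ.WeightOneBasis n) (Φ : ∀ U : EtAff p X, Fin n → Fin n → U.R)
    (κ a : ∀ U : EtAff p X, Fin n → ι → U.R)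
    (hares : ∀ {U V : EtAff p X} (φ : U.Res V) k j, φ.map (a U k j) = a V k j)
    (ha : ∀ U k j, a U k j = κ U k j + ∑ i, Φ U k i * (x U j ^ (p - 1) * a U i j ^ p))
    (hΦ : ∀ U i, f.IsPhi (f.frobPull ((F U).sec b i)) (∑ k, Φ U k i • (F U).sec b k))
    (hκ : ∀ (U : EtAff p X) j (Y : Derivation (ZMod p) (f.F.fn U) (f.F.fn U)),
      (∀ r h, Y (r • (F U).Gpos h) = der U j r • (F U).Gpos h) →
      f.IsNormal Y (∑ k, κ U k j • (F U).sec b k)) : f.admissible.Nonempty := by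
  let nabla := Torsor.trivConn (isAntip_coordAntip μ .pos) (fun U => (F U).pos)
    (fun U => (F U).isTriv_pos) hpos
  let nablaM := Torsor.trivConn (E := f.Mpos) (isAntip_coordAntip μ .levi)
    (fun U => (f.frob.map U).comp (F U).levi) (fun U => (F U).isTriv_levi.map f.frob)
    (fun φ k => by rw [AlgHom.comp_apply, ← f.frob.map_res, hlevi]; rfl)
  let nablaG := Torsor.trivConn isAntip_antip (fun U => (F U).Gpos)
    (fun U => (F U).isTriv_Gpos) hG
  have hM1 : nabla.Induces f.posM nablaM :=
    Torsor.trivConn_induces f.posM fun U k => (F U).posM_levi k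
  -- Frobenius pullbacks are combinations of trivial functions with coefficients `rᵖ`, which every
  -- derivation kills.
  have hM2 : nablaM.IsFrobenius f.frob := by
    intro U D t
    induction t using (F U).isTriv_levi.induction (isAntip_coordAntip μ .levi) with
    | add x y hx hy => rw [map_add, map_add, hx, hy, add_zero]
    | smul r k =>
      have h1 : f.frob.map U (r • (F U).levi k) = r ^ p • (f.frob.map U).comp (F U).levi k := by
        rw [Algebra.smul_def, map_mul, f.frob.map_algebraMap, ← Algebra.smul_def]
        rfl
      rw [h1]
      refine (Torsor.trivConn_smul D (r ^ p) k).trans ?_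
      rw [derivation_pow_apply_pow, zero_smul]
  have hGi : nabla.Induces f.posF nablaG :=
    Torsor.trivConn_induces f.posF fun U h => (F U).posF_Gpos h
  -- These are closed forms `aᵖ xᵖ⁻¹ dx` with Cartier image `a dx`, which is `γ`.
  let α : ∀ U : EtAff p X, Fin n × ι → Ω[U.R⁄ZMod p] := fun U q =>
    (a U q.1 q.2 ^ p * x U q.2 ^ (p - 1)) • KaehlerDifferential.D (ZMod p) U.R (x U q.2)
  let γ : ∀ U : EtAff p X, Fin n × ι → Ω[U.R⁄ZMod p] := fun U q =>
    a U q.1 q.2 • KaehlerDifferential.D (ZMod p) U.R (x U q.2)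
  have hαγ : ∀ U q, (α U q, γ U q) ∈ cartier U := fun U q =>
    AddSubgroup.subset_closure (Or.inl ⟨_, _, rfl⟩)
  have hαc : ∀ U q, IsClosedForm (α U q) := fun U q => isClosedOn_pow_smul _ _
  have hpair : ∀ (U : EtAff p X) (c y : U.R) (D : U.Vect),
      pair (c • KaehlerDifferential.D (ZMod p) U.R y) D = c * D y := by
    intro U c y D
    have h1 : pair (c • KaehlerDifferential.D (ZMod p) U.R y) D =
      D.liftKaehlerDifferential (c • KaehlerDifferential.D (ZMod p) U.R y) := rfl
    rw [h1, map_smul, Derivation.liftKaehlerDifferential_comp_D, smul_eq_mul]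
  let ω : ∀ U : EtAff p X, f.FormPos U := fun U =>
    ∑ q, (pair (α U q)).smulRight (f.frobPull ((F U).sec b q.1))
  have hωD : ∀ U (D : U.Vect), ω U D = ∑ q, pair (α U q) D • f.frobPull ((F U).sec b q.1) := by
    intro U D
    rw [LinearMap.sum_apply]
    rfl
  have hsec : ∀ {U V : EtAff p X} (φ : U.Res V) k h, ((F V).sec b k).1 h =
      f.Mneg.res φ (((F U).sec b k).1 h) := by
    intro U V φ k h
    rw [← Frame.sec_res, Frame.sec_apply, Frame.sec_apply]
    have : (F V).levi = ((F U).res φ).levi := AlgHom.ext fun k => (hlevi φ k).symm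
    rw [this]
  have hω : ω ∈ f.forms := by
    intro U V φ D D' hD h
    have h1 : ∀ (W : EtAff p X) (D : W.Vect), (ω W D).1 h =
        ∑ q, pair (α W q) D • f.frob.map W (((F W).sec b q.1).1 h) := by
      intro W D
      rw [hωD]
      simp [frobPull_apply]
    rw [h1, h1, map_sum]
    refine Finset.sum_congr rfl fun q _ => ?_
    rw [Algebra.smul_def, Algebra.smul_def, map_mul, f.Mpos.res_algebraMap, ← f.frob.map_res,
      ← hsec φ]
    congr 2
    rw [hpair, hpair, map_mul, map_mul, map_pow, map_pow, hares, hxres, ← hD, hxres]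
  have htr := isTranslate_translate hμ nabla ω hω
  let nabla' := translate hμ nabla ω hω
  have htr' : ∀ (U : EtAff p X) (D : U.Vect) t, nabla'.lift U D t = nabla.lift U D t +
      f.vertical (∑ q, pair (α U q) D • f.frobPull ((F U).sec b q.1)) t := fun U D t => by
    rw [← hωD]; exact htr U D t
  have hphi : ∀ U (D : U.Vect), f.IsPhi (ω U D)
      (∑ q : Fin n × ι, pair (α U q) D • ∑ k, Φ U k q.1 • (F U).sec b k) := fun U D => by
    rw [hωD]
    exact IsPhi.sum _ fun q => (hΦ U q.1).smul _
  choose η hη1 hη2 hη3 using hphi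
  obtain ⟨nablaG', hG', hlift⟩ := exists_induces_translate hω htr hGi η hη1 hη2
  refine ⟨nabla', ⟨nablaM, fun U D t => ?_, hM2⟩, fun U D₁ D₂ => ?_, fun U D => ?_⟩
  · rw [htr', vertical_posM, add_zero, hM1]
  · exact integrable_translate hμ hM1 hM2 (Torsor.trivConn_integrable U D₁ D₂) _ (α U) (hαc U)
      (htr' U)
  · refine ⟨∑ q : Fin n × ι, pair (γ U q) D • (F U).sec b q.1, ⟨nablaG', hG', ?_⟩, fun t => ?_⟩
    · have h1 : f.IsNormal (nablaG.lift U D)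
          (∑ j, D (x U j) • ∑ k, κ U k j • (F U).sec b k) := by
        have h2 : nablaG.lift U D = ∑ j, D (x U j) • nablaG.lift U (der U j) := by
          conv_lhs => rw [(hx U).eq_sum D, map_sum]
          exact Finset.sum_congr rfl fun j _ => map_smul _ _ _
        rw [h2]
        exact IsNormal.sum _ fun j =>
          (hκ U j _ fun r h => Torsor.trivConn_smul (der U j) r h).smul _
      have h3 := h1.add_vert hμ (hη1 U D).1 (hη3 U D) (hlift U D)
      convert h3 using 1
      simp only [hpair, γ, α, Fintype.sum_prod_type, Finset.smul_sum, smul_smul]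
      have h4 : ∀ i j, (a U i j * D (x U j)) • (F U).sec b i =
          (D (x U j) * κ U i j) • (F U).sec b i +
          ∑ l, (a U l j ^ p * x U j ^ (p - 1) * D (x U j) * Φ U i l) • (F U).sec b i := by
        intro i j
        rw [← Finset.sum_smul, ← add_smul]
        congr 1
        nth_rw 1 [ha]
        rw [add_mul, Finset.sum_mul]
        congr 1
        · ring
        · exact Finset.sum_congr rfl fun l _ => by ring
      simp only [h4, Finset.sum_add_distrib]
      congr 1
      · exact Finset.sum_comm
      · have h5 : ∀ g : Fin n → ι → Fin n → f.gNeg U,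
            ∑ i, ∑ j, ∑ l, g i j l = ∑ l, ∑ j, ∑ i, g i j l := by
          intro g
          rw [Finset.sum_comm]
          conv_rhs => rw [Finset.sum_comm]
          exact Finset.sum_congr rfl fun j _ => Finset.sum_comm
        exact h5 _
    -- The trivial connection has zero `p`-curvature, so the new `p`-curvature is `-C̃(ω)`.
    · rw [pCurv_translate hμ hM1 hM2 _ (α U) (γ U) (hαγ U) (htr' U) D t,
        Torsor.trivConn_pCurv]
      simp

end Disp

/-! ### Artin-Schreier systems -/

section ArtinSchreier

variable {p : ℕ} [Fact p.Prime]

/-- The coefficients of a solution of an Artin-Schreier equation, as polynomials in the `p`-th power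
of the last one. -/
def artinSchreierPoly (p : ℕ) {F : Type} [Field F] (d : ℕ → F) : ℕ → Polynomial F
  | 0 => 1 + Polynomial.C (d 0) * Polynomial.X
  | i + 1 => artinSchreierPoly p d i ^ p + Polynomial.C (d (i + 1)) * Polynomial.X

/-- For a Frobenius-semilinear endomorphism `T` of a finite-dimensional vector space over an
algebraically closed field, `1 - T` is surjective. -/
lemma exists_sub_eq_of_semilinear {F V : Type} [Field F] [CharP F p] [IsAlgClosed F] [AddCommGroup V]
    [Module F V] [FiniteDimensional F V] (T : V →+ V) (hT : ∀ (c : F) v, T (c • v) = c ^ p • T v)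
    (w : V) : ∃ a, a - T a = w := by
  -- In finite dimension some `e m` is a combination `∑ dᵢ e i` of earlier iterates. A solution is
  -- sought as `∑ cᵢ e i` with `i < m`.
  let e : ℕ → V := fun i => T^[i] w
  have he : ∀ i, T (e i) = e (i + 1) := fun i => (Function.iterate_succ_apply' T i w).symm
  let f : ℕ →o Submodule F V :=
    ⟨fun n => Submodule.span F (e '' (Finset.range n : Set ℕ)), fun m n h =>
      Submodule.span_mono (Set.image_mono (by
        intro i hi
        simp only [Finset.coe_range, Set.mem_Iio] at hi ⊢
        omega))⟩
  obtain ⟨m, hm⟩ := monotone_stabilizes_iff_noetherian.2 (inferInstance : IsNoetherian F V) f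
  have h1 : e m ∈ f m := by
    rw [hm (m + 1) (Nat.le_succ m)]
    exact Submodule.subset_span ⟨m, by simp, rfl⟩
  obtain ⟨d, hd⟩ : ∃ d : ℕ → F, ∑ i ∈ Finset.range m, d i • e i = e m := by
    obtain ⟨d, hd⟩ := (Submodule.mem_span_image_finset_iff_exists_fun F).1 h1
    refine ⟨fun i => if h : i ∈ Finset.range m then d ⟨i, h⟩ else 0, ?_⟩
    rw [← hd, ← Finset.sum_coe_sort]
    exact Finset.sum_congr rfl fun i _ => congrArg (fun x => x • e i) (dif_pos i.2)
  -- If `m = 0` then `w = 0`.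
  rcases m with _ | k
  · refine ⟨0, ?_⟩
    have : e 0 = 0 := by simpa using hd.symm
    rw [map_zero, sub_zero]
    exact this.symm
  let P := artinSchreierPoly p d
  -- With `t = cₖᵖ`, comparing coefficients of `a - T a = w` gives `c₀ = 1 + d₀ t` and `cᵢ₊₁ = cᵢᵖ +
  -- dᵢ₊₁ t`. So each `cᵢ` is a polynomial in `t`, and the closing condition `cₖᵖ = t` has a root
  -- because the derivative `-1` excludes a constant polynomial.
  have hder : Polynomial.derivative (P k ^ p - Polynomial.X) = -1 := by
    rw [Polynomial.derivative_sub, Polynomial.derivative_pow, Polynomial.derivative_X]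
    simp
  obtain ⟨t, ht⟩ := IsAlgClosed.exists_root (P k ^ p - Polynomial.X) (fun h => by
    rw [Polynomial.eq_C_of_degree_eq_zero h, Polynomial.derivative_C] at hder
    exact one_ne_zero (neg_eq_zero.1 hder.symm))
  rw [Polynomial.IsRoot, Polynomial.eval_sub, Polynomial.eval_pow, Polynomial.eval_X,
    sub_eq_zero] at ht
  let c : ℕ → F := fun i => (P i).eval t
  have hc0 : c 0 = 1 + d 0 * t := by simp [c, P, artinSchreierPoly]
  have hc : ∀ i, c (i + 1) = c i ^ p + d (i + 1) * t := fun i => by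
    simp [c, P, artinSchreierPoly]
  refine ⟨∑ i ∈ Finset.range (k + 1), c i • e i, ?_⟩
  have h2 : T (∑ i ∈ Finset.range (k + 1), c i • e i) =
      ∑ i ∈ Finset.range k, c i ^ p • e (i + 1) + t • ∑ i ∈ Finset.range (k + 1), d i • e i := by
    rw [map_sum, hd, Finset.sum_range_succ]
    simp only [hT, he]
    rw [← ht]
  rw [h2, Finset.sum_range_succ', Finset.sum_range_succ' (fun i => d i • e i), smul_add,
    Finset.smul_sum, hc0]
  simp only [hc, add_smul, one_smul, Finset.sum_add_distrib, smul_smul, mul_comm t]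
  change _ = e 0
  abel

variable {R σ : Type} [CommRing R] [Algebra (ZMod p) R] [Fintype σ]

/-- The ideal of the system of equations `a = κ + B a⁽ᵖ⁾`. -/
def artinSchreierIdeal (p : ℕ) (B : σ → σ → R) (κ : σ → R) : Ideal (MvPolynomial σ R) :=
  Ideal.span (Set.range fun s => MvPolynomial.X s -
    (MvPolynomial.C (κ s) + ∑ t, MvPolynomial.C (B s t) * MvPolynomial.X t ^ p))

/-- The algebra of the system of equations `a = κ + B a⁽ᵖ⁾`. -/
abbrev ArtinSchreier (p : ℕ) (B : σ → σ → R) (κ : σ → R) : Type :=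
  MvPolynomial σ R ⧸ artinSchreierIdeal p B κ

namespace ArtinSchreier

variable (B : σ → σ → R) (κ : σ → R)

/-- The universal solution. -/
def root (s : σ) : ArtinSchreier p B κ := Ideal.Quotient.mk _ (MvPolynomial.X s)

lemma root_eq (s : σ) : root (p := p) B κ s = algebraMap R _ (κ s) +
    ∑ t, algebraMap R _ (B s t) * root B κ t ^ p := by
  have h : MvPolynomial.X s - (MvPolynomial.C (κ s) + ∑ t, MvPolynomial.C (B s t) *
      MvPolynomial.X t ^ p) ∈ artinSchreierIdeal p B κ := Ideal.subset_span ⟨s, rfl⟩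
  have h1 := Ideal.Quotient.eq.2 h
  rw [map_add, map_sum] at h1
  simp only [map_mul, map_pow] at h1
  exact h1

variable {B κ}

lemma exists_hom {A : Type} [CommRing A] [Algebra R A] (a : σ → A)
    (ha : ∀ s, a s = algebraMap R A (κ s) + ∑ t, algebraMap R A (B s t) * a t ^ p) :
    ∃ g : ArtinSchreier p B κ →ₐ[R] A, ∀ s, g (root B κ s) = a s := by
  refine ⟨Ideal.Quotient.liftₐ _ (MvPolynomial.aeval a) fun x hx => ?_, fun s => ?_⟩
  · have : artinSchreierIdeal p B κ ≤ RingHom.ker (MvPolynomial.aeval a : MvPolynomial σ R →ₐ[R] A) := by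
      refine Ideal.span_le.2 ?_
      rintro _ ⟨s, rfl⟩
      simp only [SetLike.mem_coe, RingHom.mem_ker, map_sub, map_add, map_sum, map_mul, map_pow,
        MvPolynomial.aeval_X, MvPolynomial.algHom_C]
      rw [← ha, sub_self]
    exact this hx
  · exact MvPolynomial.aeval_X a s

lemma hom_ext {A : Type} [CommRing A] [Algebra R A] {g g' : ArtinSchreier p B κ →ₐ[R] A}
    (h : ∀ s, g (root B κ s) = g' (root B κ s)) : g = g' :=
  Ideal.Quotient.algHom_ext _ (MvPolynomial.algHom_ext h)

lemma hom_root {A : Type} [CommRing A] [Algebra R A] (g : ArtinSchreier p B κ →ₐ[R] A) (s : σ) :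
    g (root B κ s) = algebraMap R A (κ s) + ∑ t, algebraMap R A (B s t) * g (root B κ t) ^ p := by
  conv_lhs => rw [root_eq]
  simp only [map_add, map_sum, map_mul, map_pow, AlgHom.commutes]

/-- Modulo an ideal of square zero, `aᵖ` depends only on the residue class of `a`. So the right side
of the system, computed from any lift of a solution, is the unique solution lifting it. -/
instance : Algebra.Etale R (ArtinSchreier p B κ) where
  finitePresentation := by
    refine Algebra.FinitePresentation.quotient ?_
    exact ⟨(Set.finite_range _).toFinset, by rw [Set.Finite.coe_toFinset]; rfl⟩
  formallyEtale := by
    refine Algebra.FormallyEtale.iff_comp_bijective.2 fun A _ _ I hI => ?_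
    have hp : p.Prime := Fact.out
    have hchar : ∀ x y : A, Ideal.Quotient.mk I x = Ideal.Quotient.mk I y → x ^ p = y ^ p := by
      intro x y h
      let _ : Algebra (ZMod p) A := Algebra.compHom A (algebraMap (ZMod p) R)
      have h0 : (p : A) = 0 := by
        rw [← map_natCast (algebraMap (ZMod p) A) p]
        simp
      have h1 : x - y ∈ I := Ideal.Quotient.eq.1 h
      have h2 : (x - y) ^ 2 = 0 := by
        have := Ideal.pow_mem_pow h1 2
        rwa [hI] at this
      have h3 : (x - y) ^ p = 0 := pow_eq_zero_of_le hp.two_le h2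
      obtain ⟨r, hr⟩ := exists_add_pow_prime_eq hp (x - y) y
      rw [sub_add_cancel, h3, h0] at hr
      rw [hr]
      ring
    refine ⟨fun g g' h => hom_ext fun s => ?_, fun g => ?_⟩
    · have h1 : ∀ t, g (root B κ t) ^ p = g' (root B κ t) ^ p := fun t =>
        hchar _ _ (AlgHom.congr_fun h (root B κ t))
      rw [hom_root, hom_root]
      simp only [h1]
    · choose b hb using fun s => Ideal.Quotient.mk_surjective (I := I) (g (root B κ s))
      have h1 : ∀ s, Ideal.Quotient.mk I (algebraMap R A (κ s) +
          ∑ t, algebraMap R A (B s t) * b t ^ p) = g (root B κ s) := by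
        intro s
        rw [hom_root, map_add, map_sum]
        simp only [map_mul, map_pow, hb]
        rfl
      obtain ⟨g', hg'⟩ := exists_hom (p := p) (B := B) (κ := κ) (fun s => algebraMap R A (κ s) +
        ∑ t, algebraMap R A (B s t) * b t ^ p) fun s => by
          congr 1
          refine Finset.sum_congr rfl fun t _ => ?_
          rw [hchar _ _ ((h1 t).trans (hb t).symm)]
      refine ⟨g', hom_ext fun s => ?_⟩
      rw [AlgHom.comp_apply, hg']
      exact h1 s

/-- Over an algebraic closure of the residue field at `q`, the system reads `a - T a = κ` with `T`
Frobenius-semilinear. A solution gives a point of the spectrum above `q`. -/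
lemma comap_surjective : Function.Surjective
    (PrimeSpectrum.comap (algebraMap R (ArtinSchreier p B κ))) := by
  intro q
  let F := AlgebraicClosure q.asIdeal.ResidueField
  have hker : RingHom.ker (algebraMap R F) = q.asIdeal := by
    rw [IsScalarTower.algebraMap_eq R q.asIdeal.ResidueField F, ← RingHom.comap_ker,
      (RingHom.injective_iff_ker_eq_bot _).1 (algebraMap q.asIdeal.ResidueField F).injective]
    exact q.asIdeal.ker_algebraMap_residueField
  let _ : Algebra (ZMod p) F := Algebra.compHom F (algebraMap (ZMod p) R)
  have : CharP F p := charP_of_injective_algebraMap (algebraMap (ZMod p) F).injective p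
  let T : (σ → F) →+ (σ → F) :=
    { toFun := fun v s => ∑ t, algebraMap R F (B s t) * v t ^ p
      map_zero' := by
        funext s
        simp [(Fact.out : p.Prime).ne_zero]
      map_add' := fun v w => by
        funext s
        simp only [Pi.add_apply, add_pow_char, mul_add, Finset.sum_add_distrib] }
  obtain ⟨a, ha⟩ := exists_sub_eq_of_semilinear (p := p) (F := F) T (fun c v => by
    funext s
    change ∑ t, _ * (c * v t) ^ p = c ^ p * ∑ t, _ * v t ^ p
    rw [Finset.mul_sum]
    exact Finset.sum_congr rfl fun t _ => by ring) fun s => algebraMap R F (κ s)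
  obtain ⟨g, -⟩ := exists_hom (p := p) (B := B) (κ := κ) a fun s => by
    have := congrFun ha s
    rw [← this]
    change a s = a s - T a s + T a s
    rw [sub_add_cancel]
  refine ⟨PrimeSpectrum.comap g.toRingHom ⊥, ?_⟩
  rw [← PrimeSpectrum.comap_comp_apply]
  have : g.toRingHom.comp (algebraMap R (ArtinSchreier p B κ)) = algebraMap R F := g.comp_algebraMap
  rw [this]
  exact PrimeSpectrum.ext hker

end ArtinSchreier

end ArtinSchreier

/-! ### Étale extensions of affine charts and local coordinates. -/

namespace EtAff

variable {p : ℕ} [Fact p.Prime] {X : Scheme.{0}} {U V W : EtAff p X}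

/-- The spectrum of an étale `U.R`-algebra. -/
def extend (U : EtAff p X) (R' : Type) [CommRing R'] [Algebra U.R R'] [Algebra.Etale U.R R'] :
    EtAff p X :=
  have : Etale (Spec.map (CommRingCat.ofHom (algebraMap U.R R'))) := by
    rw [HasRingHomProperty.Spec_iff (P := @Etale)]
    exact RingHom.etale_algebraMap.2 inferInstance
  { R := R'
    alg := ((algebraMap U.R R').comp (algebraMap (ZMod p) U.R)).toAlgebra
    pt := Spec.map (CommRingCat.ofHom (algebraMap U.R R')) ≫ U.pt }

def toExtend (U : EtAff p X) (R' : Type) [CommRing R'] [Algebra U.R R'] [Algebra.Etale U.R R'] :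
    U.Res (U.extend R') where
  map := { algebraMap U.R R' with commutes' := fun _ => rfl }
  comp_pt := rfl

lemma mem_range_extend {U : EtAff p X} {R' : Type} [CommRing R'] [Algebra U.R R']
    [Algebra.Etale U.R R'] (y : PrimeSpectrum U.R)
    (hy : y ∈ Set.range (PrimeSpectrum.comap (algebraMap U.R R'))) :
    U.pt y ∈ Set.range (U.extend R').pt := by
  obtain ⟨z, rfl⟩ := hy
  refine ⟨z, ?_⟩
  exact Scheme.Hom.comp_apply (Spec.map (CommRingCat.ofHom (algebraMap U.R R'))) U.pt z

lemma range_subset_extend {U : EtAff p X} {R' : Type} [CommRing R'] [Algebra U.R R']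
    [Algebra.Etale U.R R']
    (h : Function.Surjective (PrimeSpectrum.comap (algebraMap U.R R'))) :
    Set.range U.pt ⊆ Set.range (U.extend R').pt := by
  rintro _ ⟨y, rfl⟩
  exact mem_range_extend y (h y)

def Res.comp (φ : U.Res V) (ψ : V.Res W) : U.Res W where
  map := ψ.map.comp φ.map
  comp_pt := by
    rw [← ψ.comp_pt, ← φ.comp_pt, ← Category.assoc, ← Spec.map_comp]
    rfl

/-- The structure morphism of an affine étale scheme over `Spec V.R`. -/
def toPush (V : EtAff p X) (W : EtAff p (Spec (CommRingCat.of V.R))) : V.Res (W.push V.pt) where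
  map := { (Spec.preimage W.pt).hom with
    commutes' := fun r => RingHom.congr_fun (RingHom.ext_zmod
      ((Spec.preimage W.pt).hom.comp (algebraMap (ZMod p) V.R)) (algebraMap (ZMod p) W.R)) r }
  comp_pt := by
    change Spec.map (Spec.preimage W.pt) ≫ V.pt = W.pt ≫ V.pt
    rw [Spec.map_preimage]

lemma toPush_map {W W' : EtAff p (Spec (CommRingCat.of V.R))} (ψ : W.Res W') :
    (V.toPush W').map = (ψ.push V.pt).map.comp (V.toPush W).map := by
  have h : Spec.preimage W'.pt = Spec.preimage W.pt ≫ CommRingCat.ofHom ψ.map.toRingHom := by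
    apply Spec.map_injective
    rw [Spec.map_preimage, Spec.map_comp, Spec.map_preimage, ψ.comp_pt]
  refine AlgHom.ext fun r => ?_
  change (Spec.preimage W'.pt).hom r = ψ.map ((Spec.preimage W.pt).hom r)
  rw [h]
  rfl

lemma Res.etale (φ : U.Res V) : φ.map.toRingHom.Etale := by
  have h1 : Etale (Spec.map (CommRingCat.ofHom φ.map.toRingHom) ≫ U.pt) := by
    rw [φ.comp_pt]
    infer_instance
  have h2 := Etale.of_comp (Spec.map (CommRingCat.ofHom φ.map.toRingHom)) U.pt
  rw [HasRingHomProperty.Spec_iff (P := @Etale)] at h2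
  exact h2

lemma exists_isCoord_res (φ : U.Res V) {ι : Type} [Fintype ι] [DecidableEq ι] {x : ι → U.R}
    {der : ι → U.Vect} (hx : IsCoord x der) :
    ∃ der' : ι → V.Vect, IsCoord (fun i => φ.map (x i)) der' ∧
      ∀ i, φ.Related (der i) (der' i) := by
  let _ : Algebra U.R V.R := φ.map.toRingHom.toAlgebra
  have : IsScalarTower (ZMod p) U.R V.R := IsScalarTower.of_algebraMap_eq' (RingHom.ext_zmod _ _)
  have h : Algebra.Etale U.R V.R := φ.etale
  have := h.formallyEtale
  exact hx.map V.R

/-- A smooth scheme has coordinates locally. -/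
lemma exists_isCoord (s : X ⟶ Spec (CommRingCat.of (ZMod p))) [Smooth s] (x : X) :
    ∃ (U : EtAff p X) (ι : Type) (_ : Fintype ι) (_ : DecidableEq ι) (y : ι → U.R)
      (der : ι → U.Vect), x ∈ Set.range U.pt ∧ IsCoord y der := by
  obtain ⟨O, hO, hx, -⟩ := exists_isAffineOpen_mem_and_subset (U := (⊤ : X.Opens)) (x := x) trivial
  obtain ⟨g, hg⟩ := Spec.map_surjective (hO.fromSpec ≫ s)
  obtain ⟨U, y, hy⟩ : ∃ U : EtAff p X, x ∈ Set.range U.pt :=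
    ⟨{ R := Γ(X, O), alg := g.hom.toAlgebra, pt := hO.fromSpec }, by
      change x ∈ Set.range hO.fromSpec
      rwa [hO.range_fromSpec]⟩
  have hsm := U.smooth_algebra s
  obtain ⟨S, hS, hstd⟩ := Algebra.Smooth.exists_span_eq_top_isStandardSmooth (ZMod p) U.R
  let y' : PrimeSpectrum U.R := y
  -- The members of `S` generate the unit ideal, so one of them does not vanish at the point.
  obtain ⟨t, ht, hty⟩ : ∃ t ∈ S, t ∉ y'.asIdeal := by
    by_contra! h
    exact y'.2.ne_top (top_le_iff.1 (hS ▸ Ideal.span_le.2 h))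
  have : Algebra.Etale U.R (Localization.Away t) := Algebra.Etale.of_isLocalizationAway t
  have hstd' := hstd t ht
  -- The `𝔽_p`-algebra structure on a ring is unique, which identifies the two structures in play.
  have halg : (U.extend (Localization.Away t)).alg =
    (inferInstance : Algebra (ZMod p) (Localization.Away t)) := Subsingleton.elim _ _
  have : Algebra.IsStandardSmooth (ZMod p) (U.extend (Localization.Away t)).R := by
    rw [halg]
    exact hstd'
  obtain ⟨ι, _, _, z, der, hz⟩ := exists_isCoord_of_isStandardSmooth (p := p)
    (S := (U.extend (Localization.Away t)).R)
  refine ⟨U.extend (Localization.Away t), ι, ‹_›, ‹_›, z, der, ?_, hz⟩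
  rw [← hy]
  refine mem_range_extend y' ?_
  rw [PrimeSpectrum.localization_away_comap_range (Localization.Away t) t]
  exact hty

end EtAff

/-- A torsor becomes trivial on an étale covering. -/
lemma Torsor.exists_isTriv {p : ℕ} [Fact p.Prime] {K : Type} [CommRing K] [Bialgebra (ZMod p) K]
    {X : Scheme.{0}} (E : Torsor p K X) (U : EtAff p X) :
    ∃ (V : EtAff p X) (_ : U.Res V) (J : K →ₐ[ZMod p] E.fn V),
      Set.range U.pt ⊆ Set.range V.pt ∧ E.IsTriv J := by
  obtain ⟨R', _, _, _, _, ⟨e⟩⟩ := E.locally_trivial U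
  let e' : E.fn U →ₐ[ZMod p] (U.extend R').R :=
    { e.toRingHom with
      commutes' := fun r => RingHom.congr_fun (RingHom.ext_zmod (e.toRingHom.comp
        (algebraMap (ZMod p) (E.fn U))) (algebraMap (ZMod p) (U.extend R').R)) r }
  obtain ⟨J, hJ, -⟩ := exists_isTriv_of_section (E := E) (U.toExtend R') e' e.commutes
  exact ⟨_, U.toExtend R', J, EtAff.range_subset_extend
    PrimeSpectrum.comap_surjective_of_faithfullyFlat, hJ⟩

/-! ### Étale-local existence of admissible connections. -/

namespace Disp

variable {p : ℕ} [Fact p.Prime] {H : Type} [CommRing H] [HopfAlgebra (ZMod p) H]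
  {μ : GmAction p H} {X X' : Scheme.{0}} {f : Disp μ X} {U V : EtAff p X}

lemma exists_nonempty_frame (f : Disp μ X) (U : EtAff p X) : ∃ (V : EtAff p X) (_ : U.Res V),
    Set.range U.pt ⊆ Set.range V.pt ∧ Nonempty (f.Frame V) := by
  obtain ⟨V, φ, Jn, hV, hn⟩ := f.Fneg.exists_isTriv U
  obtain ⟨W, ψ, Jp, hW, hp⟩ := f.Fpos.exists_isTriv V
  exact ⟨W, φ.comp ψ, hV.trans hW, exists_frame hp (hn.res ψ)⟩

/-- A frame of the pullback of an `F`-zip. -/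
def Frame.pull {u : X' ⟶ X} [Etale u] {W : EtAff p X'} (F : f.Frame (W.push u)) :
    (f.pullback u).Frame W where
  pos := F.pos
  neg := F.neg
  levi := F.levi
  Gpos := F.Gpos
  Gneg := F.Gneg
  isTriv_pos := F.isTriv_pos
  isTriv_neg := F.isTriv_neg
  isTriv_levi := F.isTriv_levi
  isTriv_Gpos := F.isTriv_Gpos
  isTriv_Gneg := F.isTriv_Gneg
  posF_Gpos := F.posF_Gpos
  negF_Gneg := F.negF_Gneg
  negM_levi := F.negM_levi
  posM_levi := F.posM_levi

lemma Frame.sum_sec_res (F : f.Frame U) {n : ℕ} (b : μ.WeightOneBasis n) (φ : U.Res V)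
    (c : Fin n → U.R) (h : H) : (∑ k, φ.map (c k) • (F.res φ).sec b k : f.gNeg V).1 h =
      f.Mneg.res φ ((∑ k, c k • F.sec b k : f.gNeg U).1 h) := by
  have h1 : ∀ (W : EtAff p X) (G : f.Frame W) (c : Fin n → W.R),
      (∑ k, c k • G.sec b k : f.gNeg W).1 h = ∑ k, c k • (G.sec b k).1 h := by
    intro W G c
    simp
  rw [h1, h1, map_sum]
  refine Finset.sum_congr rfl fun k _ => ?_
  rw [sec_res, Algebra.smul_def, Algebra.smul_def, map_mul, f.Mneg.res_algebraMap]

/-- A solution of the system of equations over `V` gives an admissible connection. -/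
lemma admissible_pullback_nonempty (hμ : μ.OneBounded) (F : f.Frame V) {ι : Type} [Fintype ι]
    [DecidableEq ι] {x : ι → V.R} {der : ι → V.Vect} (hx : IsCoord x der) {n : ℕ}
    (b : μ.WeightOneBasis n) {Φ : Fin n → Fin n → V.R} {κ a : Fin n → ι → V.R}
    (ha : ∀ k j, a k j = κ k j + ∑ i, Φ k i * (x j ^ (p - 1) * a i j ^ p))
    (hΦ : ∀ i, f.IsPhi (f.frobPull (F.sec b i)) (∑ k, Φ k i • F.sec b k))
    (hκ : ∀ j {W : EtAff p X} (φ : V.Res W) (D' : W.Vect), φ.Related (der j) D' →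
      ∀ (Y : Derivation (ZMod p) (f.F.fn W) (f.F.fn W)) (κ' : f.gNeg W),
      (∀ r h, Y (r • (F.res φ).Gpos h) = D' r • (F.res φ).Gpos h) →
      (∀ h, κ'.1 h = f.Mneg.res φ ((∑ k, κ k j • F.sec b k : f.gNeg V).1 h)) → f.IsNormal Y κ') :
    (f.pullback V.pt).admissible.Nonempty := by
  have hmap : ∀ {W W' : EtAff p (Spec (CommRingCat.of V.R))} (ψ : W.Res W') (r : V.R),
      ψ.map ((V.toPush W).map r) = (V.toPush W').map r := fun ψ r =>
    (AlgHom.congr_fun (EtAff.toPush_map ψ) r).symm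
  choose der' hder' hrel using fun W : EtAff p (Spec (CommRingCat.of V.R)) =>
    EtAff.exists_isCoord_res (V.toPush W) hx
  refine admissible_nonempty_of_frame (f := f.pullback V.pt) hμ
    (fun W => (F.res (V.toPush W)).pull) (fun {W W'} ψ k => ?_) (fun {W W'} ψ k => ?_)
    (fun {W W'} ψ k => ?_) (fun W j => (V.toPush W).map (x j)) der' hder'
    (fun ψ j => hmap ψ _) b (fun W k i => (V.toPush W).map (Φ k i))
    (fun W k j => (V.toPush W).map (κ k j)) (fun W k j => (V.toPush W).map (a k j))
    (fun ψ k j => hmap ψ _) (fun W k j => ?_) (fun W i => ?_) (fun W j Y hY => ?_)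
  · exact (f.Fpos.res_comp (V.toPush W) (ψ.push V.pt) (V.toPush W') (EtAff.toPush_map ψ) _).symm
  · exact (f.Mneg.res_comp (V.toPush W) (ψ.push V.pt) (V.toPush W') (EtAff.toPush_map ψ) _).symm
  · exact (f.F.res_comp (V.toPush W) (ψ.push V.pt) (V.toPush W') (EtAff.toPush_map ψ) _).symm
  · have := congrArg (V.toPush W).map (ha k j)
    simpa only [map_add, map_sum, map_mul, map_pow] using this
  · have h1 : f.IsPhi (f.frobPull ((F.res (V.toPush W)).sec b i))
        (∑ k, (V.toPush W).map (Φ k i) • (F.res (V.toPush W)).sec b k) :=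
      (hΦ i).res (V.toPush W) (fun h => by
        rw [frobPull_apply, frobPull_apply, Frame.sec_res, f.frob.map_res])
        (F.sum_sec_res b (V.toPush W) fun k => Φ k i)
    exact h1
  · have h1 : f.IsNormal Y
        (∑ k, (V.toPush W).map (κ k j) • (F.res (V.toPush W)).sec b k : f.gNeg (W.push V.pt)) :=
      hκ j (V.toPush W) (der' W j) (hrel W j) Y _ hY
        (F.sum_sec_res b (V.toPush W) fun k => κ k j)
    exact h1

/-- Every `F`-zip on a smooth scheme lifts étale-locally. -/
lemma exists_admissible_pullback_nonempty [Algebra.FiniteType (ZMod p) H] (hμ : μ.OneBounded)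
    (s : X ⟶ Spec (CommRingCat.of (ZMod p))) [Smooth s] (f : Disp μ X) (x : X) :
    ∃ U : EtAff p X, x ∈ Set.range U.pt ∧ (f.pullback U.pt).admissible.Nonempty := by
  obtain ⟨U, ι, _, _, y₀, der₀, hxU, hy₀⟩ := EtAff.exists_isCoord s x
  obtain ⟨V, φ, hV, ⟨F⟩⟩ := f.exists_nonempty_frame U
  obtain ⟨der, hy, -⟩ := EtAff.exists_isCoord_res φ hy₀
  obtain ⟨n, ⟨b⟩⟩ := μ.exists_weightOneBasis
  choose w hw using fun i => F.exists_isPhi hμ b i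
  choose Φ hΦ using fun i => F.exists_eq_sum b (w i)
  choose v hv using fun j => F.exists_isNormal hμ (der j)
  choose κ hκ using fun j => F.exists_eq_sum b (v j)
  -- The unknowns are indexed by pairs (basis vector, coordinate). The system does not mix different
  -- coordinates, so `B` is block diagonal in the second index.
  let B : Fin n × ι → Fin n × ι → V.R := fun q q' =>
    if q'.2 = q.2 then Φ q'.1 q.1 * φ.map (y₀ q.2) ^ (p - 1) else 0
  let A := ArtinSchreier p B fun q => κ q.2 q.1
  let W := V.extend A
  let ψ : V.Res W := V.toExtend A
  obtain ⟨der', hy', hrel⟩ := EtAff.exists_isCoord_res ψ hy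
  refine ⟨W, EtAff.range_subset_extend ArtinSchreier.comap_surjective (hV hxU),
    admissible_pullback_nonempty hμ (F.res ψ) hy' b (Φ := fun k i => ψ.map (Φ i k))
      (κ := fun k j => ψ.map (κ j k))
      (a := fun k j => (ArtinSchreier.root (p := p) B (fun q => κ q.2 q.1) (k, j) : A))
      (fun k j => ?_) (fun i => ?_) (fun j {W'} χ D' hD Y κ' hY hκ' => ?_)⟩
  · refine (ArtinSchreier.root_eq (p := p) B (fun q => κ q.2 q.1) (k, j)).trans ?_
    refine congrArg (fun t => ψ.map (κ j k) + t) ?_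
    rw [Fintype.sum_prod_type]
    refine Finset.sum_congr rfl fun i _ => ?_
    rw [Finset.sum_eq_single j]
    · simp only [B, if_true, map_mul, map_pow]
      rw [mul_assoc]
      rfl
    · intro j' _ hj'
      simp only [B]
      rw [if_neg hj', map_zero, zero_mul]
    · simp
  · refine (hw i).res ψ (fun h => ?_) fun h => ?_
    · rw [frobPull_apply, frobPull_apply, Frame.sec_res, f.frob.map_res]
    · rw [hΦ i]
      exact F.sum_sec_res b ψ (Φ i) h
  -- The Kodaira-Spencer form was computed on `V` uniformly in all charts over `V`, so it may be
  -- used over the solution algebra.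
  · refine hv j (ψ.comp χ) D' (fun r => ?_) Y κ' (fun r h => ?_) fun h => ?_
    · exact (hD _).trans (congrArg χ.map (hrel j r))
    · have h1 : (F.res (ψ.comp χ)).Gpos h = ((F.res ψ).res χ).Gpos h :=
        f.F.res_comp ψ χ (ψ.comp χ) rfl _
      rw [h1]
      exact hY r h
    · rw [hκ', F.sum_sec_res b ψ, ← hκ]
      exact (f.Mneg.res_comp ψ χ (ψ.comp χ) rfl _).symm

end Disp

end FZip

/-! ### The torsor property. -/

theorem mainTheorem4 (p : ℕ) [Fact p.Prime] (H : Type) [CommRing H] [HopfAlgebra (ZMod p) H]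
    [Algebra.Smooth (ZMod p) H] (μ : FZip.GmAction p H) (hμ : μ.OneBounded)
    (X : AlgebraicGeometry.Scheme.{0})
    (s : X ⟶ AlgebraicGeometry.Spec (CommRingCat.of (ZMod p))) [AlgebraicGeometry.Smooth s]
    (f : FZip.Disp μ X) :
    (∀ nabla ∈ f.admissible, ∀ ω ∈ f.group, ∃ nabla' ∈ f.admissible,
      f.IsTranslate ω nabla nabla') ∧
    (∀ nabla ∈ f.admissible, ∀ nabla' ∈ f.admissible, ∃! ω, ω ∈ f.group ∧
      f.IsTranslate ω nabla nabla') ∧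
    (∃ (I : Type) (X' : I → AlgebraicGeometry.Scheme.{0}) (u : ∀ i, X' i ⟶ X)
      (_ : ∀ i, AlgebraicGeometry.Etale (u i)),
      (∀ x : X, ∃ i, x ∈ Set.range (u i)) ∧ ∀ i, (f.pullback (u i)).admissible.Nonempty) := by
  have : Algebra.FiniteType (ZMod p) H := inferInstance
  refine ⟨fun nabla hn ω hω => FZip.Disp.exists_translate hμ hn hω,
    fun nabla hn nabla' hn' => FZip.Disp.existsUnique_isTranslate hμ
      (FZip.EtAff.smooth_algebra s) hn hn', ?_⟩
  -- The covering is indexed by the points of `X`, with one affine étale chart around each point.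
  choose U hU hne using FZip.Disp.exists_admissible_pullback_nonempty hμ s f
  exact ⟨X, _, fun x => (U x).pt, fun x => (U x).etale, fun x => ⟨x, hU x⟩, hne⟩
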